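/- **Setting.** Let $A,B,C$ be smooth positive functions on an open set of radii and let $g=-A(r)\,dt^2+B(r)\,dr^2+C(r)(d\theta^2+\sin^2\theta\,d\varphi^2)$. Let $x(\lambda)$, $\lambda\in J$ ($J\ni 0$ an open interval), be an affinely parametrized geodesic of $g$ in the spherical chart, with tangent $\ell=\dot x$, in aligned coordinates: $\theta=\pi/2$, $\ell^\theta=0$, $\varphi=0$ at $\lambda=0$. The subscript $O$ denotes evaluation at $\lambda=0$, no subscript evaluation at $\lambda$; a prime is $d/dr$. Put $E=-A\ell^t$, $L_x=-C(\sin\varphi\,\ell^\theta+\tfrac12\sin2\theta\cos\varphi\,\ell^\varphi)$, $L_y=C(\cos\varphi\,\ell^\theta-\tfrac12\sin2\theta\sin\varphi\,\ell^\varphi)$, $L_z=C\sin^2\theta\,\ell^\varphi$, $\epsilon=g(\ell,\ell)$. The bilocal geodesic operators $W_{XX},W_{XL},W_{LX},W_{LL}$ form the resolvent of the geodesic deviation equation (GDE) $\nabla_\ell\nabla_\ell\xi^\mu=R^\mu{}_{\alpha\beta\nu}\ell^\alpha\ell^\beta\xi^\nu$ started at $\lambda=0$: $\xi=W_{XX}\xi_O+W_{XL}(\nabla_\ell\xi)_O$,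 $\nabla_\ell\xi=W_{LX}\xi_O+W_{LL}(\nabla_\ell\xi)_O$. Define $$I_B=\int_0^\lambda\!\frac{d\tilde\lambda}{B(\ell^r)^2},\quad I_{AB}=\int_0^\lambda\!\frac{d\tilde\lambda}{AB(\ell^r)^2},\quad I_{BC}=\int_0^\lambda\!\frac{d\tilde\lambda}{BC(\ell^r)^2},\quad I_{ABC}=\int_0^\lambda\!\frac{d\tilde\lambda}{ABC(\ell^r)^2},$$ where, if there are radial turning points ($\ell^r=0$) strictly between $0$ and $\lambda$, the integrals (whose integrands have double poles there) are Hadamard finite parts: cut out the $\delta$-neighbourhood of the turning points, subtract $\kappa/\delta$ with the appropriate constant $\kappa$, and let $\delta\to0^+$. **1. Geodesic and quadratures.** On $J$: $\theta=\pi/2$, $\ell^\theta=0$, $L_x=L_y=0$; $E,L_z,\epsilon$ are constant; $(\ell^r)^2=\epsilon/B+E^2/(AB)-L_z^2/(BC)$; $t-t_O=-\int_0^\lambda E/A\,d\tilde\lambda$; $\varphi=\int_0^\lambda L_z/C\,d\tilde\lambda$. If $\ell^r_O\ne0$ and $\ell^r\neq0$ at $\lambda$, the four finite parts exist. If $\ell^r$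 has no zero on the segment from $0$ to $\lambda$, then $\lambda=\int_{r_O}^{r}d\rho/\ell^r$, and the four quadratures are ordinary integrals, equal to $\int_{r_O}^{r}d\rho/(B(\ell^r)^3)$, $\int d\rho/(AB(\ell^r)^3)$, $\int d\rho/(BC(\ell^r)^3)$, $\int d\rho/(ABC(\ell^r)^3)$, with $\ell^r=\pm\sqrt{\epsilon/B+E^2/(AB)-L_z^2/(BC)}$ as a function of $\rho$. **2. Solution of the GDE by first integrals.** Let $L_z\ne0$, $\ell^r_O\neq0$. For a Killing field $K$ put $\Sigma_K=\xi_\mu\nabla_\ell K^\mu-K_\mu\nabla_\ell\xi^\mu$, and let $T=\partial_t$, $\Phi_x=(0,0,-\sin\varphi,-\cot\theta\cos\varphi)$, $\Phi_y=(0,0,\cos\varphi,-\cot\theta\sin\varphi)$, $\Phi_z=\partial_\varphi$. Every solution $\xi$ of the GDE has constants $\kappa_1,\dots,\kappa_4,\Sigma_T,\Sigma_x,\Sigma_z,\mathcal B$, and conversely all values of these eight constants occur, such that $\Sigma_T,\Sigma_x,\Sigma_z$ are the values of $\Sigma_K$ for $K=T,\Phi_x,\Phi_z$ at every $\lambda$,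 $\Sigma_{\Phi_y}=-\kappa_1L_z$, $\mathcal B=\ell_\mu\nabla_\ell\xi^\mu$, $$\xi^\theta=\kappa_1\sin\varphi-\tfrac{\Sigma_x}{L_z}\cos\varphi,\qquad \nabla_\ell\xi^\theta=\xi^\theta\Big(\cot\varphi\,\ell^\varphi+\tfrac{C'}{2C}\ell^r\Big)+\tfrac{\Sigma_x}{C\sin\varphi}\ \ (\sin\varphi\ne0),$$ and wherever $\ell^r\ne0$ $$\begin{aligned} \xi^r&=\ell^r(\kappa_2-E\Sigma_TI_{AB}+L_z\Sigma_zI_{BC}+\mathcal BI_B),\qquad \nabla_\ell\xi^r=\frac{\mathcal B-E\nabla_\ell\xi^t-L_z\nabla_\ell\xi^\varphi}{B\ell^r},\\ \xi^t&=\kappa_3+\kappa_2E\Big(\tfrac1{A_O}-\tfrac1A\Big)+\Sigma_T\Big(E^2\tfrac{I_{AB}}A-L_z^2I_{ABC}+\epsilon I_{AB}\Big)+L_z\Sigma_zE\Big(I_{ABC}-\tfrac{I_{BC}}A\Big)+E\mathcal B\Big(I_{AB}-\tfrac{I_B}A\Big),\\ \nabla_\ell\xi^t&=\tfrac{A'\ell^r}{2A}\Big(\kappa_3+\kappa_2\tfrac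 E{A_O}+L_zI_{ABC}(\Sigma_zE-\Sigma_TL_z)+I_{AB}(\Sigma_T\epsilon+E\mathcal B)\Big)+\tfrac{\Sigma_T}A,\\ \xi^\varphi&=\kappa_4+\kappa_2L_z\Big(\tfrac1C-\tfrac1{C_O}\Big)+\Sigma_z\Big(L_z^2\tfrac{I_{BC}}C-E^2I_{ABC}-\epsilon I_{BC}\Big)+E\Sigma_TL_z\Big(I_{ABC}-\tfrac{I_{AB}}C\Big)+L_z\mathcal B\Big(\tfrac{I_B}C-I_{BC}\Big),\\ \nabla_\ell\xi^\varphi&=\tfrac{C'\ell^r}{2C}\Big(EI_{ABC}(\Sigma_TL_z-\Sigma_zE)-I_{BC}(\Sigma_z\epsilon+L_z\mathcal B)+\kappa_4-\kappa_2\tfrac{L_z}{C_O}\Big)-\tfrac{\Sigma_z}C. \end{aligned}$$ **3. Variation of the general solution.** The operators exist on $J$ and have the resolvent property. Let $(x_O,\ell_O,\lambda)\mapsto(x,\ell)$ be any smooth general solution of the geodesic equation containing the given geodesic, let $(\delta x,\delta\ell)$ be its total variation for $(\delta x_O,\delta\ell_O,\delta\lambda)$, and $\Delta\ell^\mu=\delta\ell^\mu+\Gamma^\mu_{\alpha\beta}\ell^\alpha\delta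 x^\beta$ at either end. Then $\delta x=W_{XX}\delta x_O+W_{XL}\Delta\ell_O+\ell\,\delta\lambda$ and $\Delta\ell=W_{LX}\delta x_O+W_{LL}\Delta\ell_O$. With $\delta E,\delta L_z,\delta\epsilon$ the variations of the conserved quantities as functions of $(x_O,\ell_O)$, if $\ell^r_O,\ell^r\ne0$: $$\begin{aligned} \delta\lambda&=\tfrac{\delta r}{\ell^r}-\tfrac{\delta r_O}{\ell^r_O}+L_zI_{BC}\delta L_z-EI_{AB}\delta E-\tfrac{I_B}2\delta\epsilon,\\ \delta t&=\delta t_O+E\Big(\tfrac{\delta r_O}{A_O\ell^r_O}-\tfrac{\delta r}{A\ell^r}\Big)+I_{ABC}L_z(L_z\delta E-E\delta L_z)+I_{AB}\Big(\tfrac E2\delta\epsilon-\epsilon\,\delta E\Big),\\ \delta\varphi&=\delta\varphi_O+L_z\Big(\tfrac{\delta r}{C\ell^r}-\tfrac{\delta r_O}{C_O\ell^r_O}\Big)+I_{ABC}E(E\delta L_z-L_z\delta E)+I_{BC}\Big(\epsilon\,\delta L_z-\tfrac{L_z\delta\epsilon}2\Big),\\ \delta\ell^t&=-\tfrac{\delta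 E}A+\tfrac{E}{A^2}A'\delta r,\qquad \delta\ell^\varphi=\tfrac{\delta L_z}C-\tfrac{L_z}{C^2}C'\delta r,\\ \delta\ell^r&=\tfrac1{\ell^r}\Big(\tfrac{\delta\epsilon}{2B}+\tfrac{E\delta E}{AB}-\tfrac{L_z\delta L_z}{BC}\Big)-\tfrac1{2\ell^r}\Big(\tfrac{\epsilon B'}{B^2}+\tfrac{E^2}{AB}\big(\tfrac{A'}A+\tfrac{B'}B\big)-\tfrac{L_z^2}{BC}\big(\tfrac{B'}B+\tfrac{C'}C\big)\Big)\delta r, \end{aligned}$$ and if $L_z\ne0$: $\delta\theta=\cos\varphi\,\delta\theta_O+\sin\varphi\,\delta\ell^\theta_O/\ell^\varphi_O$, $\ \delta\ell^\theta=\tfrac{C_O}C(\cos\varphi\,\delta\ell^\theta_O-\sin\varphi\,\ell^\varphi_O\delta\theta_O)$. **4. Aligned coordinate frame.** All components mixing $\theta$ with $t,r,\varphi$ vanish. If $L_z\neq0$, for all $\lambda\in J$, $$\begin{aligned} W_{XX}{}^\theta{}_\theta&=\cos\varphi-\tfrac{C'_O\ell^r_O}{2L_z}\sin\varphi,\quad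 W_{XL}{}^\theta{}_\theta=\tfrac{C_O}{L_z}\sin\varphi,\quad W_{LL}{}^\theta{}_\theta=\tfrac{C_O}C\cos\varphi+\tfrac{C_OC'\ell^r}{2CL_z}\sin\varphi,\\ W_{LX}{}^\theta{}_\theta&=\tfrac{\cos\varphi}{2C}(C'\ell^r-C'_O\ell^r_O)-\Big(\tfrac{L_z}C+\tfrac{C'\ell^rC'_O\ell^r_O}{4CL_z}\Big)\sin\varphi . \end{aligned}$$ If $\ell^r_O\ne0$ and $\ell^r\ne0$ (radial geodesics $L_z=0$ allowed): $$\begin{aligned} W_{XX}{}^t{}_t&=1+\tfrac{A'_O\ell^r_O}2\big(L_z^2I_{ABC}-\tfrac{E^2}AI_{AB}-\epsilon I_{AB}\big),\quad W_{XX}{}^t{}_\varphi=\tfrac{C'_O\ell^r_O}2EL_z\big(I_{ABC}-\tfrac{I_{BC}}A\big),\\ W_{XX}{}^t{}_r&=\tfrac E{\ell^r_O}\big(\tfrac1{A_O}-\tfrac1A\big)+\tfrac{C'_OL_z^2E}{2C_O}\big(\tfrac{I_{BC}}A-I_{ABC}\big)+\tfrac{A'_OE}{2A_O}\big(L_z^2I_{ABC}-\tfrac{E^2}AI_{AB}-\epsilon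 I_{AB}\big),\\ W_{XX}{}^r{}_t&=\tfrac{A'_O\ell^r_O}2E\ell^rI_{AB},\quad W_{XX}{}^r{}_\varphi=\tfrac{C'_O\ell^r_O}2L_z\ell^rI_{BC},\quad W_{XX}{}^r{}_r=\tfrac{\ell^r}{\ell^r_O}+\tfrac{\ell^r}2\big(E^2\tfrac{A'_O}{A_O}I_{AB}-L_z^2\tfrac{C'_O}{C_O}I_{BC}\big),\\ W_{XX}{}^\varphi{}_t&=\tfrac{A'_O\ell^r_O}2L_zE\big(\tfrac{I_{AB}}C-I_{ABC}\big),\quad W_{XX}{}^\varphi{}_\varphi=1+\tfrac{C'_O\ell^r_O}2\big(\tfrac{L_z^2}CI_{BC}-E^2I_{ABC}-\epsilon I_{BC}\big),\\ W_{XX}{}^\varphi{}_r&=\tfrac{L_z}{\ell^r_O}\big(\tfrac1C-\tfrac1{C_O}\big)+\tfrac{A'_O}{2A_O}E^2L_z\big(\tfrac{I_{AB}}C-I_{ABC}\big)+\tfrac{C'_O}{2C_O}L_z\big(E^2I_{ABC}-\tfrac{L_z^2}CI_{BC}+\epsilon I_{BC}\big),\\ W_{XL}{}^t{}_t&=E^2\big(I_{AB}-\tfrac{I_B}A\big)+A_O\big(E^2\tfrac{I_{AB}}A-L_z^2I_{ABC}+\epsilon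 I_{AB}\big),\quad W_{XL}{}^t{}_r=EB_O\ell^r_O\big(I_{AB}-\tfrac{I_B}A\big),\\ W_{XL}{}^t{}_\varphi&=EL_z\big(I_{AB}-\tfrac{I_B}A+C_O(\tfrac{I_{BC}}A-I_{ABC})\big),\quad W_{XL}{}^r{}_t=E\ell^r(I_B-A_OI_{AB}),\\ W_{XL}{}^r{}_r&=B_O\ell^r_O\ell^rI_B,\quad W_{XL}{}^r{}_\varphi=L_z\ell^r(I_B-C_OI_{BC}),\\ W_{XL}{}^\varphi{}_t&=EL_z\big(A_OI_{ABC}-I_{BC}+\tfrac{I_B-A_OI_{AB}}C\big),\quad W_{XL}{}^\varphi{}_r=B_O\ell^r_OL_z\big(\tfrac{I_B}C-I_{BC}\big),\\ W_{XL}{}^\varphi{}_\varphi&=L_z^2\big(\tfrac{I_B}C-I_{BC}\big)+C_O\big(E^2I_{ABC}-\tfrac{L_z^2}CI_{BC}+\epsilon I_{BC}\big),\\ W_{LX}{}^t{}_t&=\tfrac1{2A}\big(\ell^rA'-\ell^r_OA'_O+\tfrac{A'_O\ell^r_OA'\ell^r}2(L_z^2I_{ABC}-\epsilon I_{AB})\big),\quad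 W_{LX}{}^t{}_\varphi=\tfrac{L_zE}{4A}A'\ell^rC'_O\ell^r_OI_{ABC},\\ W_{LX}{}^t{}_r&=\tfrac E{2AA_O\ell^r_O}(A'\ell^r-A'_O\ell^r_O)+\tfrac{EL_z^2}{4A}A'\ell^r\big(\tfrac{A'_O}{A_O}-\tfrac{C'_O}{C_O}\big)I_{ABC}-\tfrac{A'\ell^rA'_OE\epsilon}{4AA_O}I_{AB},\\ W_{LX}{}^r{}_t&=\tfrac E{2AB\ell^r}(A'_O\ell^r_O-A'\ell^r)+\tfrac{EL_z^2}{4B}A'_O\ell^r_O\big(\tfrac{C'}C-\tfrac{A'}A\big)I_{ABC}+\tfrac{A'_O\ell^r_OA'E\epsilon}{4AB}I_{AB},\\ W_{LX}{}^r{}_r&=\tfrac{E^2(A'_O\ell^r_O-A'\ell^r)}{2ABA_O\ell^r\ell^r_O}+\tfrac{L_z^2(C'\ell^r-C'_O\ell^r_O)}{2BCC_O\ell^r\ell^r_O}+\tfrac{E^2L_z^2}{4B}\big(\tfrac{A'}A-\tfrac{C'}C\big)\big(\tfrac{C'_O}{C_O}-\tfrac{A'_O}{A_O}\big)I_{ABC}+\tfrac\epsilon{4B}\big(E^2\tfrac{A'_OA'}{A_OA}I_{AB}-L_z^2\tfrac{C'_OC'}{C_OC}I_{BC}\big),\\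 W_{LX}{}^r{}_\varphi&=\tfrac{L_z}{2BC\ell^r}(C'_O\ell^r_O-C'\ell^r)+\tfrac{E^2L_z}{4B}C'_O\ell^r_O\big(\tfrac{C'}C-\tfrac{A'}A\big)I_{ABC}+\epsilon\tfrac{L_zC'}{4BC}C'_O\ell^r_OI_{BC},\\ W_{LX}{}^\varphi{}_t&=-\tfrac{L_zE}{4C}C'\ell^rA'_O\ell^r_OI_{ABC},\\ W_{LX}{}^\varphi{}_r&=\tfrac{L_z(C'_O\ell^r_O-C'\ell^r)}{2CC_O\ell^r_O}+\tfrac{L_zE^2}{4C}C'\ell^r\big(\tfrac{C'_O}{C_O}-\tfrac{A'_O}{A_O}\big)I_{ABC}+\tfrac{C'_OL_zC'\ell^r}{4CC_O}\epsilon I_{BC},\\ W_{LX}{}^\varphi{}_\varphi&=\tfrac1{2C}(C'\ell^r-C'_O\ell^r_O)-\tfrac{E^2I_{ABC}+\epsilon I_{BC}}{4C}C'\ell^rC'_O\ell^r_O,\\ W_{LL}{}^t{}_t&=\tfrac{A_O}A+\tfrac{A'\ell^r}{2A}(E^2I_{AB}-L_z^2A_OI_{ABC}+\epsilon A_OI_{AB}),\quad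 W_{LL}{}^t{}_r=\tfrac E{2A}A'\ell^rB_O\ell^r_OI_{AB},\\ W_{LL}{}^t{}_\varphi&=\tfrac{EL_z}{2A}A'\ell^r(I_{AB}-C_OI_{ABC}),\\ W_{LL}{}^r{}_t&=\tfrac{E(A-A_O)}{AB\ell^r}+\tfrac E{2B}\big(L_z^2\tfrac{C'}CI_{BC}-E^2\tfrac{A'}AI_{AB}\big)+\tfrac{L_z^2EA_O}{2B}\big(\tfrac{A'}A-\tfrac{C'}C\big)I_{ABC}-\epsilon\tfrac{A'A_OE}{2AB}I_{AB},\\ W_{LL}{}^r{}_r&=\tfrac{B_O\ell^r_O}{B\ell^r}+\tfrac{B_O\ell^r_O}{2B}\big(L_z^2\tfrac{C'}CI_{BC}-E^2\tfrac{A'}AI_{AB}\big),\\ W_{LL}{}^r{}_\varphi&=\tfrac{L_z(C-C_O)}{BC\ell^r}+\tfrac{L_z}{2B}\big(L_z^2\tfrac{C'}CI_{BC}-E^2\tfrac{A'}AI_{AB}\big)+\tfrac{E^2L_zC_O}{2B}\big(\tfrac{A'}A-\tfrac{C'}C\big)I_{ABC}-\epsilon\tfrac{L_zC'C_O}{2BC}I_{BC},\\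 W_{LL}{}^\varphi{}_t&=\tfrac{EL_z}{2C}C'\ell^r(A_OI_{ABC}-I_{BC}),\quad W_{LL}{}^\varphi{}_r=-\tfrac{L_zB_O\ell^r_O}{2C}C'\ell^rI_{BC},\\ W_{LL}{}^\varphi{}_\varphi&=\tfrac{C_O}C+\tfrac{C'\ell^r}{2C}(E^2C_OI_{ABC}-L_z^2I_{BC}+\epsilon C_OI_{BC}). \end{aligned}$$ **5. Semi-null tetrad.** Let $\epsilon=0$, $L_z\neq0$, $Q>0$. Let $\Psi(0)=0$, $\dot\Psi=-\frac{C'}{2\sqrt{ABC}}\frac E{L_z}Q$, and $$\begin{aligned} \tilde e_2&=\Big(\sqrt{\tfrac{BC}A}\tfrac{\ell^r}{L_z},-\sqrt{\tfrac C{AB}}\tfrac E{L_z},0,0\Big),\quad \tilde u=\Big(\tfrac{E(L_z^2+CQ^2)}{2AL_z^2Q},-\tfrac{\ell^r(L_z^2+CQ^2)}{2L_z^2Q},0,\tfrac Q{2L_z}-\tfrac{L_z}{2CQ}\Big),\\ e_1&=\tfrac1{\sqrt C}\partial_\theta,\quad e_2=\tilde e_2-\tfrac\Psi Q\ell,\quad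 u=\tilde u+\Psi\tilde e_2-\tfrac{\Psi^2}{2Q}\ell . \end{aligned}$$ Then $(e_0,e_1,e_2,e_3)=(u,e_1,e_2,\ell)$ is a parallel-propagated frame along the geodesic with $u\cdot u=-1$, $u\cdot\ell=Q$, $e_A\cdot e_B=\delta_{AB}$, $u\cdot e_A=\ell\cdot e_A=\ell\cdot\ell=0$, and $u^t>0$ if $E>0$. In this tetrad (at both ends) all four operators have, for every $\lambda\in J$, the form $$\begin{pmatrix}\alpha&0&0&0\\0&\ast&0&0\\\ast&0&\ast&0\\\ast&0&\ast&\alpha\end{pmatrix},\qquad \alpha=1,\ \lambda,\ 0,\ 1\ \text{ for } W_{XX},W_{XL},W_{LX},W_{LL},$$ and, for every $\lambda\in J$, $$\begin{aligned} W_{XL}{}^1{}_1&=\tfrac{\sqrt{CC_O}}{L_z}\sin\varphi,\quad W_{XX}{}^1{}_1=\sqrt{\tfrac C{C_O}}\Big(\cos\varphi-\tfrac{C'_O\ell^r_O\sin\varphi}{2L_z}\Big),\quad W_{LL}{}^1{}_1=\sqrt{\tfrac{C_O}C}\Big(\cos\varphi+\tfrac{C'\ell^r\sin\varphi}{2L_z}\Big),\\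 W_{LX}{}^1{}_1&=\tfrac{C'\ell^r-C'_O\ell^r_O}{2\sqrt{CC_O}}\cos\varphi-\sqrt{\tfrac C{C_O}}\Big(\tfrac{L_z}C+\tfrac{C'\ell^rC'_O\ell^r_O}{4CL_z}\Big)\sin\varphi . \end{aligned}$$ If $\ell^r_O\neq0$ and $\ell^r\ne0$, then with $P=L_z^2A'-E^2C'$, $P_O=L_z^2A'_O-E^2C'_O$, $D=\sqrt{ABC}$, $D_O=\sqrt{A_OB_OC_O}$: $$\begin{aligned} W_{XL}{}^2{}_2&=DD_O\ell^r\ell^r_OI_{ABC},\quad W_{XL}{}^2{}_0=\tfrac{EQ}{L_z}\ell^rD(C_OI_{ABC}-I_{AB})-\lambda\Psi,\\ W_{XL}{}^3{}_2&=\tfrac E{L_z}\ell^r_OD_O(CI_{ABC}-I_{AB})+\tfrac\Psi QW_{XL}{}^2{}_2,\\ W_{XL}{}^3{}_0&=\tfrac Q{L_z^2}\Big(E^2\big(CC_OI_{ABC}-\tfrac{C+C_O}2I_{AB}\big)+L_z^2\big(I_B-\tfrac{C+C_O}2I_{BC}\big)\Big)+\tfrac\Psi QW_{XL}{}^2{}_0+\tfrac{\lambda\Psi^2}{2Q},\\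 W_{XX}{}^2{}_2&=\tfrac D{D_O}\Big(\tfrac{\ell^r}{\ell^r_O}+\tfrac{\ell^r}2P_OI_{ABC}\Big),\quad W_{XX}{}^2{}_0=-D\tfrac{C'_O\ell^r_O\ell^rEQ}{2L_z}I_{ABC}-\Psi,\\ W_{XX}{}^3{}_2&=\tfrac E{2L_zD_O}\Big(CI_{ABC}P_O+L_z^2(C'_OI_{BC}-A'_OI_{AB})+\tfrac{2(C-C_O)}{\ell^r_O}\Big)+\tfrac\Psi QW_{XX}{}^2{}_2,\\ W_{XX}{}^3{}_0&=\tfrac Q{2L_z^2}\big(C-C_O+C'_O\ell^r_O(L_z^2I_{BC}-E^2CI_{ABC})\big)+\tfrac\Psi QW_{XX}{}^2{}_0+\tfrac{\Psi^2}{2Q},\\ W_{LL}{}^2{}_2&=\tfrac{D_O}D\Big(\tfrac{\ell^r_O}{\ell^r}-\tfrac{\ell^r_O}2PI_{ABC}\Big),\quad W_{LL}{}^3{}_2=D_O\tfrac{C'\ell^r\ell^r_OE}{2L_z}I_{ABC}+\tfrac\Psi QW_{LL}{}^2{}_2,\\ W_{LL}{}^2{}_0&=\tfrac{QE}{2L_zD}\Big(-C_OI_{ABC}P+L_z^2(A'I_{AB}-C'I_{BC})+\tfrac{2(C_O-C)}{\ell^r}\Big)-\Psi,\\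 W_{LL}{}^3{}_0&=\tfrac Q{2L_z^2}\big(C_O-C+C'\ell^r(C_OE^2I_{ABC}-L_z^2I_{BC})\big)+\tfrac\Psi QW_{LL}{}^2{}_0+\tfrac{\Psi^2}{2Q},\\ W_{LX}{}^2{}_2&=\tfrac1{2DD_O}\Big(\tfrac{P_O}{\ell^r}-\tfrac P{\ell^r_O}-\tfrac{I_{ABC}}2PP_O\Big),\quad W_{LX}{}^2{}_0=\tfrac{EQ}{4L_zD}C'_O\ell^r_OPI_{ABC}+\tfrac{EQ}{2L_z\ell^rD}(C'\ell^r-C'_O\ell^r_O),\\ W_{LX}{}^3{}_2&=\tfrac E{4L_zD_O}C'\ell^rP_OI_{ABC}+\tfrac E{2L_z\ell^r_OD_O}(C'\ell^r-C'_O\ell^r_O)+\tfrac\Psi QW_{LX}{}^2{}_2,\\ W_{LX}{}^3{}_0&=\tfrac Q{2L_z^2}(C'\ell^r-C'_O\ell^r_O)-\tfrac{E^2Q}{4L_z^2}C'\ell^rC'_O\ell^r_OI_{ABC}+\tfrac\Psi QW_{LX}{}^2{}_0 . \end{aligned}$$ **6. Conjugate points.** The point at $\lambda\ne0$ is conjugate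 to the point at $0$ if some solution of the GDE, not identically zero, vanishes at both. If $L_z\neq0$ and $\lambda\ne0$, $\varphi(\lambda)\in\pi\mathbb Z$ implies that the point at $\lambda$ is conjugate. For $\epsilon=0$, $L_z\ne0$, $\lambda\ne0$: the point is conjugate iff the determinant of the transverse block $(W_{XL}{}^A{}_B)_{A,B=1,2}$ vanishes; $W_{XL}{}^1{}_1=0$ iff $\varphi(\lambda)\in\pi\mathbb Z$; and if there is no radial turning point between $0$ and $\lambda$ (endpoints included), the point is conjugate iff $\varphi(\lambda)\in\pi\mathbb Z$. -/

import Mathlib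

open Real Set Filter Topology MeasureTheory
open scoped ContDiff

noncomputable section

/-! ### Differential geometry in a coordinate chart of a four-dimensional spacetime

Points of the chart and components of tangent vectors are functions `Fin 4 → ℝ`; a metric is a
matrix-valued function of the point. -/

/-- Partial derivative of `f` in the coordinate direction `α`. -/
def partialDeriv (f : (Fin 4 → ℝ) → ℝ) (α : Fin 4) (y : Fin 4 → ℝ) : ℝ :=
  fderiv ℝ f y (Pi.single α 1)

/-- Christoffel symbols `Γ^μ_{αβ}` of the Levi-Civita connection of `g`. -/
def christoffel (g : (Fin 4 → ℝ) → Matrix (Fin 4) (Fin 4) ℝ) (y : Fin 4 → ℝ)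
    (μ α β : Fin 4) : ℝ :=
  (1 / 2) * ∑ ν, (g y)⁻¹ μ ν *
    (partialDeriv (fun z => g z ν β) α y + partialDeriv (fun z => g z ν α) β y
      - partialDeriv (fun z => g z α β) ν y)

/-- Riemann tensor `R^μ_{ναβ} = ∂_α Γ^μ_{νβ} - ∂_β Γ^μ_{να} + Γ^μ_{ασ} Γ^σ_{νβ} - Γ^μ_{βσ} Γ^σ_{να}`. -/
def riemann (g : (Fin 4 → ℝ) → Matrix (Fin 4) (Fin 4) ℝ) (y : Fin 4 → ℝ)
    (μ ν α β : Fin 4) : ℝ :=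
  partialDeriv (fun z => christoffel g z μ ν β) α y
    - partialDeriv (fun z => christoffel g z μ ν α) β y
    + ∑ σ, (christoffel g y μ α σ * christoffel g y σ ν β
        - christoffel g y μ β σ * christoffel g y σ ν α)

/-- The vector `Γ^μ_{αβ} v^α w^β`. -/
def gammaVec (g : (Fin 4 → ℝ) → Matrix (Fin 4) (Fin 4) ℝ) (y v w : Fin 4 → ℝ) : Fin 4 → ℝ :=
  fun μ => ∑ α, ∑ β, christoffel g y μ α β * v α * w β

/-- The tidal vector `R^μ_{αβν} ℓ^α ℓ^β ξ^ν`. -/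
def tidalVec (g : (Fin 4 → ℝ) → Matrix (Fin 4) (Fin 4) ℝ) (y v ξ : Fin 4 → ℝ) : Fin 4 → ℝ :=
  fun μ => ∑ α, ∑ β, ∑ ν, riemann g y μ α β ν * v α * v β * ξ ν

/-- `g_{μν} v^μ w^ν`. -/
def metricInner (g : (Fin 4 → ℝ) → Matrix (Fin 4) (Fin 4) ℝ) (y v w : Fin 4 → ℝ) : ℝ :=
  ∑ μ, ∑ ν, g y μ ν * v μ * w ν

/-- The vector field `ξ` along the curve `x` with velocity `ℓ` is covariantly differentiable at
parameter `s`, and `∇_ℓ ξ = ζ` there. -/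
def HasCovDerivAt (g : (Fin 4 → ℝ) → Matrix (Fin 4) (Fin 4) ℝ) (x ℓ : ℝ → Fin 4 → ℝ)
    (ξ : ℝ → Fin 4 → ℝ) (ζ : Fin 4 → ℝ) (s : ℝ) : Prop :=
  HasDerivAt ξ (ζ - gammaVec g (x s) (ℓ s) (ξ s)) s

/-- `x` is an affinely parametrized geodesic of `g` on `J`, with tangent `ℓ`. -/
structure IsGeodesic (g : (Fin 4 → ℝ) → Matrix (Fin 4) (Fin 4) ℝ) (x ℓ : ℝ → Fin 4 → ℝ)
    (J : Set ℝ) : Prop where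
  tangent : ∀ s ∈ J, HasDerivAt x (ℓ s) s
  parallel : ∀ s ∈ J, HasCovDerivAt g x ℓ ℓ 0 s

/-- `ξ` solves the geodesic deviation equation `∇_ℓ ∇_ℓ ξ^μ = R^μ_{αβν} ℓ^α ℓ^β ξ^ν` on `J`, and
`η = ∇_ℓ ξ`. -/
structure IsDeviation (g : (Fin 4 → ℝ) → Matrix (Fin 4) (Fin 4) ℝ) (x ℓ : ℝ → Fin 4 → ℝ)
    (J : Set ℝ) (ξ η : ℝ → Fin 4 → ℝ) : Prop where
  first : ∀ s ∈ J, HasCovDerivAt g x ℓ ξ (η s) s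
  second : ∀ s ∈ J, HasCovDerivAt g x ℓ η (tidalVec g (x s) (ℓ s) (ξ s)) s

/-- The four blocks of a bilocal operator from parameter `0` to parameter `s`, in components with
respect to the coordinate frames at both ends (row index at `s`, column index at `0`). -/
structure BilocalOperators where
  XX : ℝ → Matrix (Fin 4) (Fin 4) ℝ
  XL : ℝ → Matrix (Fin 4) (Fin 4) ℝ
  LX : ℝ → Matrix (Fin 4) (Fin 4) ℝ
  LL : ℝ → Matrix (Fin 4) (Fin 4) ℝ

/-- `W` is the bilocal geodesic operator along the geodesic: the resolvent of the geodesic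
deviation equation with starting point at parameter `0`. -/
structure IsBGO (g : (Fin 4 → ℝ) → Matrix (Fin 4) (Fin 4) ℝ) (x ℓ : ℝ → Fin 4 → ℝ)
    (J : Set ℝ) (W : BilocalOperators) : Prop where
  deviation_X : ∀ ν, IsDeviation g x ℓ J (fun s μ => W.XX s μ ν) (fun s μ => W.LX s μ ν)
  deviation_L : ∀ ν, IsDeviation g x ℓ J (fun s μ => W.XL s μ ν) (fun s μ => W.LL s μ ν)
  XX_zero : W.XX 0 = 1
  LX_zero : W.LX 0 = 0
  XL_zero : W.XL 0 = 0
  LL_zero : W.LL 0 = 1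

/-- The point at parameter `s` is conjugate to the point at parameter `0`: some solution of the
geodesic deviation equation, not identically zero, vanishes at both. -/
def IsConjugatePoint (g : (Fin 4 → ℝ) → Matrix (Fin 4) (Fin 4) ℝ) (x ℓ : ℝ → Fin 4 → ℝ)
    (J : Set ℝ) (s : ℝ) : Prop :=
  ∃ ξ η : ℝ → Fin 4 → ℝ, IsDeviation g x ℓ J ξ η ∧ ξ 0 = 0 ∧ ξ s = 0 ∧ ∃ σ ∈ J, ξ σ ≠ 0

/-- `Φ ((x_O, ℓ_O), s) = (x(s), ℓ(s))` is a smooth general solution of the geodesic equation in the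
region `M`, defined on an open set `U`, which contains the geodesic `(x, ℓ)` on `J`. -/
structure IsGeneralSolution (g : (Fin 4 → ℝ) → Matrix (Fin 4) (Fin 4) ℝ) (M : Set (Fin 4 → ℝ))
    (x ℓ : ℝ → Fin 4 → ℝ) (J : Set ℝ) (U : Set (((Fin 4 → ℝ) × (Fin 4 → ℝ)) × ℝ))
    (Φ : ((Fin 4 → ℝ) × (Fin 4 → ℝ)) × ℝ → (Fin 4 → ℝ) × (Fin 4 → ℝ)) : Prop where
  isOpen : IsOpen U
  smooth : ContDiffOn ℝ ∞ Φ U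
  mem_region : ∀ p ∈ U, (Φ p).1 ∈ M
  tangent : ∀ p ∈ U, HasDerivAt (fun s => (Φ (p.1, s)).1) (Φ p).2 p.2
  geodesic : ∀ p ∈ U,
    HasDerivAt (fun s => (Φ (p.1, s)).2) (-gammaVec g (Φ p).1 (Φ p).2 (Φ p).2) p.2
  initial : ∀ y, (y, (0 : ℝ)) ∈ U → Φ (y, 0) = y
  fiducial_mem : ∀ s ∈ J, ((x 0, ℓ 0), s) ∈ U
  fiducial : ∀ s ∈ J, Φ ((x 0, ℓ 0), s) = (x s, ℓ s)

/-- First variation of a function `F` of position and tangent vector. -/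
def firstVariation (F : (Fin 4 → ℝ) → (Fin 4 → ℝ) → ℝ) (y v δx δv : Fin 4 → ℝ) : ℝ :=
  fderiv ℝ (fun p : (Fin 4 → ℝ) × (Fin 4 → ℝ) => F p.1 p.2) (y, v) (δx, δv)

/-- `∇_v K` for a vector field `K`. -/
def covAlong (g : (Fin 4 → ℝ) → Matrix (Fin 4) (Fin 4) ℝ) (K : (Fin 4 → ℝ) → Fin 4 → ℝ)
    (y v : Fin 4 → ℝ) : Fin 4 → ℝ :=
  fderiv ℝ K y v + gammaVec g y v (K y)

/-- The first integral `ξ_μ ∇_ℓ K^μ - K_μ ∇_ℓ ξ^μ` of the geodesic deviation equation. -/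
def killingIntegral (g : (Fin 4 → ℝ) → Matrix (Fin 4) (Fin 4) ℝ) (x ℓ : ℝ → Fin 4 → ℝ)
    (K : (Fin 4 → ℝ) → Fin 4 → ℝ) (ξ η : ℝ → Fin 4 → ℝ) (s : ℝ) : ℝ :=
  metricInner g (x s) (ξ s) (covAlong g K (x s) (ℓ s)) - metricInner g (x s) (K (x s)) (η s)

/-! ### Static spherically symmetric metrics; coordinates `0 = t`, `1 = r`, `2 = θ`, `3 = φ` -/

/-- `-A(r) dt² + B(r) dr² + C(r) (dθ² + sin² θ dφ²)`. -/
def sssMetric (A B C : ℝ → ℝ) : (Fin 4 → ℝ) → Matrix (Fin 4) (Fin 4) ℝ :=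
  fun y => Matrix.diagonal ![-A (y 1), B (y 1), C (y 1), C (y 1) * sin (y 2) ^ 2]

/-- The region covered by the spherical coordinates, with radii in `R`. -/
def sphericalChart (R : Set ℝ) : Set (Fin 4 → ℝ) := {y | y 1 ∈ R ∧ 0 < y 2 ∧ y 2 < π}

def killingT : (Fin 4 → ℝ) → Fin 4 → ℝ := fun _ => ![1, 0, 0, 0]

def killingX : (Fin 4 → ℝ) → Fin 4 → ℝ :=
  fun y => ![0, 0, -sin (y 3), -(cos (y 2) / sin (y 2)) * cos (y 3)]

def killingY : (Fin 4 → ℝ) → Fin 4 → ℝ :=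
  fun y => ![0, 0, cos (y 3), -(cos (y 2) / sin (y 2)) * sin (y 3)]

def killingZ : (Fin 4 → ℝ) → Fin 4 → ℝ := fun _ => ![0, 0, 0, 1]

/-- The conserved energy `E = -A ℓ^t`. -/
def energy (A : ℝ → ℝ) (y v : Fin 4 → ℝ) : ℝ := -A (y 1) * v 0

/-- The conserved angular momenta `L_x`, `L_y`, `L_z`. -/
def angMomX (C : ℝ → ℝ) (y v : Fin 4 → ℝ) : ℝ :=
  -C (y 1) * (sin (y 3) * v 2 + sin (2 * y 2) / 2 * cos (y 3) * v 3)

def angMomY (C : ℝ → ℝ) (y v : Fin 4 → ℝ) : ℝ :=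
  C (y 1) * (cos (y 3) * v 2 - sin (2 * y 2) / 2 * sin (y 3) * v 3)

def angMomZ (C : ℝ → ℝ) (y v : Fin 4 → ℝ) : ℝ := C (y 1) * sin (y 2) ^ 2 * v 3

/-- `ε = g_{μν} ℓ^μ ℓ^ν`. -/
def normalization (A B C : ℝ → ℝ) (y v : Fin 4 → ℝ) : ℝ := metricInner (sssMetric A B C) y v v

/-- Initial data in aligned coordinates: the motion starts in, and tangentially to, the equatorial
plane, at `φ = 0`. -/
structure IsAligned (x ℓ : ℝ → Fin 4 → ℝ) : Prop where
  theta : x 0 2 = π / 2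
  dtheta : ℓ 0 2 = 0
  phi : x 0 3 = 0

/-- No radial turning point between parameters `0` and `s`, endpoints included. -/
def TurningFree (ℓ : ℝ → Fin 4 → ℝ) (s : ℝ) : Prop := ∀ σ ∈ uIcc 0 s, ℓ σ 1 ≠ 0

/-- `(ℓ^r)² = ε/B + E²/(AB) - L²/(BC)` as a function of the radius. -/
def radialSq (A B C : ℝ → ℝ) (E L ε : ℝ) (r : ℝ) : ℝ :=
  ε / B r + E ^ 2 / (A r * B r) - L ^ 2 / (B r * C r)

/-! ### The radial quadratures

The integrand of a radial quadrature has a double pole at every radial turning point. Along a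
segment that contains turning points the integral over the parameter is understood as Hadamard's
finite part; without turning points this is the ordinary integral. -/

/-- `v` is the finite part of the integral of `u` from `a` to `b`, where `u` has double poles at the
points of `Z`: the integral with the `δ`-neighbourhood of `Z` cut out is `κ/δ + v + o(1)` as
`δ → 0⁺`, for some constant `κ`. -/
def HasFinitePart (u : ℝ → ℝ) (Z : Set ℝ) (a b v : ℝ) : Prop :=
  ∃ κ : ℝ, Tendsto
    (fun δ : ℝ => (∫ σ in a..b, (Metric.thickening δ Z)ᶜ.indicator u σ) - κ / δ) (𝓝[>] 0) (𝓝 v)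

/-- The finite part is unique. -/
theorem HasFinitePart.unique {u : ℝ → ℝ} {Z : Set ℝ} {a b v w : ℝ}
    (hv : HasFinitePart u Z a b v) (hw : HasFinitePart u Z a b w) : v = w := by
  obtain ⟨κ, h⟩ := hv
  obtain ⟨κ', h'⟩ := hw
  have hd := h'.sub h
  have hid : Tendsto (fun δ : ℝ => δ) (𝓝[>] (0 : ℝ)) (𝓝 0) :=
    tendsto_nhdsWithin_of_tendsto_nhds tendsto_id
  have hm := hd.mul hid
  have hk : Tendsto (fun _ : ℝ => κ - κ') (𝓝[>] (0 : ℝ)) (𝓝 ((w - v) * 0)) := by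
    refine hm.congr' ?_
    filter_upwards [self_mem_nhdsWithin] with δ hδ
    have : δ ≠ 0 := ne_of_gt hδ
    field_simp
    ring
  have e : κ - κ' = (w - v) * 0 := tendsto_nhds_unique tendsto_const_nhds hk
  have e' : κ = κ' := by linarith
  subst e'
  exact tendsto_nhds_unique h h'

/-- Without poles on the (closed) path the finite part is the ordinary integral. -/
theorem hasFinitePart_integral {u : ℝ → ℝ} {Z : Set ℝ} {a b δ₀ : ℝ} (hδ₀ : 0 < δ₀)
    (hZ : Disjoint (Metric.thickening δ₀ Z) (uIcc a b)) :
    HasFinitePart u Z a b (∫ σ in a..b, u σ) := by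
  refine ⟨0, ?_⟩
  refine tendsto_const_nhds.congr' ?_
  filter_upwards [Ioo_mem_nhdsGT hδ₀] with δ hδ
  rw [zero_div, sub_zero]
  refine intervalIntegral.integral_congr fun σ hσ => ?_
  have : σ ∈ (Metric.thickening δ Z)ᶜ := fun hmem =>
    Set.disjoint_left.mp hZ (Metric.thickening_mono hδ.2.le Z hmem) hσ
  rw [Set.indicator_of_mem this]

/-- `v = ∫_0^s w(r) dσ / (ℓ^r)²` along the geodesic. -/
def IsRadialQuadrature (w : ℝ → ℝ) (x ℓ : ℝ → Fin 4 → ℝ) (J : Set ℝ) (s v : ℝ) : Prop :=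
  HasFinitePart (fun σ => w (x σ 1) / ℓ σ 1 ^ 2) {σ | σ ∈ J ∧ ℓ σ 1 = 0} 0 s v

structure RadialIntegrals where
  IB : ℝ
  IAB : ℝ
  IBC : ℝ
  IABC : ℝ

/-- The values at `s` of the quadratures `I_B`, `I_AB`, `I_BC`, `I_ABC`. -/
structure IsRadialIntegrals (A B C : ℝ → ℝ) (x ℓ : ℝ → Fin 4 → ℝ) (J : Set ℝ) (s : ℝ)
    (I : RadialIntegrals) : Prop where
  IB : IsRadialQuadrature (fun r => 1 / B r) x ℓ J s I.IB
  IAB : IsRadialQuadrature (fun r => 1 / (A r * B r)) x ℓ J s I.IAB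
  IBC : IsRadialQuadrature (fun r => 1 / (B r * C r)) x ℓ J s I.IBC
  IABC : IsRadialQuadrature (fun r => 1 / (A r * B r * C r)) x ℓ J s I.IABC

/-- The ordinary integral `∫_0^s w(r) dσ / (ℓ^r)²`. -/
def affineQuadrature (w : ℝ → ℝ) (x ℓ : ℝ → Fin 4 → ℝ) (s : ℝ) : ℝ :=
  ∫ σ in (0 : ℝ)..s, w (x σ 1) / ℓ σ 1 ^ 2

/-- The ordinary integral `∫_{r_O}^{r} w(ρ) dρ / (ℓ^r)³`, with `ℓ^r = ± √(radialSq ρ)` of sign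
`sgn`. -/
def radiusQuadrature (w F : ℝ → ℝ) (sgn r₀ r : ℝ) : ℝ :=
  ∫ ρ in r₀..r, w ρ / (sgn * √(F ρ)) ^ 3

/-- The quantities that enter the closed formulas. A subscript `₀` means evaluation at parameter
`0`, its absence evaluation at parameter `s`; `dA`, `dC` are `A'(r)`, `C'(r)` and `lr` is `ℓ^r`. -/
structure OrbitData where
  A : ℝ
  B : ℝ
  C : ℝ
  dA : ℝ
  dC : ℝ
  lr : ℝ
  A₀ : ℝ
  B₀ : ℝ
  C₀ : ℝ
  dA₀ : ℝ
  dC₀ : ℝ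
  lr₀ : ℝ
  E : ℝ
  L : ℝ
  ε : ℝ
  phi : ℝ
  s : ℝ
  IB : ℝ
  IAB : ℝ
  IBC : ℝ
  IABC : ℝ

def orbitData (A B C : ℝ → ℝ) (x ℓ : ℝ → Fin 4 → ℝ) (s : ℝ) (I : RadialIntegrals) :
    OrbitData where
  A := A (x s 1)
  B := B (x s 1)
  C := C (x s 1)
  dA := deriv A (x s 1)
  dC := deriv C (x s 1)
  lr := ℓ s 1
  A₀ := A (x 0 1)
  B₀ := B (x 0 1)
  C₀ := C (x 0 1)
  dA₀ := deriv A (x 0 1)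
  dC₀ := deriv C (x 0 1)
  lr₀ := ℓ 0 1
  E := energy A (x 0) (ℓ 0)
  L := angMomZ C (x 0) (ℓ 0)
  ε := normalization A B C (x 0) (ℓ 0)
  phi := x s 3
  s := s
  IB := I.IB
  IAB := I.IAB
  IBC := I.IBC
  IABC := I.IABC

/-! ### Closed forms in the aligned coordinate frame (rows and columns ordered `t, r, θ, φ`) -/

def coordXX (d : OrbitData) : Matrix (Fin 4) (Fin 4) ℝ :=
  !![1 + d.dA₀ * d.lr₀ / 2 * (d.L ^ 2 * d.IABC - d.E ^ 2 / d.A * d.IAB - d.ε * d.IAB),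
      d.E / d.lr₀ * (1 / d.A₀ - 1 / d.A) + d.dC₀ * d.L ^ 2 * d.E / (2 * d.C₀) * (d.IBC / d.A
        - d.IABC) + d.dA₀ * d.E / (2 * d.A₀) * (d.L ^ 2 * d.IABC - d.E ^ 2 / d.A * d.IAB
        - d.ε * d.IAB),
      0,
      d.dC₀ * d.lr₀ / 2 * d.E * d.L * (d.IABC - d.IBC / d.A);
    d.dA₀ * d.lr₀ / 2 * d.E * d.lr * d.IAB,
      d.lr / d.lr₀ + d.lr / 2 * (d.E ^ 2 * d.dA₀ / d.A₀ * d.IAB - d.L ^ 2 * d.dC₀ / d.C₀ * d.IBC),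
      0,
      d.dC₀ * d.lr₀ / 2 * d.L * d.lr * d.IBC;
    0,
      0,
      cos d.phi - d.dC₀ * d.lr₀ * sin d.phi / (2 * d.L),
      0;
    d.dA₀ * d.lr₀ / 2 * d.L * d.E * (d.IAB / d.C - d.IABC),
      d.L / d.lr₀ * (1 / d.C - 1 / d.C₀) + d.dA₀ / (2 * d.A₀) * d.E ^ 2 * d.L * (d.IAB / d.C
        - d.IABC) + d.dC₀ / (2 * d.C₀) * d.L * (d.E ^ 2 * d.IABC - d.L ^ 2 / d.C * d.IBC
        + d.ε * d.IBC),
      0,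
      1 + d.dC₀ * d.lr₀ / 2 * (d.L ^ 2 / d.C * d.IBC - d.E ^ 2 * d.IABC - d.ε * d.IBC)]

def coordXL (d : OrbitData) : Matrix (Fin 4) (Fin 4) ℝ :=
  !![d.E ^ 2 * (d.IAB - d.IB / d.A) + d.A₀ * (d.E ^ 2 * d.IAB / d.A - d.L ^ 2 * d.IABC
    + d.ε * d.IAB),
      d.E * d.B₀ * d.lr₀ * (d.IAB - d.IB / d.A),
      0,
      d.E * d.L * (d.IAB - d.IB / d.A + d.C₀ * (d.IBC / d.A - d.IABC));
    d.E * d.lr * (d.IB - d.A₀ * d.IAB),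
      d.B₀ * d.lr₀ * d.lr * d.IB,
      0,
      d.L * d.lr * (d.IB - d.C₀ * d.IBC);
    0,
      0,
      d.C₀ / d.L * sin d.phi,
      0;
    d.E * d.L * (d.A₀ * d.IABC - d.IBC + (d.IB - d.A₀ * d.IAB) / d.C),
      d.B₀ * d.lr₀ * d.L * (d.IB / d.C - d.IBC),
      0,
      d.L ^ 2 * (d.IB / d.C - d.IBC) + d.C₀ * (d.E ^ 2 * d.IABC - d.L ^ 2 / d.C * d.IBC
        + d.ε * d.IBC)]

def coordLX (d : OrbitData) : Matrix (Fin 4) (Fin 4) ℝ :=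
  !![1 / (2 * d.A) * (d.lr * d.dA - d.lr₀ * d.dA₀
    + d.dA₀ * d.lr₀ * d.dA * d.lr / 2 * (d.L ^ 2 * d.IABC - d.ε * d.IAB)),
      d.E / (2 * d.A * d.A₀ * d.lr₀) * (d.dA * d.lr - d.dA₀ * d.lr₀)
        + d.E * d.L ^ 2 / (4 * d.A) * d.dA * d.lr * (d.dA₀ / d.A₀ - d.dC₀ / d.C₀) * d.IABC
        - d.dA * d.lr * d.IAB * d.ε * d.dA₀ * d.E / (4 * d.A * d.A₀),
      0,
      d.L * d.E / (4 * d.A) * d.dA * d.lr * d.dC₀ * d.lr₀ * d.IABC;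
    d.E / (2 * d.A * d.B * d.lr) * (d.dA₀ * d.lr₀ - d.dA * d.lr)
      + d.E * d.L ^ 2 / (4 * d.B) * d.dA₀ * d.lr₀ * (d.dC / d.C - d.dA / d.A) * d.IABC
      + d.dA₀ * d.lr₀ * d.dA * d.E * d.ε / (4 * d.A * d.B) * d.IAB,
      d.E ^ 2 * (d.dA₀ * d.lr₀ - d.dA * d.lr) / (2 * d.A * d.B * d.A₀ * d.lr * d.lr₀)
        + d.L ^ 2 * (d.dC * d.lr - d.dC₀ * d.lr₀) / (2 * d.B * d.C * d.C₀ * d.lr * d.lr₀)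
        + d.E ^ 2 * d.L ^ 2 / (4 * d.B) * (d.dA / d.A - d.dC / d.C) * (d.dC₀ / d.C₀
        - d.dA₀ / d.A₀) * d.IABC + d.ε / (4 * d.B) * (d.E ^ 2 * d.dA₀ * d.dA / (d.A₀ * d.A)
        * d.IAB - d.L ^ 2 * d.IBC * d.dC₀ * d.dC / (d.C₀ * d.C)),
      0,
      d.L / (2 * d.B * d.C * d.lr) * (d.dC₀ * d.lr₀ - d.dC * d.lr)
        + d.E ^ 2 * d.L / (4 * d.B) * d.dC₀ * d.lr₀ * (d.dC / d.C - d.dA / d.A) * d.IABC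
        + d.ε * d.L * d.dC / (4 * d.B * d.C) * d.dC₀ * d.lr₀ * d.IBC;
    0,
      0,
      cos d.phi / (2 * d.C) * (d.dC * d.lr - d.dC₀ * d.lr₀) - (d.L / d.C
        + d.dC * d.lr * d.dC₀ * d.lr₀ / (4 * d.C * d.L)) * sin d.phi,
      0;
    -d.L * d.E / (4 * d.C) * d.dC * d.lr * d.dA₀ * d.lr₀ * d.IABC,
      d.L * (d.dC₀ * d.lr₀ - d.dC * d.lr) / (2 * d.C * d.C₀ * d.lr₀)
        + d.L * d.E ^ 2 / (4 * d.C) * d.dC * d.lr * (d.dC₀ / d.C₀ - d.dA₀ / d.A₀) * d.IABC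
        + d.dC₀ * d.L * d.dC * d.lr / (4 * d.C * d.C₀) * d.ε * d.IBC,
      0,
      1 / (2 * d.C) * (d.dC * d.lr - d.dC₀ * d.lr₀)
        - d.E ^ 2 / (4 * d.C) * d.dC * d.lr * d.dC₀ * d.lr₀ * d.IABC
        - d.ε * d.IBC / (4 * d.C) * d.dC * d.lr * d.dC₀ * d.lr₀]

def coordLL (d : OrbitData) : Matrix (Fin 4) (Fin 4) ℝ :=
  !![d.A₀ / d.A + d.dA * d.lr / (2 * d.A) * (d.E ^ 2 * d.IAB - d.L ^ 2 * d.A₀ * d.IABC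
    + d.ε * d.IAB * d.A₀),
      d.E / (2 * d.A) * d.dA * d.lr * d.B₀ * d.lr₀ * d.IAB,
      0,
      d.E * d.L / (2 * d.A) * d.dA * d.lr * (d.IAB - d.C₀ * d.IABC);
    d.E * (d.A - d.A₀) / (d.A * d.B * d.lr) + d.E / (2 * d.B) * (d.L ^ 2 * d.dC / d.C * d.IBC
      - d.E ^ 2 * d.dA / d.A * d.IAB) + d.L ^ 2 * d.E * d.A₀ / (2 * d.B) * (d.dA / d.A
      - d.dC / d.C) * d.IABC - d.ε * d.dA * d.A₀ * d.E / (2 * d.A * d.B) * d.IAB,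
      d.B₀ * d.lr₀ / (d.B * d.lr) + d.B₀ * d.lr₀ / (2 * d.B) * (d.L ^ 2 * d.dC / d.C * d.IBC
        - d.E ^ 2 * d.dA / d.A * d.IAB),
      0,
      d.L * (d.C - d.C₀) / (d.B * d.C * d.lr)
        + d.L / (2 * d.B) * (d.L ^ 2 * d.dC / d.C * d.IBC - d.E ^ 2 * d.dA / d.A * d.IAB)
        + d.E ^ 2 * d.L * d.C₀ / (2 * d.B) * (d.dA / d.A - d.dC / d.C) * d.IABC
        - d.ε * d.L * d.dC * d.C₀ / (2 * d.B * d.C) * d.IBC;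
    0,
      0,
      d.C₀ / d.C * cos d.phi + d.C₀ / (2 * d.C * d.L) * d.dC * d.lr * sin d.phi,
      0;
    d.E * d.L / (2 * d.C) * d.dC * d.lr * (d.A₀ * d.IABC - d.IBC),
      -d.L * d.B₀ * d.lr₀ / (2 * d.C) * d.dC * d.lr * d.IBC,
      0,
      d.C₀ / d.C + d.dC * d.lr / (2 * d.C) * (d.E ^ 2 * d.C₀ * d.IABC - d.L ^ 2 * d.IBC
        + d.ε * d.IBC * d.C₀)]

/-! ### General solution of the geodesic deviation equation -/

/-- The eight integration constants. -/
structure DeviationConstants where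
  κ₁ : ℝ
  κ₂ : ℝ
  κ₃ : ℝ
  κ₄ : ℝ
  sT : ℝ
  sx : ℝ
  sz : ℝ
  b : ℝ

/-- `(ξ, η)` is given by the explicit solution with constants `k`, where `sT`, `sx`, `sz` are the
first integrals generated by the Killing vectors and `b = ℓ_μ ∇_ℓ ξ^μ`. -/
structure IsExplicitDeviation (A B C : ℝ → ℝ) (x ℓ : ℝ → Fin 4 → ℝ) (J : Set ℝ)
    (ξ η : ℝ → Fin 4 → ℝ) (k : DeviationConstants) : Prop where
  int_T : ∀ s ∈ J, killingIntegral (sssMetric A B C) x ℓ killingT ξ η s = k.sT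
  int_x : ∀ s ∈ J, killingIntegral (sssMetric A B C) x ℓ killingX ξ η s = k.sx
  int_y : ∀ s ∈ J, killingIntegral (sssMetric A B C) x ℓ killingY ξ η s
    = -k.κ₁ * angMomZ C (x 0) (ℓ 0)
  int_z : ∀ s ∈ J, killingIntegral (sssMetric A B C) x ℓ killingZ ξ η s = k.sz
  int_b : ∀ s ∈ J, metricInner (sssMetric A B C) (x s) (ℓ s) (η s) = k.b
  xi_theta : ∀ s ∈ J,
    ξ s 2 = k.κ₁ * sin (x s 3) - k.sx / angMomZ C (x 0) (ℓ 0) * cos (x s 3)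
  eta_theta : ∀ s ∈ J, sin (x s 3) ≠ 0 →
    η s 2 = ξ s 2 * (cos (x s 3) / sin (x s 3) * ℓ s 3
        + deriv C (x s 1) / (2 * C (x s 1)) * ℓ s 1)
      + k.sx / (C (x s 1) * sin (x s 3))
  components : ∀ s ∈ J, ℓ s 1 ≠ 0 → ∀ I, IsRadialIntegrals A B C x ℓ J s I →
    let d := orbitData A B C x ℓ s I
    ξ s 1 = d.lr * (k.κ₂ - d.E * k.sT * d.IAB + d.L * k.sz * d.IBC + k.b * d.IB) ∧
    η s 1 = (k.b - d.E * η s 0 - d.L * η s 3) / (d.B * d.lr) ∧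
    ξ s 0 = k.κ₃ + k.κ₂ * d.E * (1 / d.A₀ - 1 / d.A)
      + k.sT * (d.E ^ 2 * d.IAB / d.A - d.L ^ 2 * d.IABC + d.ε * d.IAB)
      + d.L * k.sz * d.E * (d.IABC - d.IBC / d.A) + d.E * k.b * (d.IAB - d.IB / d.A) ∧
    η s 0 = d.dA * d.lr / (2 * d.A) * (k.κ₃ + k.κ₂ * d.E / d.A₀
        + d.L * d.IABC * (k.sz * d.E - k.sT * d.L) + d.IAB * (k.sT * d.ε + d.E * k.b))
      + k.sT / d.A ∧
    ξ s 3 = k.κ₄ + k.κ₂ * d.L * (1 / d.C - 1 / d.C₀)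
      + k.sz * (d.L ^ 2 * d.IBC / d.C - d.E ^ 2 * d.IABC - d.ε * d.IBC)
      + d.E * k.sT * d.L * (d.IABC - d.IAB / d.C) + d.L * k.b * (d.IB / d.C - d.IBC) ∧
    η s 3 = d.dC * d.lr / (2 * d.C) * (d.E * d.IABC * (k.sT * d.L - k.sz * d.E)
        - d.IBC * (k.sz * d.ε + d.L * k.b) + k.κ₄ - k.κ₂ * d.L / d.C₀)
      - k.sz / d.C

/-! ### The parallel-propagated semi-null tetrad of a null geodesic -/

/-- The solution of `dΨ/dλ = -C' E Q / (2 √(ABC) L)` with `Ψ(0) = 0`. -/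
def sntPsi (A B C : ℝ → ℝ) (x ℓ : ℝ → Fin 4 → ℝ) (Q s : ℝ) : ℝ :=
  ∫ σ in (0 : ℝ)..s, -(deriv C (x σ 1) / (2 * √(A (x σ 1) * B (x σ 1) * C (x σ 1)))
    * (energy A (x 0) (ℓ 0) / angMomZ C (x 0) (ℓ 0)) * Q)

/-- The transverse vector `e_1 = ∂_θ / √C`. -/
def sntE1 (C : ℝ → ℝ) (x : ℝ → Fin 4 → ℝ) (s : ℝ) : Fin 4 → ℝ :=
  ![0, 0, 1 / √(C (x s 1)), 0]

/-- The second transverse vector of the intermediate tetrad. -/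
def sntE2Tilde (A B C : ℝ → ℝ) (x ℓ : ℝ → Fin 4 → ℝ) (s : ℝ) : Fin 4 → ℝ :=
  let r := x s 1
  let E := energy A (x 0) (ℓ 0)
  let L := angMomZ C (x 0) (ℓ 0)
  ![√(B r * C r / A r) * (ℓ s 1 / L), -√(C r / (A r * B r)) * (E / L), 0, 0]

/-- The four-velocity of the intermediate tetrad. -/
def sntUTilde (A C : ℝ → ℝ) (x ℓ : ℝ → Fin 4 → ℝ) (Q s : ℝ) : Fin 4 → ℝ :=
  let r := x s 1
  let E := energy A (x 0) (ℓ 0)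
  let L := angMomZ C (x 0) (ℓ 0)
  ![E / (2 * A r * L ^ 2 * Q) * (L ^ 2 + C r * Q ^ 2),
    -(ℓ s 1 / (2 * L ^ 2 * Q)) * (L ^ 2 + C r * Q ^ 2),
    0,
    Q / (2 * L) - L / (2 * C r * Q)]

/-- The semi-null tetrad `(u, e_1, e_2, ℓ)`. -/
def sntVector (A B C : ℝ → ℝ) (x ℓ : ℝ → Fin 4 → ℝ) (Q s : ℝ) : Fin 4 → Fin 4 → ℝ :=
  let Ψ := sntPsi A B C x ℓ Q s
  ![sntUTilde A C x ℓ Q s + Ψ • sntE2Tilde A B C x ℓ s - (Ψ ^ 2 / (2 * Q)) • ℓ s,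
    sntE1 C x s,
    sntE2Tilde A B C x ℓ s - (Ψ / Q) • ℓ s,
    ℓ s]

/-- The matrix whose columns are the vectors of the tetrad. -/
def sntFrame (A B C : ℝ → ℝ) (x ℓ : ℝ → Fin 4 → ℝ) (Q s : ℝ) : Matrix (Fin 4) (Fin 4) ℝ :=
  Matrix.of fun μ a => sntVector A B C x ℓ Q s a μ

/-- Tetrad components of a bilocal operator `M` with coordinate components `M s`. -/
def sntComponents (A B C : ℝ → ℝ) (x ℓ : ℝ → Fin 4 → ℝ) (Q : ℝ)
    (M : ℝ → Matrix (Fin 4) (Fin 4) ℝ) (s : ℝ) : Matrix (Fin 4) (Fin 4) ℝ :=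
  (sntFrame A B C x ℓ Q s)⁻¹ * M s * sntFrame A B C x ℓ Q 0

/-- The sparse block form of the bilocal operators in the tetrad. -/
def IsSparseBlock (α : ℝ) (M : Matrix (Fin 4) (Fin 4) ℝ) : Prop :=
  ∃ p q a b c : ℝ, M = !![α, 0, 0, 0; 0, p, 0, 0; a, 0, q, 0; b, 0, c, α]

/-! Closed forms in the tetrad (rows and columns ordered `u, e_1, e_2, ℓ`). -/

def sntXX (d : OrbitData) (Q Ψ : ℝ) : Matrix (Fin 4) (Fin 4) ℝ :=
  let w22 := √(d.A * d.B * d.C) / √(d.A₀ * d.B₀ * d.C₀) * (d.lr / d.lr₀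
    + d.lr / 2 * (d.L ^ 2 * d.dA₀ - d.E ^ 2 * d.dC₀) * d.IABC)
  let w20 := -√(d.A * d.B * d.C) * d.dC₀ * d.lr₀ * d.lr * d.E * Q / (2 * d.L) * d.IABC - Ψ
  !![1,
      0,
      0,
      0;
    0,
      √(d.C / d.C₀) * (cos d.phi - d.dC₀ * d.lr₀ * sin d.phi / (2 * d.L)),
      0,
      0;
    w20,
      0,
      w22,
      0;
    Q / (2 * d.L ^ 2) * (d.C - d.C₀ + d.dC₀ * d.lr₀ * (d.IBC * d.L ^ 2
      - d.E ^ 2 * d.IABC * d.C)) + w20 * Ψ / Q + Ψ ^ 2 / (2 * Q),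
      0,
      d.E / (2 * d.L * √(d.A₀ * d.B₀ * d.C₀)) * (d.C * d.IABC * (d.L ^ 2 * d.dA₀
        - d.E ^ 2 * d.dC₀) + d.L ^ 2 * (d.dC₀ * d.IBC - d.dA₀ * d.IAB) + 2 * (d.C
        - d.C₀) / d.lr₀) + Ψ / Q * w22,
      1]

def sntXL (d : OrbitData) (Q Ψ : ℝ) : Matrix (Fin 4) (Fin 4) ℝ :=
  let w22 := √(d.A * d.B * d.C) * √(d.A₀ * d.B₀ * d.C₀) * d.lr * d.lr₀ * d.IABC
  let w20 := d.E * Q / d.L * d.lr * √(d.A * d.B * d.C) * (d.C₀ * d.IABC - d.IAB) - d.s * Ψ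
  !![d.s,
      0,
      0,
      0;
    0,
      √(d.C * d.C₀) / d.L * sin d.phi,
      0,
      0;
    w20,
      0,
      w22,
      0;
    Q / d.L ^ 2 * (d.E ^ 2 * (d.C * d.C₀ * d.IABC - (d.C + d.C₀) / 2 * d.IAB)
      + d.L ^ 2 * (d.IB - (d.C + d.C₀) / 2 * d.IBC)) + Ψ / Q * w20 + d.s * Ψ ^ 2 / (2 * Q),
      0,
      d.E / d.L * d.lr₀ * √(d.A₀ * d.B₀ * d.C₀) * (d.C * d.IABC - d.IAB) + w22 * Ψ / Q,
      d.s]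

def sntLX (d : OrbitData) (Q Ψ : ℝ) : Matrix (Fin 4) (Fin 4) ℝ :=
  let w22 := 1 / (2 * √(d.A * d.B * d.C) * √(d.A₀ * d.B₀ * d.C₀)) * ((d.E ^ 2 * d.dC
    - d.L ^ 2 * d.dA) / d.lr₀ - (d.E ^ 2 * d.dC₀ - d.L ^ 2 * d.dA₀) / d.lr
    - d.IABC / 2 * (d.E ^ 2 * d.dC - d.L ^ 2 * d.dA) * (d.E ^ 2 * d.dC₀ - d.L ^ 2 * d.dA₀))
  let w20 := d.E * Q / (4 * d.L) * d.dC₀ * d.lr₀ / √(d.A * d.B * d.C) * (d.L ^ 2 * d.dA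
    - d.E ^ 2 * d.dC) * d.IABC + d.E * Q / (2 * d.L * d.lr) * (d.dC * d.lr
    - d.dC₀ * d.lr₀) / √(d.A * d.B * d.C)
  !![0,
      0,
      0,
      0;
    0,
      (d.dC * d.lr - d.dC₀ * d.lr₀) / (2 * √(d.C * d.C₀)) * cos d.phi
        - √(d.C / d.C₀) * (d.L / d.C + d.dC * d.lr * d.dC₀ * d.lr₀ / (4 * d.C * d.L)) * sin d.phi,
      0,
      0;
    w20,
      0,
      w22,
      0;
    Q / (2 * d.L ^ 2) * (d.dC * d.lr - d.dC₀ * d.lr₀)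
      - d.IABC * d.dC * d.lr * d.dC₀ * d.lr₀ * d.E ^ 2 * Q / (4 * d.L ^ 2) + Ψ / Q * w20,
      0,
      d.E / (4 * d.L) * d.dC * d.lr / √(d.A₀ * d.B₀ * d.C₀) * (d.L ^ 2 * d.dA₀
        - d.E ^ 2 * d.dC₀) * d.IABC + d.E / (2 * d.L * d.lr₀) * (d.dC * d.lr
        - d.dC₀ * d.lr₀) / √(d.A₀ * d.B₀ * d.C₀) + Ψ / Q * w22,
      0]

def sntLL (d : OrbitData) (Q Ψ : ℝ) : Matrix (Fin 4) (Fin 4) ℝ :=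
  let w22 := √(d.A₀ * d.B₀ * d.C₀) / √(d.A * d.B * d.C) * (d.lr₀ / d.lr
    + d.lr₀ / 2 * (d.E ^ 2 * d.dC - d.L ^ 2 * d.dA) * d.IABC)
  let w20 := Q * d.E / (2 * d.L * √(d.A * d.B * d.C)) * (d.C₀ * d.IABC * (d.E ^ 2 * d.dC
    - d.L ^ 2 * d.dA) + d.L ^ 2 * (d.dA * d.IAB - d.dC * d.IBC) + 2 * (d.C₀ - d.C) / d.lr) - Ψ
  !![1,
      0,
      0,
      0;
    0,
      √(d.C₀ / d.C) * (cos d.phi + d.dC * d.lr * sin d.phi / (2 * d.L)),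
      0,
      0;
    w20,
      0,
      w22,
      0;
    Q / (2 * d.L ^ 2) * (d.C₀ - d.C + d.dC * d.lr * (d.C₀ * d.E ^ 2 * d.IABC
      - d.L ^ 2 * d.IBC)) + w20 * Ψ / Q + Ψ ^ 2 / (2 * Q),
      0,
      √(d.A₀ * d.B₀ * d.C₀) * d.dC * d.lr * d.lr₀ * d.E / (2 * d.L) * d.IABC + Ψ / Q * w22,
      1]

end

/-! The geodesic deviation equation is the linearized geodesic equation written covariantly: with ζ
= ∇_ℓ ξ - Γ(ℓ, ξ), the pair (ξ, ζ) solves the linearization of the geodesic field X on phase space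
(`isDeviation_iff_isVariation`). Hence only Christoffel symbols of the metric are needed and no
curvature component is ever computed. If Q is constant along all geodesics, then differentiating
DQ(X) = 0 shows that DQ(Y) is constant for every solution Y of the linearization
(`IsVariation.fderiv_const`). Applied to E, L_x, L_y, L_z and ε this integrates the deviation
equation. The integrals from L_x and L_y determine the θ component by a rotation through φ. Those
from E, L_z and ε reduce the radial component to the Wronskian identity ζ^r ℓ^r - ξ^r G = δε/(2B) +
E δE/(AB) - L_z δL_z/(BC), where G is the radial acceleration. So ξ^r/ℓ^r is a constant plus a
combination of quadratures, and ξ^t, ξ^φ follow (`variation_closed_form`).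

The analytic difficulty is the radial turning points. Since G depends only on r, ℓ^r solves y'' =
G'(r) y; if ℓ^r is nonzero at parameter 0, all its zeros are therefore simple
(`simple_turning_point`). For each weight w there is a function p, differentiable on all of J, with
p(0) = 0 and p' ℓ^r - p G = w(r) (`exists_regular_quadrature`). Away from the poles p/ℓ^r is a
primitive of w/(ℓ^r)², and across a simple pole the two boundary terms add up to a pure multiple of
1/δ plus o(1). Thus the finite part is exactly p/ℓ^r (`hasFinitePart_wronskian`). Conversely, a
function that vanishes at 0 and has zero Wronskian with ℓ^r vanishes on J
(`eq_zero_of_wronskian_eq_zero`). Every closed formula, multiplied by ℓ^r, is verified by this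
criterion, so that poles need no further attention.

The coordinate components arise by inserting unit initial data; θ decouples from t, r, φ because
reflection at the equatorial plane is an isometry. For null geodesics the solutions ℓ and λℓ fix the
last tetrad column, and the affine dependence of g(ℓ, ξ) on λ fixes the first row; the remaining
entries are contractions of explicit solutions with the tetrad.

A conjugate point is a zero of det W_XL (`isConjugatePoint_iff_det`). In the tetrad this determinant
is λ² times that of the transverse block, which is diagonal. One diagonal entry is a nonzero
multiple of sin φ, the other of I_ABC if no turning point intervenes; then I_ABC is nonzero because
its integrand is positive. -/

/-! ### Linear ordinary differential equations on an interval -/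

/-- Two points of an open interval have a common compact neighbourhood interval inside it. -/
theorem exists_Icc_subset_of_mem {J : Set ℝ} (hJo : IsOpen J) (hJc : J.OrdConnected) {s t : ℝ}
    (hs : s ∈ J) (ht : t ∈ J) :
    ∃ a c, s ∈ Ioo a c ∧ t ∈ Ioo a c ∧ Icc a c ⊆ J := by
  have hmin : min s t ∈ J := by rcases min_choice s t with h | h <;> rw [h] <;> assumption
  have hmax : max s t ∈ J := by rcases max_choice s t with h | h <;> rw [h] <;> assumption
  obtain ⟨δ, hδ, h1⟩ := Metric.isOpen_iff.1 hJo _ hmin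
  obtain ⟨δ', hδ', h2⟩ := Metric.isOpen_iff.1 hJo _ hmax
  have ha : min s t - δ / 2 ∈ J := h1 (by
    rw [Metric.mem_ball, Real.dist_eq]; simp [abs_of_pos, hδ])
  have hc : max s t + δ' / 2 ∈ J := h2 (by
    rw [Metric.mem_ball, Real.dist_eq]; simp [abs_of_pos, hδ'])
  refine ⟨_, _, ⟨?_, ?_⟩, ⟨?_, ?_⟩, hJc.out ha hc⟩
  · linarith [min_le_left s t]
  · linarith [le_max_left s t]
  · linarith [min_le_right s t]
  · linarith [le_max_right s t]

section LinearODE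

variable {E : Type*} [NormedAddCommGroup E] [NormedSpace ℝ E]

theorem exists_nnreal_bound_of_continuousOn {F : Type*} [SeminormedAddCommGroup F] {M : ℝ → F}
    {a c : ℝ} (hM : ContinuousOn M (Icc a c)) :
    ∃ K : NNReal, ∀ t ∈ Icc a c, ‖M t‖ ≤ K := by
  obtain ⟨K, hK⟩ := isCompact_Icc.exists_bound_of_continuousOn hM
  exact ⟨K.toNNReal, fun t ht => (hK t ht).trans (Real.le_coe_toNNReal K)⟩

/-- Only the compact interval around the two parameters matters: there M is bounded, so the affine
field is Lipschitz on the whole space with a uniform constant. On all of J no such constant need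
exist. -/
theorem eqOn_of_linear_ode {J : Set ℝ} (hJo : IsOpen J) (hJc : J.OrdConnected)
    {M : ℝ → E →L[ℝ] E} {b : ℝ → E} (hM : ContinuousOn M J) {t₀ : ℝ} (ht₀ : t₀ ∈ J)
    {f g : ℝ → E} (hf : ∀ t ∈ J, HasDerivAt f (M t (f t) + b t) t)
    (hg : ∀ t ∈ J, HasDerivAt g (M t (g t) + b t) t) (h0 : f t₀ = g t₀) : EqOn f g J := by
  intro s hs
  obtain ⟨a, c, h1, h2, hsub⟩ := exists_Icc_subset_of_mem hJo hJc hs ht₀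
  obtain ⟨K, hK⟩ := exists_nnreal_bound_of_continuousOn (hM.mono hsub)
  have hsub' : ∀ t ∈ Ioo a c, t ∈ J := fun t ht => hsub (Ioo_subset_Icc_self ht)
  refine ODE_solution_unique_of_mem_Ioo (v := fun t y => M t y + b t) (s := fun _ => univ) (K := K)
    (fun t ht => LipschitzOnWith.of_dist_le_mul fun y _ z _ => ?_) h2
    (fun t ht => ⟨hf t (hsub' t ht), mem_univ _⟩) (fun t ht => ⟨hg t (hsub' t ht), mem_univ _⟩)
    h0 h1
  rw [dist_add_right, dist_eq_norm, dist_eq_norm, ← map_sub]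
  exact (M t).le_of_opNorm_le (hK t (Ioo_subset_Icc_self ht)) _

/-- Componentwise truncation to the cube of half-width `ρ`. -/
def cubeClamp {ι : Type*} (ρ : ℝ) (y : ι → ℝ) : ι → ℝ := fun i => max (-ρ) (min ρ (y i))

variable {ι : Type*} [Fintype ι]

theorem lipschitzWith_cubeClamp (ρ : ℝ) : LipschitzWith 1 (cubeClamp (ι := ι) ρ) := by
  refine LipschitzWith.of_dist_le_mul fun y z => ?_
  rw [NNReal.coe_one, one_mul]
  refine (dist_pi_le_iff dist_nonneg).2 fun i => ?_
  refine le_trans ?_ (dist_le_pi_dist y z i)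
  rw [Real.dist_eq, Real.dist_eq]
  have h1 := abs_max_sub_max_le_abs (min ρ (y i)) (min ρ (z i)) (-ρ)
  have h2 := abs_min_sub_min_le_max ρ (y i) ρ (z i)
  rw [sub_self, abs_zero, max_eq_right (abs_nonneg _)] at h2
  simp only [cubeClamp]
  rw [max_comm (-ρ), max_comm (-ρ)]
  exact h1.trans h2

theorem norm_cubeClamp_le {ρ : ℝ} (hρ : 0 ≤ ρ) (y : ι → ℝ) : ‖cubeClamp ρ y‖ ≤ ρ :=
  (pi_norm_le_iff_of_nonneg hρ).2 fun _ => abs_le.2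
    ⟨le_max_left _ _, max_le (by linarith) (min_le_left _ _)⟩

theorem norm_cubeClamp_le_norm {ρ : ℝ} (hρ : 0 ≤ ρ) (y : ι → ℝ) : ‖cubeClamp ρ y‖ ≤ ‖y‖ := by
  have h0 : cubeClamp ρ (0 : ι → ℝ) = 0 := by
    funext i; simp [cubeClamp, hρ]
  have := (lipschitzWith_cubeClamp (ι := ι) ρ).dist_le_mul y 0
  simpa [h0] using this

theorem cubeClamp_eq_self {ρ : ℝ} {y : ι → ℝ} (h : ‖y‖ ≤ ρ) : cubeClamp ρ y = y := by
  funext i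
  have := abs_le.1 ((norm_le_pi_norm y i).trans h)
  simp [cubeClamp, this.1, this.2]

/-- Grönwall's bound in both time directions. -/
theorem norm_le_gronwallBound_Icc {f f' : ℝ → E} {K ε a c t₀ : ℝ} (ht₀ : t₀ ∈ Icc a c)
    (hf : ∀ t ∈ Icc a c, HasDerivWithinAt f (f' t) (Icc a c) t)
    (bound : ∀ t ∈ Icc a c, ‖f' t‖ ≤ K * ‖f t‖ + ε) :
    ∀ t ∈ Icc a c, ‖f t‖ ≤ gronwallBound ‖f t₀‖ K ε |t - t₀| := by
  intro t ht
  rcases le_total t₀ t with h | h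
  · rw [abs_of_nonneg (by linarith)]
    refine norm_le_gronwallBound_of_norm_deriv_right_le (a := t₀) (b := c) (f' := f')
      (fun τ hτ => ((hf τ ⟨ht₀.1.trans hτ.1, hτ.2⟩).continuousWithinAt).mono
        (Icc_subset_Icc_left ht₀.1)) (fun τ hτ => ?_) le_rfl
      (fun τ hτ => bound τ ⟨ht₀.1.trans hτ.1, hτ.2.le⟩) t ⟨h, ht.2⟩
    exact ((hf τ ⟨ht₀.1.trans hτ.1, hτ.2.le⟩).mono (Icc_subset_Icc_left
      (ht₀.1.trans hτ.1))).mono_of_mem_nhdsWithin (Icc_mem_nhdsGE hτ.2)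
  · rw [abs_of_nonpos (by linarith)]
    -- To the left of the initial time the forward estimate is applied to the time-reversed function
    -- τ ↦ f (-τ).
    have key := norm_le_gronwallBound_of_norm_deriv_right_le (a := -t₀) (b := -a)
      (f := fun τ => f (-τ)) (f' := fun τ => -f' (-τ)) (δ := ‖f t₀‖) (K := K) (ε := ε)
      ?_ ?_ (by simp) ?_ (-t) ⟨by linarith, by linarith [ht.1]⟩
    · simpa [neg_add_eq_sub, sub_eq_add_neg, add_comm] using key
    · intro τ hτ
      have h1 := (hf (-τ) ⟨by linarith [hτ.2], by linarith [hτ.1, ht₀.2]⟩).continuousWithinAt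
      refine h1.comp continuous_neg.continuousWithinAt fun u hu => ?_
      exact ⟨by linarith [hu.2], by linarith [hu.1, ht₀.2]⟩
    · intro τ hτ
      have h1 := hf (-τ) ⟨by linarith [hτ.2], by linarith [hτ.1, ht₀.2]⟩
      have h2 : HasDerivWithinAt (fun τ : ℝ => -τ) (-1) (Icc τ (-a)) τ :=
        (hasDerivAt_neg τ).hasDerivWithinAt
      have h3 := h1.scomp τ h2 (fun u hu => (⟨by linarith [hu.2], by linarith [hu.1, hτ.1, ht₀.2]⟩ :
        -u ∈ Icc a c))
      simpa using! h3.mono_of_mem_nhdsWithin (Icc_mem_nhdsGE hτ.2)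
    · intro τ hτ
      simpa using bound (-τ) ⟨by linarith [hτ.2], by linarith [hτ.1, ht₀.2]⟩

/-- A linear field is unbounded, so Picard-Lindelöf alone would give only short-time existence.
Truncating the argument to a cube makes the field bounded and keeps the Lipschitz constant, so the
solution exists on the whole interval. Truncation does not increase the norm, hence Grönwall's bound
for the linear equation also holds for the truncated one; the cube is chosen so large that the
truncation never acts. -/
theorem exists_linear_ode_Icc {a c t₀ : ℝ} (ht₀ : t₀ ∈ Icc a c)
    {M : ℝ → (ι → ℝ) →L[ℝ] (ι → ℝ)} {b : ℝ → ι → ℝ} (hM : ContinuousOn M (Icc a c))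
    (hb : ContinuousOn b (Icc a c)) (y₀ : ι → ℝ) :
    ∃ f : ℝ → ι → ℝ, f t₀ = y₀ ∧
      ∀ t ∈ Icc a c, HasDerivWithinAt f (M t (f t) + b t) (Icc a c) t := by
  obtain ⟨K, hK⟩ := exists_nnreal_bound_of_continuousOn hM
  obtain ⟨ε, hε⟩ := exists_nnreal_bound_of_continuousOn hb
  -- The a priori bound for the untruncated equation over the full length of the interval.
  set ρ : ℝ := gronwallBound ‖y₀‖ K ε (c - a) with hρdef
  have hca : 0 ≤ c - a := by linarith [ht₀.1, ht₀.2]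
  have hmono := gronwallBound_mono (norm_nonneg y₀) ε.2 K.2
  have hρ : 0 ≤ ρ := by
    have := hmono hca
    rw [gronwallBound_x0] at this
    exact (norm_nonneg _).trans this
  let v : ℝ → (ι → ℝ) → ι → ℝ := fun t y => M t (cubeClamp ρ y) + b t
  let Lb : NNReal := K * ⟨ρ, hρ⟩ + ε
  have hmax : 0 ≤ max (c - t₀) (t₀ - a) := le_max_of_le_left (by linarith [ht₀.2])
  -- `Lb` bounds the truncated field everywhere, so the ball of radius `Lb` times the larger time
  -- distance contains the solution up to both ends; the set of initial values is reduced to a point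
  -- (radius 0).
  have hPL : IsPicardLindelof v (⟨t₀, ht₀⟩ : Icc a c) y₀ (Lb * ⟨_, hmax⟩) 0 Lb K := by
    refine ⟨fun t ht => ?_, fun y _ => ?_, fun t ht y _ => ?_, ?_⟩
    · refine LipschitzOnWith.of_dist_le_mul fun y _ z _ => ?_
      simp only [v]
      rw [dist_add_right, dist_eq_norm, ← map_sub]
      refine ((M t).le_of_opNorm_le (hK t ht) _).trans ?_
      refine mul_le_mul_of_nonneg_left ?_ K.2
      rw [← dist_eq_norm]
      simpa using (lipschitzWith_cubeClamp ρ).dist_le_mul y z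
    · exact (hM.clm_apply continuousOn_const).add hb
    · refine (norm_add_le _ _).trans (add_le_add ?_ (hε t ht))
      refine ((M t).le_of_opNorm_le (hK t ht) _).trans ?_
      exact mul_le_mul_of_nonneg_left (norm_cubeClamp_le hρ y) K.2
    · simp only [NNReal.coe_zero, sub_zero]
      exact le_rfl
  obtain ⟨f, hf0, hf⟩ := hPL.exists_eq_forall_mem_Icc_hasDerivWithinAt₀
  refine ⟨f, hf0, fun t ht => ?_⟩
  have hbd := norm_le_gronwallBound_Icc (K := K) (ε := ε) ht₀ hf (fun t ht => by
    refine (norm_add_le _ _).trans (add_le_add ?_ (hε t ht))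
    refine ((M t).le_of_opNorm_le (hK t ht) _).trans ?_
    exact mul_le_mul_of_nonneg_left (norm_cubeClamp_le_norm hρ _) K.2) t ht
  have hle : ‖f t‖ ≤ ρ := by
    refine hbd.trans ?_
    rw [show f t₀ = y₀ from hf0]
    exact hmono (abs_le.2 ⟨by linarith [ht.1, ht₀.2], by linarith [ht.2, ht₀.1]⟩)
  have := hf t ht
  simp only [v, cubeClamp_eq_self hle] at this
  exact this

/-- A linear differential equation with continuous coefficients on an open interval has a solution
on the whole interval, for every initial value. -/
theorem exists_linear_ode [FiniteDimensional ℝ E] {J : Set ℝ} (hJo : IsOpen J)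
    (hJc : J.OrdConnected) {M : ℝ → E →L[ℝ] E} {b : ℝ → E} (hM : ContinuousOn M J)
    (hb : ContinuousOn b J) {t₀ : ℝ} (ht₀ : t₀ ∈ J) (y₀ : E) :
    ∃ f : ℝ → E, f t₀ = y₀ ∧ ∀ t ∈ J, HasDerivAt f (M t (f t) + b t) t := by
  -- Coordinates are used because the truncation refers to the sup norm, for which the cube is a
  -- ball.
  let φ : E ≃L[ℝ] (Fin (Module.finrank ℝ E) → ℝ) := (Module.finBasis ℝ E).equivFunL
  have hloc : ∀ s ∈ J, ∃ a c, ∃ f : ℝ → E, s ∈ Ioo a c ∧ t₀ ∈ Ioo a c ∧ Icc a c ⊆ J ∧ f t₀ = y₀ ∧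
      ∀ t ∈ Ioo a c, HasDerivAt f (M t (f t) + b t) t := by
    intro s hs
    obtain ⟨a, c, h1, h2, hsub⟩ := exists_Icc_subset_of_mem hJo hJc hs ht₀
    obtain ⟨f, hf0, hf⟩ := exists_linear_ode_Icc (Ioo_subset_Icc_self h2)
      (M := fun t => (φ : E →L[ℝ] _) ∘L M t ∘L (φ.symm : _ →L[ℝ] E)) (b := fun t => φ (b t))
      (continuousOn_const.clm_comp ((hM.mono hsub).clm_comp continuousOn_const))
      (φ.continuous.comp_continuousOn (hb.mono hsub)) (φ y₀)
    refine ⟨a, c, fun t => φ.symm (f t), h1, h2, hsub, by simp [hf0], fun t ht => ?_⟩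
    have h3 := (hf t (Ioo_subset_Icc_self ht)).hasDerivAt (Icc_mem_nhds ht.1 ht.2)
    have h4 := (φ.symm : _ →L[ℝ] E).hasFDerivAt.comp_hasDerivAt t h3
    simpa [Function.comp_def] using! h4
  choose! a c f h1 h2 hsub hf0 hf using hloc
  have hagree : ∀ s ∈ J, ∀ t ∈ Ioo (a s) (c s), f t t = f s t := by
    intro s hs t ht
    have htJ : t ∈ J := hsub s hs (Ioo_subset_Icc_self ht)
    have hsub' : Ioo (a s) (c s) ∩ Ioo (a t) (c t) ⊆ J := fun u hu =>
      hsub s hs (Ioo_subset_Icc_self hu.1)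
    exact eqOn_of_linear_ode (isOpen_Ioo.inter isOpen_Ioo) (ordConnected_Ioo.inter ordConnected_Ioo)
      (hM.mono hsub') (b := b) ⟨h2 s hs, h2 t htJ⟩ (fun u hu => hf t htJ u hu.2)
      (fun u hu => hf s hs u hu.1) ((hf0 t htJ).trans (hf0 s hs).symm) ⟨ht, h1 t htJ⟩
  -- Diagonal gluing: the value at t is taken from the solution on the interval chosen for t. All
  -- local intervals contain t₀, so uniqueness on overlaps makes the choice irrelevant near each
  -- point.
  refine ⟨fun t => f t t, hf0 t₀ ht₀, fun s hs => ?_⟩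
  refine (hf s hs s (h1 s hs)).congr_of_eventuallyEq ?_
  filter_upwards [Ioo_mem_nhds (h1 s hs).1 (h1 s hs).2] with t ht using hagree s hs t ht

/-- A solution of a homogeneous linear equation that vanishes at one point vanishes. -/
theorem eq_zero_of_linear_ode {J : Set ℝ} (hJo : IsOpen J) (hJc : J.OrdConnected)
    {M : ℝ → E →L[ℝ] E} (hM : ContinuousOn M J) {t₀ : ℝ} (ht₀ : t₀ ∈ J)
    {f : ℝ → E} (hf : ∀ t ∈ J, HasDerivAt f (M t (f t)) t) (h0 : f t₀ = 0) :
    ∀ t ∈ J, f t = 0 := fun t ht =>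
  eqOn_of_linear_ode hJo hJc hM (b := fun _ => 0) ht₀ (g := fun _ => 0)
    (by simpa using hf) (fun t _ => by simpa using hasDerivAt_const t (0 : E)) h0 ht

end LinearODE

/-! ### Scalar equations of second order -/

/-- The coefficient of the first order system equivalent to `f'' = m f + n f'`. -/
def secondOrderSystem (m n : ℝ) : ℝ × ℝ →L[ℝ] ℝ × ℝ :=
  ContinuousLinearMap.inl ℝ ℝ ℝ ∘L ContinuousLinearMap.snd ℝ ℝ ℝ
    + m • (ContinuousLinearMap.inr ℝ ℝ ℝ ∘L ContinuousLinearMap.fst ℝ ℝ ℝ)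
    + n • (ContinuousLinearMap.inr ℝ ℝ ℝ ∘L ContinuousLinearMap.snd ℝ ℝ ℝ)

theorem continuousOn_secondOrderSystem {J : Set ℝ} {m n : ℝ → ℝ} (hm : ContinuousOn m J)
    (hn : ContinuousOn n J) : ContinuousOn (fun t => secondOrderSystem (m t) (n t)) J := by
  unfold secondOrderSystem
  exact (continuousOn_const.add (hm.smul continuousOn_const)).add (hn.smul continuousOn_const)

theorem eq_zero_of_second_order_ode {J : Set ℝ} (hJo : IsOpen J) (hJc : J.OrdConnected)
    {m n f f' : ℝ → ℝ} (hm : ContinuousOn m J) (hn : ContinuousOn n J) {t₀ : ℝ} (ht₀ : t₀ ∈ J)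
    (hf : ∀ t ∈ J, HasDerivAt f (f' t) t)
    (hf' : ∀ t ∈ J, HasDerivAt f' (m t * f t + n t * f' t) t) (h0 : f t₀ = 0) (h0' : f' t₀ = 0) :
    ∀ t ∈ J, f t = 0 ∧ f' t = 0 := by
  intro t ht
  have := eq_zero_of_linear_ode hJo hJc (continuousOn_secondOrderSystem hm hn) ht₀
    (f := fun t => (f t, f' t)) (fun t ht => by
      simpa [secondOrderSystem] using (hf t ht).prodMk (hf' t ht)) (by simp [h0, h0']) t ht
  simpa using this

theorem exists_second_order_ode {J : Set ℝ} (hJo : IsOpen J) (hJc : J.OrdConnected)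
    {m b : ℝ → ℝ} (hm : ContinuousOn m J) (hb : ContinuousOn b J) {t₀ : ℝ} (ht₀ : t₀ ∈ J)
    (y y' : ℝ) :
    ∃ f f' : ℝ → ℝ, f t₀ = y ∧ f' t₀ = y' ∧ (∀ t ∈ J, HasDerivAt f (f' t) t) ∧
      ∀ t ∈ J, HasDerivAt f' (m t * f t + b t) t := by
  obtain ⟨f, hf0, hf⟩ := exists_linear_ode hJo hJc
    (continuousOn_secondOrderSystem hm (continuousOn_const (c := (0 : ℝ))))
    (b := fun t => ((0 : ℝ), b t)) (continuousOn_const.prodMk hb) ht₀ (y, y')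
  refine ⟨fun t => (f t).1, fun t => (f t).2, by simp [hf0], by simp [hf0], fun t ht => ?_,
    fun t ht => ?_⟩
  · have := (ContinuousLinearMap.fst ℝ ℝ ℝ).hasFDerivAt.comp_hasDerivAt t (hf t ht)
    simpa [secondOrderSystem, Function.comp_def] using this
  · have := (ContinuousLinearMap.snd ℝ ℝ ℝ).hasFDerivAt.comp_hasDerivAt t (hf t ht)
    simpa [secondOrderSystem, Function.comp_def] using this

/-! ### Finite parts of integrals with double poles -/

/-- The thickening is open, so what remains of the segment is compact and u is continuous on it.
Nothing about the structure of the pole set is needed. -/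
theorem intervalIntegrable_indicator_compl_thickening {u : ℝ → ℝ} {J Z : Set ℝ} {a b δ : ℝ}
    (hδ : 0 < δ) (hu : ContinuousOn u (J \ Z)) (hab : uIcc a b ⊆ J) :
    IntervalIntegrable ((Metric.thickening δ Z)ᶜ.indicator u) volume a b := by
  set K := uIcc a b \ Metric.thickening δ Z with hK
  have hKc : IsCompact K := isCompact_uIcc.diff Metric.isOpen_thickening
  have h1 : IntegrableOn u K := (hu.mono fun σ hσ =>
    ⟨hab hσ.1, fun h => hσ.2 (Metric.self_subset_thickening hδ _ h)⟩).integrableOn_compact hKc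
  have h2 : Integrable (K.indicator u) := (integrable_indicator_iff hKc.measurableSet).2 h1
  rw [intervalIntegrable_iff]
  refine h2.integrableOn.congr_fun (fun σ hσ => ?_) measurableSet_uIoc
  have hσ' := uIoc_subset_uIcc hσ
  by_cases h : σ ∈ Metric.thickening δ Z
  · rw [indicator_of_notMem (fun h' => h'.2 h), indicator_of_notMem (notMem_compl_iff.2 h)]
  · rw [indicator_of_mem (show σ ∈ K from ⟨hσ', h⟩), indicator_of_mem (show σ ∈ _ from h)]

theorem HasFinitePart.add_adjacent {u : ℝ → ℝ} {Z : Set ℝ} {a b c v w : ℝ}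
    (h1 : HasFinitePart u Z a b v) (h2 : HasFinitePart u Z b c w)
    (hi1 : ∀ δ > 0, IntervalIntegrable ((Metric.thickening δ Z)ᶜ.indicator u) volume a b)
    (hi2 : ∀ δ > 0, IntervalIntegrable ((Metric.thickening δ Z)ᶜ.indicator u) volume b c) :
    HasFinitePart u Z a c (v + w) := by
  obtain ⟨κ, h⟩ := h1
  obtain ⟨κ', h'⟩ := h2
  refine ⟨κ + κ', (h.add h').congr' ?_⟩
  filter_upwards [self_mem_nhdsWithin] with δ hδ
  rw [← intervalIntegral.integral_add_adjacent_intervals (hi1 δ hδ) (hi2 δ hδ)]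
  ring

theorem HasFinitePart.symm {u : ℝ → ℝ} {Z : Set ℝ} {a b v : ℝ}
    (h : HasFinitePart u Z a b v) : HasFinitePart u Z b a (-v) := by
  obtain ⟨κ, h⟩ := h
  refine ⟨-κ, h.neg.congr fun δ => ?_⟩
  rw [intervalIntegral.integral_symm]
  ring

theorem hasFinitePart_zero (Z : Set ℝ) (a b : ℝ) : HasFinitePart (fun _ => 0) Z a b 0 :=
  ⟨0, by simp⟩

theorem exists_disjoint_thickening {q : ℝ → ℝ} {J : Set ℝ} {a b : ℝ} (hJo : IsOpen J)
    (hq : ContinuousOn q J) (hab : uIcc a b ⊆ J) (h0 : ∀ σ ∈ uIcc a b, q σ ≠ 0) :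
    ∃ δ > 0, Disjoint (Metric.thickening δ {σ | σ ∈ J ∧ q σ = 0}) (uIcc a b) := by
  obtain ⟨δ, hδ, h⟩ := isCompact_uIcc.exists_thickening_subset_open
    (hq.isOpen_inter_preimage hJo isOpen_compl_singleton) (fun σ hσ => ⟨hab hσ, h0 σ hσ⟩)
  refine ⟨δ, hδ, Set.disjoint_left.2 fun σ hσ hσ' => ?_⟩
  obtain ⟨z, hz, hd⟩ := Metric.mem_thickening_iff.1 hσ
  exact (h (Metric.mem_thickening_iff.2 ⟨σ, hσ', by rwa [dist_comm]⟩)).2 hz.2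

/-- The quotient rule and the Wronskian identity make p/q a primitive of w/q². -/
theorem hasFinitePart_of_ne_zero {p q p' q' w : ℝ → ℝ} {J : Set ℝ} (hJo : IsOpen J)
    (hp : ∀ σ ∈ J, HasDerivAt p (p' σ) σ) (hq : ∀ σ ∈ J, HasDerivAt q (q' σ) σ)
    (hw : ContinuousOn w J) (hW : ∀ σ ∈ J, p' σ * q σ - p σ * q' σ = w σ) {a b : ℝ}
    (hab : uIcc a b ⊆ J) (h0 : ∀ σ ∈ uIcc a b, q σ ≠ 0) :
    HasFinitePart (fun σ => w σ / q σ ^ 2) {σ | σ ∈ J ∧ q σ = 0} a b (p b / q b - p a / q a) := by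
  have hqc : ContinuousOn q J := fun σ hσ => (hq σ hσ).continuousAt.continuousWithinAt
  obtain ⟨δ, hδ, hd⟩ := exists_disjoint_thickening hJo hqc hab h0
  have h1 : ∫ σ in a..b, w σ / q σ ^ 2 = p b / q b - p a / q a := by
    refine intervalIntegral.integral_eq_sub_of_hasDerivAt (f := fun σ => p σ / q σ)
      (fun σ hσ => ?_) ?_
    · rw [← hW σ (hab hσ)]
      exact (hp σ (hab hσ)).div (hq σ (hab hσ)) (h0 σ hσ)
    · exact ((hw.mono hab).div ((hqc.mono hab).pow 2)
        fun σ hσ => pow_ne_zero 2 (h0 σ hσ)).intervalIntegrable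
  rw [← h1]
  exact hasFinitePart_integral hδ hd

/-- A function whose second derivative vanishes at a zero has a difference quotient that is
stationary there. -/
theorem hasDerivAt_dslope_zero {q q' : ℝ → ℝ} {z : ℝ} (hq : ∀ᶠ σ in 𝓝 z, HasDerivAt q (q' σ) σ)
    (hq' : HasDerivAt q' 0 z) : HasDerivAt (dslope q z) 0 z := by
  rw [hasDerivAt_iff_isLittleO, Asymptotics.isLittleO_iff]
  intro ε hε
  have h1 := (Asymptotics.isLittleO_iff.1 (hasDerivAt_iff_isLittleO.1 hq')) hε
  obtain ⟨r, hr, h⟩ := Metric.eventually_nhds_iff_ball.1 (hq.and h1)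
  filter_upwards [Metric.ball_mem_nhds z hr] with w hw
  rcases eq_or_ne w z with rfl | hne
  · simp
  have hsub : uIcc z w ⊆ Metric.ball z r :=
    (convex_ball z r).ordConnected.uIcc_subset (Metric.mem_ball_self hr) hw
  -- Mean value inequality for q(σ) - q'(z) σ on the segment from z to w: its derivative q'(σ) -
  -- q'(z) is at most ε|w - z| there, because q' has derivative zero at z.
  have key := (convex_uIcc z w).norm_image_sub_le_of_norm_hasDerivWithin_le
    (f := fun σ => q σ - q' z * σ) (f' := fun σ => q' σ - q' z) (C := ε * ‖w - z‖)
    (fun σ hσ => (((h σ (hsub hσ)).1.sub ((hasDerivAt_id σ).const_mul (q' z))).congr_deriv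
      (by simp)).hasDerivWithinAt)
    (fun σ hσ => by
      have h2 := (h σ (hsub hσ)).2
      simp only [smul_zero, sub_zero] at h2
      refine h2.trans (mul_le_mul_of_nonneg_left ?_ hε.le)
      exact abs_sub_left_of_mem_uIcc hσ) left_mem_uIcc right_mem_uIcc
  have hd : deriv q z = q' z := hq.self_of_nhds.deriv
  have hwz : w - z ≠ 0 := sub_ne_zero.2 hne
  rw [dslope_of_ne _ hne, dslope_same, hd, slope_def_field, smul_zero, sub_zero]
  have e : (q w - q z) / (w - z) - q' z = (q w - q' z * w - (q z - q' z * z)) / (w - z) := by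
    field_simp
    ring
  rw [e, norm_div, div_le_iff₀ (norm_pos_iff.2 hwz)]
  exact key

/-- The right and left difference quotients both tend to m', and the expression is their difference.
One derivative at z suffices; this is the estimate for the two boundary terms next to a pole. -/
theorem tendsto_symmetric_second_difference {m : ℝ → ℝ} {m' z : ℝ} (h : HasDerivAt m m' z) :
    Tendsto (fun δ : ℝ => (m (z + δ) + m (z - δ) - 2 * m z) / δ) (𝓝[>] 0) (𝓝 0) := by
  have h1 := h.tendsto_slope_zero_right
  have h2 : Tendsto (fun t : ℝ => -t) (𝓝[>] (0 : ℝ)) (𝓝[<] 0) := by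
    simpa using tendsto_neg_nhdsGT (a := (0 : ℝ))
  have h3 := h.tendsto_slope_zero_left.comp h2
  have h4 := h1.sub h3
  rw [sub_self] at h4
  refine h4.congr' ?_
  filter_upwards [self_mem_nhdsWithin] with δ hδ
  have : δ ≠ 0 := ne_of_gt hδ
  simp only [Function.comp_apply, smul_eq_mul, ← sub_eq_add_neg]
  field_simp
  ring

/-- Off the pole p/q is a primitive, so the cut integral is [p/q] from a to b plus p/q at z - δ
minus p/q at z + δ. With q(σ) = (σ - z) · `dslope q z σ` and m = p / `dslope q z`, the extra terms
are -(m(z + δ) + m(z - δ))/δ = -2 m(z)/δ + o(1), so nothing finite is left over. The vanishing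
derivative of q' at z enters only through the differentiability of `dslope q z`. The hypothesis on
thickenings says that for small δ no other zero of q cuts into the interval. -/
theorem hasFinitePart_of_simple_zero {p q p' q' w : ℝ → ℝ} {J : Set ℝ} (hJo : IsOpen J)
    (hp : ∀ σ ∈ J, HasDerivAt p (p' σ) σ) (hq : ∀ σ ∈ J, HasDerivAt q (q' σ) σ)
    (hw : ContinuousOn w J) (hW : ∀ σ ∈ J, p' σ * q σ - p σ * q' σ = w σ) {a z b : ℝ}
    (hab : Icc a b ⊆ J) (haz : a < z) (hzb : z < b) (hz : q z = 0)
    (h0 : ∀ σ ∈ Icc a b, σ ≠ z → q σ ≠ 0) (hqz : q' z ≠ 0) (hq' : HasDerivAt q' 0 z)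
    (hZ : ∀ᶠ δ in 𝓝[>] (0 : ℝ), ∀ σ ∈ Icc a b,
      (σ ∈ Metric.thickening δ {σ | σ ∈ J ∧ q σ = 0} ↔ σ ∈ Metric.ball z δ)) :
    HasFinitePart (fun σ => w σ / q σ ^ 2) {σ | σ ∈ J ∧ q σ = 0} a b (p b / q b - p a / q a) := by
  set Z : Set ℝ := {σ | σ ∈ J ∧ q σ = 0} with hZdef
  set u : ℝ → ℝ := fun σ => w σ / q σ ^ 2 with hudef
  have hqc : ContinuousOn q J := fun σ hσ => (hq σ hσ).continuousAt.continuousWithinAt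
  have huc : ContinuousOn u (J \ Z) := (hw.mono sdiff_subset).div ((hqc.mono sdiff_subset).pow 2)
    fun σ hσ => pow_ne_zero 2 fun h => hσ.2 ⟨hσ.1, h⟩
  have hzJ : z ∈ J := hab ⟨haz.le, hzb.le⟩
  have hdz : HasDerivAt (dslope q z) 0 z := hasDerivAt_dslope_zero
    (Filter.eventually_of_mem (hJo.mem_nhds hzJ) fun σ hσ => hq σ hσ) hq'
  have hds : dslope q z z = q' z := by rw [dslope_same, (hq z hzJ).deriv]
  have hm := (hp z hzJ).div hdz (by rwa [hds])
  have hlim := tendsto_symmetric_second_difference hm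
  -- This is -2 m(z), since `dslope q z z` equals q'(z).
  refine ⟨-2 * (p z / q' z), ?_⟩
  have hlim' := (tendsto_const_nhds (x := p b / q b - p a / q a)).sub hlim
  rw [sub_zero] at hlim'
  refine hlim'.congr' ?_
  filter_upwards [hZ, self_mem_nhdsWithin, Ioo_mem_nhdsGT (sub_pos.2 haz),
    Ioo_mem_nhdsGT (sub_pos.2 hzb)] with δ hδZ hδ hδa hδb
  have hδ0 : (0 : ℝ) < δ := hδ
  have hδne : δ ≠ 0 := hδ0.ne'
  have hFTC : ∀ c d, c ≤ d → Icc c d ⊆ Icc a b → z ∉ Icc c d →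
      (∀ σ ∈ Icc c d, σ ∉ Metric.ball z δ) →
      ∫ σ in c..d, (Metric.thickening δ Z)ᶜ.indicator u σ = p d / q d - p c / q c := by
    intro c d hcd hsub hz hball
    have hne : ∀ σ ∈ uIcc c d, q σ ≠ 0 := fun σ hσ => by
      rw [uIcc_of_le hcd] at hσ
      exact h0 σ (hsub hσ) fun h => hz (h ▸ hσ)
    have hsubJ : uIcc c d ⊆ J := by rw [uIcc_of_le hcd]; exact hsub.trans hab
    rw [intervalIntegral.integral_congr (g := u) fun σ hσ => ?_]
    · refine intervalIntegral.integral_eq_sub_of_hasDerivAt (f := fun σ => p σ / q σ)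
        (fun σ hσ => ?_) ?_
      · rw [hudef]
        simp only
        rw [← hW σ (hsubJ hσ)]
        exact (hp σ (hsubJ hσ)).div (hq σ (hsubJ hσ)) (hne σ hσ)
      · exact (huc.mono fun σ hσ => ⟨hsubJ hσ, fun h => hne σ hσ h.2⟩).intervalIntegrable
    · rw [uIcc_of_le hcd] at hσ
      exact indicator_of_mem (mem_compl fun h => hball σ hσ ((hδZ σ (hsub hσ)).1 h)) _
  have hint : ∀ c d, c ∈ Icc a b → d ∈ Icc a b →
      IntervalIntegrable ((Metric.thickening δ Z)ᶜ.indicator u) volume c d := fun c d hc hd =>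
    intervalIntegrable_indicator_compl_thickening hδ0 huc
      ((ordConnected_Icc.uIcc_subset hc hd).trans hab)
  have ma : a ∈ Icc a b := ⟨le_rfl, by linarith⟩
  have mb : b ∈ Icc a b := ⟨by linarith, le_rfl⟩
  have m1 : z - δ ∈ Icc a b := ⟨by linarith [hδa.2], by linarith⟩
  have m2 : z + δ ∈ Icc a b := ⟨by linarith, by linarith [hδb.2]⟩
  have i1 := hFTC a (z - δ) (by linarith [hδa.2]) (Icc_subset_Icc_right m1.2)
    (fun h => by linarith [h.2]) (fun σ hσ h => by
      rw [Metric.mem_ball, Real.dist_eq, abs_lt] at h; linarith [hσ.2, h.1])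
  have i3 := hFTC (z + δ) b (by linarith [hδb.2]) (Icc_subset_Icc_left m2.1)
    (fun h => by linarith [h.1]) (fun σ hσ h => by
      rw [Metric.mem_ball, Real.dist_eq, abs_lt] at h; linarith [hσ.1, h.2])
  -- The middle piece is cut out entirely; passing to the open interval discards the endpoint z + δ,
  -- which does not belong to the removed ball.
  have i2 : ∫ σ in (z - δ)..(z + δ), (Metric.thickening δ Z)ᶜ.indicator u σ = 0 := by
    rw [intervalIntegral.integral_of_le (by linarith), integral_Ioc_eq_integral_Ioo]
    refine setIntegral_eq_zero_of_forall_eq_zero fun σ hσ => ?_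
    refine indicator_of_notMem (notMem_compl_iff.2 ?_) _
    rw [hδZ σ ⟨by linarith [hσ.1, m1.1], by linarith [hσ.2, m2.2]⟩, Real.ball_eq_Ioo]
    exact hσ
  rw [← intervalIntegral.integral_add_adjacent_intervals (hint a (z - δ) ma m1)
    (hint _ b m1 mb), ← intervalIntegral.integral_add_adjacent_intervals
    (hint (z - δ) (z + δ) m1 m2) (hint _ b m2 mb), i1, i2, i3]
  have n1 : q (z - δ) ≠ 0 := h0 _ m1 (by intro h; linarith)
  have n2 : q (z + δ) ≠ 0 := h0 _ m2 (by intro h; linarith)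
  have e1 : (p / dslope q z) (z + δ) = δ * (p (z + δ) / q (z + δ)) := by
    rw [Pi.div_apply, dslope_of_ne _ (by intro h; linarith), slope_def_field, hz]
    simp only [add_sub_cancel_left, sub_zero]
    field_simp
  have e2 : (p / dslope q z) (z - δ) = -δ * (p (z - δ) / q (z - δ)) := by
    rw [Pi.div_apply, dslope_of_ne _ (by intro h; linarith), slope_def_field, hz]
    simp only [sub_sub_cancel_left, sub_zero]
    field_simp
  have e3 : (p / dslope q z) z = p z / q' z := by rw [Pi.div_apply, hds]
  rw [e1, e2, e3]
  have hqb := h0 b mb hzb.ne'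
  have hqa := h0 a ma haz.ne
  field_simp
  ring

/-- Finite part of the integral of a quotient of a Wronskian by the square of a function with simple
zeros. -/
theorem hasFinitePart_wronskian {p q p' q' w : ℝ → ℝ} {J : Set ℝ} (hJo : IsOpen J)
    (hJc : J.OrdConnected)
    (hp : ∀ σ ∈ J, HasDerivAt p (p' σ) σ) (hq : ∀ σ ∈ J, HasDerivAt q (q' σ) σ)
    (hw : ContinuousOn w J) (hW : ∀ σ ∈ J, p' σ * q σ - p σ * q' σ = w σ)
    (hsimple : ∀ σ ∈ J, q σ = 0 → q' σ ≠ 0 ∧ HasDerivAt q' 0 σ) {a b : ℝ}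
    (ha : a ∈ J) (hb : b ∈ J) (hqa : q a ≠ 0) (hqb : q b ≠ 0) :
    HasFinitePart (fun σ => w σ / q σ ^ 2) {σ | σ ∈ J ∧ q σ = 0} a b (p b / q b - p a / q a) := by
  set Z : Set ℝ := {σ | σ ∈ J ∧ q σ = 0} with hZdef
  set u : ℝ → ℝ := fun σ => w σ / q σ ^ 2 with hudef
  have hqc : ContinuousOn q J := fun σ hσ => (hq σ hσ).continuousAt.continuousWithinAt
  have huc : ContinuousOn u (J \ Z) := (hw.mono sdiff_subset).div ((hqc.mono sdiff_subset).pow 2)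
    fun σ hσ => pow_ne_zero 2 fun h => hσ.2 ⟨hσ.1, h⟩
  have hpunct : ∀ σ ∈ J, ∀ᶠ τ in 𝓝[≠] σ, q τ ≠ 0 := fun σ hσ => by
    by_cases h : q σ = 0
    · exact (hq σ hσ).eventually_ne (hsimple σ hσ h).1
    · exact ((hq σ hσ).continuousAt.eventually_ne h).filter_mono nhdsWithin_le_nhds
  have hlocal : ∀ σ ∈ J, ∃ r > 0, ∀ c ∈ Metric.ball σ r, ∀ d ∈ Metric.ball σ r, q c ≠ 0 → q d ≠ 0 →
      HasFinitePart u Z c d (p d / q d - p c / q c) := by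
    intro σ hσ
    obtain ⟨R, hR, h⟩ := Metric.eventually_nhds_iff_ball.1
      ((eventually_nhdsWithin_iff.1 (hpunct σ hσ)).and (hJo.mem_nhds hσ))
    -- Half the radius leaves a margin: a zero at distance less than δ < R/2 from a point of the
    -- small ball lies in the ball of radius R, where σ is the only possible zero.
    refine ⟨R / 2, by linarith, ?_⟩
    have hsub : Metric.ball σ (R / 2) ⊆ Metric.ball σ R := Metric.ball_subset_ball (by linarith)
    have main : ∀ c ∈ Metric.ball σ (R / 2), ∀ d ∈ Metric.ball σ (R / 2), c ≤ d → q c ≠ 0 →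
        q d ≠ 0 → HasFinitePart u Z c d (p d / q d - p c / q c) := by
      intro c hc d hd hcd hqc0 hqd0
      have hIcc : Icc c d ⊆ Metric.ball σ (R / 2) := by
        rw [← uIcc_of_le hcd]
        exact (convex_ball σ (R / 2)).ordConnected.uIcc_subset hc hd
      have hIccJ : Icc c d ⊆ J := fun τ hτ => (h τ (hsub (hIcc hτ))).2
      by_cases hpole : q σ = 0 ∧ σ ∈ Icc c d
      · obtain ⟨hz, hcσ, hσd⟩ := hpole
        have hcσ' : c < σ := lt_of_le_of_ne hcσ fun h => hqc0 (h ▸ hz)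
        have hσd' : σ < d := lt_of_le_of_ne hσd fun h => hqd0 (h ▸ hz)
        refine hasFinitePart_of_simple_zero hJo hp hq hw hW hIccJ hcσ' hσd' hz
          (fun τ hτ hne => (h τ (hsub (hIcc hτ))).1 hne) (hsimple σ hσ hz).1 (hsimple σ hσ hz).2 ?_
        filter_upwards [Ioo_mem_nhdsGT (show (0 : ℝ) < R / 2 by linarith)] with δ hδ τ hτ
        rw [Metric.mem_thickening_iff]
        constructor
        · rintro ⟨ζ, hζ, hd⟩
          have hζσ : ζ = σ := by
            by_contra hne
            refine (h ζ ?_).1 hne hζ.2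
            have := hIcc hτ
            rw [Metric.mem_ball] at this ⊢
            linarith [dist_triangle ζ τ σ, hδ.2, dist_comm ζ τ]
          rwa [hζσ] at hd
        · exact fun hτ => ⟨σ, ⟨hσ, hz⟩, hτ⟩
      · refine hasFinitePart_of_ne_zero hJo hp hq hw hW (by rwa [uIcc_of_le hcd]) fun τ hτ => ?_
        rw [uIcc_of_le hcd] at hτ
        by_cases hτσ : τ = σ
        · subst hτσ
          exact fun h => hpole ⟨h, hτ⟩
        · exact (h τ (hsub (hIcc hτ))).1 hτσ
    intro c hc d hd hqc0 hqd0
    rcases le_total c d with hcd | hcd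
    · exact main c hc d hd hcd hqc0 hqd0
    · have := (main d hd c hc hcd hqd0 hqc0).symm
      rwa [neg_sub] at this
  -- The local formula is propagated along the interval by a transitive relation. It is stated for
  -- endpoints near σ and τ, not at them, because σ or τ may be a zero of q, where p/q has no
  -- meaning.
  let P : ℝ → ℝ → Prop := fun σ τ => ∀ᶠ e in 𝓝 σ ×ˢ 𝓝 τ, q e.1 ≠ 0 → q e.2 ≠ 0 →
    HasFinitePart u Z e.1 e.2 (p e.2 / q e.2 - p e.1 / q e.1)
  have hP : P a b := by
    refine hJc.isPreconnected.induction₂' P (fun σ hσ => ?_) (fun σ τ υ hσ hτ hυ h1 h2 => ?_) ha hb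
    · obtain ⟨r, hr, h⟩ := hlocal σ hσ
      have hb := Metric.ball_mem_nhds σ hr
      have key : ∀ τ ∈ Metric.ball σ r, P σ τ ∧ P τ σ := fun τ hτ => by
        have hτ' := Metric.isOpen_ball.mem_nhds hτ
        constructor
        · filter_upwards [Filter.prod_mem_prod hb hτ'] with e he using h e.1 he.1 e.2 he.2
        · filter_upwards [Filter.prod_mem_prod hτ' hb] with e he using h e.1 he.1 e.2 he.2
      exact nhdsWithin_le_nhds (Filter.mem_of_superset hb key)
    · obtain ⟨N1, hN1, N2, hN2, hN⟩ := Filter.mem_prod_iff.1 h1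
      obtain ⟨N3, hN3, N4, hN4, hN'⟩ := Filter.mem_prod_iff.1 h2
      -- For transitivity the intermediate endpoint is moved off τ to a nearby point with q ≠ 0,
      -- which exists because the zeros are isolated.
      have hN23 : ∀ᶠ m in 𝓝[≠] τ, m ∈ N2 ∩ N3 ∩ J := mem_nhdsWithin_of_mem_nhds
        (Filter.inter_mem (Filter.inter_mem hN2 hN3) (hJo.mem_nhds hτ))
      obtain ⟨m, hm0, ⟨hm2, hm3⟩, hmJ⟩ := ((hpunct τ hτ).and hN23).exists
      filter_upwards [Filter.prod_mem_prod hN1 hN4,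
        Filter.prod_mem_prod (hJo.mem_nhds hσ) (hJo.mem_nhds hυ)] with e he heJ he1 he2
      have f1 := hN (show (e.1, m) ∈ N1 ×ˢ N2 from ⟨he.1, hm2⟩) he1 hm0
      have f2 := hN' (show (m, e.2) ∈ N3 ×ˢ N4 from ⟨hm3, he.2⟩) hm0 he2
      have := f1.add_adjacent f2
        (fun δ hδ => intervalIntegrable_indicator_compl_thickening hδ huc
          (hJc.uIcc_subset heJ.1 hmJ))
        (fun δ hδ => intervalIntegrable_indicator_compl_thickening hδ huc
          (hJc.uIcc_subset hmJ heJ.2))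
      convert this using 1
      ring
  have hP' : ∀ᶠ e in 𝓝 (a, b), q e.1 ≠ 0 → q e.2 ≠ 0 →
      HasFinitePart u Z e.1 e.2 (p e.2 / q e.2 - p e.1 / q e.1) := by
    rw [nhds_prod_eq]
    exact hP
  exact hP'.self_of_nhds hqa hqb

/-- A function whose Wronskian with a function with simple zeros vanishes is a multiple of it. -/
theorem eq_zero_of_wronskian_eq_zero {f q f' q' : ℝ → ℝ} {J : Set ℝ} (hJo : IsOpen J)
    (hJc : J.OrdConnected)
    (hf : ∀ σ ∈ J, HasDerivAt f (f' σ) σ) (hq : ∀ σ ∈ J, HasDerivAt q (q' σ) σ)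
    (hW : ∀ σ ∈ J, f' σ * q σ - f σ * q' σ = 0)
    (hsimple : ∀ σ ∈ J, q σ = 0 → q' σ ≠ 0 ∧ HasDerivAt q' 0 σ) {a : ℝ}
    (ha : a ∈ J) (hqa : q a ≠ 0) (hfa : f a = 0) : ∀ σ ∈ J, f σ = 0 := by
  intro σ hσ
  by_cases h : q σ = 0
  · have := hW σ hσ
    rw [h, mul_zero, zero_sub, neg_eq_zero] at this
    exact (mul_eq_zero.1 this).resolve_right (hsimple σ hσ h).1
  -- Where q ≠ 0, the value f/q is the finite part of the integral of the zero function, hence 0 by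
  -- uniqueness. At a zero of q the Wronskian itself reads f q' = 0, which was used above.
  · have h1 := hasFinitePart_wronskian hJo hJc hf hq (w := fun _ => 0) continuousOn_const hW hsimple
      ha hσ hqa h
    simp only [zero_div, hfa, sub_zero] at h1
    have := h1.unique (hasFinitePart_zero _ _ _)
    exact (div_eq_zero_iff.1 this).resolve_right h

/-! ### Linearization of the geodesic equation and the geodesic deviation equation -/

section SecondDerivative

variable {E F : Type*} [NormedAddCommGroup E] [NormedSpace ℝ E] [NormedAddCommGroup F]
  [NormedSpace ℝ F]

theorem ContDiffAt.differentiableAt_fderiv {f : E → F} {p : E} (hf : ContDiffAt ℝ ∞ f p) :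
    DifferentiableAt ℝ (fderiv ℝ f) p :=
  (hf.fderiv_right (m := 1) (by norm_cast)).differentiableAt (by simp)

theorem ContDiffAt.fderiv_fderiv_comm {f : E → F} {p : E} (hf : ContDiffAt ℝ ∞ f p) (v w : E) :
    fderiv ℝ (fderiv ℝ f) p v w = fderiv ℝ (fderiv ℝ f) p w v :=
  (hf.of_le (m := 2) ENat.LEInfty.out).isSymmSndFDerivAt (by simp) v w

/-- DQ(X) = 0 near p is differentiated in the direction δ; symmetry of the second derivative puts X
into the first slot. -/
theorem fderiv_fderiv_apply_of_eventually_eq_zero {Q : E → F} {X : E → E} {p : E}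
    (hQ : ContDiffAt ℝ ∞ Q p) (hX : DifferentiableAt ℝ X p)
    (h : ∀ᶠ q in 𝓝 p, fderiv ℝ Q q (X q) = 0) (δ : E) :
    fderiv ℝ (fderiv ℝ Q) p (X p) δ + fderiv ℝ Q p (fderiv ℝ X p δ) = 0 := by
  have h2 : fderiv ℝ (fun q => fderiv ℝ Q q (X q)) p = 0 := by
    rw [Filter.EventuallyEq.fderiv_eq (f := fun _ => (0 : F)) h]
    simp
  have h3 := congrArg (fun L => L δ)
    (hQ.differentiableAt_fderiv.hasFDerivAt.clm_apply hX.hasFDerivAt).fderiv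
  rw [h2] at h3
  rw [hQ.fderiv_fderiv_comm, add_comm]
  simpa using h3.symm

/-- The flow equation ∂_v Φ = X ∘ Φ is differentiated in the direction δ, and the derivatives are
interchanged. This is the linearized equation for ∂_δ Φ. -/
theorem fderiv_fderiv_apply_of_eventually_eq_comp {Φ : E → F} {X : F → F} {p v : E}
    (hΦ : ContDiffAt ℝ ∞ Φ p) (hX : DifferentiableAt ℝ X (Φ p))
    (h : ∀ᶠ q in 𝓝 p, fderiv ℝ Φ q v = X (Φ q)) (δ : E) :
    fderiv ℝ (fderiv ℝ Φ) p v δ = fderiv ℝ X (Φ p) (fderiv ℝ Φ p δ) := by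
  have h2 : fderiv ℝ (fun q => fderiv ℝ Φ q v) p = fderiv ℝ (fun q => X (Φ q)) p :=
    Filter.EventuallyEq.fderiv_eq h
  have h3 := (hX.hasFDerivAt.comp p (hΦ.differentiableAt (by simp)).hasFDerivAt).fderiv
  have h4 := (hΦ.differentiableAt_fderiv.hasFDerivAt.clm_apply (hasFDerivAt_const v p)).fderiv
  have h5 := congrArg (fun L => L δ) (h4.symm.trans (h2.trans h3))
  rw [hΦ.fderiv_fderiv_comm]
  simpa using h5

/-- The derivative along the integral curve is D²Q(X, Y) + DQ(DX Y), which is the derivative of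
DQ(X) = 0 in the direction Y. -/
theorem hasDerivAt_fderiv_apply_of_firstIntegral {Q : E → F} {X : E → E} {c Y : ℝ → E} {s : ℝ}
    (hQ : ContDiffAt ℝ ∞ Q (c s)) (hX : DifferentiableAt ℝ X (c s))
    (h : ∀ᶠ q in 𝓝 (c s), fderiv ℝ Q q (X q) = 0) (hc : HasDerivAt c (X (c s)) s)
    (hY : HasDerivAt Y (fderiv ℝ X (c s) (Y s)) s) :
    HasDerivAt (fun s => fderiv ℝ Q (c s) (Y s)) 0 s :=
  ((hQ.differentiableAt_fderiv.hasFDerivAt.comp_hasDerivAt s hc).clm_apply hY).congr_deriv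
    (fderiv_fderiv_apply_of_eventually_eq_zero hQ hX h (Y s))

end SecondDerivative

/-! ### Phase space, the linearized geodesic equation and its resolvent -/

/-- Positions and velocities. -/
abbrev Phase := (Fin 4 → ℝ) × (Fin 4 → ℝ)

/-- An open region of the chart in which the Christoffel symbols are smooth and symmetric. -/
structure IsSmoothRegion (g : (Fin 4 → ℝ) → Matrix (Fin 4) (Fin 4) ℝ) (M : Set (Fin 4 → ℝ)) :
    Prop where
  isOpen : IsOpen M
  smooth : ∀ μ α β, ContDiffOn ℝ ∞ (fun y => christoffel g y μ α β) M
  symm : ∀ y ∈ M, ∀ μ α β, christoffel g y μ α β = christoffel g y μ β α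

/-- The vector field on phase space whose integral curves are the geodesics. -/
noncomputable def geodesicField (g : (Fin 4 → ℝ) → Matrix (Fin 4) (Fin 4) ℝ) (p : Phase) : Phase :=
  (p.2, -gammaVec g p.1 p.2 p.2)

/-- `(∂_δ Γ^μ_{αβ}) v^α w^β`. -/
noncomputable def dGammaVec (g : (Fin 4 → ℝ) → Matrix (Fin 4) (Fin 4) ℝ) (y δ v w : Fin 4 → ℝ) : Fin 4 → ℝ :=
  fun μ => ∑ α, ∑ β, fderiv ℝ (fun z => christoffel g z μ α β) y δ * v α * w β

/-- `Y` solves the linearization of the geodesic equation along `(x, ℓ)`. -/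
noncomputable def IsVariation (g : (Fin 4 → ℝ) → Matrix (Fin 4) (Fin 4) ℝ) (x ℓ : ℝ → Fin 4 → ℝ) (J : Set ℝ)
    (Y : ℝ → Phase) : Prop :=
  ∀ s ∈ J, HasDerivAt Y (fderiv ℝ (geodesicField g) (x s, ℓ s) (Y s)) s

theorem gammaVec_add_right (g : (Fin 4 → ℝ) → Matrix (Fin 4) (Fin 4) ℝ) (y v w w' : Fin 4 → ℝ) :
    gammaVec g y v (w + w') = gammaVec g y v w + gammaVec g y v w' := by
  funext μ
  simp only [gammaVec, Pi.add_apply, mul_add, Finset.sum_add_distrib]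

theorem gammaVec_smul_right (g : (Fin 4 → ℝ) → Matrix (Fin 4) (Fin 4) ℝ) (y v w : Fin 4 → ℝ)
    (c : ℝ) : gammaVec g y v (c • w) = c • gammaVec g y v w := by
  funext μ
  simp only [gammaVec, Pi.smul_apply, smul_eq_mul, Finset.mul_sum]
  exact Finset.sum_congr rfl fun α _ => Finset.sum_congr rfl fun β _ => by ring

theorem gammaVec_neg_right (g : (Fin 4 → ℝ) → Matrix (Fin 4) (Fin 4) ℝ) (y v w : Fin 4 → ℝ) :
    gammaVec g y v (-w) = -gammaVec g y v w := by
  simpa using gammaVec_smul_right g y v w (-1)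

theorem fderiv_eq_sum_partialDeriv (f : (Fin 4 → ℝ) → ℝ) (y v : Fin 4 → ℝ) :
    fderiv ℝ f y v = ∑ β, v β * partialDeriv f β y := by
  conv_lhs => rw [pi_eq_sum_univ' v]
  simp only [map_sum, map_smul, smul_eq_mul, partialDeriv]

/-- Curvature contracted twice with ℓ is rewritten by Christoffel symbols and their directional
derivatives. The right side is what the commutation of derivatives produces in the linearized
geodesic equation, so curvature is eliminated from the argument here. The proof only brings all
index sums into the common order α, β, ν. -/
theorem tidalVec_eq (g : (Fin 4 → ℝ) → Matrix (Fin 4) (Fin 4) ℝ) (y v ξ : Fin 4 → ℝ) :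
    tidalVec g y v ξ = dGammaVec g y v v ξ - dGammaVec g y ξ v v
      + gammaVec g y v (gammaVec g y v ξ) - gammaVec g y ξ (gammaVec g y v v) := by
  funext μ
  have e1 : dGammaVec g y v v ξ μ = ∑ α, ∑ β, ∑ ν,
      partialDeriv (fun z => christoffel g z μ α ν) β y * v α * v β * ξ ν := by
    simp only [dGammaVec, fderiv_eq_sum_partialDeriv, Finset.sum_mul]
    refine Finset.sum_congr rfl fun α _ => ?_
    rw [Finset.sum_comm]
    exact Finset.sum_congr rfl fun β _ => Finset.sum_congr rfl fun ν _ => by ring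
  have e2 : dGammaVec g y ξ v v μ = ∑ α, ∑ β, ∑ ν,
      partialDeriv (fun z => christoffel g z μ α β) ν y * v α * v β * ξ ν := by
    simp only [dGammaVec, fderiv_eq_sum_partialDeriv, Finset.sum_mul]
    exact Finset.sum_congr rfl fun α _ => Finset.sum_congr rfl fun β _ =>
      Finset.sum_congr rfl fun ν _ => by ring
  have e3 : gammaVec g y v (gammaVec g y v ξ) μ = ∑ α, ∑ β, ∑ ν, ∑ σ,
      christoffel g y μ β σ * christoffel g y σ α ν * v α * v β * ξ ν := by
    simp only [gammaVec, Finset.mul_sum]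
    rw [Finset.sum_comm (f := fun α β => ∑ ν, ∑ σ,
      christoffel g y μ β σ * christoffel g y σ α ν * v α * v β * ξ ν)]
    refine Finset.sum_congr rfl fun β _ => ?_
    rw [Finset.sum_comm]
    refine Finset.sum_congr rfl fun α _ => ?_
    rw [Finset.sum_comm]
    exact Finset.sum_congr rfl fun ν _ => Finset.sum_congr rfl fun σ _ => by ring
  have e4 : gammaVec g y ξ (gammaVec g y v v) μ = ∑ α, ∑ β, ∑ ν, ∑ σ,
      christoffel g y μ ν σ * christoffel g y σ α β * v α * v β * ξ ν := by
    have h : gammaVec g y ξ (gammaVec g y v v) μ = ∑ ν, ∑ α, ∑ β, ∑ σ,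
        christoffel g y μ ν σ * christoffel g y σ α β * v α * v β * ξ ν := by
      simp only [gammaVec, Finset.mul_sum]
      refine Finset.sum_congr rfl fun ν _ => ?_
      rw [Finset.sum_comm]
      refine Finset.sum_congr rfl fun α _ => ?_
      rw [Finset.sum_comm]
      exact Finset.sum_congr rfl fun β _ => Finset.sum_congr rfl fun σ _ => by ring
    rw [h, Finset.sum_comm]
    exact Finset.sum_congr rfl fun α _ => Finset.sum_comm
  simp only [Pi.sub_apply, Pi.add_apply, e1, e2, e3, e4, tidalVec, riemann,
    ← Finset.sum_add_distrib, ← Finset.sum_sub_distrib]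
  refine Finset.sum_congr rfl fun α _ => Finset.sum_congr rfl fun β _ =>
    Finset.sum_congr rfl fun ν _ => ?_
  rw [add_mul, add_mul, add_mul, Finset.sum_mul, Finset.sum_mul, Finset.sum_mul, sub_mul, sub_mul,
    sub_mul]
  rw [add_sub_assoc, ← Finset.sum_sub_distrib]
  congr 1
  exact Finset.sum_congr rfl fun σ _ => by ring

theorem hasDerivAt_gammaVec {g : (Fin 4 → ℝ) → Matrix (Fin 4) (Fin 4) ℝ}
    {y v w : ℝ → Fin 4 → ℝ} {y' v' w' : Fin 4 → ℝ} {s : ℝ}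
    (hΓ : ∀ μ α β, DifferentiableAt ℝ (fun z => christoffel g z μ α β) (y s))
    (hy : HasDerivAt y y' s) (hv : HasDerivAt v v' s) (hw : HasDerivAt w w' s) :
    HasDerivAt (fun s => gammaVec g (y s) (v s) (w s))
      (dGammaVec g (y s) y' (v s) (w s) + gammaVec g (y s) v' (w s) + gammaVec g (y s) (v s) w')
      s := by
  rw [hasDerivAt_pi] at hv hw ⊢
  intro μ
  have h := HasDerivAt.fun_sum (u := Finset.univ) fun α _ => HasDerivAt.fun_sum (u := Finset.univ)
    fun β _ => (((hΓ μ α β).hasFDerivAt.comp_hasDerivAt s hy).mul (hv α)).mul (hw β)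
  refine h.congr_deriv ?_
  simp only [gammaVec, dGammaVec, Pi.add_apply, ← Finset.sum_add_distrib]
  exact Finset.sum_congr rfl fun α _ => Finset.sum_congr rfl fun β _ => by
    simp only [Pi.mul_apply, Function.comp_apply]; ring

section Region

variable {g : (Fin 4 → ℝ) → Matrix (Fin 4) (Fin 4) ℝ} {M : Set (Fin 4 → ℝ)}

theorem IsSmoothRegion.differentiableAt (hM : IsSmoothRegion g M) {y : Fin 4 → ℝ} (hy : y ∈ M)
    (μ α β : Fin 4) : DifferentiableAt ℝ (fun z => christoffel g z μ α β) y :=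
  ((hM.smooth μ α β).contDiffAt (hM.isOpen.mem_nhds hy)).differentiableAt (by simp)

theorem IsSmoothRegion.gammaVec_comm (hM : IsSmoothRegion g M) {y : Fin 4 → ℝ} (hy : y ∈ M)
    (v w : Fin 4 → ℝ) : gammaVec g y v w = gammaVec g y w v := by
  funext μ
  simp only [gammaVec]
  rw [Finset.sum_comm]
  exact Finset.sum_congr rfl fun α _ => Finset.sum_congr rfl fun β _ => by
    rw [hM.symm y hy μ β α]; ring

theorem IsSmoothRegion.isOpen_phase (hM : IsSmoothRegion g M) :
    IsOpen (M ×ˢ (univ : Set (Fin 4 → ℝ))) := hM.isOpen.prod isOpen_univ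

theorem IsSmoothRegion.contDiffOn_geodesicField (hM : IsSmoothRegion g M) :
    ContDiffOn ℝ ∞ (geodesicField g) (M ×ˢ univ) := by
  refine contDiff_snd.contDiffOn.prodMk (ContDiffOn.neg (contDiffOn_pi.2 fun μ => ?_))
  refine ContDiffOn.sum fun α _ => ContDiffOn.sum fun β _ => ?_
  refine ((((hM.smooth μ α β).comp contDiff_fst.contDiffOn fun p hp => hp.1).mul ?_).mul ?_)
  · exact ((contDiff_apply ℝ ℝ α).comp contDiff_snd).contDiffOn
  · exact ((contDiff_apply ℝ ℝ β).comp contDiff_snd).contDiffOn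

theorem IsSmoothRegion.differentiableAt_geodesicField (hM : IsSmoothRegion g M) {p : Phase}
    (hp : p.1 ∈ M) : DifferentiableAt ℝ (geodesicField g) p :=
  (hM.contDiffOn_geodesicField.contDiffAt
    (hM.isOpen_phase.mem_nhds ⟨hp, mem_univ _⟩)).differentiableAt (by simp)

/-- The derivative is computed along a straight line in phase space, where it is the product rule
for Γ(v, v). -/
theorem IsSmoothRegion.fderiv_geodesicField (hM : IsSmoothRegion g M) {y : Fin 4 → ℝ} (hy : y ∈ M)
    (v δ w : Fin 4 → ℝ) :
    fderiv ℝ (geodesicField g) (y, v) (δ, w)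
      = (w, -(dGammaVec g y δ v v + gammaVec g y w v + gammaVec g y v w)) := by
  have hc : HasDerivAt (fun τ : ℝ => ((y, v) : Phase) + τ • (δ, w)) (δ, w) 0 := by
    simpa using ((hasDerivAt_id (0 : ℝ)).smul_const ((δ, w) : Phase)).const_add (y, v)
  have h1 := (hM.differentiableAt_geodesicField (p := (y, v)) hy).hasFDerivAt
    |>.comp_hasDerivAt_of_eq (0 : ℝ) hc (by simp)
  have hy' : HasDerivAt (fun τ : ℝ => y + τ • δ) δ 0 := by
    simpa using ((hasDerivAt_id (0 : ℝ)).smul_const δ).const_add y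
  have hv' : HasDerivAt (fun τ : ℝ => v + τ • w) w 0 := by
    simpa using ((hasDerivAt_id (0 : ℝ)).smul_const w).const_add v
  have h2 := hv'.prodMk (hasDerivAt_gammaVec (s := 0)
    (by simpa using hM.differentiableAt hy) hy' hv' hv').neg
  have := h1.unique h2
  simpa using this

theorem isVariation_iff (hM : IsSmoothRegion g M) {x ℓ : ℝ → Fin 4 → ℝ} {J : Set ℝ}
    (hx : ∀ s ∈ J, x s ∈ M) {ξ ζ : ℝ → Fin 4 → ℝ} :
    IsVariation g x ℓ J (fun s => (ξ s, ζ s)) ↔ ∀ s ∈ J, HasDerivAt ξ (ζ s) s ∧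
      HasDerivAt ζ (-(dGammaVec g (x s) (ξ s) (ℓ s) (ℓ s) + gammaVec g (x s) (ζ s) (ℓ s)
        + gammaVec g (x s) (ℓ s) (ζ s))) s := by
  refine forall₂_congr fun s hs => ?_
  rw [hM.fderiv_geodesicField (hx s hs)]
  constructor
  · intro h
    exact ⟨(ContinuousLinearMap.fst ℝ (Fin 4 → ℝ) (Fin 4 → ℝ)).hasFDerivAt.comp_hasDerivAt s h,
      (ContinuousLinearMap.snd ℝ (Fin 4 → ℝ) (Fin 4 → ℝ)).hasFDerivAt.comp_hasDerivAt s h⟩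
  · exact fun h => h.1.prodMk h.2

/-- The geodesic deviation equation is the covariant form of the linearized geodesic equation. -/
theorem isDeviation_iff_isVariation (hM : IsSmoothRegion g M) {x ℓ : ℝ → Fin 4 → ℝ} {J : Set ℝ}
    (hgeo : IsGeodesic g x ℓ J) (hx : ∀ s ∈ J, x s ∈ M) {ξ η : ℝ → Fin 4 → ℝ} :
    IsDeviation g x ℓ J ξ η ↔
      IsVariation g x ℓ J (fun s => (ξ s, η s - gammaVec g (x s) (ℓ s) (ξ s))) := by
  rw [isVariation_iff hM hx]
  have hℓ : ∀ s ∈ J, HasDerivAt ℓ (-gammaVec g (x s) (ℓ s) (ℓ s)) s := fun s hs => by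
    have := hgeo.parallel s hs
    rwa [HasCovDerivAt, zero_sub] at this
  have hG : ∀ s ∈ J, HasDerivAt ξ (η s - gammaVec g (x s) (ℓ s) (ξ s)) s →
      HasDerivAt (fun s => gammaVec g (x s) (ℓ s) (ξ s))
        (dGammaVec g (x s) (ℓ s) (ℓ s) (ξ s)
          + gammaVec g (x s) (-gammaVec g (x s) (ℓ s) (ℓ s)) (ξ s)
          + gammaVec g (x s) (ℓ s) (η s - gammaVec g (x s) (ℓ s) (ξ s))) s := fun s hs h =>
    hasDerivAt_gammaVec (hM.differentiableAt (hx s hs)) (hgeo.tangent s hs) (hℓ s hs) h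
  -- Differentiating ζ = η - Γ(ℓ, ξ) produces derivatives of Γ along ℓ and quadratic terms; the
  -- tidal vector replaces them by the derivative of Γ along ξ. Symmetry of the lower indices is
  -- what makes the quadratic terms cancel.
  have key : ∀ s ∈ J, tidalVec g (x s) (ℓ s) (ξ s) - gammaVec g (x s) (ℓ s) (η s)
      - (dGammaVec g (x s) (ℓ s) (ℓ s) (ξ s)
          + gammaVec g (x s) (-gammaVec g (x s) (ℓ s) (ℓ s)) (ξ s)
          + gammaVec g (x s) (ℓ s) (η s - gammaVec g (x s) (ℓ s) (ξ s)))
      = -(dGammaVec g (x s) (ξ s) (ℓ s) (ℓ s)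
        + gammaVec g (x s) (η s - gammaVec g (x s) (ℓ s) (ξ s)) (ℓ s)
        + gammaVec g (x s) (ℓ s) (η s - gammaVec g (x s) (ℓ s) (ξ s))) := fun s hs => by
    rw [tidalVec_eq, hM.gammaVec_comm (hx s hs) (-gammaVec g (x s) (ℓ s) (ℓ s)),
      hM.gammaVec_comm (hx s hs) (η s - gammaVec g (x s) (ℓ s) (ξ s)) (ℓ s), gammaVec_neg_right, sub_eq_add_neg (η s),
      gammaVec_add_right, gammaVec_neg_right]
    abel
  constructor
  · intro h s hs
    refine ⟨h.first s hs, ?_⟩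
    rw [← key s hs]
    exact (h.second s hs).sub (hG s hs (h.first s hs))
  · refine fun h => ⟨fun s hs => (h s hs).1, fun s hs => ?_⟩
    have h1 := (h s hs).2.add (hG s hs (h s hs).1)
    rw [← key s hs] at h1
    rw [sub_add_cancel] at h1
    refine h1.congr_of_eventuallyEq (Filter.Eventually.of_forall fun s => ?_)
    simp

theorem IsSmoothRegion.continuousOn_fderiv_geodesicField (hM : IsSmoothRegion g M)
    {x ℓ : ℝ → Fin 4 → ℝ} {J : Set ℝ} (hgeo : IsGeodesic g x ℓ J) (hx : ∀ s ∈ J, x s ∈ M) :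
    ContinuousOn (fun s => fderiv ℝ (geodesicField g) (x s, ℓ s)) J := by
  have h1 := hM.contDiffOn_geodesicField.continuousOn_fderiv_of_isOpen hM.isOpen_phase (by simp)
  refine h1.comp (f := fun s => (x s, ℓ s)) (fun s hs => ?_) fun s hs => ⟨hx s hs, mem_univ _⟩
  exact ((hgeo.tangent s hs).continuousAt.prodMk
    (hgeo.parallel s hs).continuousAt).continuousWithinAt

section Deviation

variable {x ℓ : ℝ → Fin 4 → ℝ} {J : Set ℝ} (hM : IsSmoothRegion g M) (hgeo : IsGeodesic g x ℓ J)
  (hx : ∀ s ∈ J, x s ∈ M) (hJo : IsOpen J) (hJc : J.OrdConnected) (hJ0 : (0 : ℝ) ∈ J)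

include hM hgeo hx hJo hJc hJ0

theorem IsVariation.eqOn {Y Z : ℝ → Phase} (hY : IsVariation g x ℓ J Y)
    (hZ : IsVariation g x ℓ J Z) (h0 : Y 0 = Z 0) : EqOn Y Z J :=
  eqOn_of_linear_ode hJo hJc (b := fun _ => 0) (hM.continuousOn_fderiv_geodesicField hgeo hx) hJ0
    (fun s hs => by simpa using hY s hs) (fun s hs => by simpa using hZ s hs) h0

theorem exists_isDeviation (ξ₀ η₀ : Fin 4 → ℝ) :
    ∃ ξ η, IsDeviation g x ℓ J ξ η ∧ ξ 0 = ξ₀ ∧ η 0 = η₀ := by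
  obtain ⟨Y, hY0, hY⟩ := exists_linear_ode hJo hJc
    (hM.continuousOn_fderiv_geodesicField hgeo hx) (b := fun _ => 0) continuousOn_const hJ0
    (ξ₀, η₀ - gammaVec g (x 0) (ℓ 0) ξ₀)
  refine ⟨fun s => (Y s).1, fun s => (Y s).2 + gammaVec g (x s) (ℓ s) (Y s).1,
    (isDeviation_iff_isVariation hM hgeo hx).2 ?_, by simp [hY0], by simp [hY0]⟩
  simpa [IsVariation] using hY

theorem exists_isBGO : ∃ W, IsBGO g x ℓ J W := by
  have h := exists_isDeviation hM hgeo hx hJo hJc hJ0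
  choose ξ η hd h0 h0' using h
  refine ⟨⟨fun s => .of fun μ ν => ξ (Pi.single ν 1) 0 s μ,
    fun s => .of fun μ ν => ξ 0 (Pi.single ν 1) s μ,
    fun s => .of fun μ ν => η (Pi.single ν 1) 0 s μ,
    fun s => .of fun μ ν => η 0 (Pi.single ν 1) s μ⟩, fun ν => hd _ _, fun ν => hd _ _, ?_, ?_, ?_,
    ?_⟩ <;> ext μ ν <;> simp [h0, h0', Matrix.one_apply, Pi.single_apply]

omit hJo hJc hJ0 in
theorem IsDeviation.add {ξ η ξ' η' : ℝ → Fin 4 → ℝ} (h : IsDeviation g x ℓ J ξ η)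
    (h' : IsDeviation g x ℓ J ξ' η') : IsDeviation g x ℓ J (ξ + ξ') (η + η') := by
  rw [isDeviation_iff_isVariation hM hgeo hx] at *
  have e : (fun s => ((ξ + ξ') s, (η + η') s - gammaVec g (x s) (ℓ s) ((ξ + ξ') s))) = fun s =>
      (ξ s, η s - gammaVec g (x s) (ℓ s) (ξ s)) + (ξ' s, η' s - gammaVec g (x s) (ℓ s) (ξ' s)) := by
    funext s
    simp only [Pi.add_apply, gammaVec_add_right, Prod.mk_add_mk, Prod.mk.injEq, true_and]
    abel
  rw [e]
  exact fun s hs => ((h s hs).add (h' s hs)).congr_deriv (map_add _ _ _).symm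

omit hJo hJc hJ0 in
theorem IsDeviation.smul {ξ η : ℝ → Fin 4 → ℝ} (c : ℝ) (h : IsDeviation g x ℓ J ξ η) :
    IsDeviation g x ℓ J (c • ξ) (c • η) := by
  rw [isDeviation_iff_isVariation hM hgeo hx] at *
  have e : (fun s => ((c • ξ) s, (c • η) s - gammaVec g (x s) (ℓ s) ((c • ξ) s))) = fun s =>
      c • (ξ s, η s - gammaVec g (x s) (ℓ s) (ξ s)) := by
    funext s
    simp only [Pi.smul_apply, gammaVec_smul_right, Prod.smul_mk, smul_sub]
  rw [e]
  exact fun s hs => ((h s hs).const_smul c).congr_deriv (map_smul _ _ _).symm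

theorem IsDeviation.eqOn {ξ η ξ' η' : ℝ → Fin 4 → ℝ} (h : IsDeviation g x ℓ J ξ η)
    (h' : IsDeviation g x ℓ J ξ' η') (h0 : ξ 0 = ξ' 0) (h0' : η 0 = η' 0) :
    ∀ s ∈ J, ξ s = ξ' s ∧ η s = η' s := by
  intro s hs
  have := IsVariation.eqOn hM hgeo hx hJo hJc hJ0 ((isDeviation_iff_isVariation hM hgeo hx).1 h)
    ((isDeviation_iff_isVariation hM hgeo hx).1 h') (by simp [h0, h0']) hs
  simp only [Prod.mk.injEq] at this
  refine ⟨this.1, ?_⟩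
  have h2 := this.2
  rw [this.1] at h2
  exact sub_left_injective h2

/-- The superposition of the eight columns, weighted by the initial data, is a deviation with the
same data, so uniqueness applies. -/
theorem IsBGO.resolvent {W : BilocalOperators} (hW : IsBGO g x ℓ J W) {ξ η : ℝ → Fin 4 → ℝ}
    (h : IsDeviation g x ℓ J ξ η) {s : ℝ} (hs : s ∈ J) :
    ξ s = (W.XX s).mulVec (ξ 0) + (W.XL s).mulVec (η 0) ∧
      η s = (W.LX s).mulVec (ξ 0) + (W.LL s).mulVec (η 0) := by
  have hadd := fun {ξ η ξ' η'} => IsDeviation.add (ξ := ξ) (η := η) (ξ' := ξ') (η' := η') hM hgeo hx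
  have hX := fun ν => IsDeviation.smul hM hgeo hx (ξ 0 ν) (hW.deviation_X ν)
  have hL := fun ν => IsDeviation.smul hM hgeo hx (η 0 ν) (hW.deviation_L ν)
  have hsum := hadd (hadd (hadd (hadd (hX 0) (hX 1)) (hX 2)) (hX 3))
    (hadd (hadd (hadd (hL 0) (hL 1)) (hL 2)) (hL 3))
  have key := IsDeviation.eqOn hM hgeo hx hJo hJc hJ0 h hsum
    (by
      funext μ
      fin_cases μ <;> simp [hW.XX_zero, hW.XL_zero, Matrix.one_apply])
    (by
      funext μ
      fin_cases μ <;> simp [hW.LX_zero, hW.LL_zero, Matrix.one_apply]) s hs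
  constructor
  · rw [key.1]
    funext μ
    simp [Matrix.mulVec, dotProduct, Fin.sum_univ_four]
    ring
  · rw [key.2]
    funext μ
    simp [Matrix.mulVec, dotProduct, Fin.sum_univ_four]
    ring

omit hJ0 in
/-- The first variation of a first integral of the geodesic equation is conserved. -/
theorem IsVariation.fderiv_const {Q : Phase → ℝ} (hQ : ContDiffOn ℝ ∞ Q (M ×ˢ univ))
    (hQF : ∀ p ∈ M ×ˢ univ, fderiv ℝ Q p (geodesicField g p) = 0) {Y : ℝ → Phase}
    (hY : IsVariation g x ℓ J Y) {s t : ℝ} (hs : s ∈ J) (ht : t ∈ J) :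
    fderiv ℝ Q (x s, ℓ s) (Y s) = fderiv ℝ Q (x t, ℓ t) (Y t) := by
  have hder : ∀ s ∈ J, HasDerivAt (fun s => fderiv ℝ Q (x s, ℓ s) (Y s)) 0 s := by
    intro s hs
    have hmem : ((x s, ℓ s) : Phase) ∈ M ×ˢ (univ : Set (Fin 4 → ℝ)) := ⟨hx s hs, mem_univ _⟩
    have hnhds := hM.isOpen_phase.mem_nhds hmem
    have hQs : ContDiffAt ℝ ∞ Q (x s, ℓ s) := hQ.contDiffAt hnhds
    have hp : HasDerivAt (fun s => ((x s, ℓ s) : Phase)) (geodesicField g (x s, ℓ s)) s := by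
      have := hgeo.parallel s hs
      rw [HasCovDerivAt, zero_sub] at this
      exact (hgeo.tangent s hs).prodMk this
    exact hasDerivAt_fderiv_apply_of_firstIntegral (c := fun s => (x s, ℓ s)) hQs
      (hM.differentiableAt_geodesicField (p := (x s, ℓ s)) (hx s hs))
      (Filter.eventually_of_mem hnhds hQF) hp (hY s hs)
  exact hJo.is_const_of_deriv_eq_zero hJc.isPreconnected
    (fun s hs => (hder s hs).differentiableAt.differentiableWithinAt)
    (fun s hs => (hder s hs).deriv) hs ht

omit hJ0 hM hx in
/-- First integrals are constant along geodesics. -/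
theorem IsGeodesic.const_of_fderiv_eq_zero {Q : Phase → ℝ}
    (hQ : ∀ s ∈ J, DifferentiableAt ℝ Q (x s, ℓ s))
    (hQF : ∀ s ∈ J, fderiv ℝ Q (x s, ℓ s) (geodesicField g (x s, ℓ s)) = 0) {s t : ℝ} (hs : s ∈ J)
    (ht : t ∈ J) : Q (x s, ℓ s) = Q (x t, ℓ t) := by
  have hder : ∀ s ∈ J, HasDerivAt (fun s => Q (x s, ℓ s)) 0 s := fun s hs => by
    have := hgeo.parallel s hs
    rw [HasCovDerivAt, zero_sub] at this
    have h1 := (hQ s hs).hasFDerivAt.comp_hasDerivAt s ((hgeo.tangent s hs).prodMk this)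
    exact h1.congr_deriv (hQF s hs)
  exact hJo.is_const_of_deriv_eq_zero hJc.isPreconnected
    (fun s hs => (hder s hs).differentiableAt.differentiableWithinAt)
    (fun s hs => (hder s hs).deriv) hs ht

end Deviation

/-- The derivative of a general solution with respect to the initial data solves the linearized
geodesic equation. -/
theorem IsGeneralSolution.isVariation {x ℓ : ℝ → Fin 4 → ℝ} {J : Set ℝ} (hM : IsSmoothRegion g M)
    {U : Set (Phase × ℝ)} {Φ : Phase × ℝ → Phase} (hΦ : IsGeneralSolution g M x ℓ J U Φ)
    (δ : Phase) :
    IsVariation g x ℓ J (fun s => fderiv ℝ Φ ((x 0, ℓ 0), s) (δ, 0)) := by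
  intro s hs
  set p : Phase × ℝ := ((x 0, ℓ 0), s) with hp
  have hpU : p ∈ U := hΦ.fiducial_mem s hs
  have hnhds := hΦ.isOpen.mem_nhds hpU
  have hsm : ContDiffAt ℝ ∞ Φ p := hΦ.smooth.contDiffAt hnhds
  -- The geodesic equation of all neighbouring solutions is recorded on the open set U, so that it
  -- can be differentiated with respect to the initial data.
  have hflow : ∀ q ∈ U, fderiv ℝ Φ q (0, 1) = geodesicField g (Φ q) := by
    intro q hq
    have h1 : DifferentiableAt ℝ Φ q :=
      (hΦ.smooth.contDiffAt (hΦ.isOpen.mem_nhds hq)).differentiableAt (by simp)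
    have hc : HasDerivAt (fun s : ℝ => ((q.1, s) : Phase × ℝ)) (0, 1) q.2 :=
      (hasDerivAt_const _ _).prodMk (hasDerivAt_id _)
    exact HasDerivAt.unique (h1.hasFDerivAt.comp_hasDerivAt q.2 hc :)
      ((hΦ.tangent q hq).prodMk (hΦ.geodesic q hq) :)
  have hc : HasDerivAt (fun s : ℝ => (((x 0, ℓ 0), s) : Phase × ℝ)) (0, 1) s :=
    (hasDerivAt_const _ _).prodMk (hasDerivAt_id _)
  have h1 := (hsm.differentiableAt_fderiv.hasFDerivAt.comp_hasDerivAt s hc).clm_apply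
    (hasDerivAt_const s ((δ, 0) : Phase × ℝ))
  refine h1.congr_deriv ?_
  rw [map_zero, add_zero, fderiv_fderiv_apply_of_eventually_eq_comp hsm
    (hM.differentiableAt_geodesicField (hΦ.mem_region p hpU))
    (Filter.eventually_of_mem hnhds hflow)]
  rw [hp, hΦ.fiducial s hs]

theorem IsGeneralSolution.fderiv_time {x ℓ : ℝ → Fin 4 → ℝ} {J : Set ℝ}
    {U : Set (Phase × ℝ)} {Φ : Phase × ℝ → Phase} (hΦ : IsGeneralSolution g M x ℓ J U Φ) {s : ℝ}
    (hs : s ∈ J) :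
    fderiv ℝ Φ ((x 0, ℓ 0), s) (0, 1) = geodesicField g (x s, ℓ s) := by
  have hpU := hΦ.fiducial_mem s hs
  have h1 : DifferentiableAt ℝ Φ ((x 0, ℓ 0), s) :=
    (hΦ.smooth.contDiffAt (hΦ.isOpen.mem_nhds hpU)).differentiableAt (by simp)
  have hc : HasDerivAt (fun s : ℝ => (((x 0, ℓ 0), s) : Phase × ℝ)) (0, 1) s :=
    (hasDerivAt_const _ _).prodMk (hasDerivAt_id _)
  rw [← hΦ.fiducial s hs]
  exact HasDerivAt.unique (h1.hasFDerivAt.comp_hasDerivAt s hc :)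
    ((hΦ.tangent _ hpU).prodMk (hΦ.geodesic _ hpU) :)

theorem IsGeneralSolution.fderiv_initial {x ℓ : ℝ → Fin 4 → ℝ} {J : Set ℝ} (hJ0 : (0 : ℝ) ∈ J)
    {U : Set (Phase × ℝ)} {Φ : Phase × ℝ → Phase} (hΦ : IsGeneralSolution g M x ℓ J U Φ)
    (δ : Phase) : fderiv ℝ Φ ((x 0, ℓ 0), 0) (δ, 0) = δ := by
  have hpU := hΦ.fiducial_mem 0 hJ0
  have h1 : DifferentiableAt ℝ Φ ((x 0, ℓ 0), 0) :=
    (hΦ.smooth.contDiffAt (hΦ.isOpen.mem_nhds hpU)).differentiableAt (by simp)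
  have hc : HasFDerivAt (fun y : Phase => ((y, (0 : ℝ)) : Phase × ℝ))
      ((ContinuousLinearMap.id ℝ Phase).prod 0) (x 0, ℓ 0) :=
    (hasFDerivAt_id _).prodMk (hasFDerivAt_const _ _)
  have h2 := h1.hasFDerivAt.comp (x 0, ℓ 0) hc
  have h3 : HasFDerivAt (Φ ∘ fun y : Phase => (y, (0 : ℝ))) (ContinuousLinearMap.id ℝ Phase)
      (x 0, ℓ 0) := by
    -- At parameter 0 the map is the identity only where it is defined; openness of U makes this a
    -- neighbourhood of the fiducial data.
    refine (hasFDerivAt_id _).congr_of_eventuallyEq ?_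
    have hcont : ContinuousAt (fun y : Phase => ((y, (0 : ℝ)) : Phase × ℝ)) (x 0, ℓ 0) :=
      hc.continuousAt
    filter_upwards [hcont (hΦ.isOpen.mem_nhds hpU)] with y hy using hΦ.initial y hy
  exact congrArg (fun L => L δ) (h2.unique h3)

end Region

/-! ### The static spherically symmetric metric -/

/-- Smooth positive metric functions on an open set of radii. -/
structure IsMetricProfile (A B C : ℝ → ℝ) (R : Set ℝ) : Prop where
  isOpen : IsOpen R
  smoothA : ContDiffOn ℝ ∞ A R
  smoothB : ContDiffOn ℝ ∞ B R
  smoothC : ContDiffOn ℝ ∞ C R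
  posA : ∀ r ∈ R, 0 < A r
  posB : ∀ r ∈ R, 0 < B r
  posC : ∀ r ∈ R, 0 < C r

theorem hasDerivAt_of_contDiffOn {f : ℝ → ℝ} {R : Set ℝ} (hR : IsOpen R) (hf : ContDiffOn ℝ ∞ f R)
    {r : ℝ} (hr : r ∈ R) : HasDerivAt f (deriv f r) r :=
  ((hf.contDiffAt (hR.mem_nhds hr)).differentiableAt (by simp)).hasDerivAt

theorem contDiffOn_deriv_of_contDiffOn {f : ℝ → ℝ} {R : Set ℝ} (hR : IsOpen R)
    (hf : ContDiffOn ℝ ∞ f R) : ContDiffOn ℝ ∞ (deriv f) R :=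
  hf.deriv_of_isOpen hR (by simp)

theorem isOpen_sphericalChart {R : Set ℝ} (hR : IsOpen R) : IsOpen (sphericalChart R) :=
  (hR.preimage (continuous_apply 1)).inter
    ((isOpen_lt continuous_const (continuous_apply 2)).inter
      (isOpen_lt (continuous_apply 2) continuous_const))

theorem sin_pos_of_mem_sphericalChart {R : Set ℝ} {y : Fin 4 → ℝ} (hy : y ∈ sphericalChart R) :
    0 < sin (y 2) := sin_pos_of_pos_of_lt_pi hy.2.1 hy.2.2

theorem partialDeriv_radial {f : ℝ → ℝ} {f' : ℝ} {y : Fin 4 → ℝ} (h : HasDerivAt f f' (y 1))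
    (α : Fin 4) : partialDeriv (fun z => f (z 1)) α y = if α = 1 then f' else 0 := by
  have h1 : HasFDerivAt (fun z : Fin 4 → ℝ => f (z 1)) _ y :=
    h.comp_hasFDerivAt y (hasFDerivAt_apply (𝕜 := ℝ) (1 : Fin 4) y)
  rw [partialDeriv, h1.fderiv]
  simp [Pi.single_apply, eq_comm]

/-- The nonvanishing components of the metric. -/
noncomputable def sssDiag (A B C : ℝ → ℝ) (y : Fin 4 → ℝ) : Fin 4 → ℝ :=
  ![-A (y 1), B (y 1), C (y 1), C (y 1) * sin (y 2) ^ 2]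

/-- The partial derivatives of the nonvanishing components of the metric. -/
noncomputable def sssGrad (A B C : ℝ → ℝ) (y : Fin 4 → ℝ) : Matrix (Fin 4) (Fin 4) ℝ :=
  !![0, -deriv A (y 1), 0, 0; 0, deriv B (y 1), 0, 0; 0, deriv C (y 1), 0, 0;
    0, deriv C (y 1) * sin (y 2) ^ 2, 2 * C (y 1) * sin (y 2) * cos (y 2), 0]

/-- The Christoffel symbols of a diagonal metric. -/
noncomputable def sssChristoffel (A B C : ℝ → ℝ) (y : Fin 4 → ℝ) (μ α β : Fin 4) : ℝ :=
  1 / 2 * ((sssDiag A B C y μ)⁻¹ * ((if μ = β then sssGrad A B C y μ α else 0)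
    + (if μ = α then sssGrad A B C y μ β else 0) - (if α = β then sssGrad A B C y α μ else 0)))

theorem contDiffOn_radial {f : ℝ → ℝ} {R : Set ℝ} (hf : ContDiffOn ℝ ∞ f R) :
    ContDiffOn ℝ ∞ (fun y : Fin 4 → ℝ => f (y 1)) (sphericalChart R) :=
  hf.comp (contDiff_apply ℝ ℝ (1 : Fin 4)).contDiffOn fun _ hy => hy.1

section Profile

variable {A B C : ℝ → ℝ} {R : Set ℝ} (P : IsMetricProfile A B C R)
include P

namespace IsMetricProfile

theorem hasDerivAtA {r : ℝ} (hr : r ∈ R) : HasDerivAt A (deriv A r) r :=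
  hasDerivAt_of_contDiffOn P.isOpen P.smoothA hr

theorem hasDerivAtB {r : ℝ} (hr : r ∈ R) : HasDerivAt B (deriv B r) r :=
  hasDerivAt_of_contDiffOn P.isOpen P.smoothB hr

theorem hasDerivAtC {r : ℝ} (hr : r ∈ R) : HasDerivAt C (deriv C r) r :=
  hasDerivAt_of_contDiffOn P.isOpen P.smoothC hr

theorem sssDiag_ne_zero {y : Fin 4 → ℝ} (hy : y ∈ sphericalChart R) (μ : Fin 4) :
    sssDiag A B C y μ ≠ 0 := by
  have hA := (P.posA _ hy.1).ne'
  have hB := (P.posB _ hy.1).ne'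
  have hC := (P.posC _ hy.1).ne'
  have hs := (sin_pos_of_mem_sphericalChart hy).ne'
  fin_cases μ <;> simp [sssDiag, hA, hB, hC, hs]

theorem partialDeriv_metric {y : Fin 4 → ℝ} (hy : y ∈ sphericalChart R) (i j α : Fin 4) :
    partialDeriv (fun z => sssMetric A B C z i j) α y
      = if i = j then sssGrad A B C y i α else 0 := by
  by_cases hij : i = j
  · subst hij
    rw [if_pos rfl]
    have e : ∀ i, (fun z => sssMetric A B C z i i) = fun z => sssDiag A B C z i := fun i => by
      funext z
      simp [sssMetric, sssDiag]
    rw [e]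
    fin_cases i
    · have := partialDeriv_radial (P.hasDerivAtA hy.1).neg α
      simp only [Pi.neg_apply] at this
      simp only [sssDiag, Fin.zero_eta, Matrix.cons_val_zero, this]
      fin_cases α <;> simp [sssGrad]
    · have := partialDeriv_radial (P.hasDerivAtB hy.1) α
      simp only [sssDiag, Fin.mk_one, Matrix.cons_val_one, Matrix.cons_val_zero, this]
      fin_cases α <;> simp [sssGrad]
    · have := partialDeriv_radial (P.hasDerivAtC hy.1) α
      simp only [sssDiag, Fin.reduceFinMk, Matrix.cons_val, this]
      fin_cases α <;> simp [sssGrad]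
    · have h1 : HasFDerivAt (fun z : Fin 4 → ℝ => C (z 1)) _ y :=
        (P.hasDerivAtC hy.1).comp_hasFDerivAt y (hasFDerivAt_apply (𝕜 := ℝ) (1 : Fin 4) y)
      have h2 : HasFDerivAt (fun z : Fin 4 → ℝ => sin (z 2)) _ y :=
        (hasFDerivAt_apply (𝕜 := ℝ) (2 : Fin 4) y).sin
      have h3 := (h1.mul (h2.pow 2)).fderiv
      have e3 : (fun z => sssDiag A B C z 3)
          = (fun z : Fin 4 → ℝ => C (z 1)) * fun z : Fin 4 → ℝ => sin (z 2) ^ 2 := by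
        funext z; simp [sssDiag]
      rw [partialDeriv]
      simp only [Fin.reduceFinMk]
      rw [e3, h3]
      fin_cases α <;> simp [sssGrad] <;> ring
  · rw [if_neg hij]
    have e : (fun z => sssMetric A B C z i j) = fun _ => 0 := by
      funext z
      simp [sssMetric, hij]
    simp [e, partialDeriv]

theorem christoffel_eq {y : Fin 4 → ℝ} (hy : y ∈ sphericalChart R) (μ α β : Fin 4) :
    christoffel (sssMetric A B C) y μ α β = sssChristoffel A B C y μ α β := by
  have hinv : (sssMetric A B C y)⁻¹ = Matrix.diagonal fun μ => (sssDiag A B C y μ)⁻¹ := by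
    refine Matrix.inv_eq_right_inv ?_
    rw [sssMetric, Matrix.diagonal_mul_diagonal, ← Matrix.diagonal_one]
    congr 1
    funext μ
    exact mul_inv_cancel₀ (P.sssDiag_ne_zero hy μ)
  rw [christoffel, hinv, sssChristoffel]
  simp only [P.partialDeriv_metric hy, Matrix.diagonal_apply]
  rw [Finset.sum_eq_single μ (fun ν _ h => by rw [if_neg (Ne.symm h), zero_mul]) (by simp)]
  rw [if_pos rfl]

theorem contDiffOn_sssDiag (μ : Fin 4) :
    ContDiffOn ℝ ∞ (fun y => sssDiag A B C y μ) (sphericalChart R) := by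
  have hs : ContDiffOn ℝ ∞ (fun y : Fin 4 → ℝ => sin (y 2)) (sphericalChart R) :=
    (contDiff_sin.comp (contDiff_apply ℝ ℝ (2 : Fin 4))).contDiffOn
  fin_cases μ
  · exact (contDiffOn_radial P.smoothA).neg
  · exact contDiffOn_radial P.smoothB
  · exact contDiffOn_radial P.smoothC
  · exact (contDiffOn_radial P.smoothC).mul (hs.pow 2)

theorem contDiffOn_sssGrad (i α : Fin 4) :
    ContDiffOn ℝ ∞ (fun y => sssGrad A B C y i α) (sphericalChart R) := by
  have hs : ContDiffOn ℝ ∞ (fun y : Fin 4 → ℝ => sin (y 2)) (sphericalChart R) :=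
    (contDiff_sin.comp (contDiff_apply ℝ ℝ (2 : Fin 4))).contDiffOn
  have hc : ContDiffOn ℝ ∞ (fun y : Fin 4 → ℝ => cos (y 2)) (sphericalChart R) :=
    (contDiff_cos.comp (contDiff_apply ℝ ℝ (2 : Fin 4))).contDiffOn
  have dA := contDiffOn_radial (contDiffOn_deriv_of_contDiffOn P.isOpen P.smoothA)
  have dB := contDiffOn_radial (contDiffOn_deriv_of_contDiffOn P.isOpen P.smoothB)
  have dC := contDiffOn_radial (contDiffOn_deriv_of_contDiffOn P.isOpen P.smoothC)
  fin_cases i <;> fin_cases α <;> first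
    | exact contDiffOn_const
    | exact dA.neg
    | exact dB
    | exact dC
    | exact dC.mul (hs.pow 2)
    | exact ((contDiffOn_const.mul (contDiffOn_radial P.smoothC)).mul hs).mul hc

theorem isSmoothRegion : IsSmoothRegion (sssMetric A B C) (sphericalChart R) where
  isOpen := isOpen_sphericalChart P.isOpen
  smooth μ α β := by
    refine ContDiffOn.congr (f := fun y => sssChristoffel A B C y μ α β) ?_
      fun y hy => P.christoffel_eq hy μ α β
    refine contDiffOn_const.mul (((P.contDiffOn_sssDiag μ).inv fun y hy =>
      P.sssDiag_ne_zero hy μ).mul ((ContDiffOn.add ?_ ?_).sub ?_))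
    all_goals
      split_ifs
      · exact P.contDiffOn_sssGrad _ _
      · exact contDiffOn_const
  symm y hy μ α β := by
    rw [P.christoffel_eq hy, P.christoffel_eq hy, sssChristoffel, sssChristoffel]
    by_cases h : α = β
    · subst h; rfl
    · rw [if_neg h, if_neg (Ne.symm h), add_comm]

/-- Together with the smoothness and symmetry of the Christoffel symbols, this is the form in which
the connection enters all later computations. -/
theorem gammaVec_eq {y : Fin 4 → ℝ} (hy : y ∈ sphericalChart R) (v w : Fin 4 → ℝ) :
    gammaVec (sssMetric A B C) y v w =
      ![deriv A (y 1) / (2 * A (y 1)) * (v 0 * w 1 + v 1 * w 0),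
        deriv A (y 1) / (2 * B (y 1)) * v 0 * w 0 + deriv B (y 1) / (2 * B (y 1)) * v 1 * w 1
          - deriv C (y 1) / (2 * B (y 1)) * (v 2 * w 2 + sin (y 2) ^ 2 * v 3 * w 3),
        deriv C (y 1) / (2 * C (y 1)) * (v 1 * w 2 + v 2 * w 1)
          - sin (y 2) * cos (y 2) * v 3 * w 3,
        deriv C (y 1) / (2 * C (y 1)) * (v 1 * w 3 + v 3 * w 1)
          + cos (y 2) / sin (y 2) * (v 2 * w 3 + v 3 * w 2)] := by
  have hA := (P.posA _ hy.1).ne'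
  have hB := (P.posB _ hy.1).ne'
  have hC := (P.posC _ hy.1).ne'
  have hs := (sin_pos_of_mem_sphericalChart hy).ne'
  funext μ
  simp only [gammaVec, P.christoffel_eq hy, sssChristoffel, Fin.sum_univ_four]
  fin_cases μ <;> simp [sssDiag, sssGrad] <;> field_simp <;> ring

end IsMetricProfile
end Profile

/-! ### First integrals of the geodesic equation on phase space -/

section FirstIntegrals

variable {A B C : ℝ → ℝ} {R : Set ℝ}

theorem normalization_eq (A B C : ℝ → ℝ) (y v : Fin 4 → ℝ) :
    normalization A B C y v = -A (y 1) * v 0 ^ 2 + B (y 1) * v 1 ^ 2 + C (y 1) * v 2 ^ 2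
      + C (y 1) * sin (y 2) ^ 2 * v 3 ^ 2 := by
  simp [normalization, metricInner, sssMetric, Fin.sum_univ_four, Matrix.diagonal_apply]
  ring

/-- A component of the position along a line in phase space. -/
theorem hasDerivAt_line_apply (y δ : Fin 4 → ℝ) (i : Fin 4) :
    HasDerivAt (fun τ : ℝ => y i + τ * δ i) (δ i) 0 := by
  simpa using ((hasDerivAt_id (0 : ℝ)).mul_const (δ i)).const_add (y i)

/-- Reduces first variations to derivatives of functions of one variable along straight lines in
phase space. -/
theorem fderiv_phase_eq {Q : Phase → ℝ} {y v δ w : Fin 4 → ℝ} {d : ℝ}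
    (hQ : DifferentiableAt ℝ Q (y, v))
    (h : HasDerivAt (fun τ : ℝ => Q (fun i => y i + τ * δ i, fun i => v i + τ * w i)) d 0) :
    fderiv ℝ Q (y, v) (δ, w) = d := by
  have hc : HasDerivAt (fun τ : ℝ => ((fun i => y i + τ * δ i, fun i => v i + τ * w i) : Phase))
      (δ, w) 0 :=
    (hasDerivAt_pi.2 (hasDerivAt_line_apply y δ)).prodMk (hasDerivAt_pi.2 (hasDerivAt_line_apply v w))
  exact HasDerivAt.unique (hQ.hasFDerivAt.comp_hasDerivAt_of_eq (0 : ℝ) hc (by simp) :) h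

theorem contDiffOn_phase_radial {f : ℝ → ℝ} (hf : ContDiffOn ℝ ∞ f R) :
    ContDiffOn ℝ ∞ (fun p : Phase => f (p.1 1)) (sphericalChart R ×ˢ univ) :=
  (contDiffOn_radial hf).comp contDiff_fst.contDiffOn fun _ hp => hp.1

theorem contDiff_position (i : Fin 4) : ContDiff ℝ ∞ fun p : Phase => p.1 i :=
  (contDiff_apply ℝ ℝ i).comp contDiff_fst

theorem contDiff_velocity (i : Fin 4) : ContDiff ℝ ∞ fun p : Phase => p.2 i :=
  (contDiff_apply ℝ ℝ i).comp contDiff_snd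

namespace IsMetricProfile

variable (P : IsMetricProfile A B C R)
include P

theorem contDiffOn_energy :
    ContDiffOn ℝ ∞ (fun p : Phase => energy A p.1 p.2) (sphericalChart R ×ˢ univ) :=
  (contDiffOn_phase_radial P.smoothA).neg.mul (contDiff_velocity 0).contDiffOn

theorem contDiffOn_angMomX :
    ContDiffOn ℝ ∞ (fun p : Phase => angMomX C p.1 p.2) (sphericalChart R ×ˢ univ) := by
  refine (contDiffOn_phase_radial P.smoothC).neg.mul (ContDiff.contDiffOn ?_)
  have := contDiff_position
  have := contDiff_velocity
  fun_prop

theorem contDiffOn_angMomY :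
    ContDiffOn ℝ ∞ (fun p : Phase => angMomY C p.1 p.2) (sphericalChart R ×ˢ univ) := by
  refine (contDiffOn_phase_radial P.smoothC).mul (ContDiff.contDiffOn ?_)
  have := contDiff_position
  have := contDiff_velocity
  fun_prop

theorem contDiffOn_angMomZ :
    ContDiffOn ℝ ∞ (fun p : Phase => angMomZ C p.1 p.2) (sphericalChart R ×ˢ univ) := by
  refine ((contDiffOn_phase_radial P.smoothC).mul (ContDiff.contDiffOn ?_)).mul
    (contDiff_velocity 3).contDiffOn
  have := contDiff_position
  fun_prop

theorem contDiffOn_normalization :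
    ContDiffOn ℝ ∞ (fun p : Phase => normalization A B C p.1 p.2) (sphericalChart R ×ˢ univ) := by
  simp only [normalization_eq]
  have h2 := fun i => ((contDiff_velocity i).pow 2).contDiffOn (s := sphericalChart R ×ˢ univ)
  have hs : ContDiff ℝ ∞ fun p : Phase => sin (p.1 2) ^ 2 := by
    have := contDiff_position
    fun_prop
  exact ((((contDiffOn_phase_radial P.smoothA).neg.mul (h2 0)).add
    ((contDiffOn_phase_radial P.smoothB).mul (h2 1))).add
    ((contDiffOn_phase_radial P.smoothC).mul (h2 2))).add
    (((contDiffOn_phase_radial P.smoothC).mul hs.contDiffOn).mul (h2 3))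

variable {y : Fin 4 → ℝ}

theorem differentiableAt_phase (hy : y ∈ sphericalChart R) {Q : Phase → ℝ}
    (hQ : ContDiffOn ℝ ∞ Q (sphericalChart R ×ˢ univ)) (v : Fin 4 → ℝ) :
    DifferentiableAt ℝ Q (y, v) :=
  (hQ.contDiffAt (P.isSmoothRegion.isOpen_phase.mem_nhds ⟨hy, mem_univ _⟩)).differentiableAt
    (by simp)

theorem hasDerivAt_line_radial (hy : y ∈ sphericalChart R) {f : ℝ → ℝ} (hf : ContDiffOn ℝ ∞ f R)
    (δ : Fin 4 → ℝ) :
    HasDerivAt (fun τ : ℝ => f (y 1 + τ * δ 1)) (deriv f (y 1) * δ 1) 0 :=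
  (hasDerivAt_of_contDiffOn P.isOpen hf hy.1).comp_of_eq (0 : ℝ) (hasDerivAt_line_apply y δ 1)
    (by simp)

theorem firstVariation_energy (hy : y ∈ sphericalChart R) (v δ w : Fin 4 → ℝ) :
    firstVariation (energy A) y v δ w = -deriv A (y 1) * δ 1 * v 0 - A (y 1) * w 0 := by
  refine fderiv_phase_eq (P.differentiableAt_phase hy P.contDiffOn_energy v) ?_
  have hA := P.hasDerivAt_line_radial hy P.smoothA δ
  refine (hA.neg.mul (hasDerivAt_line_apply v w 0)).congr_deriv ?_
  simp
  ring

theorem firstVariation_angMomZ (hy : y ∈ sphericalChart R) (v δ w : Fin 4 → ℝ) :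
    firstVariation (angMomZ C) y v δ w = deriv C (y 1) * δ 1 * sin (y 2) ^ 2 * v 3
      + C (y 1) * (2 * sin (y 2) * cos (y 2) * δ 2) * v 3 + C (y 1) * sin (y 2) ^ 2 * w 3 := by
  refine fderiv_phase_eq (P.differentiableAt_phase hy P.contDiffOn_angMomZ v) ?_
  have hC := P.hasDerivAt_line_radial hy P.smoothC δ
  have hs := (hasDerivAt_line_apply y δ 2).sin
  refine ((hC.mul (hs.pow 2)).mul (hasDerivAt_line_apply v w 3)).congr_deriv ?_
  simp
  ring

theorem firstVariation_angMomX (hy : y ∈ sphericalChart R) (v δ w : Fin 4 → ℝ) :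
    firstVariation (angMomX C) y v δ w =
      -(deriv C (y 1) * δ 1 * (sin (y 3) * v 2 + sin (2 * y 2) / 2 * cos (y 3) * v 3))
      - C (y 1) * (cos (y 3) * δ 3 * v 2 + sin (y 3) * w 2 + cos (2 * y 2) * δ 2 * cos (y 3) * v 3
        - sin (2 * y 2) / 2 * sin (y 3) * δ 3 * v 3 + sin (2 * y 2) / 2 * cos (y 3) * w 3) := by
  refine fderiv_phase_eq (P.differentiableAt_phase hy P.contDiffOn_angMomX v) ?_
  have hC := P.hasDerivAt_line_radial hy P.smoothC δ
  have hs := ((hasDerivAt_line_apply y δ 2).const_mul 2).sin.div_const 2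
  have hp := hasDerivAt_line_apply y δ 3
  refine (hC.neg.mul ((hp.sin.mul (hasDerivAt_line_apply v w 2)).add
    ((hs.mul hp.cos).mul (hasDerivAt_line_apply v w 3)))).congr_deriv ?_
  simp
  ring

theorem firstVariation_angMomY (hy : y ∈ sphericalChart R) (v δ w : Fin 4 → ℝ) :
    firstVariation (angMomY C) y v δ w =
      deriv C (y 1) * δ 1 * (cos (y 3) * v 2 - sin (2 * y 2) / 2 * sin (y 3) * v 3)
      + C (y 1) * (-sin (y 3) * δ 3 * v 2 + cos (y 3) * w 2 - cos (2 * y 2) * δ 2 * sin (y 3) * v 3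
        - sin (2 * y 2) / 2 * cos (y 3) * δ 3 * v 3 - sin (2 * y 2) / 2 * sin (y 3) * w 3) := by
  refine fderiv_phase_eq (P.differentiableAt_phase hy P.contDiffOn_angMomY v) ?_
  have hC := P.hasDerivAt_line_radial hy P.smoothC δ
  have hs := ((hasDerivAt_line_apply y δ 2).const_mul 2).sin.div_const 2
  have hp := hasDerivAt_line_apply y δ 3
  refine (hC.mul ((hp.cos.mul (hasDerivAt_line_apply v w 2)).sub
    ((hs.mul hp.sin).mul (hasDerivAt_line_apply v w 3)))).congr_deriv ?_
  simp only [Pi.mul_apply, Pi.sub_apply, zero_mul, add_zero]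
  ring

theorem firstVariation_normalization (hy : y ∈ sphericalChart R) (v δ w : Fin 4 → ℝ) :
    firstVariation (normalization A B C) y v δ w =
      -deriv A (y 1) * δ 1 * v 0 ^ 2 - 2 * A (y 1) * v 0 * w 0 + deriv B (y 1) * δ 1 * v 1 ^ 2
      + 2 * B (y 1) * v 1 * w 1 + deriv C (y 1) * δ 1 * (v 2 ^ 2 + sin (y 2) ^ 2 * v 3 ^ 2)
      + 2 * C (y 1) * (v 2 * w 2 + sin (y 2) * cos (y 2) * δ 2 * v 3 ^ 2
        + sin (y 2) ^ 2 * v 3 * w 3) := by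
  refine fderiv_phase_eq (P.differentiableAt_phase hy P.contDiffOn_normalization v) ?_
  have hA := P.hasDerivAt_line_radial hy P.smoothA δ
  have hB := P.hasDerivAt_line_radial hy P.smoothB δ
  have hC := P.hasDerivAt_line_radial hy P.smoothC δ
  have hs := (hasDerivAt_line_apply y δ 2).sin
  have hv := fun i => (hasDerivAt_line_apply v w i).pow 2
  simp only [normalization_eq]
  refine ((((hA.neg.mul (hv 0)).add (hB.mul (hv 1))).add (hC.mul (hv 2))).add
    ((hC.mul (hs.pow 2)).mul (hv 3))).congr_deriv ?_
  simp
  ring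

section Conserved

variable (hy : y ∈ sphericalChart R) (v : Fin 4 → ℝ)
include hy

/-- Conservation is stated as DQ(X) = 0 at every point of phase space over the chart. Knowing it
only along the given geodesic would not allow the differentiation that yields first integrals of the
deviation equation. -/
theorem firstVariation_energy_geodesic :
    firstVariation (energy A) y v v (-gammaVec (sssMetric A B C) y v v) = 0 := by
  have hA := (P.posA _ hy.1).ne'
  rw [P.firstVariation_energy hy, P.gammaVec_eq hy]
  simp
  field_simp
  ring

theorem firstVariation_angMomZ_geodesic :
    firstVariation (angMomZ C) y v v (-gammaVec (sssMetric A B C) y v v) = 0 := by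
  have hC := (P.posC _ hy.1).ne'
  have hs := (sin_pos_of_mem_sphericalChart hy).ne'
  rw [P.firstVariation_angMomZ hy, P.gammaVec_eq hy]
  simp
  field_simp
  ring

theorem firstVariation_angMomX_geodesic :
    firstVariation (angMomX C) y v v (-gammaVec (sssMetric A B C) y v v) = 0 := by
  have hC := (P.posC _ hy.1).ne'
  have hs := (sin_pos_of_mem_sphericalChart hy).ne'
  rw [P.firstVariation_angMomX hy, P.gammaVec_eq hy, sin_two_mul, cos_two_mul]
  simp
  field_simp
  ring

theorem firstVariation_angMomY_geodesic :
    firstVariation (angMomY C) y v v (-gammaVec (sssMetric A B C) y v v) = 0 := by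
  have hC := (P.posC _ hy.1).ne'
  have hs := (sin_pos_of_mem_sphericalChart hy).ne'
  rw [P.firstVariation_angMomY hy, P.gammaVec_eq hy, sin_two_mul, cos_two_mul]
  simp
  field_simp
  ring

theorem firstVariation_normalization_geodesic :
    firstVariation (normalization A B C) y v v (-gammaVec (sssMetric A B C) y v v) = 0 := by
  have hA := (P.posA _ hy.1).ne'
  have hB := (P.posB _ hy.1).ne'
  have hC := (P.posC _ hy.1).ne'
  have hs := (sin_pos_of_mem_sphericalChart hy).ne'
  rw [P.firstVariation_normalization hy, P.gammaVec_eq hy]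
  simp
  field_simp
  ring

end Conserved
end IsMetricProfile
end FirstIntegrals

/-! ### Geodesics in aligned coordinates -/

/-- The radial acceleration as a function of the radius. -/
noncomputable def radialAcc (A B C : ℝ → ℝ) (E L ε r : ℝ) : ℝ := deriv (radialSq A B C E L ε) r / 2

theorem contDiffOn_radialSq {A B C : ℝ → ℝ} {R : Set ℝ} (P : IsMetricProfile A B C R)
    (E L ε : ℝ) : ContDiffOn ℝ ∞ (radialSq A B C E L ε) R :=
  ((contDiffOn_const.div P.smoothB fun r hr => (P.posB r hr).ne').add
    (contDiffOn_const.div (P.smoothA.mul P.smoothB) fun r hr =>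
      (mul_pos (P.posA r hr) (P.posB r hr)).ne')).sub
    (contDiffOn_const.div (P.smoothB.mul P.smoothC) fun r hr =>
      (mul_pos (P.posB r hr) (P.posC r hr)).ne')

theorem contDiffOn_radialAcc {A B C : ℝ → ℝ} {R : Set ℝ} (P : IsMetricProfile A B C R)
    (E L ε : ℝ) : ContDiffOn ℝ ∞ (radialAcc A B C E L ε) R :=
  (contDiffOn_deriv_of_contDiffOn P.isOpen (contDiffOn_radialSq P E L ε)).div_const 2

theorem radialAcc_eq {A B C : ℝ → ℝ} {R : Set ℝ} (P : IsMetricProfile A B C R) (E L ε : ℝ) {r : ℝ}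
    (hr : r ∈ R) : radialAcc A B C E L ε r =
      -(1 / 2) * (ε * deriv B r / B r ^ 2
        + E ^ 2 / (A r * B r) * (deriv A r / A r + deriv B r / B r)
        - L ^ 2 / (B r * C r) * (deriv B r / B r + deriv C r / C r)) := by
  have hA := P.hasDerivAtA hr
  have hB := P.hasDerivAtB hr
  have hC := P.hasDerivAtC hr
  have pA := (P.posA r hr).ne'
  have pB := (P.posB r hr).ne'
  have pC := (P.posC r hr).ne'
  have h := ((((hasDerivAt_const r ε).div hB pB).add
    ((hasDerivAt_const r (E ^ 2)).div (hA.mul hB) (mul_ne_zero pA pB))).sub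
    ((hasDerivAt_const r (L ^ 2)).div (hB.mul hC) (mul_ne_zero pB pC)))
  have h' : HasDerivAt (radialSq A B C E L ε) _ r := h
  rw [radialAcc, h'.deriv]
  simp only [Pi.mul_apply]
  field_simp
  ring

/-- A geodesic in aligned coordinates. -/
structure IsAlignedOrbit (A B C : ℝ → ℝ) (R J : Set ℝ) (x ℓ : ℝ → Fin 4 → ℝ) : Prop where
  profile : IsMetricProfile A B C R
  isOpen : IsOpen J
  ordConnected : J.OrdConnected
  zero_mem : (0 : ℝ) ∈ J
  geodesic : IsGeodesic (sssMetric A B C) x ℓ J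
  chart : ∀ s ∈ J, x s ∈ sphericalChart R
  aligned : IsAligned x ℓ

namespace IsAlignedOrbit

variable {A B C : ℝ → ℝ} {R J : Set ℝ} {x ℓ : ℝ → Fin 4 → ℝ} (H : IsAlignedOrbit A B C R J x ℓ)
  {s : ℝ}
include H

theorem radius_mem (hs : s ∈ J) : x s 1 ∈ R := (H.chart s hs).1

theorem posA (hs : s ∈ J) : 0 < A (x s 1) := H.profile.posA _ (H.radius_mem hs)

theorem posB (hs : s ∈ J) : 0 < B (x s 1) := H.profile.posB _ (H.radius_mem hs)

theorem posC (hs : s ∈ J) : 0 < C (x s 1) := H.profile.posC _ (H.radius_mem hs)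

theorem hasDerivAt_position (hs : s ∈ J) (i : Fin 4) : HasDerivAt (fun s => x s i) (ℓ s i) s :=
  hasDerivAt_pi.1 (H.geodesic.tangent s hs) i

theorem hasDerivAt_velocity (hs : s ∈ J) :
    HasDerivAt ℓ (-gammaVec (sssMetric A B C) (x s) (ℓ s) (ℓ s)) s := by
  have := H.geodesic.parallel s hs
  rwa [HasCovDerivAt, zero_sub] at this

theorem hasDerivAt_radial {f : ℝ → ℝ} (hf : ContDiffOn ℝ ∞ f R) (hs : s ∈ J) :
    HasDerivAt (fun s => f (x s 1)) (deriv f (x s 1) * ℓ s 1) s :=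
  (hasDerivAt_of_contDiffOn H.profile.isOpen hf (H.radius_mem hs)).comp s
    (H.hasDerivAt_position hs 1)

theorem continuousOn_radial {f : ℝ → ℝ} (hf : ContDiffOn ℝ ∞ f R) :
    ContinuousOn (fun s => f (x s 1)) J := fun _ hs =>
  (H.hasDerivAt_radial hf hs).continuousAt.continuousWithinAt

theorem continuousOn_velocity (i : Fin 4) : ContinuousOn (fun s => ℓ s i) J := fun _ hs =>
  (hasDerivAt_pi.1 (H.hasDerivAt_velocity hs) i).continuousAt.continuousWithinAt

theorem const_of_firstVariation {F : (Fin 4 → ℝ) → (Fin 4 → ℝ) → ℝ}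
    (hF : ContDiffOn ℝ ∞ (fun p : Phase => F p.1 p.2) (sphericalChart R ×ˢ univ))
    (h : ∀ y ∈ sphericalChart R, ∀ v,
      firstVariation F y v v (-gammaVec (sssMetric A B C) y v v) = 0) (hs : s ∈ J) :
    F (x s) (ℓ s) = F (x 0) (ℓ 0) :=
  IsGeodesic.const_of_fderiv_eq_zero H.geodesic H.isOpen H.ordConnected
    (Q := fun p : Phase => F p.1 p.2)
    (fun s hs => H.profile.differentiableAt_phase (H.chart s hs) hF (ℓ s))
    (fun s hs => h _ (H.chart s hs) _) hs H.zero_mem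

theorem energy_const (hs : s ∈ J) : energy A (x s) (ℓ s) = energy A (x 0) (ℓ 0) :=
  H.const_of_firstVariation H.profile.contDiffOn_energy
    (fun _ hy v => H.profile.firstVariation_energy_geodesic hy v) hs

theorem angMomZ_const (hs : s ∈ J) : angMomZ C (x s) (ℓ s) = angMomZ C (x 0) (ℓ 0) :=
  H.const_of_firstVariation H.profile.contDiffOn_angMomZ
    (fun _ hy v => H.profile.firstVariation_angMomZ_geodesic hy v) hs

theorem normalization_const (hs : s ∈ J) :
    normalization A B C (x s) (ℓ s) = normalization A B C (x 0) (ℓ 0) :=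
  H.const_of_firstVariation H.profile.contDiffOn_normalization
    (fun _ hy v => H.profile.firstVariation_normalization_geodesic hy v) hs

theorem angMomX_eq_zero (hs : s ∈ J) : angMomX C (x s) (ℓ s) = 0 := by
  rw [H.const_of_firstVariation H.profile.contDiffOn_angMomX
    (fun _ hy v => H.profile.firstVariation_angMomX_geodesic hy v) hs]
  simp [angMomX, H.aligned.theta, H.aligned.dtheta, H.aligned.phi, mul_div_cancel₀]

theorem angMomY_eq_zero (hs : s ∈ J) : angMomY C (x s) (ℓ s) = 0 := by
  rw [H.const_of_firstVariation H.profile.contDiffOn_angMomY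
    (fun _ hy v => H.profile.firstVariation_angMomY_geodesic hy v) hs]
  simp [angMomY, H.aligned.theta, H.aligned.dtheta, H.aligned.phi]

/-- L_x = L_y = 0 are two linear equations that differ by a rotation through φ; rotating back
isolates ℓ^θ whatever θ is. Constancy of θ is a consequence. -/
theorem velocity_theta (hs : s ∈ J) : ℓ s 2 = 0 := by
  have hX := H.angMomX_eq_zero hs
  have hY := H.angMomY_eq_zero hs
  have hC := (H.posC hs).ne'
  rw [angMomX, mul_eq_zero, neg_eq_zero] at hX
  rw [angMomY, mul_eq_zero] at hY
  have hX' := hX.resolve_left hC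
  have hY' := hY.resolve_left hC
  linear_combination sin (x s 3) * hX' + cos (x s 3) * hY' - ℓ s 2 * sin_sq_add_cos_sq (x s 3)

theorem theta_eq (hs : s ∈ J) : x s 2 = π / 2 := by
  rw [← H.aligned.theta]
  exact H.isOpen.is_const_of_deriv_eq_zero H.ordConnected.isPreconnected (f := fun s => x s 2)
    (fun s hs => (H.hasDerivAt_position hs 2).differentiableAt.differentiableWithinAt)
    (fun s hs => by rw [(H.hasDerivAt_position hs 2).deriv]; exact H.velocity_theta hs) hs
    H.zero_mem

theorem velocity_t (hs : s ∈ J) : ℓ s 0 = -energy A (x 0) (ℓ 0) / A (x s 1) := by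
  have := (H.posA hs).ne'
  rw [← H.energy_const hs, energy]
  field_simp

theorem velocity_phi (hs : s ∈ J) : ℓ s 3 = angMomZ C (x 0) (ℓ 0) / C (x s 1) := by
  have := (H.posC hs).ne'
  rw [← H.angMomZ_const hs, angMomZ, H.theta_eq hs, sin_pi_div_two]
  field_simp

theorem velocity_r_sq (hs : s ∈ J) : ℓ s 1 ^ 2 = radialSq A B C (energy A (x 0) (ℓ 0))
    (angMomZ C (x 0) (ℓ 0)) (normalization A B C (x 0) (ℓ 0)) (x s 1) := by
  have hA := (H.posA hs).ne'
  have hB := (H.posB hs).ne'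
  have hC := (H.posC hs).ne'
  rw [radialSq, ← H.normalization_const hs, normalization_eq, H.theta_eq hs, sin_pi_div_two,
    H.velocity_theta hs, H.velocity_t hs, H.velocity_phi hs]
  field_simp
  ring

theorem gammaVec_eq (hs : s ∈ J) (v w : Fin 4 → ℝ) :
    gammaVec (sssMetric A B C) (x s) v w =
      ![deriv A (x s 1) / (2 * A (x s 1)) * (v 0 * w 1 + v 1 * w 0),
        deriv A (x s 1) / (2 * B (x s 1)) * v 0 * w 0 + deriv B (x s 1) / (2 * B (x s 1)) * v 1 * w 1
          - deriv C (x s 1) / (2 * B (x s 1)) * (v 2 * w 2 + v 3 * w 3),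
        deriv C (x s 1) / (2 * C (x s 1)) * (v 1 * w 2 + v 2 * w 1),
        deriv C (x s 1) / (2 * C (x s 1)) * (v 1 * w 3 + v 3 * w 1)] := by
  rw [H.profile.gammaVec_eq (H.chart s hs), H.theta_eq hs, sin_pi_div_two, cos_pi_div_two]
  simp

/-- The radial equation of motion. -/
theorem hasDerivAt_velocity_r (hs : s ∈ J) :
    HasDerivAt (fun s => ℓ s 1) (radialAcc A B C (energy A (x 0) (ℓ 0))
      (angMomZ C (x 0) (ℓ 0)) (normalization A B C (x 0) (ℓ 0)) (x s 1)) s := by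
  refine (hasDerivAt_pi.1 (H.hasDerivAt_velocity hs) 1).congr_deriv ?_
  have hA := (H.posA hs).ne'
  have hB := (H.posB hs).ne'
  have hC := (H.posC hs).ne'
  have hr := H.velocity_r_sq hs
  rw [radialAcc_eq H.profile _ _ _ (H.radius_mem hs), H.gammaVec_eq hs]
  simp only [Pi.neg_apply, Matrix.cons_val_one, Matrix.cons_val_zero, H.velocity_theta hs,
    H.velocity_t hs, H.velocity_phi hs]
  -- The only velocity left in the acceleration is the square of ℓ^r, which is a function of r.
  -- Arguing from the geodesic equation keeps the result valid at turning points, where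
  -- differentiating (ℓ^r)² and dividing by ℓ^r would fail.
  have e : deriv B (x s 1) / (2 * B (x s 1)) * ℓ s 1 * ℓ s 1
    = deriv B (x s 1) / (2 * B (x s 1)) * ℓ s 1 ^ 2 := by ring
  rw [e, hr, radialSq]
  field_simp
  ring

theorem hasDerivAt_radialAcc (hs : s ∈ J) (E L ε : ℝ) :
    HasDerivAt (fun s => radialAcc A B C E L ε (x s 1))
      (deriv (radialAcc A B C E L ε) (x s 1) * ℓ s 1) s :=
  H.hasDerivAt_radial (contDiffOn_radialAcc H.profile E L ε) hs

/-- Radial turning points of a geodesic that is not circular are simple. -/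
theorem simple_turning_point (h0 : ℓ 0 1 ≠ 0) : ∀ σ ∈ J, ℓ σ 1 = 0 →
    radialAcc A B C (energy A (x 0) (ℓ 0)) (angMomZ C (x 0) (ℓ 0))
      (normalization A B C (x 0) (ℓ 0)) (x σ 1) ≠ 0 ∧
    HasDerivAt (fun s => radialAcc A B C (energy A (x 0) (ℓ 0)) (angMomZ C (x 0) (ℓ 0))
      (normalization A B C (x 0) (ℓ 0)) (x s 1)) 0 σ := by
  intro σ hσ hz
  refine ⟨fun h => h0 ?_, ?_⟩
  -- ℓ^r solves y'' = G'(r) y. If both ℓ^r and its derivative vanished at σ, ℓ^r would vanish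
  -- identically, contrary to its value at 0.
  · exact (eq_zero_of_second_order_ode H.isOpen H.ordConnected
      (H.continuousOn_radial (contDiffOn_deriv_of_contDiffOn H.profile.isOpen
        (contDiffOn_radialAcc H.profile _ _ _))) (n := fun _ => 0) continuousOn_const hσ
      (fun t ht => H.hasDerivAt_velocity_r ht)
      (fun t ht => by simpa using H.hasDerivAt_radialAcc ht _ _ _) hz h 0 H.zero_mem).1
  · simpa [hz] using H.hasDerivAt_radialAcc hσ (energy A (x 0) (ℓ 0)) (angMomZ C (x 0) (ℓ 0))
      (normalization A B C (x 0) (ℓ 0))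

theorem uIcc_subset (hs : s ∈ J) : uIcc 0 s ⊆ J := H.ordConnected.uIcc_subset H.zero_mem hs

theorem time_eq (hs : s ∈ J) :
    x s 0 - x 0 0 = -∫ σ in (0 : ℝ)..s, energy A (x 0) (ℓ 0) / A (x σ 1) := by
  rw [← intervalIntegral.integral_neg]
  refine (intervalIntegral.integral_eq_sub_of_hasDerivAt (f := fun s => x s 0) (fun σ hσ => ?_)
    ?_).symm
  · rw [← neg_div, ← H.velocity_t (H.uIcc_subset hs hσ)]
    exact H.hasDerivAt_position (H.uIcc_subset hs hσ) 0
  · exact (ContinuousOn.neg (continuousOn_const.div ((H.continuousOn_radial H.profile.smoothA).mono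
      (H.uIcc_subset hs)) fun σ hσ => (H.posA (H.uIcc_subset hs hσ)).ne')).intervalIntegrable

theorem phi_eq (hs : s ∈ J) : x s 3 = ∫ σ in (0 : ℝ)..s, angMomZ C (x 0) (ℓ 0) / C (x σ 1) := by
  have h : x s 3 - x 0 3 = ∫ σ in (0 : ℝ)..s, angMomZ C (x 0) (ℓ 0) / C (x σ 1) := by
    refine (intervalIntegral.integral_eq_sub_of_hasDerivAt (f := fun s => x s 3) (fun σ hσ => ?_)
      ?_).symm
    · rw [← H.velocity_phi (H.uIcc_subset hs hσ)]
      exact H.hasDerivAt_position (H.uIcc_subset hs hσ) 3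
    · exact (continuousOn_const.div ((H.continuousOn_radial H.profile.smoothC).mono
        (H.uIcc_subset hs)) fun σ hσ => (H.posC (H.uIcc_subset hs hσ)).ne').intervalIntegrable
  rwa [H.aligned.phi, sub_zero] at h

/-! ### Radial quadratures along the orbit -/

/-- The sign of ℓ^r is continuous on a connected segment without zeros, hence constant. -/
theorem radial_velocity_eq_sign (hs : s ∈ J) (ht : TurningFree ℓ s) {σ : ℝ} (hσ : σ ∈ uIcc 0 s) :
    ℓ σ 1 = SignType.sign (ℓ 0 1) * √(radialSq A B C (energy A (x 0) (ℓ 0))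
      (angMomZ C (x 0) (ℓ 0)) (normalization A B C (x 0) (ℓ 0)) (x σ 1)) := by
  have hJ := H.uIcc_subset hs hσ
  rw [← H.velocity_r_sq hJ, sqrt_sq_eq_abs]
  have hsign : SignType.sign (ℓ σ 1) = SignType.sign (ℓ 0 1) := by
    have hc : ContinuousOn (fun σ => SignType.sign (ℓ σ 1)) (uIcc 0 s) := fun τ hτ =>
      ((continuousAt_sign_of_ne_zero (ht τ hτ)).comp_continuousWithinAt
        (f := fun σ => ℓ σ 1) ((H.continuousOn_velocity 1).mono (H.uIcc_subset hs) τ hτ))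
    exact isPreconnected_uIcc.constant hc hσ left_mem_uIcc
  rw [← hsign, sign_mul_abs]

/-- Substitution ρ = r(σ): the factor dρ = ℓ^r dσ lowers the power of ℓ^r by one. The case n = 0, w
= 1 gives the affine parameter, n = 2 the four quadratures. -/
theorem integral_comp_radius (hs : s ∈ J) (ht : TurningFree ℓ s) {w : ℝ → ℝ}
    (hw : ContDiffOn ℝ ∞ w R) (n : ℕ) :
    ∫ ρ in (x 0 1)..(x s 1), w ρ / (SignType.sign (ℓ 0 1) * √(radialSq A B C
      (energy A (x 0) (ℓ 0)) (angMomZ C (x 0) (ℓ 0)) (normalization A B C (x 0) (ℓ 0)) ρ)) ^ (n + 1)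
      = ∫ σ in (0 : ℝ)..s, w (x σ 1) / ℓ σ 1 ^ n := by
  have hsub := H.uIcc_subset hs
  rw [← intervalIntegral.integral_comp_mul_deriv' (f := fun σ => x σ 1) (f' := fun σ => ℓ σ 1)
    (fun σ hσ => H.hasDerivAt_position (hsub hσ) 1) ((H.continuousOn_velocity 1).mono hsub)]
  · refine intervalIntegral.integral_congr fun σ hσ => ?_
    have h0 := ht σ hσ
    simp only [Function.comp_apply]
    rw [← H.radial_velocity_eq_sign hs ht hσ, pow_succ]
    field_simp
  · have himg : (fun σ => x σ 1) '' uIcc 0 s ⊆ R := by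
      rintro _ ⟨σ, hσ, rfl⟩
      exact H.radius_mem (hsub hσ)
    refine (hw.continuousOn.mono himg).div ((continuousOn_const.mul
      ((contDiffOn_radialSq H.profile _ _ _).continuousOn.mono himg).sqrt).pow _) ?_
    rintro _ ⟨σ, hσ, rfl⟩
    refine pow_ne_zero _ ?_
    simp only
    rw [← H.radial_velocity_eq_sign hs ht hσ]
    exact ht σ hσ

/-- The regularization `p = ℓ^r ∫ w / (ℓ^r)²` of a radial quadrature extends through turning
points. -/
theorem exists_regular_quadrature (h0 : ℓ 0 1 ≠ 0) {w : ℝ → ℝ} (hw : ContDiffOn ℝ ∞ w R) :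
    ∃ p p' : ℝ → ℝ, p 0 = 0 ∧ (∀ s ∈ J, HasDerivAt p (p' s) s) ∧
      ∀ s ∈ J, p' s * ℓ s 1 - p s * radialAcc A B C (energy A (x 0) (ℓ 0))
        (angMomZ C (x 0) (ℓ 0)) (normalization A B C (x 0) (ℓ 0)) (x s 1) = w (x s 1) := by
  set G := radialAcc A B C (energy A (x 0) (ℓ 0))
    (angMomZ C (x 0) (ℓ 0)) (normalization A B C (x 0) (ℓ 0)) with hG
  have hGs : ContDiffOn ℝ ∞ G R := contDiffOn_radialAcc H.profile _ _ _
  -- p solves p'' = G'(r) p + w'(r), whose homogeneous part is the equation of ℓ^r. The data p(0) =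
  -- 0, p'(0) = w/ℓ^r make the Wronskian identity true at 0.
  obtain ⟨p, p', hp0, hp0', hp, hp'⟩ := exists_second_order_ode H.isOpen H.ordConnected
    (H.continuousOn_radial (contDiffOn_deriv_of_contDiffOn H.profile.isOpen hGs))
    (H.continuousOn_radial (contDiffOn_deriv_of_contDiffOn H.profile.isOpen hw)) H.zero_mem
    0 (w (x 0 1) / ℓ 0 1)
  refine ⟨p, p', hp0, hp, fun s hs => ?_⟩
  -- The defect of the identity has derivative (G'p + w')ℓ^r + p'G - p'G - pG'ℓ^r - w'ℓ^r = 0.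
  have hder : ∀ t ∈ J, HasDerivAt (fun s => p' s * ℓ s 1 - p s * G (x s 1) - w (x s 1)) 0 t := by
    intro t ht
    refine ((((hp' t ht).mul (H.hasDerivAt_velocity_r ht)).sub ((hp t ht).mul
      (H.hasDerivAt_radial hGs ht))).sub (H.hasDerivAt_radial hw ht)).congr_deriv ?_
    ring
  have hconst := H.isOpen.is_const_of_deriv_eq_zero H.ordConnected.isPreconnected
    (fun t ht => (hder t ht).differentiableAt.differentiableWithinAt)
    (fun t ht => (hder t ht).deriv) hs H.zero_mem
  simp only [hp0, hp0', zero_mul, sub_zero, div_mul_cancel₀ _ h0, sub_self] at hconst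
  linarith

theorem isRadialQuadrature_of_regular (h0 : ℓ 0 1 ≠ 0) {w p p' : ℝ → ℝ} (hw : ContDiffOn ℝ ∞ w R)
    (hp0 : p 0 = 0) (hp : ∀ s ∈ J, HasDerivAt p (p' s) s)
    (hW : ∀ s ∈ J, p' s * ℓ s 1 - p s * radialAcc A B C (energy A (x 0) (ℓ 0))
        (angMomZ C (x 0) (ℓ 0)) (normalization A B C (x 0) (ℓ 0)) (x s 1) = w (x s 1))
    (hs : s ∈ J) (h1 : ℓ s 1 ≠ 0) : IsRadialQuadrature w x ℓ J s (p s / ℓ s 1) := by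
  have := hasFinitePart_wronskian H.isOpen H.ordConnected hp
    (fun σ hσ => H.hasDerivAt_velocity_r hσ) (H.continuousOn_radial hw) hW
    (H.simple_turning_point h0) H.zero_mem hs h0 h1
  rwa [hp0, zero_div, sub_zero] at this

theorem isRadialQuadrature_affine (hs : s ∈ J) (ht : TurningFree ℓ s) (w : ℝ → ℝ) :
    IsRadialQuadrature w x ℓ J s (affineQuadrature w x ℓ s) := by
  obtain ⟨δ, hδ, hd⟩ := exists_disjoint_thickening H.isOpen (H.continuousOn_velocity 1)
    (H.uIcc_subset hs) ht
  exact hasFinitePart_integral hδ hd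

theorem contDiffOn_wB : ContDiffOn ℝ ∞ (fun r => 1 / B r) R :=
  contDiffOn_const.div H.profile.smoothB fun r hr => (H.profile.posB r hr).ne'

theorem contDiffOn_wAB : ContDiffOn ℝ ∞ (fun r => 1 / (A r * B r)) R :=
  contDiffOn_const.div (H.profile.smoothA.mul H.profile.smoothB) fun r hr =>
    (mul_pos (H.profile.posA r hr) (H.profile.posB r hr)).ne'

theorem contDiffOn_wBC : ContDiffOn ℝ ∞ (fun r => 1 / (B r * C r)) R :=
  contDiffOn_const.div (H.profile.smoothB.mul H.profile.smoothC) fun r hr =>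
    (mul_pos (H.profile.posB r hr) (H.profile.posC r hr)).ne'

theorem contDiffOn_wABC : ContDiffOn ℝ ∞ (fun r => 1 / (A r * B r * C r)) R :=
  contDiffOn_const.div ((H.profile.smoothA.mul H.profile.smoothB).mul H.profile.smoothC)
    fun r hr => (mul_pos (mul_pos (H.profile.posA r hr) (H.profile.posB r hr))
      (H.profile.posC r hr)).ne'

theorem isRadialIntegrals_affine (hs : s ∈ J) (ht : TurningFree ℓ s) :
    IsRadialIntegrals A B C x ℓ J s ⟨affineQuadrature (fun r => 1 / B r) x ℓ s,
        affineQuadrature (fun r => 1 / (A r * B r)) x ℓ s,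
        affineQuadrature (fun r => 1 / (B r * C r)) x ℓ s,
        affineQuadrature (fun r => 1 / (A r * B r * C r)) x ℓ s⟩ :=
  ⟨H.isRadialQuadrature_affine hs ht _, H.isRadialQuadrature_affine hs ht _,
    H.isRadialQuadrature_affine hs ht _, H.isRadialQuadrature_affine hs ht _⟩

theorem exists_isRadialIntegrals (h0 : ℓ 0 1 ≠ 0) (hs : s ∈ J) (h1 : ℓ s 1 ≠ 0) :
    ∃ I, IsRadialIntegrals A B C x ℓ J s I := by
  have key : ∀ w : ℝ → ℝ, ContDiffOn ℝ ∞ w R → ∃ v, IsRadialQuadrature w x ℓ J s v := fun w hw =>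
    let ⟨_, _, hp0, hp, hW⟩ := H.exists_regular_quadrature h0 hw
    ⟨_, H.isRadialQuadrature_of_regular h0 hw hp0 hp hW hs h1⟩
  obtain ⟨a, ha⟩ := key _ H.contDiffOn_wB
  obtain ⟨b, hb⟩ := key _ H.contDiffOn_wAB
  obtain ⟨c, hc⟩ := key _ H.contDiffOn_wBC
  obtain ⟨d, hd⟩ := key _ H.contDiffOn_wABC
  exact ⟨⟨a, b, c, d⟩, ha, hb, hc, hd⟩

end IsAlignedOrbit

theorem IsRadialIntegrals.unique {A B C : ℝ → ℝ} {x ℓ : ℝ → Fin 4 → ℝ} {J : Set ℝ} {s : ℝ}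
    {I I' : RadialIntegrals} (h : IsRadialIntegrals A B C x ℓ J s I)
    (h' : IsRadialIntegrals A B C x ℓ J s I') : I = I' := by
  cases I
  cases I'
  have h1 := HasFinitePart.unique h.IB h'.IB
  have h2 := HasFinitePart.unique h.IAB h'.IAB
  have h3 := HasFinitePart.unique h.IBC h'.IBC
  have h4 := HasFinitePart.unique h.IABC h'.IABC
  simp only at h1 h2 h3 h4
  rw [h1, h2, h3, h4]

/-! ### Solution of the linearized geodesic equation by first integrals -/

namespace IsAlignedOrbit

variable {A B C : ℝ → ℝ} {R J : Set ℝ} {x ℓ : ℝ → Fin 4 → ℝ} (H : IsAlignedOrbit A B C R J x ℓ)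
  {s : ℝ}
include H

theorem firstVariation_const {F : (Fin 4 → ℝ) → (Fin 4 → ℝ) → ℝ}
    (hF : ContDiffOn ℝ ∞ (fun p : Phase => F p.1 p.2) (sphericalChart R ×ˢ univ))
    (h : ∀ y ∈ sphericalChart R, ∀ v,
      firstVariation F y v v (-gammaVec (sssMetric A B C) y v v) = 0) {ξ ζ : ℝ → Fin 4 → ℝ}
    (hY : IsVariation (sssMetric A B C) x ℓ J fun s => (ξ s, ζ s)) (hs : s ∈ J) :
    firstVariation F (x s) (ℓ s) (ξ s) (ζ s) = firstVariation F (x 0) (ℓ 0) (ξ 0) (ζ 0) :=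
  IsVariation.fderiv_const H.profile.isSmoothRegion H.geodesic H.chart H.isOpen H.ordConnected
    (Q := fun p : Phase => F p.1 p.2) hF (fun p hp => h p.1 hp.1 p.2) hY hs H.zero_mem

theorem firstVariation_energy (hs : s ∈ J) (δ w : Fin 4 → ℝ) :
    firstVariation (energy A) (x s) (ℓ s) δ w =
      energy A (x 0) (ℓ 0) * deriv A (x s 1) / A (x s 1) * δ 1 - A (x s 1) * w 0 := by
  have hA := (H.posA hs).ne'
  rw [H.profile.firstVariation_energy (H.chart s hs), H.velocity_t hs]
  field_simp

theorem firstVariation_angMomZ (hs : s ∈ J) (δ w : Fin 4 → ℝ) :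
    firstVariation (angMomZ C) (x s) (ℓ s) δ w =
      angMomZ C (x 0) (ℓ 0) * deriv C (x s 1) / C (x s 1) * δ 1 + C (x s 1) * w 3 := by
  have hC := (H.posC hs).ne'
  rw [H.profile.firstVariation_angMomZ (H.chart s hs), H.velocity_phi hs, H.theta_eq hs,
    sin_pi_div_two, cos_pi_div_two]
  field_simp
  ring

theorem firstVariation_angMomX (hs : s ∈ J) (δ w : Fin 4 → ℝ) :
    firstVariation (angMomX C) (x s) (ℓ s) δ w =
      angMomZ C (x 0) (ℓ 0) * cos (x s 3) * δ 2 - C (x s 1) * sin (x s 3) * w 2 := by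
  have hC := (H.posC hs).ne'
  rw [H.profile.firstVariation_angMomX (H.chart s hs), H.velocity_phi hs, H.velocity_theta hs,
    H.theta_eq hs, mul_div_cancel₀ π (two_ne_zero (α := ℝ)), sin_pi, cos_pi]
  field_simp
  ring

theorem firstVariation_angMomY (hs : s ∈ J) (δ w : Fin 4 → ℝ) :
    firstVariation (angMomY C) (x s) (ℓ s) δ w =
      angMomZ C (x 0) (ℓ 0) * sin (x s 3) * δ 2 + C (x s 1) * cos (x s 3) * w 2 := by
  have hC := (H.posC hs).ne'
  rw [H.profile.firstVariation_angMomY (H.chart s hs), H.velocity_phi hs, H.velocity_theta hs,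
    H.theta_eq hs, mul_div_cancel₀ π (two_ne_zero (α := ℝ)), sin_pi, cos_pi]
  field_simp
  ring

theorem firstVariation_normalization (hs : s ∈ J) (δ w : Fin 4 → ℝ) :
    firstVariation (normalization A B C) (x s) (ℓ s) δ w =
      (-deriv A (x s 1) * (energy A (x 0) (ℓ 0) / A (x s 1)) ^ 2 + deriv B (x s 1) * ℓ s 1 ^ 2
        + deriv C (x s 1) * (angMomZ C (x 0) (ℓ 0) / C (x s 1)) ^ 2) * δ 1
      + 2 * (energy A (x 0) (ℓ 0) * w 0 + B (x s 1) * ℓ s 1 * w 1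
        + angMomZ C (x 0) (ℓ 0) * w 3) := by
  have hA := (H.posA hs).ne'
  have hC := (H.posC hs).ne'
  rw [H.profile.firstVariation_normalization (H.chart s hs), H.velocity_phi hs,
    H.velocity_theta hs, H.velocity_t hs, H.theta_eq hs, sin_pi_div_two, cos_pi_div_two]
  field_simp
  ring

/-- A velocity variation with prescribed first variations of the conserved quantities. -/
theorem variation_velocity_t (hs : s ∈ J) (δ w : Fin 4 → ℝ) :
    w 0 = -firstVariation (energy A) (x s) (ℓ s) δ w / A (x s 1)
      + energy A (x 0) (ℓ 0) * deriv A (x s 1) / A (x s 1) ^ 2 * δ 1 := by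
  have hA := (H.posA hs).ne'
  rw [H.firstVariation_energy hs]
  field_simp
  ring

theorem variation_velocity_phi (hs : s ∈ J) (δ w : Fin 4 → ℝ) :
    w 3 = firstVariation (angMomZ C) (x s) (ℓ s) δ w / C (x s 1)
      - angMomZ C (x 0) (ℓ 0) * deriv C (x s 1) / C (x s 1) ^ 2 * δ 1 := by
  have hC := (H.posC hs).ne'
  rw [H.firstVariation_angMomZ hs]
  field_simp
  ring

/-- The left side is the Wronskian of the radial variation with ℓ^r. It arises by solving δε for the
radial velocity variation and eliminating the other two velocities by δE and δL_z. Nothing is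
divided by ℓ^r, so it holds at turning points. -/
theorem variation_velocity_r (hs : s ∈ J) (δ w : Fin 4 → ℝ) :
    w 1 * ℓ s 1 - δ 1 * radialAcc A B C (energy A (x 0) (ℓ 0)) (angMomZ C (x 0) (ℓ 0))
        (normalization A B C (x 0) (ℓ 0)) (x s 1) =
      firstVariation (normalization A B C) (x s) (ℓ s) δ w / (2 * B (x s 1))
        + energy A (x 0) (ℓ 0) * firstVariation (energy A) (x s) (ℓ s) δ w
          / (A (x s 1) * B (x s 1))
        - angMomZ C (x 0) (ℓ 0) * firstVariation (angMomZ C) (x s) (ℓ s) δ w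
          / (B (x s 1) * C (x s 1)) := by
  have hA := (H.posA hs).ne'
  have hB := (H.posB hs).ne'
  have hC := (H.posC hs).ne'
  rw [H.firstVariation_angMomZ hs, H.firstVariation_energy hs, H.firstVariation_normalization hs,
    H.velocity_r_sq hs, radialSq, radialAcc_eq H.profile _ _ _ (H.radius_mem hs)]
  field_simp
  ring

/-- On the equatorial plane δL_x and δL_y involve only ξ^θ and ζ^θ, through a rotation by φ;
inverting the rotation solves the θ motion on all of J, turning points included. -/
theorem variation_theta {ξ ζ : ℝ → Fin 4 → ℝ}
    (hY : IsVariation (sssMetric A B C) x ℓ J fun s => (ξ s, ζ s)) (hs : s ∈ J) :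
    angMomZ C (x 0) (ℓ 0) * ξ s 2 = angMomZ C (x 0) (ℓ 0) * ξ 0 2 * cos (x s 3)
        + C (x 0 1) * ζ 0 2 * sin (x s 3) ∧
      C (x s 1) * ζ s 2 = C (x 0 1) * ζ 0 2 * cos (x s 3)
        - angMomZ C (x 0) (ℓ 0) * ξ 0 2 * sin (x s 3) := by
  have hX := H.firstVariation_const H.profile.contDiffOn_angMomX
    (fun _ hy v => H.profile.firstVariation_angMomX_geodesic hy v) hY hs
  have hZ := H.firstVariation_const H.profile.contDiffOn_angMomY
    (fun _ hy v => H.profile.firstVariation_angMomY_geodesic hy v) hY hs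
  rw [H.firstVariation_angMomX hs, H.firstVariation_angMomX H.zero_mem, H.aligned.phi, cos_zero,
    sin_zero] at hX
  rw [H.firstVariation_angMomY hs, H.firstVariation_angMomY H.zero_mem, H.aligned.phi, cos_zero,
    sin_zero] at hZ
  have h1 := sin_sq_add_cos_sq (x s 3)
  constructor
  · linear_combination cos (x s 3) * hX + sin (x s 3) * hZ
      - angMomZ C (x 0) (ℓ 0) * ξ s 2 * h1
  · linear_combination -sin (x s 3) * hX + cos (x s 3) * hZ - C (x s 1) * ζ s 2 * h1

theorem variation_energy_const {ξ ζ : ℝ → Fin 4 → ℝ}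
    (hY : IsVariation (sssMetric A B C) x ℓ J fun s => (ξ s, ζ s)) (hs : s ∈ J) :
    firstVariation (energy A) (x s) (ℓ s) (ξ s) (ζ s)
      = firstVariation (energy A) (x 0) (ℓ 0) (ξ 0) (ζ 0) :=
  H.firstVariation_const H.profile.contDiffOn_energy
    (fun _ hy v => H.profile.firstVariation_energy_geodesic hy v) hY hs

theorem variation_angMomZ_const {ξ ζ : ℝ → Fin 4 → ℝ}
    (hY : IsVariation (sssMetric A B C) x ℓ J fun s => (ξ s, ζ s)) (hs : s ∈ J) :
    firstVariation (angMomZ C) (x s) (ℓ s) (ξ s) (ζ s)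
      = firstVariation (angMomZ C) (x 0) (ℓ 0) (ξ 0) (ζ 0) :=
  H.firstVariation_const H.profile.contDiffOn_angMomZ
    (fun _ hy v => H.profile.firstVariation_angMomZ_geodesic hy v) hY hs

theorem variation_normalization_const {ξ ζ : ℝ → Fin 4 → ℝ}
    (hY : IsVariation (sssMetric A B C) x ℓ J fun s => (ξ s, ζ s)) (hs : s ∈ J) :
    firstVariation (normalization A B C) (x s) (ℓ s) (ξ s) (ζ s)
      = firstVariation (normalization A B C) (x 0) (ℓ 0) (ξ 0) (ζ 0) :=
  H.firstVariation_const H.profile.contDiffOn_normalization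
    (fun _ hy v => H.profile.firstVariation_normalization_geodesic hy v) hY hs

/-- A function with a given Wronskian with `ℓ^r`, together with the quadrature it represents. -/
theorem exists_regular_quadrature_unique (h0 : ℓ 0 1 ≠ 0) {w : ℝ → ℝ} (hw : ContDiffOn ℝ ∞ w R) :
    ∃ p p' : ℝ → ℝ, p 0 = 0 ∧ (∀ s ∈ J, HasDerivAt p (p' s) s) ∧
      (∀ s ∈ J, p' s * ℓ s 1 - p s * radialAcc A B C (energy A (x 0) (ℓ 0))
        (angMomZ C (x 0) (ℓ 0)) (normalization A B C (x 0) (ℓ 0)) (x s 1) = w (x s 1)) ∧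
      ∀ s ∈ J, ℓ s 1 ≠ 0 → ∀ v, IsRadialQuadrature w x ℓ J s v → p s = ℓ s 1 * v := by
  obtain ⟨p, p', hp0, hp, hW⟩ := H.exists_regular_quadrature h0 hw
  refine ⟨p, p', hp0, hp, hW, fun s hs h1 v hv => ?_⟩
  rw [HasFinitePart.unique hv (H.isRadialQuadrature_of_regular h0 hw hp0 hp hW hs h1),
    mul_div_cancel₀ _ h1]

/-- The verification tool of the file: an identity containing quadratures is multiplied by ℓ^r,
which turns these into differentiable functions on J, and is then checked through its Wronskian with
ℓ^r. -/
theorem eq_zero_of_wronskian (h0 : ℓ 0 1 ≠ 0) {f f' : ℝ → ℝ}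
    (hf : ∀ s ∈ J, HasDerivAt f (f' s) s)
    (hW : ∀ s ∈ J, f' s * ℓ s 1 - f s * radialAcc A B C (energy A (x 0) (ℓ 0))
        (angMomZ C (x 0) (ℓ 0)) (normalization A B C (x 0) (ℓ 0)) (x s 1) = 0)
    (hf0 : f 0 = 0) (hs : s ∈ J) : f s = 0 :=
  eq_zero_of_wronskian_eq_zero H.isOpen H.ordConnected hf
    (fun _ hσ => H.hasDerivAt_velocity_r hσ) hW (H.simple_turning_point h0) H.zero_mem h0 hf0 s hs

/-- Formally λ is the integral of (ℓ^r)²/(ℓ^r)² with the numerator expanded as a function of r. To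
include turning points, the regularized combination is compared with λℓ^r, whose Wronskian with ℓ^r
is (ℓ^r)². -/
theorem parameter_eq (h0 : ℓ 0 1 ≠ 0) (hs : s ∈ J) (h1 : ℓ s 1 ≠ 0) {I : RadialIntegrals}
    (hI : IsRadialIntegrals A B C x ℓ J s I) :
    s = normalization A B C (x 0) (ℓ 0) * I.IB + energy A (x 0) (ℓ 0) ^ 2 * I.IAB
      - angMomZ C (x 0) (ℓ 0) ^ 2 * I.IBC := by
  obtain ⟨pB, pB', pB0, hpB, hWB, hB⟩ := H.exists_regular_quadrature_unique h0 H.contDiffOn_wB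
  obtain ⟨pAB, pAB', pAB0, hpAB, hWAB, hAB⟩ := H.exists_regular_quadrature_unique h0 H.contDiffOn_wAB
  obtain ⟨pBC, pBC', pBC0, hpBC, hWBC, hBC⟩ := H.exists_regular_quadrature_unique h0 H.contDiffOn_wBC
  have key := H.eq_zero_of_wronskian h0 (s := s)
    (fun t ht => ((((hpB t ht).const_mul (normalization A B C (x 0) (ℓ 0))).add
      ((hpAB t ht).const_mul (energy A (x 0) (ℓ 0) ^ 2))).sub
      ((hpBC t ht).const_mul (angMomZ C (x 0) (ℓ 0) ^ 2))).sub
      ((hasDerivAt_id t).mul (H.hasDerivAt_velocity_r ht)))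
    (fun t ht => by
      have hA := (H.posA ht).ne'
      have hB := (H.posB ht).ne'
      have hC := (H.posC ht).ne'
      have hr := H.velocity_r_sq ht
      rw [radialSq] at hr
      simp only [Pi.sub_apply, Pi.add_apply, Pi.mul_apply, id_eq]
      linear_combination normalization A B C (x 0) (ℓ 0) * hWB t ht
        + energy A (x 0) (ℓ 0) ^ 2 * hWAB t ht - angMomZ C (x 0) (ℓ 0) ^ 2 * hWBC t ht - hr)
    (by simp [pB0, pAB0, pBC0]) hs
  simp only [Pi.sub_apply, Pi.add_apply, Pi.mul_apply, id_eq] at key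
  rw [hB s hs h1 _ hI.IB, hAB s hs h1 _ hI.IAB, hBC s hs h1 _ hI.IBC] at key
  refine mul_left_cancel₀ h1 ?_
  linear_combination -key

/-- The radial Wronskian identity determines ξ^r as ℓ^r times a constant plus quadratures. The t and
φ equations are then integrated by parts: the combinations ξ^t + (E/A) ξ^r/ℓ^r and ξ^φ - (L/C)
ξ^r/ℓ^r have derivatives that are constant combinations of the integrands of I_AB, I_BC and I_ABC.
All three claims are proved multiplied by ℓ^r. Constants enter through equations, so that callers
can supply them in any form. -/
theorem variation_closed_form (h0 : ℓ 0 1 ≠ 0) {ξ ζ : ℝ → Fin 4 → ℝ}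
    (hY : IsVariation (sssMetric A B C) x ℓ J fun s => (ξ s, ζ s)) (hs : s ∈ J) (h1 : ℓ s 1 ≠ 0)
    {I : RadialIntegrals} (hI : IsRadialIntegrals A B C x ℓ J s I) {e l d E L ε : ℝ}
    (he : firstVariation (energy A) (x 0) (ℓ 0) (ξ 0) (ζ 0) = e)
    (hl : firstVariation (angMomZ C) (x 0) (ℓ 0) (ξ 0) (ζ 0) = l)
    (hd : firstVariation (normalization A B C) (x 0) (ℓ 0) (ξ 0) (ζ 0) = d)
    (hE : energy A (x 0) (ℓ 0) = E) (hL : angMomZ C (x 0) (ℓ 0) = L)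
    (hε : normalization A B C (x 0) (ℓ 0) = ε) :
    ξ s 1 = ℓ s 1 * (ξ 0 1 / ℓ 0 1 + d / 2 * I.IB + E * e * I.IAB - L * l * I.IBC) ∧
    ξ s 0 = ξ 0 0 + E * (ξ 0 1 / (A (x 0 1) * ℓ 0 1) - ξ s 1 / (A (x s 1) * ℓ s 1))
      + I.IABC * L * (L * e - E * l) + I.IAB * (E / 2 * d - ε * e) ∧
    ξ s 3 = ξ 0 3 + L * (ξ s 1 / (C (x s 1) * ℓ s 1) - ξ 0 1 / (C (x 0 1) * ℓ 0 1))
      + I.IABC * E * (E * l - L * e) + I.IBC * (ε * l - L * d / 2) := by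
  obtain ⟨pB, pB', pB0, hpB, hWB, hB⟩ := H.exists_regular_quadrature_unique h0 H.contDiffOn_wB
  obtain ⟨pAB, pAB', pAB0, hpAB, hWAB, hAB⟩ := H.exists_regular_quadrature_unique h0 H.contDiffOn_wAB
  obtain ⟨pBC, pBC', pBC0, hpBC, hWBC, hBC⟩ := H.exists_regular_quadrature_unique h0 H.contDiffOn_wBC
  obtain ⟨pABC, pABC', pABC0, hpABC, hWABC, hABC⟩ :=
    H.exists_regular_quadrature_unique h0 H.contDiffOn_wABC
  have hcomp := (isVariation_iff H.profile.isSmoothRegion H.chart).1 hY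
  have hξ : ∀ t ∈ J, ∀ i, HasDerivAt (fun s => ξ s i) (ζ t i) t := fun t ht =>
    hasDerivAt_pi.1 (hcomp t ht).1
  have hr : ∀ t ∈ J, ℓ t 1 ^ 2 = radialSq A B C E L ε (x t 1) := fun t ht => by
    rw [H.velocity_r_sq ht, hE, hL, hε]
  have hV : ∀ t ∈ J, ζ t 1 * ℓ t 1 - ξ t 1 * radialAcc A B C E L ε (x t 1) = d / (2 * B (x t 1))
      + E * e / (A (x t 1) * B (x t 1)) - L * l / (B (x t 1) * C (x t 1)) := fun t ht => by
    rw [← he, ← hl, ← hd, ← H.variation_energy_const hY ht, ← H.variation_angMomZ_const hY ht,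
      ← H.variation_normalization_const hY ht, ← hE, ← hL, ← hε]
    exact H.variation_velocity_r ht (ξ t) (ζ t)
  have hT : ∀ t ∈ J, ζ t 0 = -e / A (x t 1) + E * deriv A (x t 1) / A (x t 1) ^ 2 * ξ t 1 :=
    fun t ht => by
      rw [← he, ← H.variation_energy_const hY ht, ← hE]
      exact H.variation_velocity_t ht (ξ t) (ζ t)
  have hF : ∀ t ∈ J, ζ t 3 = l / C (x t 1) - L * deriv C (x t 1) / C (x t 1) ^ 2 * ξ t 1 :=
    fun t ht => by
      rw [← hl, ← H.variation_angMomZ_const hY ht, ← hL]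
      exact H.variation_velocity_phi ht (ξ t) (ζ t)
  have hvr := fun t (ht : t ∈ J) => H.hasDerivAt_velocity_r ht
  have hwr := fun {f f' : ℝ → ℝ} => H.eq_zero_of_wronskian (f := f) (f' := f') h0 (s := s)
  simp only [hE, hL, hε] at hWB hWAB hWBC hWABC hvr hwr
  -- Difference of ξ^r and the claimed expression, written with the regular functions p instead of
  -- the quadratures.
  have k1 := hwr
    (fun t ht => ((((hξ t ht 1).sub ((hvr t ht).const_mul (ξ 0 1 / ℓ 0 1))).sub
      ((hpB t ht).const_mul (d / 2))).sub ((hpAB t ht).const_mul (E * e))).add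
      ((hpBC t ht).const_mul (L * l)))
    (fun t ht => by
      have hA := (H.posA ht).ne'
      have hB := (H.posB ht).ne'
      have hC := (H.posC ht).ne'
      simp only [Pi.sub_apply, Pi.add_apply]
      linear_combination hV t ht - d / 2 * hWB t ht - E * e * hWAB t ht + L * l * hWBC t ht)
    (by simp [pB0, pAB0, pBC0, div_mul_cancel₀ _ h0]) hs
  -- ℓ^r times the claimed formula for ξ^t, with E ξ^r/A already free of ℓ^r in the denominator; the
  -- Wronskian of this difference with ℓ^r is shown to vanish.
  have k2 := hwr
    (fun t ht => (((((hvr t ht).mul ((hξ t ht 0).sub_const (ξ 0 0))).sub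
      ((hvr t ht).const_mul (E * (ξ 0 1 / ℓ 0 1) / A (x 0 1)))).add
      (((hξ t ht 1).div (H.hasDerivAt_radial H.profile.smoothA ht) (H.posA ht).ne').const_mul E)).sub
      ((hpABC t ht).const_mul (L * (L * e - E * l)))).sub
      ((hpAB t ht).const_mul (E / 2 * d - ε * e)))
    (fun t ht => by
      have hA := (H.posA ht).ne'
      have hB := (H.posB ht).ne'
      have hC := (H.posC ht).ne'
      have hrt := hr t ht
      rw [radialSq] at hrt
      -- The cancellation of integrands that remains once (ℓ^r)² is replaced by its function of r;
      -- it explains the coefficients of I_ABC and I_AB.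
      have alg : (ε / B (x t 1) + E ^ 2 / (A (x t 1) * B (x t 1)) - L ^ 2 / (B (x t 1) * C (x t 1)))
          * (-e / A (x t 1)) + E / A (x t 1) * (d / (2 * B (x t 1))
          + E * e / (A (x t 1) * B (x t 1)) - L * l / (B (x t 1) * C (x t 1)))
          - 1 / (A (x t 1) * B (x t 1) * C (x t 1)) * (L * (L * e - E * l))
          - 1 / (A (x t 1) * B (x t 1)) * (E / 2 * d - ε * e) = 0 := by
        field_simp
        ring
      have hVt := hV t ht
      have hTt := hT t ht
      have hW1 := hWAB t ht
      have hW2 := hWABC t ht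
      simp only [Pi.sub_apply, Pi.add_apply, Pi.mul_apply, Pi.div_apply]
      have e1 : (ζ t 1 * A (x t 1) - ξ t 1 * (deriv A (x t 1) * ℓ t 1)) / A (x t 1) ^ 2
          = ζ t 1 / A (x t 1) - ξ t 1 * deriv A (x t 1) * ℓ t 1 / A (x t 1) ^ 2 := by
        field_simp
      rw [e1]
      linear_combination alg + E / A (x t 1) * hVt + ℓ t 1 ^ 2 * hTt
        - (E / 2 * d - ε * e) * hW1 - (L * (L * e - E * l)) * hW2 + (-e / A (x t 1)) * hrt)
    (by
      have hA := (H.posA H.zero_mem).ne'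
      simp only [Pi.sub_apply, Pi.add_apply, Pi.mul_apply, Pi.div_apply, pAB0, pABC0]
      field_simp
      ring) hs
  have k3 := hwr
    (fun t ht => (((((hvr t ht).mul ((hξ t ht 3).sub_const (ξ 0 3))).add
      ((hvr t ht).const_mul (L * (ξ 0 1 / ℓ 0 1) / C (x 0 1)))).sub
      (((hξ t ht 1).div (H.hasDerivAt_radial H.profile.smoothC ht) (H.posC ht).ne').const_mul L)).sub
      ((hpABC t ht).const_mul (E * (E * l - L * e)))).sub
      ((hpBC t ht).const_mul (ε * l - L * d / 2)))
    (fun t ht => by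
      have hA := (H.posA ht).ne'
      have hB := (H.posB ht).ne'
      have hC := (H.posC ht).ne'
      have hrt := hr t ht
      rw [radialSq] at hrt
      have alg : (ε / B (x t 1) + E ^ 2 / (A (x t 1) * B (x t 1)) - L ^ 2 / (B (x t 1) * C (x t 1)))
          * (l / C (x t 1)) - L / C (x t 1) * (d / (2 * B (x t 1))
          + E * e / (A (x t 1) * B (x t 1)) - L * l / (B (x t 1) * C (x t 1)))
          - 1 / (A (x t 1) * B (x t 1) * C (x t 1)) * (E * (E * l - L * e))
          - 1 / (B (x t 1) * C (x t 1)) * (ε * l - L * d / 2) = 0 := by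
        field_simp
        ring
      have hVt := hV t ht
      have hTt := hF t ht
      have hW1 := hWBC t ht
      have hW2 := hWABC t ht
      simp only [Pi.sub_apply, Pi.add_apply, Pi.mul_apply, Pi.div_apply]
      have e1 : (ζ t 1 * C (x t 1) - ξ t 1 * (deriv C (x t 1) * ℓ t 1)) / C (x t 1) ^ 2
          = ζ t 1 / C (x t 1) - ξ t 1 * deriv C (x t 1) * ℓ t 1 / C (x t 1) ^ 2 := by
        field_simp
      rw [e1]
      linear_combination alg - L / C (x t 1) * hVt + ℓ t 1 ^ 2 * hTt
        - (ε * l - L * d / 2) * hW1 - (E * (E * l - L * e)) * hW2 + (l / C (x t 1)) * hrt)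
    (by
      have hC := (H.posC H.zero_mem).ne'
      simp only [Pi.sub_apply, Pi.add_apply, Pi.mul_apply, Pi.div_apply, pBC0, pABC0]
      field_simp
      ring) hs
  simp only [Pi.sub_apply, Pi.add_apply, Pi.mul_apply, Pi.div_apply, hB s hs h1 _ hI.IB, hAB s hs h1 _ hI.IAB,
    hBC s hs h1 _ hI.IBC, hABC s hs h1 _ hI.IABC] at k1 k2 k3
  have hA := (H.posA hs).ne'
  have hC := (H.posC hs).ne'
  have hA0 := (H.posA H.zero_mem).ne'
  have hC0 := (H.posC H.zero_mem).ne'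
  refine ⟨by linear_combination k1, ?_, ?_⟩
  · refine mul_left_cancel₀ h1 ?_
    field_simp at k2 ⊢
    linear_combination k2
  · refine mul_left_cancel₀ h1 ?_
    field_simp at k3 ⊢
    linear_combination k3

end IsAlignedOrbit

/-! ### Reflection at the equatorial plane -/

/-- Reflection of a tangent vector at the equatorial plane. -/
noncomputable def reflectTheta (v : Fin 4 → ℝ) : Fin 4 → ℝ := ![v 0, v 1, -v 2, v 3]

theorem reflectTheta_sub (v w : Fin 4 → ℝ) :
    reflectTheta (v - w) = reflectTheta v - reflectTheta w := by
  funext i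
  fin_cases i <;> simp [reflectTheta]
  ring

theorem hasDerivAt_reflectTheta {f : ℝ → Fin 4 → ℝ} {f' : Fin 4 → ℝ} {s : ℝ}
    (hf : HasDerivAt f f' s) : HasDerivAt (fun s => reflectTheta (f s)) (reflectTheta f') s := by
  rw [hasDerivAt_pi] at hf ⊢
  intro i
  fin_cases i
  · simpa [reflectTheta] using hf 0
  · simpa [reflectTheta] using hf 1
  · simpa [reflectTheta] using (hf 2).fun_neg
  · simpa [reflectTheta] using hf 3

theorem gammaVec_zero_left (g : (Fin 4 → ℝ) → Matrix (Fin 4) (Fin 4) ℝ) (y w : Fin 4 → ℝ) :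
    gammaVec g y 0 w = 0 := by
  funext μ
  simp [gammaVec]

theorem gammaVec_zero_right (g : (Fin 4 → ℝ) → Matrix (Fin 4) (Fin 4) ℝ) (y v : Fin 4 → ℝ) :
    gammaVec g y v 0 = 0 := by
  funext μ
  simp [gammaVec]

namespace IsMetricProfile

variable {A B C : ℝ → ℝ} {R : Set ℝ} (P : IsMetricProfile A B C R)
include P

/-- The map θ ↦ π - θ is an isometry, so Γ is equivariant between mirror points. -/
theorem gammaVec_reflectTheta {y y' : Fin 4 → ℝ} (hy : y ∈ sphericalChart R)
    (hy' : y' ∈ sphericalChart R) (h1 : y' 1 = y 1) (h2 : y' 2 = π - y 2) (v w : Fin 4 → ℝ) :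
    gammaVec (sssMetric A B C) y' (reflectTheta v) (reflectTheta w) =
      reflectTheta (gammaVec (sssMetric A B C) y v w) := by
  rw [P.gammaVec_eq hy, P.gammaVec_eq hy', h1, h2, sin_pi_sub, cos_pi_sub]
  funext i
  fin_cases i <;> simp [reflectTheta] <;> ring

/-- The equivariance is differentiated along the line y + τδ. As y lies on the equator, the mirror
image of this line is y + τ times the reflected δ. No derivative of a Christoffel symbol has to be
computed. -/
theorem dGammaVec_reflectTheta {y : Fin 4 → ℝ} (hy : y ∈ sphericalChart R) (h2 : y 2 = π / 2)
    (δ v w : Fin 4 → ℝ) :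
    dGammaVec (sssMetric A B C) y (reflectTheta δ) (reflectTheta v) (reflectTheta w) =
      reflectTheta (dGammaVec (sssMetric A B C) y δ v w) := by
  have line : ∀ δ : Fin 4 → ℝ, HasDerivAt (fun τ : ℝ => y + τ • δ) δ 0 := fun δ => by
    simpa using ((hasDerivAt_id (0 : ℝ)).smul_const δ).const_add y
  have key : ∀ δ v w : Fin 4 → ℝ, HasDerivAt
      (fun τ : ℝ => gammaVec (sssMetric A B C) (y + τ • δ) v w)
      (dGammaVec (sssMetric A B C) y δ v w) 0 := fun δ v w => by
    have := hasDerivAt_gammaVec (g := sssMetric A B C) (s := (0 : ℝ)) (y := fun τ => y + τ • δ)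
      (by simpa using P.isSmoothRegion.differentiableAt hy) (line δ) (hasDerivAt_const 0 v)
      (hasDerivAt_const 0 w)
    simpa [gammaVec_zero_left, gammaVec_zero_right] using this
  have mem : ∀ δ : Fin 4 → ℝ, ∀ᶠ τ in 𝓝 (0 : ℝ), y + τ • δ ∈ sphericalChart R := fun δ =>
    (line δ).continuousAt.eventually_mem (P.isSmoothRegion.isOpen.mem_nhds (by simpa using hy))
  refine (key _ _ _).unique ((hasDerivAt_reflectTheta (key δ v w)).congr_of_eventuallyEq ?_)
  filter_upwards [mem δ, mem (reflectTheta δ)] with τ h h'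
  refine P.gammaVec_reflectTheta h h' (by simp [reflectTheta]) ?_ v w
  simp only [reflectTheta, Pi.add_apply, Pi.smul_apply, smul_eq_mul, Matrix.cons_val, h2]
  ring

end IsMetricProfile

namespace IsAlignedOrbit

variable {A B C : ℝ → ℝ} {R J : Set ℝ} {x ℓ : ℝ → Fin 4 → ℝ} (H : IsAlignedOrbit A B C R J x ℓ)
  {s : ℝ}
include H

theorem reflectTheta_velocity (hs : s ∈ J) : reflectTheta (ℓ s) = ℓ s := by
  funext i
  fin_cases i <;> simp [reflectTheta, H.velocity_theta hs]

theorem gammaVec_reflectTheta (hs : s ∈ J) (v w : Fin 4 → ℝ) :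
    gammaVec (sssMetric A B C) (x s) (reflectTheta v) (reflectTheta w) =
      reflectTheta (gammaVec (sssMetric A B C) (x s) v w) :=
  H.profile.gammaVec_reflectTheta (H.chart s hs) (H.chart s hs) rfl
    (by rw [H.theta_eq hs]; ring) v w

theorem isDeviation_iff {ξ η : ℝ → Fin 4 → ℝ} :
    IsDeviation (sssMetric A B C) x ℓ J ξ η ↔ IsVariation (sssMetric A B C) x ℓ J
      fun s => (ξ s, η s - gammaVec (sssMetric A B C) (x s) (ℓ s) (ξ s)) :=
  isDeviation_iff_isVariation H.profile.isSmoothRegion H.geodesic H.chart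

/-- The orbit lies in the fixed plane of the isometry, which therefore maps deviations along it to
deviations. -/
theorem isDeviation_reflectTheta {ξ η : ℝ → Fin 4 → ℝ}
    (hD : IsDeviation (sssMetric A B C) x ℓ J ξ η) :
    IsDeviation (sssMetric A B C) x ℓ J (fun s => reflectTheta (ξ s))
      fun s => reflectTheta (η s) := by
  rw [H.isDeviation_iff, isVariation_iff H.profile.isSmoothRegion H.chart] at hD ⊢
  intro s hs
  obtain ⟨h1, h2⟩ := hD s hs
  have e : ∀ s ∈ J, reflectTheta (η s) - gammaVec (sssMetric A B C) (x s) (ℓ s) (reflectTheta (ξ s))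
      = reflectTheta (η s - gammaVec (sssMetric A B C) (x s) (ℓ s) (ξ s)) := fun s hs => by
    rw [reflectTheta_sub, ← H.gammaVec_reflectTheta hs, H.reflectTheta_velocity hs]
  rw [e s hs]
  refine ⟨hasDerivAt_reflectTheta h1, ((hasDerivAt_reflectTheta h2).congr_of_eventuallyEq ?_).congr_deriv
    ?_⟩
  · filter_upwards [H.isOpen.mem_nhds hs] with t ht using e t ht
  · have hd := H.profile.dGammaVec_reflectTheta (H.chart s hs) (H.theta_eq hs) (ξ s) (ℓ s) (ℓ s)
    have hg := fun w => H.gammaVec_reflectTheta hs (ℓ s) w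
    have hg' := fun w => H.gammaVec_reflectTheta hs w (ℓ s)
    rw [H.reflectTheta_velocity hs] at hd
    simp only [H.reflectTheta_velocity hs] at hg hg'
    rw [hd, hg, hg']
    funext i
    fin_cases i <;> simp [reflectTheta]
    ring

theorem isDeviation_eqOn {ξ η ξ' η' : ℝ → Fin 4 → ℝ}
    (h : IsDeviation (sssMetric A B C) x ℓ J ξ η) (h' : IsDeviation (sssMetric A B C) x ℓ J ξ' η')
    (h0 : ξ 0 = ξ' 0) (h0' : η 0 = η' 0) (hs : s ∈ J) : ξ s = ξ' s ∧ η s = η' s :=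
  IsDeviation.eqOn H.profile.isSmoothRegion H.geodesic H.chart H.isOpen H.ordConnected H.zero_mem
    h h' h0 h0' s hs

/-- A deviation that starts tangentially to the equatorial plane stays so. -/
theorem deviation_theta_eq_zero {ξ η : ℝ → Fin 4 → ℝ}
    (hD : IsDeviation (sssMetric A B C) x ℓ J ξ η) (h0 : ξ 0 2 = 0) (h0' : η 0 2 = 0)
    (hs : s ∈ J) : ξ s 2 = 0 ∧ η s 2 = 0 := by
  -- The mirror image has the same initial data, so the deviation equals it and its θ component
  -- equals its negative.
  obtain ⟨h1, h2⟩ := H.isDeviation_eqOn (H.isDeviation_reflectTheta hD) hD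
    (by funext i; fin_cases i <;> simp [reflectTheta, h0])
    (by funext i; fin_cases i <;> simp [reflectTheta, h0']) hs
  have h1' := congrFun h1 2
  have h2' := congrFun h2 2
  simp only [reflectTheta, Matrix.cons_val] at h1' h2'
  constructor <;> linarith

/-- A deviation that starts orthogonally to the equatorial plane stays so. -/
theorem deviation_eq_zero {ξ η : ℝ → Fin 4 → ℝ}
    (hD : IsDeviation (sssMetric A B C) x ℓ J ξ η) (h0 : ∀ μ, μ ≠ 2 → ξ 0 μ = 0 ∧ η 0 μ = 0)
    (hs : s ∈ J) {μ : Fin 4} (hμ : μ ≠ 2) : ξ s μ = 0 ∧ η s μ = 0 := by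
  have hsmul := IsDeviation.smul H.profile.isSmoothRegion H.geodesic H.chart (-1) hD
  have a0 := h0 0 (by decide)
  have a1 := h0 1 (by decide)
  have a3 := h0 3 (by decide)
  -- Here the mirror image has the initial data of -ξ.
  obtain ⟨h1, h2⟩ := H.isDeviation_eqOn (H.isDeviation_reflectTheta hD) hsmul
    (by funext i; fin_cases i <;> simp [reflectTheta, a0, a1, a3])
    (by funext i; fin_cases i <;> simp [reflectTheta, a0, a1, a3]) hs
  have h1' := congrFun h1 μ
  have h2' := congrFun h2 μ
  fin_cases μ <;> simp [reflectTheta] at h1' h2' hμ ⊢ <;> constructor <;> linarith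

/-! ### The first integrals in terms of `ξ` and `∇_ℓ ξ` -/

/-- Inserting the ordinary derivative η - Γ(ℓ, ξ) turns the variation of a conserved quantity into a
covariant first integral: δE is -Σ_T, δL_z is -Σ_z, and δε is 2 g(ℓ, ∇_ℓ ξ). -/
theorem firstVariation_energy_covariant (hs : s ∈ J) (ξ η : Fin 4 → ℝ) :
    firstVariation (energy A) (x s) (ℓ s) ξ (η - gammaVec (sssMetric A B C) (x s) (ℓ s) ξ) =
      -A (x s 1) * η 0 + deriv A (x s 1) / 2
        * (energy A (x 0) (ℓ 0) / A (x s 1) * ξ 1 + ℓ s 1 * ξ 0) := by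
  have hA := (H.posA hs).ne'
  rw [H.firstVariation_energy hs, H.gammaVec_eq hs]
  simp only [Pi.sub_apply, Matrix.cons_val, H.velocity_t hs]
  field_simp
  ring

theorem firstVariation_angMomZ_covariant (hs : s ∈ J) (ξ η : Fin 4 → ℝ) :
    firstVariation (angMomZ C) (x s) (ℓ s) ξ (η - gammaVec (sssMetric A B C) (x s) (ℓ s) ξ) =
      C (x s 1) * η 3 + deriv C (x s 1) / 2
        * (angMomZ C (x 0) (ℓ 0) / C (x s 1) * ξ 1 - ℓ s 1 * ξ 3) := by
  have hC := (H.posC hs).ne'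
  rw [H.firstVariation_angMomZ hs, H.gammaVec_eq hs]
  simp only [Pi.sub_apply, Matrix.cons_val, H.velocity_phi hs]
  field_simp
  ring

theorem firstVariation_normalization_covariant (hs : s ∈ J) (ξ η : Fin 4 → ℝ) :
    firstVariation (normalization A B C) (x s) (ℓ s) ξ
        (η - gammaVec (sssMetric A B C) (x s) (ℓ s) ξ) =
      2 * (energy A (x 0) (ℓ 0) * η 0 + B (x s 1) * ℓ s 1 * η 1
        + angMomZ C (x 0) (ℓ 0) * η 3) := by
  have hA := (H.posA hs).ne'
  have hB := (H.posB hs).ne'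
  have hC := (H.posC hs).ne'
  rw [H.firstVariation_normalization hs, H.gammaVec_eq hs]
  simp only [Pi.sub_apply, Matrix.cons_val, H.velocity_phi hs, H.velocity_t hs,
    H.velocity_theta hs]
  field_simp
  ring

theorem deviation_energy_const {ξ η : ℝ → Fin 4 → ℝ}
    (hD : IsDeviation (sssMetric A B C) x ℓ J ξ η) (hs : s ∈ J) :
    -A (x s 1) * η s 0 + deriv A (x s 1) / 2
        * (energy A (x 0) (ℓ 0) / A (x s 1) * ξ s 1 + ℓ s 1 * ξ s 0) =
      -A (x 0 1) * η 0 0 + deriv A (x 0 1) / 2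
        * (energy A (x 0) (ℓ 0) / A (x 0 1) * ξ 0 1 + ℓ 0 1 * ξ 0 0) := by
  rw [← H.firstVariation_energy_covariant hs, ← H.firstVariation_energy_covariant H.zero_mem]
  exact H.variation_energy_const (H.isDeviation_iff.1 hD) hs

theorem deviation_angMomZ_const {ξ η : ℝ → Fin 4 → ℝ}
    (hD : IsDeviation (sssMetric A B C) x ℓ J ξ η) (hs : s ∈ J) :
    C (x s 1) * η s 3 + deriv C (x s 1) / 2
        * (angMomZ C (x 0) (ℓ 0) / C (x s 1) * ξ s 1 - ℓ s 1 * ξ s 3) =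
      C (x 0 1) * η 0 3 + deriv C (x 0 1) / 2
        * (angMomZ C (x 0) (ℓ 0) / C (x 0 1) * ξ 0 1 - ℓ 0 1 * ξ 0 3) := by
  rw [← H.firstVariation_angMomZ_covariant hs, ← H.firstVariation_angMomZ_covariant H.zero_mem]
  exact H.variation_angMomZ_const (H.isDeviation_iff.1 hD) hs

theorem deviation_normalization_const {ξ η : ℝ → Fin 4 → ℝ}
    (hD : IsDeviation (sssMetric A B C) x ℓ J ξ η) (hs : s ∈ J) :
    energy A (x 0) (ℓ 0) * η s 0 + B (x s 1) * ℓ s 1 * η s 1 + angMomZ C (x 0) (ℓ 0) * η s 3 =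
      energy A (x 0) (ℓ 0) * η 0 0 + B (x 0 1) * ℓ 0 1 * η 0 1
        + angMomZ C (x 0) (ℓ 0) * η 0 3 := by
  refine mul_left_cancel₀ (two_ne_zero (α := ℝ)) ?_
  rw [← H.firstVariation_normalization_covariant hs (ξ s),
    ← H.firstVariation_normalization_covariant H.zero_mem (ξ 0)]
  exact H.variation_normalization_const (H.isDeviation_iff.1 hD) hs

/-- The `θ` component of a deviation. -/
theorem deviation_theta {ξ η : ℝ → Fin 4 → ℝ}
    (hD : IsDeviation (sssMetric A B C) x ℓ J ξ η) (hs : s ∈ J) :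
    angMomZ C (x 0) (ℓ 0) * ξ s 2 = angMomZ C (x 0) (ℓ 0) * ξ 0 2 * cos (x s 3)
        + (C (x 0 1) * η 0 2 - deriv C (x 0 1) / 2 * ℓ 0 1 * ξ 0 2) * sin (x s 3) ∧
      C (x s 1) * η s 2 - deriv C (x s 1) / 2 * ℓ s 1 * ξ s 2
        = (C (x 0 1) * η 0 2 - deriv C (x 0 1) / 2 * ℓ 0 1 * ξ 0 2) * cos (x s 3)
        - angMomZ C (x 0) (ℓ 0) * ξ 0 2 * sin (x s 3) := by
  have h := H.variation_theta (H.isDeviation_iff.1 hD) hs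
  have e : ∀ s ∈ J, C (x s 1) * (η s - gammaVec (sssMetric A B C) (x s) (ℓ s) (ξ s)) 2
      = C (x s 1) * η s 2 - deriv C (x s 1) / 2 * ℓ s 1 * ξ s 2 := fun s hs => by
    have hC := (H.posC hs).ne'
    rw [H.gammaVec_eq hs]
    simp only [Pi.sub_apply, Matrix.cons_val, H.velocity_theta hs]
    field_simp
    ring
  rwa [e s hs, e 0 H.zero_mem] at h

end IsAlignedOrbit

/-! ### Explicit solution in terms of the initial data -/

/-- The deviation `(ξ, η)` at parameter `s` is the one with initial data `(ξ₀, η₀)`, in the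
components tangential to the equatorial plane. -/
def OrbitData.IsPropagated (d : OrbitData) (ξ₀ η₀ ξ η : Fin 4 → ℝ) : Prop :=
  ∀ κ sT sz b : ℝ, κ * d.lr₀ = ξ₀ 1 →
    sT = d.A₀ * η₀ 0 - d.dA₀ / 2 * (d.E / d.A₀ * ξ₀ 1 + d.lr₀ * ξ₀ 0) →
    sz = -(d.C₀ * η₀ 3 + d.dC₀ / 2 * (d.L / d.C₀ * ξ₀ 1 - d.lr₀ * ξ₀ 3)) →
    b = d.E * η₀ 0 + d.B₀ * d.lr₀ * η₀ 1 + d.L * η₀ 3 →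
    ξ 1 = d.lr * (κ - d.E * sT * d.IAB + d.L * sz * d.IBC + b * d.IB) ∧
    η 1 = (b - d.E * η 0 - d.L * η 3) / (d.B * d.lr) ∧
    ξ 0 = ξ₀ 0 + κ * d.E * (1 / d.A₀ - 1 / d.A)
      + sT * (d.E ^ 2 * d.IAB / d.A - d.L ^ 2 * d.IABC + d.ε * d.IAB)
      + d.L * sz * d.E * (d.IABC - d.IBC / d.A) + d.E * b * (d.IAB - d.IB / d.A) ∧
    η 0 = d.dA * d.lr / (2 * d.A) * (ξ₀ 0 + κ * d.E / d.A₀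
        + d.L * d.IABC * (sz * d.E - sT * d.L) + d.IAB * (sT * d.ε + d.E * b))
      + sT / d.A ∧
    ξ 3 = ξ₀ 3 + κ * d.L * (1 / d.C - 1 / d.C₀)
      + sz * (d.L ^ 2 * d.IBC / d.C - d.E ^ 2 * d.IABC - d.ε * d.IBC)
      + d.E * sT * d.L * (d.IABC - d.IAB / d.C) + d.L * b * (d.IB / d.C - d.IBC) ∧
    η 3 = d.dC * d.lr / (2 * d.C) * (d.E * d.IABC * (sT * d.L - sz * d.E)
        - d.IBC * (sz * d.ε + d.L * b) + ξ₀ 3 - κ * d.L / d.C₀)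
      - sz / d.C

/-- Both endpoints of a segment of the orbit are regular points. -/
structure OrbitData.IsRegular (d : OrbitData) : Prop where
  A : d.A ≠ 0
  B : d.B ≠ 0
  C : d.C ≠ 0
  lr : d.lr ≠ 0
  A₀ : d.A₀ ≠ 0
  B₀ : d.B₀ ≠ 0
  C₀ : d.C₀ ≠ 0
  lr₀ : d.lr₀ ≠ 0

theorem IsAlignedOrbit.isRegular {A B C : ℝ → ℝ} {R J : Set ℝ} {x ℓ : ℝ → Fin 4 → ℝ}
    (H : IsAlignedOrbit A B C R J x ℓ) (h0 : ℓ 0 1 ≠ 0) {s : ℝ} (hs : s ∈ J) (h1 : ℓ s 1 ≠ 0)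
    (I : RadialIntegrals) : (orbitData A B C x ℓ s I).IsRegular :=
  ⟨(H.posA hs).ne', (H.posB hs).ne', (H.posC hs).ne', h1, (H.posA H.zero_mem).ne',
    (H.posB H.zero_mem).ne', (H.posC H.zero_mem).ne', h0⟩

/-- `variation_closed_form` is used with δE = -Σ_T, δL_z = -Σ_z and δε twice the constant b. The
derivatives then come algebraically: η^t and η^φ from conservation of Σ_T and Σ_z, and η^r from that
of b. -/
theorem IsAlignedOrbit.isPropagated {A B C : ℝ → ℝ} {R J : Set ℝ} {x ℓ : ℝ → Fin 4 → ℝ}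
    (H : IsAlignedOrbit A B C R J x ℓ) (h0 : ℓ 0 1 ≠ 0) {s : ℝ} (hs : s ∈ J) (h1 : ℓ s 1 ≠ 0)
    {I : RadialIntegrals} (hI : IsRadialIntegrals A B C x ℓ J s I) {ξ η : ℝ → Fin 4 → ℝ}
    (hD : IsDeviation (sssMetric A B C) x ℓ J ξ η) :
    (orbitData A B C x ℓ s I).IsPropagated (ξ 0) (η 0) (ξ s) (η s) := by
  intro κ sT sz b hκ hT hz hb
  have hY := H.isDeviation_iff.1 hD
  have hE := H.deviation_energy_const hD hs
  have hL := H.deviation_angMomZ_const hD hs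
  have hN := H.deviation_normalization_const hD hs
  obtain ⟨k1, k0, k3⟩ := H.variation_closed_form h0 hY hs h1 hI
    (H.firstVariation_energy_covariant H.zero_mem (ξ 0) (η 0))
    (H.firstVariation_angMomZ_covariant H.zero_mem (ξ 0) (η 0))
    (H.firstVariation_normalization_covariant H.zero_mem (ξ 0) (η 0)) rfl rfl rfl
  have hA := (H.posA hs).ne'
  have hB := (H.posB hs).ne'
  have hC := (H.posC hs).ne'
  have hA0 := (H.posA H.zero_mem).ne'
  have hC0 := (H.posC H.zero_mem).ne'
  simp only [orbitData] at hκ hT hz hb ⊢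
  have hT' : -A (x 0 1) * η 0 0 + deriv A (x 0 1) / 2
        * (energy A (x 0) (ℓ 0) / A (x 0 1) * ξ 0 1 + ℓ 0 1 * ξ 0 0) = -sT := by rw [hT]; ring
  have hz' : C (x 0 1) * η 0 3 + deriv C (x 0 1) / 2
        * (angMomZ C (x 0) (ℓ 0) / C (x 0 1) * ξ 0 1 - ℓ 0 1 * ξ 0 3) = -sz := by rw [hz]; ring
  rw [hT', hz', ← hb, ← hκ, mul_div_cancel_right₀ _ h0] at k1
  rw [hT', hz', ← hb, k1, ← hκ] at k0 k3
  rw [hT'] at hE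
  rw [hz'] at hL
  rw [← hb] at hN
  -- The combination (E/A) ξ^r/ℓ^r + ξ^t appears; in it all terms with 1/A cancel, so the formula
  -- for η^t contains neither I_B nor I_BC.
  have e0 : η s 0 = sT / A (x s 1) + deriv A (x s 1) * ℓ s 1 / (2 * A (x s 1)) * (energy A (x 0) (ℓ 0) / A (x s 1)
      * (ξ s 1 / ℓ s 1) + ξ s 0) := by
    field_simp at hE ⊢
    linear_combination -hE
  have e3 : η s 3 = -sz / C (x s 1) + deriv C (x s 1) * ℓ s 1 / (2 * C (x s 1)) * (ξ s 3 - angMomZ C (x 0) (ℓ 0) / C (x s 1)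
      * (ξ s 1 / ℓ s 1)) := by
    field_simp at hL ⊢
    linear_combination hL
  rw [k1, k0, mul_div_cancel_left₀ _ h1] at e0
  rw [k1, k3, mul_div_cancel_left₀ _ h1] at e3
  refine ⟨?_, ?_, ?_, ?_, ?_, ?_⟩
  · rw [k1]
    ring
  · field_simp
    linear_combination hN
  · rw [k0]
    field_simp
    ring
  · rw [e0]
    field_simp
    ring
  · rw [k3]
    field_simp
    ring
  · rw [e3]
    field_simp
    ring

/-! ### Closed forms in the aligned coordinate frame -/

namespace OrbitData

variable {d : OrbitData} (hd : d.IsRegular) {ξ η : Fin 4 → ℝ}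
include hd

/-- One column of the operators: the unit vector determines the constants κ, Σ_T, Σ_z, b, which are
handed over in simplified form. The row μ = 2 is excluded because θ is treated separately. -/
theorem IsPropagated.coord_X_t (h : d.IsPropagated (Pi.single 0 1) 0 ξ η) {μ : Fin 4} (hμ : μ ≠ 2) :
    ξ μ = coordXX d μ 0 ∧ η μ = coordLX d μ 0 := by
  obtain ⟨hA, hB, hC, hr, hA0, hB0, hC0, hr0⟩ := hd
  obtain ⟨k1, l1, k0, l0, k3, l3⟩ := h 0 (-(d.dA₀ / 2 * d.lr₀)) 0 0 (by simp) (by simp) (by simp)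
    (by simp)
  simp only [Pi.single_eq_same, Pi.single_eq_of_ne (show (3 : Fin 4) ≠ 0 by decide)] at k0 l0 k3 l3
  rw [l0, l3] at l1
  fin_cases μ
  · simp only [coordXX, coordLX, Matrix.of_apply, Matrix.cons_val, Fin.zero_eta]
    exact ⟨by rw [k0]; ring, by rw [l0]; field_simp; ring⟩
  · simp only [coordXX, coordLX, Matrix.of_apply, Matrix.cons_val, Fin.mk_one]
    exact ⟨by rw [k1]; ring, by rw [l1]; field_simp; ring⟩
  · exact absurd rfl hμ
  · simp only [coordXX, coordLX, Matrix.of_apply, Matrix.cons_val, Fin.reduceFinMk]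
    exact ⟨by rw [k3]; ring, by rw [l3]; field_simp; ring⟩

theorem IsPropagated.coord_X_r (h : d.IsPropagated (Pi.single 1 1) 0 ξ η) {μ : Fin 4} (hμ : μ ≠ 2) :
    ξ μ = coordXX d μ 1 ∧ η μ = coordLX d μ 1 := by
  obtain ⟨hA, hB, hC, hr, hA0, hB0, hC0, hr0⟩ := hd
  obtain ⟨k1, l1, k0, l0, k3, l3⟩ := h (1 / d.lr₀) (-(d.dA₀ / 2 * (d.E / d.A₀)))
    (-(d.dC₀ / 2 * (d.L / d.C₀))) 0 (by simp [hr0]) (by simp) (by simp) (by simp)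
  simp only [Pi.single_eq_of_ne (show (0 : Fin 4) ≠ 1 by decide),
    Pi.single_eq_of_ne (show (3 : Fin 4) ≠ 1 by decide)] at k0 l0 k3 l3
  rw [l0, l3] at l1
  fin_cases μ
  · simp only [coordXX, coordLX, Matrix.of_apply, Matrix.cons_val, Fin.zero_eta]
    exact ⟨by rw [k0]; field_simp; ring, by rw [l0]; field_simp; ring⟩
  · simp only [coordXX, coordLX, Matrix.of_apply, Matrix.cons_val, Fin.mk_one]
    exact ⟨by rw [k1]; field_simp; ring, by rw [l1]; field_simp; ring⟩
  · exact absurd rfl hμ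
  · simp only [coordXX, coordLX, Matrix.of_apply, Matrix.cons_val, Fin.reduceFinMk]
    exact ⟨by rw [k3]; field_simp; ring, by rw [l3]; field_simp; ring⟩

theorem IsPropagated.coord_X_phi (h : d.IsPropagated (Pi.single 3 1) 0 ξ η) {μ : Fin 4} (hμ : μ ≠ 2) :
    ξ μ = coordXX d μ 3 ∧ η μ = coordLX d μ 3 := by
  obtain ⟨hA, hB, hC, hr, hA0, hB0, hC0, hr0⟩ := hd
  obtain ⟨k1, l1, k0, l0, k3, l3⟩ := h 0 0 (d.dC₀ / 2 * d.lr₀) 0 (by simp) (by simp) (by simp)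
    (by simp)
  simp only [Pi.single_eq_same, Pi.single_eq_of_ne (show (0 : Fin 4) ≠ 3 by decide)] at k0 l0 k3 l3
  rw [l0, l3] at l1
  fin_cases μ
  · simp only [coordXX, coordLX, Matrix.of_apply, Matrix.cons_val, Fin.zero_eta]
    exact ⟨by rw [k0]; ring, by rw [l0]; field_simp; ring⟩
  · simp only [coordXX, coordLX, Matrix.of_apply, Matrix.cons_val, Fin.mk_one]
    exact ⟨by rw [k1]; ring, by rw [l1]; field_simp; ring⟩
  · exact absurd rfl hμ
  · simp only [coordXX, coordLX, Matrix.of_apply, Matrix.cons_val, Fin.reduceFinMk]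
    exact ⟨by rw [k3]; ring, by rw [l3]; field_simp; ring⟩

theorem IsPropagated.coord_L_t (h : d.IsPropagated 0 (Pi.single 0 1) ξ η) {μ : Fin 4} (hμ : μ ≠ 2) :
    ξ μ = coordXL d μ 0 ∧ η μ = coordLL d μ 0 := by
  obtain ⟨hA, hB, hC, hr, hA0, hB0, hC0, hr0⟩ := hd
  obtain ⟨k1, l1, k0, l0, k3, l3⟩ := h 0 d.A₀ 0 d.E (by simp) (by simp) (by simp) (by simp)
  simp only [Pi.zero_apply] at k0 l0 k3 l3
  rw [l0, l3] at l1
  fin_cases μ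
  · simp only [coordXL, coordLL, Matrix.of_apply, Matrix.cons_val, Fin.zero_eta]
    exact ⟨by rw [k0]; ring, by rw [l0]; field_simp; ring⟩
  · simp only [coordXL, coordLL, Matrix.of_apply, Matrix.cons_val, Fin.mk_one]
    exact ⟨by rw [k1]; ring, by rw [l1]; field_simp; ring⟩
  · exact absurd rfl hμ
  · simp only [coordXL, coordLL, Matrix.of_apply, Matrix.cons_val, Fin.reduceFinMk]
    exact ⟨by rw [k3]; ring, by rw [l3]; field_simp; ring⟩

theorem IsPropagated.coord_L_r (h : d.IsPropagated 0 (Pi.single 1 1) ξ η) {μ : Fin 4} (hμ : μ ≠ 2) :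
    ξ μ = coordXL d μ 1 ∧ η μ = coordLL d μ 1 := by
  obtain ⟨hA, hB, hC, hr, hA0, hB0, hC0, hr0⟩ := hd
  obtain ⟨k1, l1, k0, l0, k3, l3⟩ := h 0 0 0 (d.B₀ * d.lr₀) (by simp) (by simp) (by simp) (by simp)
  simp only [Pi.zero_apply] at k0 l0 k3 l3
  rw [l0, l3] at l1
  fin_cases μ
  · simp only [coordXL, coordLL, Matrix.of_apply, Matrix.cons_val, Fin.zero_eta]
    exact ⟨by rw [k0]; ring, by rw [l0]; field_simp; ring⟩
  · simp only [coordXL, coordLL, Matrix.of_apply, Matrix.cons_val, Fin.mk_one]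
    exact ⟨by rw [k1]; ring, by rw [l1]; field_simp; ring⟩
  · exact absurd rfl hμ
  · simp only [coordXL, coordLL, Matrix.of_apply, Matrix.cons_val, Fin.reduceFinMk]
    exact ⟨by rw [k3]; ring, by rw [l3]; field_simp; ring⟩

theorem IsPropagated.coord_L_phi (h : d.IsPropagated 0 (Pi.single 3 1) ξ η) {μ : Fin 4} (hμ : μ ≠ 2) :
    ξ μ = coordXL d μ 3 ∧ η μ = coordLL d μ 3 := by
  obtain ⟨hA, hB, hC, hr, hA0, hB0, hC0, hr0⟩ := hd
  obtain ⟨k1, l1, k0, l0, k3, l3⟩ := h 0 0 (-d.C₀) d.L (by simp) (by simp) (by simp) (by simp)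
  simp only [Pi.zero_apply] at k0 l0 k3 l3
  rw [l0, l3] at l1
  fin_cases μ
  · simp only [coordXL, coordLL, Matrix.of_apply, Matrix.cons_val, Fin.zero_eta]
    exact ⟨by rw [k0]; ring, by rw [l0]; field_simp; ring⟩
  · simp only [coordXL, coordLL, Matrix.of_apply, Matrix.cons_val, Fin.mk_one]
    exact ⟨by rw [k1]; ring, by rw [l1]; field_simp; ring⟩
  · exact absurd rfl hμ
  · simp only [coordXL, coordLL, Matrix.of_apply, Matrix.cons_val, Fin.reduceFinMk]
    exact ⟨by rw [k3]; ring, by rw [l3]; field_simp; ring⟩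

end OrbitData

namespace IsAlignedOrbit

variable {A B C : ℝ → ℝ} {R J : Set ℝ} {x ℓ : ℝ → Fin 4 → ℝ} (H : IsAlignedOrbit A B C R J x ℓ)
  {s : ℝ} {W : BilocalOperators} (hW : IsBGO (sssMetric A B C) x ℓ J W)
include H hW

/-- Reflection symmetry: a column started along θ stays along θ, and a column started tangentially
to the plane stays tangential. -/
theorem bgo_decouple (hs : s ∈ J) {μ : Fin 4} (hμ : μ ≠ 2) :
    W.XX s μ 2 = 0 ∧ W.XX s 2 μ = 0 ∧ W.XL s μ 2 = 0 ∧ W.XL s 2 μ = 0 ∧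
      W.LX s μ 2 = 0 ∧ W.LX s 2 μ = 0 ∧ W.LL s μ 2 = 0 ∧ W.LL s 2 μ = 0 := by
  have a := H.deviation_eq_zero (hW.deviation_X 2)
    (fun ν hν => by simp [hW.XX_zero, hW.LX_zero, Matrix.one_apply_ne hν]) hs hμ
  have b := H.deviation_eq_zero (hW.deviation_L 2)
    (fun ν hν => by simp [hW.XL_zero, hW.LL_zero, Matrix.one_apply_ne hν]) hs hμ
  have a' := H.deviation_theta_eq_zero (hW.deviation_X μ)
    (by simp [hW.XX_zero, Matrix.one_apply_ne hμ.symm]) (by simp [hW.LX_zero]) hs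
  have b' := H.deviation_theta_eq_zero (hW.deviation_L μ)
    (by simp [hW.XL_zero]) (by simp [hW.LL_zero, Matrix.one_apply_ne hμ.symm]) hs
  exact ⟨a.1, a'.1, b.1, b'.1, a.2, a'.2, b.2, b'.2⟩

/-- The θ entries contain no quadrature, so `I` is arbitrary and turning points are harmless, even
at the endpoints. -/
theorem bgo_theta (hL : angMomZ C (x 0) (ℓ 0) ≠ 0) (hs : s ∈ J) (I : RadialIntegrals) :
    W.XX s 2 2 = coordXX (orbitData A B C x ℓ s I) 2 2 ∧
      W.XL s 2 2 = coordXL (orbitData A B C x ℓ s I) 2 2 ∧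
      W.LX s 2 2 = coordLX (orbitData A B C x ℓ s I) 2 2 ∧
      W.LL s 2 2 = coordLL (orbitData A B C x ℓ s I) 2 2 := by
  have hC := (H.posC hs).ne'
  have hC0 := (H.posC H.zero_mem).ne'
  obtain ⟨a, a'⟩ := H.deviation_theta (hW.deviation_X 2) hs
  obtain ⟨b, b'⟩ := H.deviation_theta (hW.deviation_L 2) hs
  simp only [hW.XX_zero, hW.LX_zero, hW.XL_zero, hW.LL_zero, Matrix.one_apply_eq,
    Matrix.zero_apply] at a a' b b'
  have ea : W.XX s 2 2 = coordXX (orbitData A B C x ℓ s I) 2 2 := by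
    simp only [coordXX, orbitData, Matrix.of_apply, Matrix.cons_val]
    refine mul_left_cancel₀ hL ?_
    rw [a]
    field_simp
    ring
  have eb : W.XL s 2 2 = coordXL (orbitData A B C x ℓ s I) 2 2 := by
    simp only [coordXL, orbitData, Matrix.of_apply, Matrix.cons_val]
    refine mul_left_cancel₀ hL ?_
    rw [b]
    field_simp
    ring
  refine ⟨ea, eb, ?_, ?_⟩
  · rw [ea] at a'
    simp only [coordXX, coordLX, orbitData, Matrix.of_apply, Matrix.cons_val] at a' ⊢
    field_simp at a' ⊢
    linear_combination 2 * a'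
  · rw [eb] at b'
    simp only [coordXL, coordLL, orbitData, Matrix.of_apply, Matrix.cons_val] at b' ⊢
    field_simp at b' ⊢
    linear_combination b'

/-- The condition on the indices excludes only the θθ entry of a radial geodesic, whose closed form
divides by L_z. -/
theorem bgo_coord (h0 : ℓ 0 1 ≠ 0) (hs : s ∈ J) (h1 : ℓ s 1 ≠ 0) {I : RadialIntegrals}
    (hI : IsRadialIntegrals A B C x ℓ J s I) {μ ν : Fin 4}
    (hμν : μ ≠ 2 ∨ ν ≠ 2 ∨ angMomZ C (x 0) (ℓ 0) ≠ 0) :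
    W.XX s μ ν = coordXX (orbitData A B C x ℓ s I) μ ν ∧
      W.XL s μ ν = coordXL (orbitData A B C x ℓ s I) μ ν ∧
      W.LX s μ ν = coordLX (orbitData A B C x ℓ s I) μ ν ∧
      W.LL s μ ν = coordLL (orbitData A B C x ℓ s I) μ ν := by
  have hd := H.isRegular h0 hs h1 I
  have hX : ∀ ν, (orbitData A B C x ℓ s I).IsPropagated (Pi.single ν 1) 0
      (fun μ => W.XX s μ ν) (fun μ => W.LX s μ ν) := fun ν => by
    have h := H.isPropagated h0 hs h1 hI (hW.deviation_X ν)
    have e1 : (fun μ => W.XX 0 μ ν) = Pi.single ν 1 := by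
      funext μ; simp [hW.XX_zero, Matrix.one_apply, Pi.single_apply]
    have e2 : (fun μ => W.LX 0 μ ν) = 0 := by funext μ; simp [hW.LX_zero]
    rwa [e1, e2] at h
  have hL : ∀ ν, (orbitData A B C x ℓ s I).IsPropagated 0 (Pi.single ν 1)
      (fun μ => W.XL s μ ν) (fun μ => W.LL s μ ν) := fun ν => by
    have h := H.isPropagated h0 hs h1 hI (hW.deviation_L ν)
    have e1 : (fun μ => W.LL 0 μ ν) = Pi.single ν 1 := by
      funext μ; simp [hW.LL_zero, Matrix.one_apply, Pi.single_apply]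
    have e2 : (fun μ => W.XL 0 μ ν) = 0 := by funext μ; simp [hW.XL_zero]
    rwa [e1, e2] at h
  by_cases hμ : μ = 2
  · subst hμ
    by_cases hν : ν = 2
    · subst hν
      exact H.bgo_theta hW (by simpa using hμν) hs I
    · obtain ⟨-, a, -, b, -, c, -, d⟩ := H.bgo_decouple hW hs hν
      rw [a, b, c, d]
      fin_cases ν <;> simp [coordXX, coordXL, coordLX, coordLL] at hν ⊢
  · fin_cases ν
    · have a := (hX 0).coord_X_t hd hμ
      have b := (hL 0).coord_L_t hd hμ
      exact ⟨a.1, b.1, a.2, b.2⟩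
    · have a := (hX 1).coord_X_r hd hμ
      have b := (hL 1).coord_L_r hd hμ
      exact ⟨a.1, b.1, a.2, b.2⟩
    · obtain ⟨a, -, b, -, c, -, d, -⟩ := H.bgo_decouple hW hs hμ
      simp only [Fin.reduceFinMk]
      rw [a, b, c, d]
      fin_cases μ <;> simp [coordXX, coordXL, coordLX, coordLL] at hμ ⊢
    · have a := (hX 3).coord_X_phi hd hμ
      have b := (hL 3).coord_L_phi hd hμ
      exact ⟨a.1, b.1, a.2, b.2⟩

end IsAlignedOrbit

/-! ### Killing vectors and the general solution of the geodesic deviation equation -/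

theorem metricInner_sssMetric (A B C : ℝ → ℝ) (y v w : Fin 4 → ℝ) :
    metricInner (sssMetric A B C) y v w = -A (y 1) * v 0 * w 0 + B (y 1) * v 1 * w 1
      + C (y 1) * v 2 * w 2 + C (y 1) * sin (y 2) ^ 2 * v 3 * w 3 := by
  simp [metricInner, sssMetric, Fin.sum_univ_four, Matrix.diagonal]

theorem hasDerivAt_line (y v : Fin 4 → ℝ) : HasDerivAt (fun τ : ℝ => fun i => y i + τ * v i) v 0 :=
  hasDerivAt_pi.2 (hasDerivAt_line_apply y v)

theorem fderiv_apply_eq_of_line {K : (Fin 4 → ℝ) → Fin 4 → ℝ} {y v d : Fin 4 → ℝ}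
    (hK : ∀ i, DifferentiableAt ℝ (fun y => K y i) y)
    (h : ∀ i, HasDerivAt (fun τ : ℝ => K (fun j => y j + τ * v j) i) (d i) 0) :
    fderiv ℝ K y v = d := by
  have hK' : DifferentiableAt ℝ K y := differentiableAt_pi.2 hK
  exact HasDerivAt.unique (hK'.hasFDerivAt.comp_hasDerivAt_of_eq (0 : ℝ) (hasDerivAt_line y v)
    (by simp)) (hasDerivAt_pi.2 h)

theorem fderiv_killingX {y : Fin 4 → ℝ} (h : sin (y 2) ≠ 0) (v : Fin 4 → ℝ) :
    fderiv ℝ killingX y v = ![0, 0, -cos (y 3) * v 3,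
      v 2 / sin (y 2) ^ 2 * cos (y 3) + cos (y 2) / sin (y 2) * (sin (y 3) * v 3)] := by
  have h2 := hasDerivAt_line_apply y v 2
  have h3 := hasDerivAt_line_apply y v 3
  refine fderiv_apply_eq_of_line (fun i => ?_) fun i => ?_
  · fin_cases i <;> simp only [killingX, Fin.zero_eta, Fin.mk_one, Fin.reduceFinMk,
      Matrix.cons_val] <;> fun_prop (disch := assumption)
  · fin_cases i <;> simp only [killingX, Fin.zero_eta, Fin.mk_one, Fin.reduceFinMk,
      Matrix.cons_val]
    · exact hasDerivAt_const _ _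
    · exact hasDerivAt_const _ _
    · refine h3.sin.fun_neg.congr_deriv ?_
      simp
    · refine (((h2.cos.fun_div h2.sin (by simpa using h)).fun_neg).fun_mul h3.cos).congr_deriv ?_
      have := sin_sq_add_cos_sq (y 2)
      simp only [zero_mul, add_zero]
      field_simp
      linear_combination v 2 * cos (y 3) * this

theorem fderiv_killingY {y : Fin 4 → ℝ} (h : sin (y 2) ≠ 0) (v : Fin 4 → ℝ) :
    fderiv ℝ killingY y v = ![0, 0, -sin (y 3) * v 3,
      v 2 / sin (y 2) ^ 2 * sin (y 3) - cos (y 2) / sin (y 2) * (cos (y 3) * v 3)] := by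
  have h2 := hasDerivAt_line_apply y v 2
  have h3 := hasDerivAt_line_apply y v 3
  refine fderiv_apply_eq_of_line (fun i => ?_) fun i => ?_
  · fin_cases i <;> simp only [killingY, Fin.zero_eta, Fin.mk_one, Fin.reduceFinMk,
      Matrix.cons_val] <;> fun_prop (disch := assumption)
  · fin_cases i <;> simp only [killingY, Fin.zero_eta, Fin.mk_one, Fin.reduceFinMk,
      Matrix.cons_val]
    · exact hasDerivAt_const _ _
    · exact hasDerivAt_const _ _
    · refine h3.cos.congr_deriv ?_
      simp
    · refine (((h2.cos.fun_div h2.sin (by simpa using h)).fun_neg).fun_mul h3.sin).congr_deriv ?_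
      have := sin_sq_add_cos_sq (y 2)
      simp only [zero_mul, add_zero]
      field_simp
      linear_combination v 2 * sin (y 3) * this

namespace IsAlignedOrbit

variable {A B C : ℝ → ℝ} {R J : Set ℝ} {x ℓ : ℝ → Fin 4 → ℝ} (H : IsAlignedOrbit A B C R J x ℓ)
  {s : ℝ}
include H

theorem metricInner_eq (hs : s ∈ J) (v w : Fin 4 → ℝ) :
    metricInner (sssMetric A B C) (x s) v w = -A (x s 1) * v 0 * w 0 + B (x s 1) * v 1 * w 1
      + C (x s 1) * v 2 * w 2 + C (x s 1) * v 3 * w 3 := by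
  rw [metricInner_sssMetric, H.theta_eq hs, sin_pi_div_two]
  ring

theorem metricInner_velocity (hs : s ∈ J) (v : Fin 4 → ℝ) :
    metricInner (sssMetric A B C) (x s) (ℓ s) v = energy A (x 0) (ℓ 0) * v 0
      + B (x s 1) * ℓ s 1 * v 1 + angMomZ C (x 0) (ℓ 0) * v 3 := by
  have hA := (H.posA hs).ne'
  have hC := (H.posC hs).ne'
  rw [H.metricInner_eq hs, H.velocity_t hs, H.velocity_phi hs, H.velocity_theta hs]
  field_simp
  ring

theorem sin_theta_ne_zero (hs : s ∈ J) : sin (x s 2) ≠ 0 := by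
  rw [H.theta_eq hs, sin_pi_div_two]
  exact one_ne_zero

/-- ∇_ℓ K is read off from Γ; the result is minus the variation of the conserved quantity g(K, ℓ),
here E. -/
theorem killingIntegral_T (hs : s ∈ J) (ξ η : ℝ → Fin 4 → ℝ) :
    killingIntegral (sssMetric A B C) x ℓ killingT ξ η s = A (x s 1) * η s 0
      - deriv A (x s 1) / 2 * (energy A (x 0) (ℓ 0) / A (x s 1) * ξ s 1 + ℓ s 1 * ξ s 0) := by
  have hA := (H.posA hs).ne'
  have hB := (H.posB hs).ne'
  have h : fderiv ℝ killingT (x s) (ℓ s) = 0 := by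
    rw [show killingT = fun _ => ![1, 0, 0, 0] from rfl, fderiv_fun_const]
    rfl
  rw [killingIntegral, covAlong, h, zero_add, H.metricInner_eq hs, H.metricInner_eq hs,
    H.gammaVec_eq hs]
  simp only [killingT, Matrix.cons_val, H.velocity_t hs]
  field_simp
  ring

theorem killingIntegral_Z (hs : s ∈ J) (ξ η : ℝ → Fin 4 → ℝ) :
    killingIntegral (sssMetric A B C) x ℓ killingZ ξ η s = -(C (x s 1) * η s 3
      + deriv C (x s 1) / 2 * (angMomZ C (x 0) (ℓ 0) / C (x s 1) * ξ s 1 - ℓ s 1 * ξ s 3)) := by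
  have hB := (H.posB hs).ne'
  have hC := (H.posC hs).ne'
  have h : fderiv ℝ killingZ (x s) (ℓ s) = 0 := by
    rw [show killingZ = fun _ => ![0, 0, 0, 1] from rfl, fderiv_fun_const]
    rfl
  rw [killingIntegral, covAlong, h, zero_add, H.metricInner_eq hs, H.metricInner_eq hs,
    H.gammaVec_eq hs]
  simp only [killingZ, Matrix.cons_val, H.velocity_phi hs]
  field_simp
  ring

/-- Only ξ^θ and ∇_ℓ ξ^θ survive at θ = π/2. With its companion for `killingY` it forms a rotated
pair, from which the θ component is recovered. -/
theorem killingIntegral_X (hs : s ∈ J) (ξ η : ℝ → Fin 4 → ℝ) :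
    killingIntegral (sssMetric A B C) x ℓ killingX ξ η s
      = -(angMomZ C (x 0) (ℓ 0) * cos (x s 3) * ξ s 2)
        + sin (x s 3) * (C (x s 1) * η s 2 - deriv C (x s 1) / 2 * ℓ s 1 * ξ s 2) := by
  have hC := (H.posC hs).ne'
  rw [killingIntegral, covAlong, fderiv_killingX (H.sin_theta_ne_zero hs), H.metricInner_eq hs,
    H.metricInner_eq hs, H.gammaVec_eq hs]
  simp only [killingX, Matrix.cons_val, H.velocity_phi hs, H.velocity_theta hs, H.theta_eq hs,
    cos_pi_div_two, Pi.add_apply]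
  field_simp
  ring

theorem killingIntegral_Y (hs : s ∈ J) (ξ η : ℝ → Fin 4 → ℝ) :
    killingIntegral (sssMetric A B C) x ℓ killingY ξ η s
      = -(angMomZ C (x 0) (ℓ 0) * sin (x s 3) * ξ s 2)
        - cos (x s 3) * (C (x s 1) * η s 2 - deriv C (x s 1) / 2 * ℓ s 1 * ξ s 2) := by
  have hC := (H.posC hs).ne'
  rw [killingIntegral, covAlong, fderiv_killingY (H.sin_theta_ne_zero hs), H.metricInner_eq hs,
    H.metricInner_eq hs, H.gammaVec_eq hs]
  simp only [killingY, Matrix.cons_val, H.velocity_phi hs, H.velocity_theta hs, H.theta_eq hs,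
    cos_pi_div_two, Pi.add_apply]
  field_simp
  ring

/-- The integration constants of a deviation are determined by its initial data. -/
theorem isExplicitDeviation (h0 : ℓ 0 1 ≠ 0) (hL : angMomZ C (x 0) (ℓ 0) ≠ 0)
    {ξ η : ℝ → Fin 4 → ℝ} (hD : IsDeviation (sssMetric A B C) x ℓ J ξ η) {k : DeviationConstants}
    (h₁ : k.κ₁ * angMomZ C (x 0) (ℓ 0)
      = C (x 0 1) * η 0 2 - deriv C (x 0 1) / 2 * ℓ 0 1 * ξ 0 2)
    (h₂ : k.κ₂ * ℓ 0 1 = ξ 0 1) (h₃ : k.κ₃ = ξ 0 0) (h₄ : k.κ₄ = ξ 0 3)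
    (hT : k.sT = A (x 0 1) * η 0 0 - deriv A (x 0 1) / 2
      * (energy A (x 0) (ℓ 0) / A (x 0 1) * ξ 0 1 + ℓ 0 1 * ξ 0 0))
    (hx : k.sx = -(angMomZ C (x 0) (ℓ 0) * ξ 0 2))
    (hz : k.sz = -(C (x 0 1) * η 0 3 + deriv C (x 0 1) / 2
      * (angMomZ C (x 0) (ℓ 0) / C (x 0 1) * ξ 0 1 - ℓ 0 1 * ξ 0 3)))
    (hb : k.b = energy A (x 0) (ℓ 0) * η 0 0 + B (x 0 1) * ℓ 0 1 * η 0 1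
      + angMomZ C (x 0) (ℓ 0) * η 0 3) :
    IsExplicitDeviation A B C x ℓ J ξ η k := by
  have hθ : ∀ s ∈ J, angMomZ C (x 0) (ℓ 0) * ξ s 2 = -k.sx * cos (x s 3)
        + k.κ₁ * angMomZ C (x 0) (ℓ 0) * sin (x s 3) ∧
      C (x s 1) * η s 2 - deriv C (x s 1) / 2 * ℓ s 1 * ξ s 2
        = k.κ₁ * angMomZ C (x 0) (ℓ 0) * cos (x s 3) + k.sx * sin (x s 3) := fun s hs => by
    have h := H.deviation_theta hD hs
    rw [← h₁] at h
    exact ⟨by rw [h.1, hx]; ring, by rw [h.2, hx]; ring⟩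
  have hξ : ∀ s ∈ J, ξ s 2
      = k.κ₁ * sin (x s 3) - k.sx / angMomZ C (x 0) (ℓ 0) * cos (x s 3) := fun s hs => by
    refine mul_left_cancel₀ hL ?_
    rw [(hθ s hs).1]
    field_simp
    ring
  refine ⟨fun s hs => ?_, fun s hs => ?_, fun s hs => ?_, fun s hs => ?_, fun s hs => ?_, hξ,
    fun s hs hsin => ?_, fun s hs h1 I hI => ?_⟩
  · have := H.deviation_energy_const hD hs
    rw [H.killingIntegral_T hs, hT]
    linear_combination -this
  · rw [H.killingIntegral_X hs]
    linear_combination -cos (x s 3) * (hθ s hs).1 + sin (x s 3) * (hθ s hs).2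
      + k.sx * sin_sq_add_cos_sq (x s 3)
  · rw [H.killingIntegral_Y hs]
    linear_combination -sin (x s 3) * (hθ s hs).1 - cos (x s 3) * (hθ s hs).2
      - k.κ₁ * angMomZ C (x 0) (ℓ 0) * sin_sq_add_cos_sq (x s 3)
  · have := H.deviation_angMomZ_const hD hs
    rw [H.killingIntegral_Z hs, hz]
    linear_combination -this
  · rw [H.metricInner_velocity hs, hb]
    exact H.deviation_normalization_const hD hs
  · have hC := (H.posC hs).ne'
    have h1 := hξ s hs
    have h2 := (hθ s hs).2
    have h3 := sin_sq_add_cos_sq (x s 3)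
    rw [H.velocity_phi hs]
    field_simp at h1 h2 ⊢
    -- κ₁ is eliminated between the formulas for ξ^θ and ∇_ℓ ξ^θ; this costs the division by sin φ,
    -- and sin² + cos² = 1 isolates Σ_x.
    linear_combination sin (x s 3) * h2 - 2 * cos (x s 3) * h1 + 2 * k.sx * h3
  · rw [h₃, h₄]
    exact H.isPropagated h0 hs h1 hI hD k.κ₂ k.sT k.sz k.b h₂ hT hz hb

theorem exists_isExplicitDeviation_of_isDeviation (h0 : ℓ 0 1 ≠ 0)
    (hL : angMomZ C (x 0) (ℓ 0) ≠ 0) {ξ η : ℝ → Fin 4 → ℝ}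
    (hD : IsDeviation (sssMetric A B C) x ℓ J ξ η) :
    ∃ k, IsExplicitDeviation A B C x ℓ J ξ η k :=
  -- The six omitted constants are read off from the defining equations closed by `rfl`.
  ⟨⟨(C (x 0 1) * η 0 2 - deriv C (x 0 1) / 2 * ℓ 0 1 * ξ 0 2) / angMomZ C (x 0) (ℓ 0),
    ξ 0 1 / ℓ 0 1, _, _, _, _, _, _⟩, H.isExplicitDeviation h0 hL hD (div_mul_cancel₀ _ hL)
      (div_mul_cancel₀ _ h0) rfl rfl rfl rfl rfl rfl⟩

/-- The constants depend on the eight initial values through a triangular linear system, solved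
explicitly; its pivots are A, C, L_z, ℓ^r and B ℓ^r at parameter 0. -/
theorem exists_isDeviation_isExplicitDeviation (h0 : ℓ 0 1 ≠ 0)
    (hL : angMomZ C (x 0) (ℓ 0) ≠ 0) (k : DeviationConstants) :
    ∃ ξ η, IsDeviation (sssMetric A B C) x ℓ J ξ η ∧ IsExplicitDeviation A B C x ℓ J ξ η k := by
  have hA := (H.posA H.zero_mem).ne'
  have hB := (H.posB H.zero_mem).ne'
  have hC := (H.posC H.zero_mem).ne'
  have hex := exists_isDeviation H.profile.isSmoothRegion H.geodesic H.chart H.isOpen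
    H.ordConnected H.zero_mem
  have hk := fun ξ η hD => H.isExplicitDeviation (ξ := ξ) (η := η) h0 hL hD (k := k)
  set a := A (x 0 1)
  set b := B (x 0 1)
  set c := C (x 0 1)
  set a' := deriv A (x 0 1)
  set c' := deriv C (x 0 1)
  set E := energy A (x 0) (ℓ 0)
  set L := angMomZ C (x 0) (ℓ 0)
  set r := ℓ 0 1
  let η0 := (k.sT + a' / 2 * (E / a * (k.κ₂ * r) + r * k.κ₃)) / a
  let η3 := (-k.sz - c' / 2 * (L / c * (k.κ₂ * r) - r * k.κ₄)) / c
  obtain ⟨ξ, η, hD, hξ, hη⟩ := hex ![k.κ₃, k.κ₂ * r, -k.sx / L, k.κ₄]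
    ![η0, (k.b - E * η0 - L * η3) / (b * r), (k.κ₁ * L + c' / 2 * r * (-k.sx / L)) / c, η3]
  refine ⟨ξ, η, hD, hk ξ η hD ?_ ?_ ?_ ?_ ?_ ?_ ?_ ?_⟩ <;>
    simp only [hξ, hη, Matrix.cons_val, η0, η3] <;> field_simp <;> ring

end IsAlignedOrbit

/-! ### Variation of the general solution of the geodesic equation -/

namespace IsAlignedOrbit

variable {A B C : ℝ → ℝ} {R J : Set ℝ} {x ℓ : ℝ → Fin 4 → ℝ} (H : IsAlignedOrbit A B C R J x ℓ)
  {s : ℝ} {U : Set (Phase × ℝ)} {Φ : Phase × ℝ → Phase}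
  (hΦ : IsGeneralSolution (sssMetric A B C) (sphericalChart R) x ℓ J U Φ)
include H hΦ

/-- The total variation of a general solution is a linearized geodesic plus a reparametrization. -/
theorem exists_isVariation_of_isGeneralSolution (δx δℓ : Fin 4 → ℝ) :
    ∃ ξ ζ : ℝ → Fin 4 → ℝ, IsVariation (sssMetric A B C) x ℓ J (fun s => (ξ s, ζ s)) ∧
      ξ 0 = δx ∧ ζ 0 = δℓ ∧ ∀ s ∈ J, ∀ δs : ℝ, fderiv ℝ Φ ((x 0, ℓ 0), s) ((δx, δℓ), δs)
        = (ξ s + δs • ℓ s, ζ s - δs • gammaVec (sssMetric A B C) (x s) (ℓ s) (ℓ s)) := by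
  have h0 := hΦ.fderiv_initial H.zero_mem (δx, δℓ)
  refine ⟨fun s => (fderiv ℝ Φ ((x 0, ℓ 0), s) ((δx, δℓ), 0)).1,
    fun s => (fderiv ℝ Φ ((x 0, ℓ 0), s) ((δx, δℓ), 0)).2,
    hΦ.isVariation H.profile.isSmoothRegion (δx, δℓ), by simp only [h0], by simp only [h0], fun s hs δs => ?_⟩
  have e : (((δx, δℓ), δs) : Phase × ℝ) = ((δx, δℓ), 0) + δs • (0, 1) := by simp
  rw [e, map_add, map_smul, hΦ.fderiv_time hs]
  simp [geodesicField, Prod.ext_iff, sub_eq_add_neg]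

/-- The variation δλ of the endpoint adds a multiple of the geodesic field, on which the derivative
of a first integral vanishes. -/
theorem variation_firstIntegral {F : (Fin 4 → ℝ) → (Fin 4 → ℝ) → ℝ}
    (hF : ContDiffOn ℝ ∞ (fun p : Phase => F p.1 p.2) (sphericalChart R ×ˢ univ))
    (h : ∀ y ∈ sphericalChart R, ∀ v,
      firstVariation F y v v (-gammaVec (sssMetric A B C) y v v) = 0) (hs : s ∈ J)
    (δx δℓ : Fin 4 → ℝ) (δs : ℝ) :
    firstVariation F (x s) (ℓ s) (fderiv ℝ Φ ((x 0, ℓ 0), s) ((δx, δℓ), δs)).1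
        (fderiv ℝ Φ ((x 0, ℓ 0), s) ((δx, δℓ), δs)).2
      = firstVariation F (x 0) (ℓ 0) δx δℓ := by
  obtain ⟨ξ, ζ, hY, rfl, rfl, hv⟩ := H.exists_isVariation_of_isGeneralSolution hΦ δx δℓ
  rw [hv s hs δs, ← H.firstVariation_const hF h hY hs]
  have e : ((ξ s + δs • ℓ s, ζ s - δs • gammaVec (sssMetric A B C) (x s) (ℓ s) (ℓ s)) : Phase)
      = (ξ s, ζ s) + δs • (ℓ s, -gammaVec (sssMetric A B C) (x s) (ℓ s) (ℓ s)) := by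
    simp [sub_eq_add_neg]
  have h2 := h (x s) (H.chart s hs) (ℓ s)
  rw [firstVariation] at h2
  simp only [firstVariation]
  rw [e, map_add, map_smul, h2, smul_zero, add_zero]

/-- Endpoint reparametrization adds ℓ δλ to the position; because ℓ is parallel, it adds nothing to
the covariant variation of the tangent. -/
theorem variation_eq_bgo {W : BilocalOperators} (hW : IsBGO (sssMetric A B C) x ℓ J W)
    (hs : s ∈ J) (δx δℓ : Fin 4 → ℝ) (δs : ℝ) :
    (fderiv ℝ Φ ((x 0, ℓ 0), s) ((δx, δℓ), δs)).1 = (W.XX s).mulVec δx + (W.XL s).mulVec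
        (δℓ + gammaVec (sssMetric A B C) (x 0) (ℓ 0) δx) + δs • ℓ s ∧
      (fderiv ℝ Φ ((x 0, ℓ 0), s) ((δx, δℓ), δs)).2 + gammaVec (sssMetric A B C) (x s) (ℓ s)
          (fderiv ℝ Φ ((x 0, ℓ 0), s) ((δx, δℓ), δs)).1
        = (W.LX s).mulVec δx + (W.LL s).mulVec
          (δℓ + gammaVec (sssMetric A B C) (x 0) (ℓ 0) δx) := by
  obtain ⟨ξ, ζ, hY, rfl, rfl, hv⟩ := H.exists_isVariation_of_isGeneralSolution hΦ δx δℓ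
  have hD : IsDeviation (sssMetric A B C) x ℓ J ξ
      fun s => ζ s + gammaVec (sssMetric A B C) (x s) (ℓ s) (ξ s) :=
    H.isDeviation_iff.2 (by simpa using hY)
  obtain ⟨h1, h2⟩ := hW.resolvent H.profile.isSmoothRegion H.geodesic H.chart H.isOpen
    H.ordConnected H.zero_mem hD hs
  rw [hv s hs δs, ← h1, ← h2, gammaVec_add_right, gammaVec_smul_right]
  exact ⟨rfl, by module⟩

theorem variation_theta_of_isGeneralSolution (hL : angMomZ C (x 0) (ℓ 0) ≠ 0) (hs : s ∈ J)
    (δx δℓ : Fin 4 → ℝ) (δs : ℝ) :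
    (fderiv ℝ Φ ((x 0, ℓ 0), s) ((δx, δℓ), δs)).1 2
        = cos (x s 3) * δx 2 + sin (x s 3) * (δℓ 2 / ℓ 0 3) ∧
      (fderiv ℝ Φ ((x 0, ℓ 0), s) ((δx, δℓ), δs)).2 2 = C (x 0 1) / C (x s 1)
        * (cos (x s 3) * δℓ 2 - sin (x s 3) * ℓ 0 3 * δx 2) := by
  obtain ⟨ξ, ζ, hY, rfl, rfl, hv⟩ := H.exists_isVariation_of_isGeneralSolution hΦ δx δℓ
  obtain ⟨h1, h2⟩ := H.variation_theta hY hs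
  have hC := (H.posC hs).ne'
  have hC0 := (H.posC H.zero_mem).ne'
  rw [hv s hs δs, H.gammaVec_eq hs, H.velocity_phi H.zero_mem]
  simp only [Pi.add_apply, Pi.sub_apply, Pi.smul_apply, Matrix.cons_val, H.velocity_theta hs,
    smul_eq_mul]
  constructor
  · refine mul_left_cancel₀ hL ?_
    field_simp
    linear_combination h1
  · field_simp
    linear_combination 2 * h2

/-- The total variation is ξ + ℓ δλ. Its radial part gives δλ; in t and φ the terms with δλ cancel,
since ξ^r/ℓ^r = δr/ℓ^r - δλ. The velocity variations are algebraic consequences of δE, δL_z and δε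
at the endpoint. -/
theorem variation_closed_form_of_isGeneralSolution (h0 : ℓ 0 1 ≠ 0) (hs : s ∈ J) (h1 : ℓ s 1 ≠ 0)
    {I : RadialIntegrals} (hI : IsRadialIntegrals A B C x ℓ J s I) (δx δℓ : Fin 4 → ℝ) (δs : ℝ)
    {Dx Dl : Fin 4 → ℝ} (hDv : fderiv ℝ Φ ((x 0, ℓ 0), s) ((δx, δℓ), δs) = (Dx, Dl))
    {E L ε δE δL δε : ℝ}
    (hE : energy A (x 0) (ℓ 0) = E) (hL : angMomZ C (x 0) (ℓ 0) = L)
    (hε : normalization A B C (x 0) (ℓ 0) = ε)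
    (he : firstVariation (energy A) (x 0) (ℓ 0) δx δℓ = δE)
    (hl : firstVariation (angMomZ C) (x 0) (ℓ 0) δx δℓ = δL)
    (hd : firstVariation (normalization A B C) (x 0) (ℓ 0) δx δℓ = δε) :
    δs = Dx 1 / ℓ s 1 - δx 1 / ℓ 0 1 + L * I.IBC * δL - E * I.IAB * δE - I.IB / 2 * δε ∧
    Dx 0 = δx 0 + E * (δx 1 / (A (x 0 1) * ℓ 0 1) - Dx 1 / (A (x s 1) * ℓ s 1))
      + I.IABC * L * (L * δE - E * δL) + I.IAB * (E / 2 * δε - ε * δE) ∧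
    Dx 3 = δx 3 + L * (Dx 1 / (C (x s 1) * ℓ s 1) - δx 1 / (C (x 0 1) * ℓ 0 1))
      + I.IABC * E * (E * δL - L * δE) + I.IBC * (ε * δL - L * δε / 2) ∧
    Dl 0 = -δE / A (x s 1) + E / A (x s 1) ^ 2 * deriv A (x s 1) * Dx 1 ∧
    Dl 3 = δL / C (x s 1) - L / C (x s 1) ^ 2 * deriv C (x s 1) * Dx 1 ∧
    Dl 1 = 1 / ℓ s 1 * (δε / (2 * B (x s 1)) + E * δE / (A (x s 1) * B (x s 1))
        - L * δL / (B (x s 1) * C (x s 1)))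
      - 1 / (2 * ℓ s 1) * (ε * deriv B (x s 1) / B (x s 1) ^ 2
          + E ^ 2 / (A (x s 1) * B (x s 1)) * (deriv A (x s 1) / A (x s 1)
            + deriv B (x s 1) / B (x s 1))
          - L ^ 2 / (B (x s 1) * C (x s 1)) * (deriv B (x s 1) / B (x s 1)
            + deriv C (x s 1) / C (x s 1))) * Dx 1 := by
  have hA := (H.posA hs).ne'
  have hB := (H.posB hs).ne'
  have hC := (H.posC hs).ne'
  have hA0 := (H.posA H.zero_mem).ne'
  have hC0 := (H.posC H.zero_mem).ne'
  have fE := H.variation_firstIntegral hΦ H.profile.contDiffOn_energy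
    (fun _ hy v => H.profile.firstVariation_energy_geodesic hy v) hs δx δℓ δs
  have fL := H.variation_firstIntegral hΦ H.profile.contDiffOn_angMomZ
    (fun _ hy v => H.profile.firstVariation_angMomZ_geodesic hy v) hs δx δℓ δs
  have fε := H.variation_firstIntegral hΦ H.profile.contDiffOn_normalization
    (fun _ hy v => H.profile.firstVariation_normalization_geodesic hy v) hs δx δℓ δs
  rw [hDv] at fE fL fε
  have v0 := H.variation_velocity_t hs Dx Dl
  have v3 := H.variation_velocity_phi hs Dx Dl
  have v1 := H.variation_velocity_r hs Dx Dl
  rw [fE, he, hE] at v0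
  rw [fL, hl, hL] at v3
  rw [fE, he, fL, hl, fε, hd, hE, hL, hε, radialAcc_eq H.profile _ _ _ (H.radius_mem hs)] at v1
  obtain ⟨ξ, ζ, hY, rfl, rfl, hv⟩ := H.exists_isVariation_of_isGeneralSolution hΦ δx δℓ
  obtain ⟨k1, k0, k3⟩ := H.variation_closed_form h0 hY hs h1 hI he hl hd hE hL hε
  rw [hv s hs δs, Prod.mk.injEq] at hDv
  have d0 : Dx 0 = ξ s 0 + δs * (-E / A (x s 1)) := by
    rw [← hDv.1, ← hE, ← H.velocity_t hs]; rfl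
  have d1 : Dx 1 = ξ s 1 + δs * ℓ s 1 := by rw [← hDv.1]; rfl
  have d3 : Dx 3 = ξ s 3 + δs * (L / C (x s 1)) := by
    rw [← hDv.1, ← hL, ← H.velocity_phi hs]; rfl
  refine ⟨?_, ?_, ?_, ?_, ?_, ?_⟩
  · rw [d1, k1]
    field_simp
    ring
  · rw [d0, d1, k0]
    field_simp
    ring
  · rw [d3, d1, k3]
    field_simp
    ring
  · rw [v0]
    ring
  · rw [v3]
    ring
  · refine mul_left_cancel₀ h1 ?_
    rw [mul_comm, eq_add_of_sub_eq v1]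
    field_simp
    ring

end IsAlignedOrbit

/-! ### Covariant derivatives along a curve -/

section CovariantDerivative

variable {g : (Fin 4 → ℝ) → Matrix (Fin 4) (Fin 4) ℝ} {x ℓ ξ ξ' : ℝ → Fin 4 → ℝ}
  {ζ ζ' : Fin 4 → ℝ} {s : ℝ}

theorem HasCovDerivAt.add (h : HasCovDerivAt g x ℓ ξ ζ s) (h' : HasCovDerivAt g x ℓ ξ' ζ' s) :
    HasCovDerivAt g x ℓ (fun s => ξ s + ξ' s) (ζ + ζ') s := by
  refine (HasDerivAt.fun_add h h').congr_deriv ?_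
  rw [gammaVec_add_right]
  abel

theorem HasCovDerivAt.smul {f : ℝ → ℝ} {f' : ℝ} (hf : HasDerivAt f f' s)
    (h : HasCovDerivAt g x ℓ ξ ζ s) :
    HasCovDerivAt g x ℓ (fun s => f s • ξ s) (f' • ξ s + f s • ζ) s := by
  refine (HasDerivAt.fun_smul hf h).congr_deriv ?_
  rw [gammaVec_smul_right]
  module

end CovariantDerivative

/-- All roots in the tetrad are expressed by D = √(ABC), so that D can be treated as one symbol. -/
theorem sqrt_mul_div_eq {a b c : ℝ} (ha : 0 < a) : √(b * c / a) = √(a * b * c) / a := by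
  rw [show b * c / a = a * b * c / a ^ 2 by field_simp, sqrt_div' _ (sq_nonneg a), sqrt_sq ha.le]

theorem sqrt_div_mul_eq {a b c : ℝ} (ha : 0 < a) (hb : 0 < b) :
    √(c / (a * b)) = √(a * b * c) / (a * b) := by
  have hab := mul_pos ha hb
  rw [show c / (a * b) = a * b * c / (a * b) ^ 2 by field_simp, sqrt_div' _ (sq_nonneg _),
    sqrt_sq hab.le]

namespace IsAlignedOrbit

variable {A B C : ℝ → ℝ} {R J : Set ℝ} {x ℓ : ℝ → Fin 4 → ℝ} (H : IsAlignedOrbit A B C R J x ℓ)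
  {s : ℝ}
include H

/-! ### The semi-null tetrad -/

theorem sntE2Tilde_eq (hs : s ∈ J) : sntE2Tilde A B C x ℓ s =
    ![√(A (x s 1) * B (x s 1) * C (x s 1)) * ℓ s 1 / (A (x s 1) * angMomZ C (x 0) (ℓ 0)),
      -(√(A (x s 1) * B (x s 1) * C (x s 1)) * energy A (x 0) (ℓ 0)
        / (A (x s 1) * B (x s 1) * angMomZ C (x 0) (ℓ 0))), 0, 0] := by
  have hA := H.posA hs
  have hB := H.posB hs
  simp only [sntE2Tilde]
  rw [sqrt_mul_div_eq hA, sqrt_div_mul_eq hA hB]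
  simp only [neg_mul, div_mul_div_comm]

theorem velocity_sq_of_null (hε : normalization A B C (x 0) (ℓ 0) = 0) (hs : s ∈ J) :
    ℓ s 1 ^ 2 = energy A (x 0) (ℓ 0) ^ 2 / (A (x s 1) * B (x s 1))
      - angMomZ C (x 0) (ℓ 0) ^ 2 / (B (x s 1) * C (x s 1)) := by
  rw [H.velocity_r_sq hs, hε, radialSq, zero_div, zero_add]

theorem sqrt_sq_mul (hs : s ∈ J) : √(A (x s 1) * B (x s 1) * C (x s 1)) ^ 2
    = A (x s 1) * B (x s 1) * C (x s 1) :=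
  sq_sqrt (mul_pos (mul_pos (H.posA hs) (H.posB hs)) (H.posC hs)).le

theorem sqrt_mul_pos (hs : s ∈ J) : 0 < √(A (x s 1) * B (x s 1) * C (x s 1)) :=
  sqrt_pos.2 (mul_pos (mul_pos (H.posA hs) (H.posB hs)) (H.posC hs))

theorem hasDerivAt_sqrt_mul (hs : s ∈ J) :
    HasDerivAt (fun s => √(A (x s 1) * B (x s 1) * C (x s 1)))
      (√(A (x s 1) * B (x s 1) * C (x s 1)) / 2 * (deriv A (x s 1) / A (x s 1)
        + deriv B (x s 1) / B (x s 1) + deriv C (x s 1) / C (x s 1)) * ℓ s 1) s := by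
  have hA := H.posA hs
  have hB := H.posB hs
  have hC := H.posC hs
  refine ((((H.hasDerivAt_radial H.profile.smoothA hs).fun_mul
    (H.hasDerivAt_radial H.profile.smoothB hs)).fun_mul
    (H.hasDerivAt_radial H.profile.smoothC hs)).sqrt
      (mul_pos (mul_pos hA hB) hC).ne').congr_deriv ?_
  have h := H.sqrt_sq_mul hs
  have h' := (H.sqrt_mul_pos hs).ne'
  have hA' := hA.ne'
  have hB' := hB.ne'
  have hC' := hC.ne'
  generalize √(A (x s 1) * B (x s 1) * C (x s 1)) = D at h h' ⊢
  rw [div_eq_iff (mul_ne_zero two_ne_zero h')]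
  field_simp
  linear_combination -((deriv A (x s 1) * B (x s 1) * C (x s 1)
    + A (x s 1) * deriv B (x s 1) * C (x s 1) + A (x s 1) * B (x s 1) * deriv C (x s 1)) * ℓ s 1) * h

theorem hasDerivAt_sntPsi (Q : ℝ) (hs : s ∈ J) : HasDerivAt (sntPsi A B C x ℓ Q)
    (-(deriv C (x s 1) / (2 * √(A (x s 1) * B (x s 1) * C (x s 1)))
      * (energy A (x 0) (ℓ 0) / angMomZ C (x 0) (ℓ 0)) * Q)) s := by
  have hc : ContinuousOn (fun s => -(deriv C (x s 1) / (2 * √(A (x s 1) * B (x s 1) * C (x s 1)))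
      * (energy A (x 0) (ℓ 0) / angMomZ C (x 0) (ℓ 0)) * Q)) J := by
    refine ((ContinuousOn.div ?_ ?_ ?_).mul continuousOn_const |>.mul continuousOn_const).neg
    · exact H.continuousOn_radial
        (contDiffOn_deriv_of_contDiffOn H.profile.isOpen H.profile.smoothC)
    · exact continuousOn_const.mul fun t ht =>
        (H.hasDerivAt_sqrt_mul ht).continuousAt.continuousWithinAt
    · exact fun t ht => mul_ne_zero two_ne_zero (H.sqrt_mul_pos ht).ne'
  exact intervalIntegral.integral_hasDerivAt_right
    ((hc.mono (H.uIcc_subset hs)).intervalIntegrable)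
    (hc.stronglyMeasurableAtFilter H.isOpen s hs) (hc.continuousAt (H.isOpen.mem_nhds hs))

theorem hasCovDerivAt_sntE1 (hs : s ∈ J) :
    HasCovDerivAt (sssMetric A B C) x ℓ (sntE1 C x) 0 s := by
  have hC := H.posC hs
  have h := (sqrt_pos.2 hC).ne'
  have hq := sq_sqrt hC.le
  have hC' := hC.ne'
  refine hasDerivAt_pi.2 fun i => ?_
  rw [H.gammaVec_eq hs]
  simp only [sntE1]
  fin_cases i <;> simp only [Fin.zero_eta, Fin.mk_one, Fin.reduceFinMk, Matrix.cons_val,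
    Pi.sub_apply, Pi.zero_apply]
  · exact (hasDerivAt_const _ _).congr_deriv (by ring)
  · exact (hasDerivAt_const _ _).congr_deriv (by rw [H.velocity_theta hs]; ring)
  · refine ((hasDerivAt_const s (1 : ℝ)).fun_div
      ((H.hasDerivAt_radial H.profile.smoothC hs).sqrt hC') h).congr_deriv ?_
    rw [hq]
    field_simp
    ring
  · exact (hasDerivAt_const _ _).congr_deriv (by ring)

/-- The intermediate vector fails to be parallel only by a multiple of ℓ. This multiple and the one
for `sntUTilde` are matched, so that one null rotation repairs both vectors. -/
theorem hasCovDerivAt_sntE2Tilde (hL : angMomZ C (x 0) (ℓ 0) ≠ 0)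
    (hε : normalization A B C (x 0) (ℓ 0) = 0) (hs : s ∈ J) :
    HasCovDerivAt (sssMetric A B C) x ℓ (sntE2Tilde A B C x ℓ)
      ((-(deriv C (x s 1) / (2 * √(A (x s 1) * B (x s 1) * C (x s 1)))
        * (energy A (x 0) (ℓ 0) / angMomZ C (x 0) (ℓ 0)))) • ℓ s) s := by
  have hA := (H.posA hs).ne'
  have hB := (H.posB hs).ne'
  have hC := (H.posC hs).ne'
  have hD := (H.sqrt_mul_pos hs).ne'
  have hD2 := H.sqrt_sq_mul hs
  have hr := H.velocity_sq_of_null hε hs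
  have dD := H.hasDerivAt_sqrt_mul hs
  have dA := H.hasDerivAt_radial H.profile.smoothA hs
  have dB := H.hasDerivAt_radial H.profile.smoothB hs
  have dr := H.hasDerivAt_velocity_r hs
  rw [radialAcc_eq H.profile _ _ _ (H.radius_mem hs), hε] at dr
  -- 1/D becomes D/(ABC), so that both sides of each component are linear in D.
  have hk : deriv C (x s 1) / (2 * √(A (x s 1) * B (x s 1) * C (x s 1)))
      = deriv C (x s 1) * √(A (x s 1) * B (x s 1) * C (x s 1))
        / (2 * (A (x s 1) * B (x s 1) * C (x s 1))) := by
    field_simp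
    rw [hD2]
    ring
  rw [hk]
  refine HasDerivAt.congr_of_eventuallyEq (f := fun s =>
    ![√(A (x s 1) * B (x s 1) * C (x s 1)) * ℓ s 1 / (A (x s 1) * angMomZ C (x 0) (ℓ 0)),
      -(√(A (x s 1) * B (x s 1) * C (x s 1)) * energy A (x 0) (ℓ 0)
        / (A (x s 1) * B (x s 1) * angMomZ C (x 0) (ℓ 0))), 0, 0]) ?_
    (by filter_upwards [H.isOpen.mem_nhds hs] with t ht using H.sntE2Tilde_eq ht)
  refine hasDerivAt_pi.2 fun i => ?_
  rw [H.gammaVec_eq hs, H.sntE2Tilde_eq hs]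
  fin_cases i <;> simp only [Fin.zero_eta, Fin.mk_one, Fin.reduceFinMk, Matrix.cons_val,
    Pi.sub_apply, Pi.smul_apply, smul_eq_mul]
  · refine ((dD.fun_mul dr).fun_div (dA.mul_const _) (mul_ne_zero hA hL)).congr_deriv ?_
    rw [H.velocity_t hs]
    -- The identity is now linear in D and holds for any value of it; only the null relation for
    -- (ℓ^r)² is still needed.
    generalize √(A (x s 1) * B (x s 1) * C (x s 1)) = D
    linear_combination (norm := skip) D / (2 * A (x s 1) * angMomZ C (x 0) (ℓ 0))
      * (deriv B (x s 1) / B (x s 1) + deriv C (x s 1) / C (x s 1)) * hr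
    field_simp
    ring
  · refine ((dD.mul_const _).fun_div ((dA.fun_mul dB).mul_const _)
      (mul_ne_zero (mul_ne_zero hA hB) hL)).fun_neg.congr_deriv ?_
    rw [H.velocity_t hs]
    generalize √(A (x s 1) * B (x s 1) * C (x s 1)) = D
    field_simp
    ring
  · exact (hasDerivAt_const _ _).congr_deriv (by rw [H.velocity_theta hs]; ring)
  · refine (hasDerivAt_const _ _).congr_deriv ?_
    rw [H.velocity_phi hs]
    field_simp
    ring

theorem hasCovDerivAt_sntUTilde (hL : angMomZ C (x 0) (ℓ 0) ≠ 0)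
    (hε : normalization A B C (x 0) (ℓ 0) = 0) {Q : ℝ} (hQ : Q ≠ 0) (hs : s ∈ J) :
    HasCovDerivAt (sssMetric A B C) x ℓ (sntUTilde A C x ℓ Q)
      ((deriv C (x s 1) / (2 * √(A (x s 1) * B (x s 1) * C (x s 1)))
        * (energy A (x 0) (ℓ 0) / angMomZ C (x 0) (ℓ 0)) * Q) • sntE2Tilde A B C x ℓ s) s := by
  have hA := (H.posA hs).ne'
  have hB := (H.posB hs).ne'
  have hC := (H.posC hs).ne'
  have hD := (H.sqrt_mul_pos hs).ne'
  have hr := H.velocity_sq_of_null hε hs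
  have dA := H.hasDerivAt_radial H.profile.smoothA hs
  have dC := H.hasDerivAt_radial H.profile.smoothC hs
  have dr := H.hasDerivAt_velocity_r hs
  rw [radialAcc_eq H.profile _ _ _ (H.radius_mem hs), hε] at dr
  refine hasDerivAt_pi.2 fun i => ?_
  rw [H.gammaVec_eq hs, H.sntE2Tilde_eq hs]
  simp only [sntUTilde]
  fin_cases i <;> simp only [Fin.zero_eta, Fin.mk_one, Fin.reduceFinMk, Matrix.cons_val,
    Pi.sub_apply, Pi.smul_apply, smul_eq_mul]
  · refine (((hasDerivAt_const s (energy A (x 0) (ℓ 0))).fun_div (((dA.const_mul 2).mul_const _).mul_const _)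
      (mul_ne_zero (mul_ne_zero (mul_ne_zero two_ne_zero hA) (pow_ne_zero 2 hL)) hQ)).fun_mul
      ((dC.mul_const (Q ^ 2)).const_add _)).congr_deriv ?_
    rw [H.velocity_t hs]
    generalize √(A (x s 1) * B (x s 1) * C (x s 1)) = D at hD ⊢
    field_simp
    ring
  · refine (((dr.div_const _).fun_neg).fun_mul
      ((dC.mul_const (Q ^ 2)).const_add _)).congr_deriv ?_
    rw [H.velocity_t hs, H.velocity_phi hs]
    generalize √(A (x s 1) * B (x s 1) * C (x s 1)) = D at hD ⊢
    linear_combination (norm := skip) (-(deriv C (x s 1) * Q / (2 * angMomZ C (x 0) (ℓ 0) ^ 2))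
      - deriv B (x s 1) / (2 * B (x s 1)) * (angMomZ C (x 0) (ℓ 0) ^ 2 + C (x s 1) * Q ^ 2)
        / (2 * angMomZ C (x 0) (ℓ 0) ^ 2 * Q)) * hr
    field_simp
    ring
  · exact (hasDerivAt_const _ _).congr_deriv (by rw [H.velocity_theta hs]; ring)
  · refine (((hasDerivAt_const s _).fun_div ((dC.const_mul 2).mul_const Q)
      (mul_ne_zero (mul_ne_zero two_ne_zero hC) hQ)).const_sub _).congr_deriv ?_
    rw [H.velocity_phi hs]
    field_simp
    ring

theorem hasCovDerivAt_velocity (hs : s ∈ J) : HasCovDerivAt (sssMetric A B C) x ℓ ℓ 0 s :=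
  H.geodesic.parallel s hs

/-- Null rotation about ℓ by the angle Ψ. With ∇ẽ₂ = -kℓ and ∇ũ = kQẽ₂, the choice Ψ' = -kQ cancels
both the ẽ₂ term and the ℓ terms in ∇u, and the ℓ term in ∇e₂. -/
theorem hasCovDerivAt_sntVector (hL : angMomZ C (x 0) (ℓ 0) ≠ 0)
    (hε : normalization A B C (x 0) (ℓ 0) = 0) {Q : ℝ} (hQ : Q ≠ 0) (hs : s ∈ J) (a : Fin 4) :
    HasCovDerivAt (sssMetric A B C) x ℓ (fun σ => sntVector A B C x ℓ Q σ a) 0 s := by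
  have dP := H.hasDerivAt_sntPsi Q hs
  have d2 := H.hasCovDerivAt_sntE2Tilde hL hε hs
  have du := H.hasCovDerivAt_sntUTilde hL hε hQ hs
  have dl := H.hasCovDerivAt_velocity hs
  set k := deriv C (x s 1) / (2 * √(A (x s 1) * B (x s 1) * C (x s 1)))
        * (energy A (x 0) (ℓ 0) / angMomZ C (x 0) (ℓ 0))
  fin_cases a
  · have h := ((du.add (d2.smul dP)).add (dl.smul ((dP.fun_pow 2).div_const (2 * Q)).fun_neg))
    simp only [neg_smul, ← sub_eq_add_neg] at h
    refine HasDerivAt.congr_deriv h ?_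
    congr 1
    funext i
    simp only [Pi.add_apply, Pi.sub_apply, Pi.smul_apply, Pi.neg_apply, Pi.zero_apply, smul_eq_mul]
    field_simp
    simp
    ring
  · exact H.hasCovDerivAt_sntE1 hs
  · have h := d2.add (dl.smul (dP.div_const Q).fun_neg)
    simp only [neg_smul, ← sub_eq_add_neg] at h
    refine HasDerivAt.congr_deriv h ?_
    congr 1
    funext i
    simp only [Pi.add_apply, Pi.sub_apply, Pi.smul_apply, Pi.neg_apply, Pi.zero_apply, smul_eq_mul]
    field_simp
    ring
  · exact dl

end IsAlignedOrbit

/-! ### Gram matrix of the semi-null tetrad -/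

section MetricInner

variable (g : (Fin 4 → ℝ) → Matrix (Fin 4) (Fin 4) ℝ) (y v v' w : Fin 4 → ℝ) (c : ℝ)

theorem metricInner_eq_dotProduct : metricInner g y v w = v ⬝ᵥ (g y).mulVec w := by
  simp only [metricInner, dotProduct, Matrix.mulVec, Finset.mul_sum]
  exact Finset.sum_congr rfl fun _ _ => Finset.sum_congr rfl fun _ _ => by ring

theorem metricInner_add_left :
    metricInner g y (v + v') w = metricInner g y v w + metricInner g y v' w := by
  simp only [metricInner_eq_dotProduct, add_dotProduct]

theorem metricInner_sub_left :
    metricInner g y (v - v') w = metricInner g y v w - metricInner g y v' w := by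
  simp only [metricInner_eq_dotProduct, sub_dotProduct]

theorem metricInner_smul_left : metricInner g y (c • v) w = c * metricInner g y v w := by
  simp only [metricInner_eq_dotProduct, smul_dotProduct, smul_eq_mul]

theorem metricInner_smul_right : metricInner g y v (c • w) = c * metricInner g y v w := by
  simp only [metricInner_eq_dotProduct, Matrix.mulVec_smul, dotProduct_smul, smul_eq_mul]

end MetricInner

theorem metricInner_sssMetric_comm (A B C : ℝ → ℝ) (y v w : Fin 4 → ℝ) :
    metricInner (sssMetric A B C) y v w = metricInner (sssMetric A B C) y w v := by
  rw [metricInner_sssMetric, metricInner_sssMetric]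
  ring

/-- Gram matrix of a semi-null tetrad. -/
noncomputable def semiNullGram (Q : ℝ) : Matrix (Fin 4) (Fin 4) ℝ :=
  !![-1, 0, 0, Q; 0, 1, 0, 0; 0, 0, 1, 0; Q, 0, 0, 0]

noncomputable def semiNullGramInv (Q : ℝ) : Matrix (Fin 4) (Fin 4) ℝ :=
  !![0, 0, 0, 1 / Q; 0, 1, 0, 0; 0, 0, 1, 0; 1 / Q, 0, 0, 1 / Q ^ 2]

theorem semiNullGramInv_mul {Q : ℝ} (hQ : Q ≠ 0) : semiNullGramInv Q * semiNullGram Q = 1 := by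
  ext i j
  fin_cases i <;> fin_cases j <;>
    simp [semiNullGram, semiNullGramInv, Matrix.mul_apply, Fin.sum_univ_four, hQ]
  field_simp
  ring

namespace IsAlignedOrbit

variable {A B C : ℝ → ℝ} {R J : Set ℝ} {x ℓ : ℝ → Fin 4 → ℝ} (H : IsAlignedOrbit A B C R J x ℓ)
  {s : ℝ}
include H

theorem metricInner_sntE1 (hs : s ∈ J) (v : Fin 4 → ℝ) :
    metricInner (sssMetric A B C) (x s) (sntE1 C x s) v = √(C (x s 1)) * v 2 := by
  have hC := H.posC hs
  have h := (sqrt_pos.2 hC).ne'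
  have hq := sq_sqrt hC.le
  rw [H.metricInner_eq hs]
  simp only [sntE1, Matrix.cons_val]
  field_simp
  rw [hq]
  ring

theorem metricInner_sntE2Tilde (hL : angMomZ C (x 0) (ℓ 0) ≠ 0) (hs : s ∈ J) (v : Fin 4 → ℝ) :
    metricInner (sssMetric A B C) (x s) (sntE2Tilde A B C x ℓ s) v =
      -(√(A (x s 1) * B (x s 1) * C (x s 1)) / angMomZ C (x 0) (ℓ 0)
        * (ℓ s 1 * v 0 + energy A (x 0) (ℓ 0) / A (x s 1) * v 1)) := by
  have hA := (H.posA hs).ne'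
  have hB := (H.posB hs).ne'
  rw [H.metricInner_eq hs, H.sntE2Tilde_eq hs]
  generalize √(A (x s 1) * B (x s 1) * C (x s 1)) = D
  simp only [Matrix.cons_val]
  field_simp
  ring

theorem metricInner_sntUTilde (hL : angMomZ C (x 0) (ℓ 0) ≠ 0) {Q : ℝ} (hQ : Q ≠ 0) (hs : s ∈ J)
    (v : Fin 4 → ℝ) :
    metricInner (sssMetric A B C) (x s) (sntUTilde A C x ℓ Q s) v =
      -((angMomZ C (x 0) (ℓ 0) ^ 2 + C (x s 1) * Q ^ 2) / (2 * angMomZ C (x 0) (ℓ 0) ^ 2 * Q)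
          * (energy A (x 0) (ℓ 0) * v 0 + B (x s 1) * ℓ s 1 * v 1))
        + (C (x s 1) * Q / (2 * angMomZ C (x 0) (ℓ 0)) - angMomZ C (x 0) (ℓ 0) / (2 * Q))
          * v 3 := by
  have hA := (H.posA hs).ne'
  have hC := (H.posC hs).ne'
  rw [H.metricInner_eq hs]
  simp only [sntUTilde, Matrix.cons_val]
  field_simp
  ring

/-- The products of the intermediate tetrad are computed directly; the null condition is used for
ũ·ℓ, ẽ₂·ẽ₂ and ũ·ũ. The null rotation preserves the Gram matrix by bilinearity. -/
theorem metricInner_sntVector (hL : angMomZ C (x 0) (ℓ 0) ≠ 0)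
    (hε : normalization A B C (x 0) (ℓ 0) = 0) {Q : ℝ} (hQ : Q ≠ 0) (hs : s ∈ J) (a b : Fin 4) :
    metricInner (sssMetric A B C) (x s) (sntVector A B C x ℓ Q s a) (sntVector A B C x ℓ Q s b)
      = semiNullGram Q a b := by
  have hA := (H.posA hs).ne'
  have hB := (H.posB hs).ne'
  have hC := (H.posC hs).ne'
  have hr := H.velocity_sq_of_null hε hs
  have hD2 := H.sqrt_sq_mul hs
  have hll : metricInner (sssMetric A B C) (x s) (ℓ s) (ℓ s) = 0 := by
    rw [← hε]; exact H.normalization_const hs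
  have hl2 : metricInner (sssMetric A B C) (x s) (ℓ s) (sntE2Tilde A B C x ℓ s) = 0 := by
    rw [H.metricInner_velocity hs, H.sntE2Tilde_eq hs]
    generalize √(A (x s 1) * B (x s 1) * C (x s 1)) = D
    simp only [Matrix.cons_val]
    field_simp
    ring
  have hlu : metricInner (sssMetric A B C) (x s) (ℓ s) (sntUTilde A C x ℓ Q s) = Q := by
    rw [H.metricInner_velocity hs]
    simp only [sntUTilde, Matrix.cons_val]
    linear_combination (norm := skip) -B (x s 1) * ((angMomZ C (x 0) (ℓ 0) ^ 2 + C (x s 1) * Q ^ 2)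
      / (2 * angMomZ C (x 0) (ℓ 0) ^ 2 * Q)) * hr
    field_simp
    ring
  have h22 : metricInner (sssMetric A B C) (x s) (sntE2Tilde A B C x ℓ s)
      (sntE2Tilde A B C x ℓ s) = 1 := by
    rw [H.metricInner_sntE2Tilde hL hs, H.sntE2Tilde_eq hs]
    generalize √(A (x s 1) * B (x s 1) * C (x s 1)) = D at hD2 ⊢
    simp only [Matrix.cons_val]
    linear_combination (norm := skip) -(D ^ 2 / (angMomZ C (x 0) (ℓ 0) ^ 2 * A (x s 1))) * hr
      + 1 / (A (x s 1) * B (x s 1) * C (x s 1)) * hD2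
    field_simp
    ring
  have h2u : metricInner (sssMetric A B C) (x s) (sntE2Tilde A B C x ℓ s)
      (sntUTilde A C x ℓ Q s) = 0 := by
    rw [H.metricInner_sntE2Tilde hL hs]
    simp only [sntUTilde, Matrix.cons_val]
    field_simp
    ring
  have huu : metricInner (sssMetric A B C) (x s) (sntUTilde A C x ℓ Q s)
      (sntUTilde A C x ℓ Q s) = -1 := by
    rw [H.metricInner_sntUTilde hL hQ hs]
    simp only [sntUTilde, Matrix.cons_val]
    linear_combination (norm := skip) B (x s 1) * ((angMomZ C (x 0) (ℓ 0) ^ 2 + C (x s 1) * Q ^ 2)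
      / (2 * angMomZ C (x 0) (ℓ 0) ^ 2 * Q)) ^ 2 * hr
    field_simp
    ring
  have h1 := fun v => H.metricInner_sntE1 hs v
  have hsq := mul_self_sqrt (H.posC hs).le
  have hsq0 := (sqrt_pos.2 (H.posC hs)).ne'
  have h11 : metricInner (sssMetric A B C) (x s) (sntE1 C x s) (sntE1 C x s) = 1 := by
    rw [h1]
    simp only [sntE1, Matrix.cons_val]
    field_simp
  have h12 : metricInner (sssMetric A B C) (x s) (sntE1 C x s) (sntE2Tilde A B C x ℓ s) = 0 := by
    rw [h1]; simp [sntE2Tilde]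
  have h1u : metricInner (sssMetric A B C) (x s) (sntE1 C x s) (sntUTilde A C x ℓ Q s) = 0 := by
    rw [h1]; simp [sntUTilde]
  have h1l : metricInner (sssMetric A B C) (x s) (sntE1 C x s) (ℓ s) = 0 := by
    rw [h1, H.velocity_theta hs, mul_zero]
  have comm := metricInner_sssMetric_comm A B C (x s)
  have h2l := (comm _ _).trans hl2
  have hul := (comm _ _).trans hlu
  have hu2 := (comm _ _).trans h2u
  have h21 := (comm _ _).trans h12
  have hu1 := (comm _ _).trans h1u
  have hl1 := (comm _ _).trans h1l
  have addr : ∀ u v w, metricInner (sssMetric A B C) (x s) u (v + w)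
      = metricInner (sssMetric A B C) (x s) u v + metricInner (sssMetric A B C) (x s) u w :=
    fun u v w => by rw [comm, metricInner_add_left, comm v, comm w]
  have subr : ∀ u v w, metricInner (sssMetric A B C) (x s) u (v - w)
      = metricInner (sssMetric A B C) (x s) u v - metricInner (sssMetric A B C) (x s) u w :=
    fun u v w => by rw [comm, metricInner_sub_left, comm v, comm w]
  fin_cases a <;> fin_cases b <;>
    simp only [sntVector, semiNullGram, Fin.zero_eta, Fin.mk_one, Fin.reduceFinMk, Matrix.cons_val,
      Matrix.of_apply, metricInner_add_left, metricInner_sub_left, metricInner_smul_left,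
      metricInner_smul_right, addr, subr, hll, hl2, hlu, h22, h2u, huu, h11, h12, h1u, h1l, h2l,
      hul, hu2, h21, hu1, hl1] <;> field_simp <;> ring

theorem sntFrame_gram (hL : angMomZ C (x 0) (ℓ 0) ≠ 0)
    (hε : normalization A B C (x 0) (ℓ 0) = 0) {Q : ℝ} (hQ : Q ≠ 0) (hs : s ∈ J) :
    (sntFrame A B C x ℓ Q s).transpose * sssMetric A B C (x s) * sntFrame A B C x ℓ Q s
      = semiNullGram Q := by
  ext a b
  rw [← H.metricInner_sntVector hL hε hQ hs a b, metricInner_eq_dotProduct, Matrix.mul_assoc]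
  rfl

/-- The Gram matrix gives the inverse of the frame without a 4 × 4 inversion, so tetrad components
become inner products with the tetrad vectors. -/
theorem sntFrame_left_inv (hL : angMomZ C (x 0) (ℓ 0) ≠ 0)
    (hε : normalization A B C (x 0) (ℓ 0) = 0) {Q : ℝ} (hQ : Q ≠ 0) (hs : s ∈ J) :
    semiNullGramInv Q * ((sntFrame A B C x ℓ Q s).transpose * sssMetric A B C (x s))
      * sntFrame A B C x ℓ Q s = 1 := by
  rw [Matrix.mul_assoc, H.sntFrame_gram hL hε hQ hs, semiNullGramInv_mul hQ]

theorem isUnit_det_sntFrame (hL : angMomZ C (x 0) (ℓ 0) ≠ 0)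
    (hε : normalization A B C (x 0) (ℓ 0) = 0) {Q : ℝ} (hQ : Q ≠ 0) (hs : s ∈ J) :
    IsUnit (sntFrame A B C x ℓ Q s).det :=
  Matrix.isUnit_det_of_left_inverse (H.sntFrame_left_inv hL hε hQ hs)

/-- Tetrad components of a bilocal operator by contraction with the tetrad vectors. -/
theorem sntComponents_eq (hL : angMomZ C (x 0) (ℓ 0) ≠ 0)
    (hε : normalization A B C (x 0) (ℓ 0) = 0) {Q : ℝ} (hQ : Q ≠ 0) (hs : s ∈ J)
    (M : ℝ → Matrix (Fin 4) (Fin 4) ℝ) (a b : Fin 4) :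
    sntComponents A B C x ℓ Q M s a b = ∑ c, semiNullGramInv Q a c
      * metricInner (sssMetric A B C) (x s) (sntVector A B C x ℓ Q s c)
        ((M s).mulVec (sntVector A B C x ℓ Q 0 b)) := by
  rw [sntComponents, Matrix.inv_eq_left_inv (H.sntFrame_left_inv hL hε hQ hs), Matrix.mul_assoc,
    Matrix.mul_assoc, Matrix.mul_apply]
  refine Finset.sum_congr rfl fun c _ => ?_
  rw [metricInner_eq_dotProduct, Matrix.mul_assoc]
  rfl

/-- u^t is quadratic in Ψ with leading coefficient E/(2AQ); completing the square leaves a sum of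
squares with positive remainder. -/
theorem sntVector_t_pos (hL : angMomZ C (x 0) (ℓ 0) ≠ 0)
    (hε : normalization A B C (x 0) (ℓ 0) = 0) {Q : ℝ} (hQ : 0 < Q)
    (hE : 0 < energy A (x 0) (ℓ 0)) (hs : s ∈ J) : 0 < sntVector A B C x ℓ Q s 0 0 := by
  have hA := H.posA hs
  have hB := (H.posB hs).ne'
  have hC := (H.posC hs).ne'
  have hr := H.velocity_sq_of_null hε hs
  have hD2 := H.sqrt_sq_mul hs
  have hA' := hA.ne'
  have hQ' := hQ.ne'
  have hE' := hE.ne'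
  have key : sntVector A B C x ℓ Q s 0 0 = ((energy A (x 0) (ℓ 0) * sntPsi A B C x ℓ Q s
      + Q * √(A (x s 1) * B (x s 1) * C (x s 1)) * ℓ s 1 / angMomZ C (x 0) (ℓ 0)) ^ 2
      + energy A (x 0) (ℓ 0) ^ 2 + A (x s 1) * Q ^ 2)
        / (2 * A (x s 1) * Q * energy A (x 0) (ℓ 0)) := by
    simp only [sntVector, Matrix.cons_val, Pi.add_apply, Pi.sub_apply, Pi.smul_apply, smul_eq_mul,
      H.sntE2Tilde_eq hs, sntUTilde, H.velocity_t hs]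
    generalize √(A (x s 1) * B (x s 1) * C (x s 1)) = D at hD2 ⊢
    generalize energy A (x 0) (ℓ 0) = E at hE' hr ⊢
    generalize angMomZ C (x 0) (ℓ 0) = L at hL hr ⊢
    linear_combination (norm := skip) -(Q * D ^ 2 / (2 * A (x s 1) * E * L ^ 2)) * hr
      - Q / (2 * A (x s 1) * E * L ^ 2) * (E ^ 2 / (A (x s 1) * B (x s 1))
        - L ^ 2 / (B (x s 1) * C (x s 1))) * hD2
    field_simp
    ring
  rw [key]
  positivity

end IsAlignedOrbit

/-! ### Contractions of null deviations with the tetrad -/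

namespace OrbitData

/-- Inner product with the second transverse vector, where `D = √(ABC)`. -/
noncomputable def contractE2 (d : OrbitData) (D : ℝ) (v : Fin 4 → ℝ) : ℝ :=
  -(D / d.L * (d.lr * v 0 + d.E / d.A * v 1))

/-- Inner product with the four-velocity of the intermediate tetrad. -/
noncomputable def contractU (d : OrbitData) (Q : ℝ) (v : Fin 4 → ℝ) : ℝ :=
  -((d.L ^ 2 + d.C * Q ^ 2) / (2 * d.L ^ 2 * Q) * (d.E * v 0 + d.B * d.lr * v 1))
    + (d.C * Q / (2 * d.L) - d.L / (2 * Q)) * v 3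

/-- The orbit is null, with `D = √(ABC)` at its ends. -/
structure IsNull (d : OrbitData) (D D₀ : ℝ) : Prop extends d.IsRegular where
  null : d.ε = 0
  angMom_ne_zero : d.L ≠ 0
  ne_zero : D ≠ 0
  ne_zero₀ : D₀ ≠ 0
  sq_eq : D ^ 2 = d.A * d.B * d.C
  sq_eq₀ : D₀ ^ 2 = d.A₀ * d.B₀ * d.C₀
  lr_sq : d.lr ^ 2 = d.E ^ 2 / (d.A * d.B) - d.L ^ 2 / (d.B * d.C)
  lr₀_sq : d.lr₀ ^ 2 = d.E ^ 2 / (d.A₀ * d.B₀) - d.L ^ 2 / (d.B₀ * d.C₀)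
  parameter_eq : d.s = d.E ^ 2 * d.IAB - d.L ^ 2 * d.IBC

variable {d : OrbitData} {D D₀ Q : ℝ} {ξ₀ η₀ ξ η : Fin 4 → ℝ}

/-- The deviation, in its components tangential to the plane, is split as qℓ + p∂_t + r∂_φ with q =
ξ^r/ℓ^r. Since ẽ₂ is orthogonal to ℓ and to ∂_φ, its contraction sees only p; ũ contributes Qq
because ũ·ℓ = Q. In p and r all terms with 1/A and 1/C cancel. The parameters p, q, r are left to
the caller, who can supply simplified values. -/
theorem IsPropagated.contract (h : d.IsPropagated ξ₀ η₀ ξ η) (hd : d.IsNull D D₀) (hQ : Q ≠ 0)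
    {κ sT sz b p q r : ℝ} (hκ : κ * d.lr₀ = ξ₀ 1)
    (hT : sT = d.A₀ * η₀ 0 - d.dA₀ / 2 * (d.E / d.A₀ * ξ₀ 1 + d.lr₀ * ξ₀ 0))
    (hz : sz = -(d.C₀ * η₀ 3 + d.dC₀ / 2 * (d.L / d.C₀ * ξ₀ 1 - d.lr₀ * ξ₀ 3)))
    (hb : b = d.E * η₀ 0 + d.B₀ * d.lr₀ * η₀ 1 + d.L * η₀ 3)
    (hp : ξ₀ 0 + κ * d.E / d.A₀ + d.L * d.IABC * (sz * d.E - sT * d.L) + d.E * b * d.IAB = p)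
    (hq : κ - d.E * sT * d.IAB + d.L * sz * d.IBC + b * d.IB = q)
    (hr : ξ₀ 3 - κ * d.L / d.C₀ + d.E * d.IABC * (sT * d.L - sz * d.E) - d.L * b * d.IBC = r) :
    d.contractE2 D ξ = -(D * d.lr / d.L * p) ∧
    d.contractU Q ξ = Q * q - (d.L ^ 2 + d.C * Q ^ 2) / (2 * d.L ^ 2 * Q) * d.E * p
      + (d.C * Q / (2 * d.L) - d.L / (2 * Q)) * r ∧
    d.contractE2 D η = (d.L * (d.dA * d.lr / 2 * p + sT) - d.C * d.E * b / d.L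
      + d.E * (d.dC * d.lr / 2 * r - sz)) / (D * d.lr) ∧
    d.contractU Q η = -((d.L ^ 2 + d.C * Q ^ 2) / (2 * d.L ^ 2 * Q) * b)
      + Q / d.L * (d.dC * d.lr / 2 * r - sz) := by
  obtain ⟨k1, l1, k0, l0, k3, l3⟩ := h κ sT sz b hκ hT hz hb
  obtain ⟨⟨hA, hB, hC, hlr, hA0, hB0, hC0, hlr0⟩, hε, hL, hD, hD0, hD2, -, hr2, -, -⟩ := hd
  rw [hε] at k0 l0 k3 l3
  have k1' : ξ 1 = d.lr * q := by rw [k1, ← hq]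
  have k0' : ξ 0 = p - d.E / d.A * q := by rw [k0, ← hq, ← hp]; field_simp; ring
  have k3' : ξ 3 = r + d.L / d.C * q := by rw [k3, ← hq, ← hr]; field_simp; ring
  have l0' : η 0 = (d.dA * d.lr / 2 * p + sT) / d.A := by rw [l0, ← hp]; field_simp; ring
  have l3' : η 3 = (d.dC * d.lr / 2 * r - sz) / d.C := by rw [l3, ← hr]; field_simp; ring
  clear k0 k1 k3 l0 l3 hp hq hr
  simp only [contractE2, contractU, k1', k0', k3', l1, l0', l3']
  generalize d.dA * d.lr / 2 * p + sT = P
  generalize d.dC * d.lr / 2 * r - sz = S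
  refine ⟨?_, ?_, ?_, ?_⟩
  · field_simp
    ring
  · linear_combination (norm := skip) -((d.L ^ 2 + d.C * Q ^ 2) / (2 * d.L ^ 2 * Q)) * d.B * q * hr2
    field_simp
    ring
  · linear_combination (norm := skip) -(D / (d.L * d.lr) * P / d.A) * hr2
      + (d.L * P - d.C * d.E * b / d.L + d.E * S) / (D * d.lr * (d.A * d.B * d.C)) * hD2
    field_simp
    ring
  · field_simp
    ring

/-- A deviation that starts along the second transverse vector. -/
theorem IsPropagated.contract_X_e2 (h : d.IsPropagated
      ![d.B₀ * d.C₀ * d.lr₀ / (D₀ * d.L), -(d.C₀ * d.E / (D₀ * d.L)), 0, 0] 0 ξ η)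
    (hd : d.IsNull D D₀) (hQ : Q ≠ 0) :
    d.contractE2 D ξ = D / D₀ * (d.lr / d.lr₀
      + d.lr / 2 * (d.L ^ 2 * d.dA₀ - d.E ^ 2 * d.dC₀) * d.IABC) ∧
    d.contractU Q ξ / Q = d.E / (2 * d.L * D₀) * (d.C * d.IABC * (d.L ^ 2 * d.dA₀
        - d.E ^ 2 * d.dC₀) + d.L ^ 2 * (d.dC₀ * d.IBC - d.dA₀ * d.IAB) + 2 * (d.C
        - d.C₀) / d.lr₀) ∧
    d.contractE2 D η = 1 / (2 * D * D₀) * ((d.E ^ 2 * d.dC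
      - d.L ^ 2 * d.dA) / d.lr₀ - (d.E ^ 2 * d.dC₀ - d.L ^ 2 * d.dA₀) / d.lr
      - d.IABC / 2 * (d.E ^ 2 * d.dC - d.L ^ 2 * d.dA) * (d.E ^ 2 * d.dC₀ - d.L ^ 2 * d.dA₀)) ∧
    d.contractU Q η / Q = d.E / (4 * d.L) * d.dC * d.lr / D₀ * (d.L ^ 2 * d.dA₀
        - d.E ^ 2 * d.dC₀) * d.IABC + d.E / (2 * d.L * d.lr₀) * (d.dC * d.lr
        - d.dC₀ * d.lr₀) / D₀ := by
  have hd' := hd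
  obtain ⟨⟨hA, hB, hC, hlr, hA0, hB0, hC0, hlr0⟩, hε, hL, hD, hD0, -, -, -, hr0, -⟩ := hd
  -- b = 0 because the derivative starts at zero. In Σ_T and p the null relation for ℓ^r_O has
  -- collapsed the terms with E² and (ℓ^r_O)² to a term with L².
  obtain ⟨c1, c2, c3, c4⟩ := h.contract hd' hQ (κ := -(d.C₀ * d.E / (D₀ * d.L * d.lr₀)))
    (sT := d.dA₀ * d.L / (2 * D₀)) (sz := d.dC₀ * d.E / (2 * D₀)) (b := 0)
    (p := -(d.L / D₀ * (1 / d.lr₀ + d.IABC / 2 * (d.L ^ 2 * d.dA₀ - d.E ^ 2 * d.dC₀))))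
    (q := -(d.C₀ * d.E / (D₀ * d.L * d.lr₀)) + d.E * d.L / (2 * D₀)
      * (d.dC₀ * d.IBC - d.dA₀ * d.IAB))
    (r := d.E / D₀ * (1 / d.lr₀ + d.IABC / 2 * (d.L ^ 2 * d.dA₀ - d.E ^ 2 * d.dC₀)))
    (by simp only [Matrix.cons_val]; field_simp)
    (by
      simp only [Matrix.cons_val, Pi.zero_apply]
      linear_combination (norm := skip) d.dA₀ / 2 * (d.B₀ * d.C₀) / (D₀ * d.L) * hr0
      field_simp
      ring)
    (by
      simp only [Matrix.cons_val, Pi.zero_apply]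
      field_simp
      ring)
    (by simp)
    (by
      simp only [Matrix.cons_val]
      linear_combination (norm := skip) (d.B₀ * d.C₀) / (D₀ * d.L * d.lr₀) * hr0
      field_simp
      ring)
    (by ring)
    (by
      simp only [Matrix.cons_val]
      field_simp
      ring)
  refine ⟨?_, ?_, ?_, ?_⟩
  · rw [c1]
    field_simp
  · rw [c2]
    field_simp
    ring
  · rw [c3]
    field_simp
    ring
  · rw [c4]
    field_simp
    ring

/-- A deviation that starts along the four-velocity. -/
theorem IsPropagated.contract_X_u (h : d.IsPropagated
      ![d.E / (2 * d.A₀ * d.L ^ 2 * Q) * (d.L ^ 2 + d.C₀ * Q ^ 2),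
        -(d.lr₀ / (2 * d.L ^ 2 * Q)) * (d.L ^ 2 + d.C₀ * Q ^ 2), 0,
        Q / (2 * d.L) - d.L / (2 * d.C₀ * Q)] 0 ξ η)
    (hd : d.IsNull D D₀) (hQ : Q ≠ 0) :
    d.contractE2 D ξ = -D * d.dC₀ * d.lr₀ * d.lr * d.E * Q / (2 * d.L) * d.IABC ∧
    d.contractU Q ξ / Q + 1 / Q = Q / (2 * d.L ^ 2) * (d.C - d.C₀ + d.dC₀ * d.lr₀
      * (d.IBC * d.L ^ 2 - d.E ^ 2 * d.IABC * d.C)) ∧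
    d.contractE2 D η = d.E * Q / (4 * d.L) * d.dC₀ * d.lr₀ / D * (d.L ^ 2 * d.dA
      - d.E ^ 2 * d.dC) * d.IABC + d.E * Q / (2 * d.L * d.lr) * (d.dC * d.lr
      - d.dC₀ * d.lr₀) / D ∧
    d.contractU Q η / Q = Q / (2 * d.L ^ 2) * (d.dC * d.lr - d.dC₀ * d.lr₀)
      - d.IABC * d.dC * d.lr * d.dC₀ * d.lr₀ * d.E ^ 2 * Q / (4 * d.L ^ 2) := by
  have hd' := hd
  obtain ⟨⟨hA, hB, hC, hlr, hA0, hB0, hC0, hlr0⟩, hε, hL, hD, hD0, -, -, -, hr0, -⟩ := hd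
  obtain ⟨c1, c2, c3, c4⟩ := h.contract hd' hQ
    (κ := -((d.L ^ 2 + d.C₀ * Q ^ 2) / (2 * d.L ^ 2 * Q)))
    (sT := 0) (sz := d.dC₀ * d.lr₀ * Q / (2 * d.L)) (b := 0)
    (p := d.E * d.IABC * d.dC₀ * d.lr₀ * Q / 2)
    (q := -((d.L ^ 2 + d.C₀ * Q ^ 2) / (2 * d.L ^ 2 * Q)) + d.IBC * d.dC₀ * d.lr₀ * Q / 2)
    (r := Q / d.L * (1 - d.E ^ 2 * d.IABC * d.dC₀ * d.lr₀ / 2))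
    (by simp only [Matrix.cons_val]; field_simp)
    (by
      simp only [Matrix.cons_val, Pi.zero_apply]
      field_simp
      ring)
    (by
      simp only [Matrix.cons_val, Pi.zero_apply]
      field_simp
      ring)
    (by simp)
    (by
      simp only [Matrix.cons_val]
      field_simp
      ring)
    (by
      field_simp
      ring)
    (by
      simp only [Matrix.cons_val]
      field_simp
      ring)
  refine ⟨?_, ?_, ?_, ?_⟩
  · rw [c1]
    field_simp
  · rw [c2]
    field_simp
    ring
  · rw [c3]
    field_simp
    ring
  · rw [c4]
    field_simp
    ring

/-- A deviation whose derivative starts along the second transverse vector. -/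
theorem IsPropagated.contract_L_e2 (h : d.IsPropagated 0
      ![D₀ * d.lr₀ / (d.A₀ * d.L), -(D₀ * d.E / (d.A₀ * d.B₀ * d.L)), 0, 0] ξ η)
    (hd : d.IsNull D D₀) (hQ : Q ≠ 0) :
    d.contractE2 D ξ = D * D₀ * d.lr * d.lr₀ * d.IABC ∧
    d.contractU Q ξ / Q = d.E / d.L * d.lr₀ * D₀ * (d.C * d.IABC - d.IAB) ∧
    d.contractE2 D η = D₀ / D * (d.lr₀ / d.lr
      + d.lr₀ / 2 * (d.E ^ 2 * d.dC - d.L ^ 2 * d.dA) * d.IABC) ∧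
    d.contractU Q η / Q = D₀ * d.dC * d.lr * d.lr₀ * d.E / (2 * d.L) * d.IABC := by
  have hd' := hd
  obtain ⟨⟨hA, hB, hC, hlr, hA0, hB0, hC0, hlr0⟩, hε, hL, hD, hD0, -, -, -, hr0, -⟩ := hd
  obtain ⟨c1, c2, c3, c4⟩ := h.contract hd' hQ (κ := 0)
    (sT := D₀ * d.lr₀ / d.L) (sz := 0) (b := 0)
    (p := -(d.L * d.IABC * D₀ * d.lr₀))
    (q := -(d.E * d.IAB * D₀ * d.lr₀ / d.L))
    (r := d.E * d.IABC * D₀ * d.lr₀)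
    (by simp)
    (by
      simp only [Matrix.cons_val, Pi.zero_apply]
      field_simp
      ring)
    (by simp)
    (by
      simp only [Matrix.cons_val]
      field_simp
      ring)
    (by
      simp only [Pi.zero_apply]
      field_simp
      ring)
    (by
      field_simp
      ring)
    (by
      simp only [Pi.zero_apply]
      field_simp
      ring)
  refine ⟨?_, ?_, ?_, ?_⟩
  · rw [c1]
    field_simp
  · rw [c2]
    field_simp
    ring
  · rw [c3]
    field_simp
    ring
  · rw [c4]
    field_simp
    ring

/-- A deviation whose derivative starts along the four-velocity. -/
theorem IsPropagated.contract_L_u (h : d.IsPropagated 0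
      ![d.E / (2 * d.A₀ * d.L ^ 2 * Q) * (d.L ^ 2 + d.C₀ * Q ^ 2),
        -(d.lr₀ / (2 * d.L ^ 2 * Q)) * (d.L ^ 2 + d.C₀ * Q ^ 2), 0,
        Q / (2 * d.L) - d.L / (2 * d.C₀ * Q)] ξ η)
    (hd : d.IsNull D D₀) (hQ : Q ≠ 0) :
    d.contractE2 D ξ = d.E * Q / d.L * d.lr * D * (d.C₀ * d.IABC - d.IAB) ∧
    d.contractU Q ξ / Q + d.s / Q = Q / d.L ^ 2 * (d.E ^ 2 * (d.C * d.C₀ * d.IABC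
      - (d.C + d.C₀) / 2 * d.IAB) + d.L ^ 2 * (d.IB - (d.C + d.C₀) / 2 * d.IBC)) ∧
    d.contractE2 D η = Q * d.E / (2 * d.L * D) * (d.C₀ * d.IABC * (d.E ^ 2 * d.dC
      - d.L ^ 2 * d.dA) + d.L ^ 2 * (d.dA * d.IAB - d.dC * d.IBC) + 2 * (d.C₀ - d.C) / d.lr) ∧
    d.contractU Q η / Q + 1 / Q = Q / (2 * d.L ^ 2) * (d.C₀ - d.C + d.dC * d.lr
      * (d.C₀ * d.E ^ 2 * d.IABC - d.L ^ 2 * d.IBC)) := by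
  have hd' := hd
  obtain ⟨⟨hA, hB, hC, hlr, hA0, hB0, hC0, hlr0⟩, hε, hL, hD, hD0, -, -, -, hr0, hs⟩ := hd
  -- κ = 0 because the deviation starts at zero, and b = Q is the product of ℓ with the
  -- four-velocity.
  obtain ⟨c1, c2, c3, c4⟩ := h.contract hd' hQ (κ := 0)
    (sT := d.E * (d.L ^ 2 + d.C₀ * Q ^ 2) / (2 * d.L ^ 2 * Q))
    (sz := d.L / (2 * Q) - d.C₀ * Q / (2 * d.L)) (b := Q)
    (p := d.E * Q * (d.IAB - d.C₀ * d.IABC))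
    (q := Q * d.IB - d.E ^ 2 * (d.L ^ 2 + d.C₀ * Q ^ 2) / (2 * d.L ^ 2 * Q) * d.IAB
      + d.L * (d.L / (2 * Q) - d.C₀ * Q / (2 * d.L)) * d.IBC)
    (r := d.E ^ 2 * d.IABC * d.C₀ * Q / d.L - d.L * Q * d.IBC)
    (by simp)
    (by
      simp only [Matrix.cons_val, Pi.zero_apply]
      field_simp
      ring)
    (by
      simp only [Matrix.cons_val, Pi.zero_apply]
      field_simp
      ring)
    (by
      simp only [Matrix.cons_val]
      linear_combination (norm := skip) (d.B₀ * (d.L ^ 2 + d.C₀ * Q ^ 2) / (2 * d.L ^ 2 * Q)) * hr0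
      field_simp
      ring)
    (by
      simp only [Pi.zero_apply]
      field_simp
      ring)
    (by
      field_simp
      ring)
    (by
      simp only [Pi.zero_apply]
      field_simp
      ring)
  refine ⟨?_, ?_, ?_, ?_⟩
  · rw [c1]
    field_simp
    ring
  -- The affine parameter is replaced by its quadratures; this removes the terms proportional to
  -- 1/Q.
  · rw [c2, hs]
    field_simp
    ring
  · rw [c3]
    field_simp
    ring
  · rw [c4]
    field_simp
    ring

end OrbitData

namespace IsAlignedOrbit

variable {A B C : ℝ → ℝ} {R J : Set ℝ} {x ℓ : ℝ → Fin 4 → ℝ} (H : IsAlignedOrbit A B C R J x ℓ)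
  {s : ℝ}
include H

/-! ### Trivial solutions of the geodesic deviation equation -/

/-- Shift of the parameter: the four terms of `tidalVec_eq` cancel in pairs when ξ = ℓ. -/
theorem isDeviation_velocity : IsDeviation (sssMetric A B C) x ℓ J ℓ 0 := by
  refine ⟨fun s hs => H.geodesic.parallel s hs, fun s _ => ?_⟩
  have h : tidalVec (sssMetric A B C) (x s) (ℓ s) (ℓ s) = 0 := by
    rw [tidalVec_eq]
    abel
  rw [h]
  simp only [HasCovDerivAt, Pi.zero_apply, gammaVec_zero_right, sub_zero]
  exact hasDerivAt_const s 0

/-- Rescaling of the affine parameter; together with ℓ itself it gives the last tetrad column of all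
four operators. -/
theorem isDeviation_smul_velocity :
    IsDeviation (sssMetric A B C) x ℓ J (fun s => s • ℓ s) ℓ := by
  refine ⟨fun s hs => ?_, fun s hs => ?_⟩
  · simpa using HasCovDerivAt.smul (hasDerivAt_id s) (H.geodesic.parallel s hs)
  · have h : tidalVec (sssMetric A B C) (x s) (ℓ s) (s • ℓ s) = 0 := by
      have hd : ∀ v w : Fin 4 → ℝ, dGammaVec (sssMetric A B C) (x s) (s • v) w w
          = s • dGammaVec (sssMetric A B C) (x s) v w w := fun v w => by
        funext μ
        simp only [dGammaVec, map_smul, Pi.smul_apply, smul_eq_mul, Finset.mul_sum]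
        exact Finset.sum_congr rfl fun α _ => Finset.sum_congr rfl fun β _ => by ring
      have hd' : ∀ v w : Fin 4 → ℝ, dGammaVec (sssMetric A B C) (x s) w w (s • v)
          = s • dGammaVec (sssMetric A B C) (x s) w w v := fun v w => by
        funext μ
        simp only [dGammaVec, Pi.smul_apply, smul_eq_mul, Finset.mul_sum]
        exact Finset.sum_congr rfl fun α _ => Finset.sum_congr rfl fun β _ => by ring
      rw [tidalVec_eq, hd, hd', gammaVec_smul_right, gammaVec_smul_right,
        H.profile.isSmoothRegion.gammaVec_comm (H.chart s hs) (s • ℓ s), gammaVec_smul_right,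
        H.profile.isSmoothRegion.gammaVec_comm (H.chart s hs)
          (gammaVec (sssMetric A B C) (x s) (ℓ s) (ℓ s)) (ℓ s)]
      abel
    rw [h]
    exact H.geodesic.parallel s hs

/-- The component of a deviation along the tangent is affine in the parameter. -/
theorem metricInner_velocity_deviation {ξ η : ℝ → Fin 4 → ℝ}
    (hD : IsDeviation (sssMetric A B C) x ℓ J ξ η) (hs : s ∈ J) :
    metricInner (sssMetric A B C) (x s) (ℓ s) (ξ s)
        = metricInner (sssMetric A B C) (x 0) (ℓ 0) (ξ 0)
          + s * metricInner (sssMetric A B C) (x 0) (ℓ 0) (η 0) ∧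
      metricInner (sssMetric A B C) (x s) (ℓ s) (η s)
        = metricInner (sssMetric A B C) (x 0) (ℓ 0) (η 0) := by
  have hη : ∀ s ∈ J, metricInner (sssMetric A B C) (x s) (ℓ s) (η s)
        = metricInner (sssMetric A B C) (x 0) (ℓ 0) (η 0) := fun s hs => by
    rw [H.metricInner_velocity hs, H.metricInner_velocity H.zero_mem]
    exact H.deviation_normalization_const hD hs
  refine ⟨?_, hη s hs⟩
  -- Metric compatibility by hand: the derivative of g(ℓ, ξ) is g(ℓ, ∇_ℓ ξ), which is a first
  -- integral. Subtracting the linear term leaves a constant.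
  have hder : ∀ t ∈ J, HasDerivAt (fun t => energy A (x 0) (ℓ 0) * ξ t 0
      + B (x t 1) * ℓ t 1 * ξ t 1 + angMomZ C (x 0) (ℓ 0) * ξ t 3
      - t * metricInner (sssMetric A B C) (x 0) (ℓ 0) (η 0)) 0 t := fun t ht => by
    have hA := (H.posA ht).ne'
    have hB := (H.posB ht).ne'
    have hC := (H.posC ht).ne'
    have hξ := hasDerivAt_pi.1 (hD.first t ht)
    have dB := H.hasDerivAt_radial H.profile.smoothB ht
    have dr := H.hasDerivAt_velocity_r ht
    refine (((((hξ 0).const_mul _).fun_add ((dB.fun_mul dr).fun_mul (hξ 1))).fun_add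
      ((hξ 3).const_mul _)).fun_sub ((hasDerivAt_id t).mul_const _)).congr_deriv ?_
    rw [← hη t ht, H.metricInner_velocity ht, H.gammaVec_eq ht,
      radialAcc_eq H.profile _ _ _ (H.radius_mem ht)]
    have hr := H.velocity_r_sq ht
    rw [radialSq] at hr
    simp only [Pi.sub_apply, Matrix.cons_val, H.velocity_t ht, H.velocity_phi ht,
      H.velocity_theta ht]
    linear_combination (norm := skip) deriv B (x t 1) * ξ t 1 / 2 * hr
    field_simp
    ring
  have hconst := H.isOpen.is_const_of_deriv_eq_zero H.ordConnected.isPreconnected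
    (fun t ht => (hder t ht).differentiableAt.differentiableWithinAt)
    (fun t ht => (hder t ht).deriv) hs H.zero_mem
  rw [H.metricInner_velocity hs, H.metricInner_velocity H.zero_mem (ξ 0)]
  linear_combination hconst

variable {W : BilocalOperators} (hW : IsBGO (sssMetric A B C) x ℓ J W)
include hW

theorem bgo_mulVec {ξ η : ℝ → Fin 4 → ℝ} (hD : IsDeviation (sssMetric A B C) x ℓ J ξ η)
    (hs : s ∈ J) : ξ s = (W.XX s).mulVec (ξ 0) + (W.XL s).mulVec (η 0) ∧
      η s = (W.LX s).mulVec (ξ 0) + (W.LL s).mulVec (η 0) :=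
  hW.resolvent H.profile.isSmoothRegion H.geodesic H.chart H.isOpen H.ordConnected H.zero_mem hD hs

theorem exists_isDeviation_X (v : Fin 4 → ℝ) : ∃ ξ η, IsDeviation (sssMetric A B C) x ℓ J ξ η ∧
    ξ 0 = v ∧ η 0 = 0 ∧ ∀ s ∈ J, ξ s = (W.XX s).mulVec v ∧ η s = (W.LX s).mulVec v := by
  obtain ⟨ξ, η, hD, h0, h0'⟩ := exists_isDeviation H.profile.isSmoothRegion H.geodesic H.chart
    H.isOpen H.ordConnected H.zero_mem v 0
  refine ⟨ξ, η, hD, h0, h0', fun s hs => ?_⟩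
  simpa [h0, h0'] using H.bgo_mulVec hW hD hs

theorem exists_isDeviation_L (v : Fin 4 → ℝ) : ∃ ξ η, IsDeviation (sssMetric A B C) x ℓ J ξ η ∧
    ξ 0 = 0 ∧ η 0 = v ∧ ∀ s ∈ J, ξ s = (W.XL s).mulVec v ∧ η s = (W.LL s).mulVec v := by
  obtain ⟨ξ, η, hD, h0, h0'⟩ := exists_isDeviation H.profile.isSmoothRegion H.geodesic H.chart
    H.isOpen H.ordConnected H.zero_mem 0 v
  refine ⟨ξ, η, hD, h0, h0', fun s hs => ?_⟩
  simpa [h0, h0'] using H.bgo_mulVec hW hD hs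

theorem bgo_mulVec_velocity (hs : s ∈ J) :
    (W.XX s).mulVec (ℓ 0) = ℓ s ∧ (W.XL s).mulVec (ℓ 0) = s • ℓ s ∧
      (W.LX s).mulVec (ℓ 0) = 0 ∧ (W.LL s).mulVec (ℓ 0) = ℓ s := by
  have h1 := H.bgo_mulVec hW H.isDeviation_velocity hs
  have h2 := H.bgo_mulVec hW H.isDeviation_smul_velocity hs
  simp only [Pi.zero_apply, Matrix.mulVec_zero, add_zero, zero_smul, zero_add] at h1 h2
  exact ⟨h1.1.symm, h2.1.symm, h1.2.symm, h2.2.symm⟩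

theorem metricInner_velocity_bgo (hs : s ∈ J) (v : Fin 4 → ℝ) :
    metricInner (sssMetric A B C) (x s) (ℓ s) ((W.XX s).mulVec v)
        = 1 * metricInner (sssMetric A B C) (x 0) (ℓ 0) v ∧
      metricInner (sssMetric A B C) (x s) (ℓ s) ((W.XL s).mulVec v)
        = s * metricInner (sssMetric A B C) (x 0) (ℓ 0) v ∧
      metricInner (sssMetric A B C) (x s) (ℓ s) ((W.LX s).mulVec v)
        = 0 * metricInner (sssMetric A B C) (x 0) (ℓ 0) v ∧
      metricInner (sssMetric A B C) (x s) (ℓ s) ((W.LL s).mulVec v)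
        = 1 * metricInner (sssMetric A B C) (x 0) (ℓ 0) v := by
  obtain ⟨ξ, η, hD, h0, h0', h⟩ := H.exists_isDeviation_X hW v
  obtain ⟨ξ', η', hD', k0, k0', k⟩ := H.exists_isDeviation_L hW v
  have hz : metricInner (sssMetric A B C) (x 0) (ℓ 0) 0 = 0 := by simp [metricInner]
  have a := H.metricInner_velocity_deviation hD hs
  have b := H.metricInner_velocity_deviation hD' hs
  rw [(h s hs).1, (h s hs).2, h0, h0', hz] at a
  rw [(k s hs).1, (k s hs).2, k0, k0', hz] at b
  refine ⟨by rw [a.1]; ring, by rw [b.1]; ring, by rw [a.2]; ring, by rw [b.2]; ring⟩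

omit hW

/-! ### Components in the semi-null tetrad -/

theorem sntVector_zero (Q : ℝ) : sntVector A B C x ℓ Q 0
    = ![sntUTilde A C x ℓ Q 0, sntE1 C x 0, sntE2Tilde A B C x ℓ 0, ℓ 0] := by
  have := H.zero_mem
  simp [sntVector, sntPsi]

section Components

variable (hL : angMomZ C (x 0) (ℓ 0) ≠ 0) (hε : normalization A B C (x 0) (ℓ 0) = 0) {Q : ℝ}
  (hQ : Q ≠ 0) (hs : s ∈ J) (M : ℝ → Matrix (Fin 4) (Fin 4) ℝ)
include hL hε hQ hs

/-- The rows are the dual covectors obtained from the inverse Gram matrix: ℓ/Q, e₁, e₂ and (u +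
ℓ/Q)/Q, with u and e₂ expanded in the intermediate tetrad. -/
theorem sntComponents_row (b : Fin 4) :
    sntComponents A B C x ℓ Q M s 0 b = metricInner (sssMetric A B C) (x s) (ℓ s)
        ((M s).mulVec (sntVector A B C x ℓ Q 0 b)) / Q ∧
      sntComponents A B C x ℓ Q M s 1 b = √(C (x s 1))
        * (M s).mulVec (sntVector A B C x ℓ Q 0 b) 2 ∧
      sntComponents A B C x ℓ Q M s 2 b = metricInner (sssMetric A B C) (x s)
        (sntE2Tilde A B C x ℓ s) ((M s).mulVec (sntVector A B C x ℓ Q 0 b))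
        - sntPsi A B C x ℓ Q s / Q * metricInner (sssMetric A B C) (x s) (ℓ s)
          ((M s).mulVec (sntVector A B C x ℓ Q 0 b)) ∧
      sntComponents A B C x ℓ Q M s 3 b = (metricInner (sssMetric A B C) (x s)
        (sntUTilde A C x ℓ Q s) ((M s).mulVec (sntVector A B C x ℓ Q 0 b))
        + sntPsi A B C x ℓ Q s * metricInner (sssMetric A B C) (x s)
          (sntE2Tilde A B C x ℓ s) ((M s).mulVec (sntVector A B C x ℓ Q 0 b))
        - sntPsi A B C x ℓ Q s ^ 2 / (2 * Q) * metricInner (sssMetric A B C) (x s) (ℓ s)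
          ((M s).mulVec (sntVector A B C x ℓ Q 0 b))) / Q
        + metricInner (sssMetric A B C) (x s) (ℓ s)
          ((M s).mulVec (sntVector A B C x ℓ Q 0 b)) / Q ^ 2 := by
  simp only [H.sntComponents_eq hL hε hQ hs]
  generalize (M s).mulVec (sntVector A B C x ℓ Q 0 b) = v
  simp only [Fin.sum_univ_four, semiNullGramInv, Matrix.of_apply, Matrix.cons_val, zero_mul,
    zero_add, add_zero, one_mul, sntVector, metricInner_add_left, metricInner_sub_left,
    metricInner_smul_left, H.metricInner_sntE1 hs]
  refine ⟨by ring, trivial, trivial, by ring⟩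

theorem sntComponents_theta :
    sntComponents A B C x ℓ Q M s 1 1 = √(C (x s 1)) / √(C (x 0 1)) * M s 2 2 := by
  rw [(H.sntComponents_row hL hε hQ hs M 1).2.1, H.sntVector_zero]
  simp [sntE1, Matrix.mulVec, dotProduct, Fin.sum_univ_four]
  ring

/-- Three facts give the pattern: M maps ℓ to αℓ (last column), contraction with ℓ is reproduced up
to α (first row, because ℓ/Q is the covector dual to u), and θ decouples (row and column of e₁). -/
theorem isSparseBlock_sntComponents {α : ℝ} (hM : ∀ μ, μ ≠ 2 → M s μ 2 = 0 ∧ M s 2 μ = 0)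
    (hv : (M s).mulVec (ℓ 0) = α • ℓ s) (hrow : ∀ v, metricInner (sssMetric A B C) (x s) (ℓ s)
      ((M s).mulVec v) = α * metricInner (sssMetric A B C) (x 0) (ℓ 0) v) :
    IsSparseBlock α (sntComponents A B C x ℓ Q M s) := by
  have row := H.sntComponents_row hL hε hQ hs M
  have gram := fun a b => H.metricInner_sntVector hL hε hQ H.zero_mem a b
  have h3 : sntVector A B C x ℓ Q 0 3 = ℓ 0 := rfl
  have hr : ∀ b, sntComponents A B C x ℓ Q M s 0 b = α * semiNullGram Q 3 b / Q := fun b => by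
    rw [(row b).1, hrow, ← gram 3 b, h3]
  have hc : ∀ a, sntComponents A B C x ℓ Q M s a 3
      = α * ∑ c, semiNullGramInv Q a c * semiNullGram Q c 3 := fun a => by
    rw [H.sntComponents_eq hL hε hQ hs, h3, hv, Finset.mul_sum]
    refine Finset.sum_congr rfl fun c _ => ?_
    rw [metricInner_smul_right, ← H.metricInner_sntVector hL hε hQ hs c 3]
    have : sntVector A B C x ℓ Q s 3 = ℓ s := rfl
    rw [this]
    ring
  have m0 := hM 0 (by decide)
  have m1 := hM 1 (by decide)
  have m3 := hM 3 (by decide)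
  have hθ : ∀ b, b ≠ 1 → sntComponents A B C x ℓ Q M s 1 b = 0 := fun b hb => by
    rw [(row b).2.1, H.sntVector_zero]
    fin_cases b
    · simp [Matrix.mulVec, dotProduct, Fin.sum_univ_four, m0, m1, m3, sntUTilde]
    · exact absurd rfl hb
    · simp [Matrix.mulVec, dotProduct, Fin.sum_univ_four, m0, m1, m3, sntE2Tilde]
    · simp [Matrix.mulVec, dotProduct, Fin.sum_univ_four, m0, m1, m3,
        H.velocity_theta H.zero_mem]
  have hw : ∀ μ, μ ≠ 2 → (M s).mulVec (sntVector A B C x ℓ Q 0 1) μ = 0 := fun μ hμ => by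
    rw [H.sntVector_zero]
    simp [Matrix.mulVec, dotProduct, Fin.sum_univ_four, sntE1, (hM μ hμ).1]
  have w0 := hw 0 (by decide)
  have w1 := hw 1 (by decide)
  have w3 := hw 3 (by decide)
  have hl := H.metricInner_velocity hs ((M s).mulVec (sntVector A B C x ℓ Q 0 1))
  have he := H.metricInner_sntE2Tilde hL hs ((M s).mulVec (sntVector A B C x ℓ Q 0 1))
  have hu := H.metricInner_sntUTilde hL hQ hs ((M s).mulVec (sntVector A B C x ℓ Q 0 1))
  simp only [w0, w1, w3, mul_zero, add_zero, neg_zero] at hl he hu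
  have h21 : sntComponents A B C x ℓ Q M s 2 1 = 0 := by rw [(row 1).2.2.1, he, hl]; ring
  have h31 : sntComponents A B C x ℓ Q M s 3 1 = 0 := by
    rw [(row 1).2.2.2, he, hl, hu]; ring
  refine ⟨sntComponents A B C x ℓ Q M s 1 1, sntComponents A B C x ℓ Q M s 2 2,
    sntComponents A B C x ℓ Q M s 2 0, sntComponents A B C x ℓ Q M s 3 0,
    sntComponents A B C x ℓ Q M s 3 2, ?_⟩
  ext a b
  fin_cases a
  · fin_cases b <;> simp [hr, semiNullGram, hQ]
  · fin_cases b
    · simpa using hθ 0 (by decide)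
    · simp
    · simpa using hθ 2 (by decide)
    · simpa using hθ 3 (by decide)
  · fin_cases b
    · simp
    · simpa using h21
    · simp
    · simp [hc, semiNullGram, semiNullGramInv, Fin.sum_univ_four]
  · fin_cases b
    · simp
    · simpa using h31
    · simp
    · simp [hc, semiNullGram, semiNullGramInv, Fin.sum_univ_four, hQ]

end Components

end IsAlignedOrbit

/-! ### Closed forms of the bilocal operators in the tetrad -/

theorem IsSparseBlock.eq_of {α : ℝ} {M : Matrix (Fin 4) (Fin 4) ℝ} (h : IsSparseBlock α M) :
    M = !![α, 0, 0, 0; 0, M 1 1, 0, 0; M 2 0, 0, M 2 2, 0; M 3 0, 0, M 3 2, α] := by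
  obtain ⟨p, q, a, b, c, rfl⟩ := h
  rfl

/-- The first row and the last column contain only α, so the determinant factors through the
transverse block. -/
theorem IsSparseBlock.det_eq {α : ℝ} {M : Matrix (Fin 4) (Fin 4) ℝ} (h : IsSparseBlock α M) :
    M.det = α ^ 2 * (M.submatrix ![1, 2] ![1, 2]).det := by
  obtain ⟨p, q, a, b, c, rfl⟩ := h
  rw [Matrix.det_fin_two]
  simp [Matrix.det_succ_row_zero, Fin.sum_univ_succ, Fin.succAbove]
  ring

namespace IsAlignedOrbit

variable {A B C : ℝ → ℝ} {R J : Set ℝ} {x ℓ : ℝ → Fin 4 → ℝ} (H : IsAlignedOrbit A B C R J x ℓ)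
  {s : ℝ} {W : BilocalOperators} (hW : IsBGO (sssMetric A B C) x ℓ J W)
include H

theorem isNull (hL : angMomZ C (x 0) (ℓ 0) ≠ 0) (hε : normalization A B C (x 0) (ℓ 0) = 0)
    (h0 : ℓ 0 1 ≠ 0) (hs : s ∈ J) (h1 : ℓ s 1 ≠ 0)
    {I : RadialIntegrals} (hI : IsRadialIntegrals A B C x ℓ J s I) :
    (orbitData A B C x ℓ s I).IsNull (√(A (x s 1) * B (x s 1) * C (x s 1)))
      (√(A (x 0 1) * B (x 0 1) * C (x 0 1))) := by
  refine ⟨H.isRegular h0 hs h1 I, hε, hL, (H.sqrt_mul_pos hs).ne', (H.sqrt_mul_pos H.zero_mem).ne',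
    H.sqrt_sq_mul hs, H.sqrt_sq_mul H.zero_mem, H.velocity_sq_of_null hε hs,
    H.velocity_sq_of_null hε H.zero_mem, ?_⟩
  have h := H.parameter_eq h0 hs h1 hI
  rw [hε, zero_mul, zero_add] at h
  exact h

include hW

theorem isSparseBlock_bgo (hL : angMomZ C (x 0) (ℓ 0) ≠ 0)
    (hε : normalization A B C (x 0) (ℓ 0) = 0) {Q : ℝ} (hQ : Q ≠ 0) (hs : s ∈ J) :
    IsSparseBlock 1 (sntComponents A B C x ℓ Q W.XX s) ∧
      IsSparseBlock s (sntComponents A B C x ℓ Q W.XL s) ∧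
      IsSparseBlock 0 (sntComponents A B C x ℓ Q W.LX s) ∧
      IsSparseBlock 1 (sntComponents A B C x ℓ Q W.LL s) := by
  have dec := fun μ (hμ : μ ≠ 2) => H.bgo_decouple hW hs hμ
  have vel := H.bgo_mulVec_velocity hW hs
  have row := H.metricInner_velocity_bgo hW hs
  refine ⟨H.isSparseBlock_sntComponents hL hε hQ hs _ (fun μ hμ => ?_) (by simp [vel.1])
      fun v => (row v).1,
    H.isSparseBlock_sntComponents hL hε hQ hs _ (fun μ hμ => ?_) vel.2.1 fun v => (row v).2.1,
    H.isSparseBlock_sntComponents hL hε hQ hs _ (fun μ hμ => ?_) (by simp [vel.2.2.1])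
      fun v => (row v).2.2.1,
    H.isSparseBlock_sntComponents hL hε hQ hs _ (fun μ hμ => ?_) (by simp [vel.2.2.2])
      fun v => (row v).2.2.2⟩ <;> obtain ⟨a, b, c, d, e, f, g, h⟩ := dec μ hμ
  exacts [⟨a, b⟩, ⟨c, d⟩, ⟨e, f⟩, ⟨g, h⟩]

theorem sntComponents_bgo_theta (hL : angMomZ C (x 0) (ℓ 0) ≠ 0)
    (hε : normalization A B C (x 0) (ℓ 0) = 0) {Q : ℝ} (hQ : Q ≠ 0) (hs : s ∈ J)
    (I : RadialIntegrals) (Ψ : ℝ) :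
    sntComponents A B C x ℓ Q W.XX s 1 1 = sntXX (orbitData A B C x ℓ s I) Q Ψ 1 1 ∧
      sntComponents A B C x ℓ Q W.XL s 1 1 = sntXL (orbitData A B C x ℓ s I) Q Ψ 1 1 ∧
      sntComponents A B C x ℓ Q W.LX s 1 1 = sntLX (orbitData A B C x ℓ s I) Q Ψ 1 1 ∧
      sntComponents A B C x ℓ Q W.LL s 1 1 = sntLL (orbitData A B C x ℓ s I) Q Ψ 1 1 := by
  obtain ⟨e1, e2, e3, e4⟩ := H.bgo_theta hW hL hs I
  have th := fun M => H.sntComponents_theta hL hε hQ hs M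
  have hC := (H.posC hs).le
  have hC0 := (H.posC H.zero_mem).le
  have q1 : √(C (x s 1) / C (x 0 1)) = √(C (x s 1)) / √(C (x 0 1)) := sqrt_div hC _
  have q2 : √(C (x 0 1) / C (x s 1)) = √(C (x 0 1)) / √(C (x s 1)) := sqrt_div hC0 _
  have q3 : √(C (x s 1) * C (x 0 1)) = √(C (x s 1)) * √(C (x 0 1)) := sqrt_mul hC _
  have a2 := sq_sqrt hC
  have b2 := sq_sqrt hC0
  have a0 := (sqrt_pos.2 (H.posC hs)).ne'
  have b0 := (sqrt_pos.2 (H.posC H.zero_mem)).ne'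
  rw [th, th, th, th, e1, e2, e3, e4]
  simp only [sntXX, sntXL, sntLX, sntLL, coordXX, coordXL, coordLX, coordLL, orbitData,
    Matrix.of_apply, Matrix.cons_val, q1, q2, q3]
  generalize √(C (x s 1)) = a at *
  generalize √(C (x 0 1)) = b at *
  rw [← a2, ← b2]
  refine ⟨?_, ?_, ?_, ?_⟩
  · trivial
  · field_simp
  · field_simp
  · field_simp

section ClosedForm

variable (hL : angMomZ C (x 0) (ℓ 0) ≠ 0) (hε : normalization A B C (x 0) (ℓ 0) = 0) {Q : ℝ}
  (hQ : Q ≠ 0) (h0 : ℓ 0 1 ≠ 0) (hs : s ∈ J) (h1 : ℓ s 1 ≠ 0) {I : RadialIntegrals}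
  (hI : IsRadialIntegrals A B C x ℓ J s I)
include hL hε hQ h0 hs h1 hI

/-- After the sparse pattern and the θ entry only four entries are left. They are the contractions
of the deviations started along u and e₂ with the intermediate vectors, followed by the null
rotation through Ψ at the endpoint; at the start Ψ = 0. -/
theorem sntComponents_X_eq :
    sntComponents A B C x ℓ Q W.XX s
        = sntXX (orbitData A B C x ℓ s I) Q (sntPsi A B C x ℓ Q s) ∧
      sntComponents A B C x ℓ Q W.LX s
        = sntLX (orbitData A B C x ℓ s I) Q (sntPsi A B C x ℓ Q s) := by
  have hn := H.isNull hL hε h0 hs h1 hI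
  obtain ⟨s1, -, s2, -⟩ := H.isSparseBlock_bgo hW hL hε hQ hs
  obtain ⟨t1, -, t2, -⟩ := H.sntComponents_bgo_theta hW hL hε hQ hs I (sntPsi A B C x ℓ Q s)
  have row := fun M b => H.sntComponents_row hL hε hQ hs M b
  have vrow := H.metricInner_velocity_bgo hW hs
  have gram := fun a b => H.metricInner_sntVector hL hε hQ H.zero_mem a b
  have g0 : metricInner (sssMetric A B C) (x 0) (ℓ 0) (sntVector A B C x ℓ Q 0 0) = Q := gram 3 0
  have g2 : metricInner (sssMetric A B C) (x 0) (ℓ 0) (sntVector A B C x ℓ Q 0 2) = 0 := gram 3 2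
  have u0 : sntVector A B C x ℓ Q 0 0 = sntUTilde A C x ℓ Q 0 := by rw [H.sntVector_zero]; rfl
  have u2 : sntVector A B C x ℓ Q 0 2 = ![B (x 0 1) * C (x 0 1) * ℓ 0 1
      / (√(A (x 0 1) * B (x 0 1) * C (x 0 1)) * angMomZ C (x 0) (ℓ 0)), -(C (x 0 1)
      * energy A (x 0) (ℓ 0) / (√(A (x 0 1) * B (x 0 1) * C (x 0 1)) * angMomZ C (x 0) (ℓ 0))),
      0, 0] := by
    have e : sntVector A B C x ℓ Q 0 2 = sntE2Tilde A B C x ℓ 0 := by rw [H.sntVector_zero]; rfl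
    have hA := (H.posA H.zero_mem).ne'
    have hB := (H.posB H.zero_mem).ne'
    have hD := (H.sqrt_mul_pos H.zero_mem).ne'
    have hD2 := H.sqrt_sq_mul H.zero_mem
    rw [e, H.sntE2Tilde_eq H.zero_mem]
    generalize √(A (x 0 1) * B (x 0 1) * C (x 0 1)) = D at hD hD2 ⊢
    -- D² = ABC moves D into the denominator, the form in which it stands in the closed formulas for
    -- initial displacements.
    have k1 : D * ℓ 0 1 / (A (x 0 1) * angMomZ C (x 0) (ℓ 0))
        = B (x 0 1) * C (x 0 1) * ℓ 0 1 / (D * angMomZ C (x 0) (ℓ 0)) := by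
      rw [div_eq_div_iff (mul_ne_zero hA hL) (mul_ne_zero hD hL)]
      linear_combination ℓ 0 1 * angMomZ C (x 0) (ℓ 0) * hD2
    have k2 : D * energy A (x 0) (ℓ 0) / (A (x 0 1) * B (x 0 1) * angMomZ C (x 0) (ℓ 0))
        = C (x 0 1) * energy A (x 0) (ℓ 0) / (D * angMomZ C (x 0) (ℓ 0)) := by
      rw [div_eq_div_iff (mul_ne_zero (mul_ne_zero hA hB) hL) (mul_ne_zero hD hL)]
      linear_combination energy A (x 0) (ℓ 0) * angMomZ C (x 0) (ℓ 0) * hD2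
    rw [k1, k2]
  obtain ⟨ξ, η, hdev, hξ, hη, hv⟩ := H.exists_isDeviation_X hW (sntVector A B C x ℓ Q 0 0)
  obtain ⟨ξ', η', hdev', hξ', hη', hv'⟩ := H.exists_isDeviation_X hW (sntVector A B C x ℓ Q 0 2)
  have P0 := H.isPropagated h0 hs h1 hI hdev
  have P2 := H.isPropagated h0 hs h1 hI hdev'
  rw [(hv s hs).1, (hv s hs).2, hξ, hη] at P0
  rw [(hv' s hs).1, (hv' s hs).2, hξ', hη'] at P2
  -- Only the initial vector is expanded; its occurrences inside the operators must stay intact to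
  -- match the tetrad components.
  nth_rewrite 1 [u0] at P0
  nth_rewrite 1 [u2] at P2
  obtain ⟨a1, a2, a3, a4⟩ := P0.contract_X_u hn hQ
  obtain ⟨b1, b2, b3, b4⟩ := P2.contract_X_e2 hn hQ
  have c2 : ∀ v, metricInner (sssMetric A B C) (x s) (sntE2Tilde A B C x ℓ s) v
      = (orbitData A B C x ℓ s I).contractE2 (√(A (x s 1) * B (x s 1) * C (x s 1))) v :=
    fun v => H.metricInner_sntE2Tilde hL hs v
  have cu : ∀ v, metricInner (sssMetric A B C) (x s) (sntUTilde A C x ℓ Q s) v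
      = (orbitData A B C x ℓ s I).contractU Q v := fun v => H.metricInner_sntUTilde hL hQ hs v
  rw [← add_div, div_eq_iff hQ] at a2
  rw [div_eq_iff hQ] at a4 b2 b4
  have a2' := eq_sub_of_add_eq a2
  have hD := hn.ne_zero
  have hD₀ := hn.ne_zero₀
  constructor
  · rw [s1.eq_of, t1, (row _ 0).2.2.1, (row _ 2).2.2.1, (row _ 0).2.2.2, (row _ 2).2.2.2,
      (vrow _).1, (vrow _).1, g0, g2, c2, c2, cu, cu, a1, a2', b1, b2]
    simp only [sntXX, orbitData, Matrix.of_apply, Matrix.cons_val]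
    generalize √(A (x s 1) * B (x s 1) * C (x s 1)) = D at hD ⊢
    generalize √(A (x 0 1) * B (x 0 1) * C (x 0 1)) = D₀ at hD₀ ⊢
    congr 1
    simp only [Matrix.vecCons_inj, true_and, and_true]
    refine ⟨⟨?_, ?_⟩, ?_, ?_⟩
    all_goals field_simp
    all_goals ring
  · rw [s2.eq_of, t2, (row _ 0).2.2.1, (row _ 2).2.2.1, (row _ 0).2.2.2, (row _ 2).2.2.2,
      (vrow _).2.2.1, (vrow _).2.2.1, g0, g2, c2, c2, cu, cu, a3, a4, b3, b4]
    simp only [sntLX, orbitData, Matrix.of_apply, Matrix.cons_val]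
    generalize √(A (x s 1) * B (x s 1) * C (x s 1)) = D at hD ⊢
    generalize √(A (x 0 1) * B (x 0 1) * C (x 0 1)) = D₀ at hD₀ ⊢
    congr 1
    simp only [Matrix.vecCons_inj, true_and, and_true]
    refine ⟨⟨?_, ?_⟩, ?_, ?_⟩
    all_goals field_simp
    all_goals ring

theorem sntComponents_L_eq :
    sntComponents A B C x ℓ Q W.XL s
        = sntXL (orbitData A B C x ℓ s I) Q (sntPsi A B C x ℓ Q s) ∧
      sntComponents A B C x ℓ Q W.LL s
        = sntLL (orbitData A B C x ℓ s I) Q (sntPsi A B C x ℓ Q s) := by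
  have hn := H.isNull hL hε h0 hs h1 hI
  obtain ⟨-, s1, -, s2⟩ := H.isSparseBlock_bgo hW hL hε hQ hs
  obtain ⟨-, t1, -, t2⟩ := H.sntComponents_bgo_theta hW hL hε hQ hs I (sntPsi A B C x ℓ Q s)
  have row := fun M b => H.sntComponents_row hL hε hQ hs M b
  have vrow := H.metricInner_velocity_bgo hW hs
  have gram := fun a b => H.metricInner_sntVector hL hε hQ H.zero_mem a b
  have g0 : metricInner (sssMetric A B C) (x 0) (ℓ 0) (sntVector A B C x ℓ Q 0 0) = Q := gram 3 0
  have g2 : metricInner (sssMetric A B C) (x 0) (ℓ 0) (sntVector A B C x ℓ Q 0 2) = 0 := gram 3 2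
  have u0 : sntVector A B C x ℓ Q 0 0 = sntUTilde A C x ℓ Q 0 := by rw [H.sntVector_zero]; rfl
  have u2 : sntVector A B C x ℓ Q 0 2 = ![√(A (x 0 1) * B (x 0 1) * C (x 0 1)) * ℓ 0 1
      / (A (x 0 1) * angMomZ C (x 0) (ℓ 0)), -(√(A (x 0 1) * B (x 0 1) * C (x 0 1))
      * energy A (x 0) (ℓ 0) / (A (x 0 1) * B (x 0 1) * angMomZ C (x 0) (ℓ 0))), 0, 0] := by
    have e : sntVector A B C x ℓ Q 0 2 = sntE2Tilde A B C x ℓ 0 := by rw [H.sntVector_zero]; rfl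
    rw [e, H.sntE2Tilde_eq H.zero_mem]
  obtain ⟨ξ, η, hdev, hξ, hη, hv⟩ := H.exists_isDeviation_L hW (sntVector A B C x ℓ Q 0 0)
  obtain ⟨ξ', η', hdev', hξ', hη', hv'⟩ := H.exists_isDeviation_L hW (sntVector A B C x ℓ Q 0 2)
  have P0 := H.isPropagated h0 hs h1 hI hdev
  have P2 := H.isPropagated h0 hs h1 hI hdev'
  rw [(hv s hs).1, (hv s hs).2, hξ, hη] at P0
  rw [(hv' s hs).1, (hv' s hs).2, hξ', hη'] at P2
  nth_rewrite 1 [u0] at P0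
  nth_rewrite 1 [u2] at P2
  obtain ⟨a1, a2, a3, a4⟩ := P0.contract_L_u hn hQ
  obtain ⟨b1, b2, b3, b4⟩ := P2.contract_L_e2 hn hQ
  have c2 : ∀ v, metricInner (sssMetric A B C) (x s) (sntE2Tilde A B C x ℓ s) v
      = (orbitData A B C x ℓ s I).contractE2 (√(A (x s 1) * B (x s 1) * C (x s 1))) v :=
    fun v => H.metricInner_sntE2Tilde hL hs v
  have cu : ∀ v, metricInner (sssMetric A B C) (x s) (sntUTilde A C x ℓ Q s) v
      = (orbitData A B C x ℓ s I).contractU Q v := fun v => H.metricInner_sntUTilde hL hQ hs v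
  rw [← add_div, div_eq_iff hQ] at a2
  rw [← add_div, div_eq_iff hQ] at a4
  rw [div_eq_iff hQ] at b2 b4
  have a4' := eq_sub_of_add_eq a4
  have a2' := eq_sub_of_add_eq a2
  have hD := hn.ne_zero
  have hD₀ := hn.ne_zero₀
  constructor
  · rw [s1.eq_of, t1, (row _ 0).2.2.1, (row _ 2).2.2.1, (row _ 0).2.2.2, (row _ 2).2.2.2,
      (vrow _).2.1, (vrow _).2.1, g0, g2, c2, c2, cu, cu, a1, a2', b1, b2]
    simp only [sntXL, orbitData, Matrix.of_apply, Matrix.cons_val]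
    generalize √(A (x s 1) * B (x s 1) * C (x s 1)) = D at hD ⊢
    generalize √(A (x 0 1) * B (x 0 1) * C (x 0 1)) = D₀ at hD₀ ⊢
    congr 1
    simp only [Matrix.vecCons_inj, true_and, and_true]
    refine ⟨⟨?_, ?_⟩, ?_, ?_⟩
    all_goals field_simp
    all_goals ring
  · rw [s2.eq_of, t2, (row _ 0).2.2.1, (row _ 2).2.2.1, (row _ 0).2.2.2, (row _ 2).2.2.2,
      (vrow _).2.2.2, (vrow _).2.2.2, g0, g2, c2, c2, cu, cu, a3, a4', b3, b4]
    simp only [sntLL, orbitData, Matrix.of_apply, Matrix.cons_val]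
    generalize √(A (x s 1) * B (x s 1) * C (x s 1)) = D at hD ⊢
    generalize √(A (x 0 1) * B (x 0 1) * C (x 0 1)) = D₀ at hD₀ ⊢
    congr 1
    simp only [Matrix.vecCons_inj, true_and, and_true]
    refine ⟨⟨?_, ?_⟩, ?_, ?_⟩
    all_goals field_simp
    all_goals ring

end ClosedForm

end IsAlignedOrbit

/-! ### Conjugate points -/

namespace IsAlignedOrbit

variable {A B C : ℝ → ℝ} {R J : Set ℝ} {x ℓ : ℝ → Fin 4 → ℝ} (H : IsAlignedOrbit A B C R J x ℓ)
  {s : ℝ}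
include H

/-- If ξ vanished on J, its derivative at 0 would vanish too, but that derivative is η(0) because
ξ(0) = 0. -/
theorem exists_deviation_ne_zero {ξ η : ℝ → Fin 4 → ℝ}
    (hD : IsDeviation (sssMetric A B C) x ℓ J ξ η) (h0 : ξ 0 = 0) (h0' : η 0 ≠ 0) :
    ∃ σ ∈ J, ξ σ ≠ 0 := by
  by_contra! h
  have h1 := hD.first 0 H.zero_mem
  simp only [HasCovDerivAt, h0, gammaVec_zero_right, sub_zero] at h1
  have h2 : HasDerivAt ξ 0 0 := (hasDerivAt_const (0 : ℝ) (0 : Fin 4 → ℝ)).congr_of_eventuallyEq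
    (eventually_of_mem (H.isOpen.mem_nhds H.zero_mem) h)
  exact h0' (h1.unique h2)

/-- The witness is the deviation out of the equatorial plane, with ξ = 0 and ∇_ℓ ξ along θ
initially: it stays orthogonal to the plane and is proportional to sin φ. No null condition is used.
-/
theorem isConjugatePoint_of_phi (hL : angMomZ C (x 0) (ℓ 0) ≠ 0) (hs : s ∈ J)
    (hφ : ∃ n : ℤ, x s 3 = n * π) : IsConjugatePoint (sssMetric A B C) x ℓ J s := by
  obtain ⟨n, hn⟩ := hφ
  obtain ⟨ξ, η, hD, h0, h0'⟩ := exists_isDeviation H.profile.isSmoothRegion H.geodesic H.chart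
    H.isOpen H.ordConnected H.zero_mem 0 (Pi.single 2 1)
  refine ⟨ξ, η, hD, h0, ?_, H.exists_deviation_ne_zero hD h0 ?_⟩
  · have hθ := (H.deviation_theta hD hs).1
    rw [hn, sin_int_mul_pi, h0] at hθ
    simp only [Pi.zero_apply, mul_zero, zero_mul, add_zero, mul_eq_zero, hL, false_or] at hθ
    funext μ
    by_cases hμ : μ = 2
    · rw [hμ, hθ, Pi.zero_apply]
    · exact (H.deviation_eq_zero hD (fun ν hν => by simp [h0, h0', hν]) hs hμ).1
  · rw [h0']
    simp

variable {W : BilocalOperators} (hW : IsBGO (sssMetric A B C) x ℓ J W)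
include hW

/-- Deviations vanishing at 0 correspond to vectors v through ξ = W_XL v, so those vanishing at s
form the kernel; nontriviality of ξ is equivalent to v ≠ 0. -/
theorem isConjugatePoint_iff_det (hs : s ∈ J) :
    IsConjugatePoint (sssMetric A B C) x ℓ J s ↔ (W.XL s).det = 0 := by
  rw [← Matrix.exists_mulVec_eq_zero_iff]
  constructor
  · rintro ⟨ξ, η, hD, h0, h1, σ, hσ, hne⟩
    refine ⟨η 0, fun h => hne ?_, ?_⟩
    · have := (H.bgo_mulVec hW hD hσ).1
      rwa [h0, h, Matrix.mulVec_zero, Matrix.mulVec_zero, add_zero] at this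
    · have := (H.bgo_mulVec hW hD hs).1
      rwa [h0, h1, Matrix.mulVec_zero, zero_add, eq_comm] at this
  · rintro ⟨v, hv, h⟩
    obtain ⟨ξ, η, hD, h0, h0', hξ⟩ := H.exists_isDeviation_L hW v
    exact ⟨ξ, η, hD, h0, (hξ s hs).1.trans h,
      H.exists_deviation_ne_zero hD h0 (by rwa [h0'])⟩

variable (hL : angMomZ C (x 0) (ℓ 0) ≠ 0) (hε : normalization A B C (x 0) (ℓ 0) = 0) {Q : ℝ}
  (hQ : Q ≠ 0) (hs : s ∈ J)
include hL hε hQ hs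

/-- The frames are invertible and the longitudinal factor of the determinant is s², nonzero by
assumption. -/
theorem isConjugatePoint_iff_det_transverse (hs0 : s ≠ 0) :
    IsConjugatePoint (sssMetric A B C) x ℓ J s ↔
      ((sntComponents A B C x ℓ Q W.XL s).submatrix ![1, 2] ![1, 2]).det = 0 := by
  have hF := H.isUnit_det_sntFrame hL hε hQ hs
  have hF0 := H.isUnit_det_sntFrame hL hε hQ H.zero_mem
  have hF' := (Matrix.isUnit_nonsing_inv_det _ hF).ne_zero
  rw [H.isConjugatePoint_iff_det hW hs]
  have h := (H.isSparseBlock_bgo hW hL hε hQ hs).2.1.det_eq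
  rw [sntComponents, Matrix.det_mul, Matrix.det_mul, ← sntComponents] at h
  have h2 : s ^ 2 ≠ 0 := pow_ne_zero _ hs0
  constructor
  · intro hd
    rw [hd, mul_zero, zero_mul] at h
    exact (mul_eq_zero.1 h.symm).resolve_left h2
  · intro hd
    rw [hd, mul_zero] at h
    exact (mul_eq_zero.1 ((mul_eq_zero.1 h).resolve_right hF0.ne_zero)).resolve_left hF'

theorem sntComponents_XL_theta : sntComponents A B C x ℓ Q W.XL s 1 1
    = √(C (x s 1) * C (x 0 1)) * sin (x s 3) / angMomZ C (x 0) (ℓ 0) := by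
  -- Dummy quadratures and Ψ: the entry does not depend on them.
  rw [(H.sntComponents_bgo_theta hW hL hε hQ hs ⟨0, 0, 0, 0⟩ 0).2.1]
  simp only [sntXL, orbitData, Matrix.of_apply, Matrix.cons_val]
  ring

theorem sntComponents_XL_theta_eq_zero_iff :
    sntComponents A B C x ℓ Q W.XL s 1 1 = 0 ↔ ∃ n : ℤ, x s 3 = n * π := by
  have hc := (sqrt_pos.2 (mul_pos (H.posC hs) (H.posC H.zero_mem))).ne'
  rw [H.sntComponents_XL_theta hW hL hε hQ hs, div_eq_zero_iff, or_iff_left hL, mul_eq_zero,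
    or_iff_right hc, sin_eq_zero_iff]
  exact exists_congr fun _ => eq_comm

omit hW hL hε hQ in
-- A positive continuous integrand over a nondegenerate segment. Beyond a turning point this
-- argument breaks down, since a finite part of a positive function need not be positive.
theorem affineQuadrature_wABC_ne_zero (ht : TurningFree ℓ s) (hs0 : s ≠ 0) :
    affineQuadrature (fun r => 1 / (A r * B r * C r)) x ℓ s ≠ 0 := by
  have hsub := H.uIcc_subset hs
  have hpos : ∀ σ ∈ uIcc 0 s, 0 < 1 / (A (x σ 1) * B (x σ 1) * C (x σ 1)) / ℓ σ 1 ^ 2 :=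
    fun σ hσ => by
      have h1 := H.posA (hsub hσ)
      have h2 := H.posB (hsub hσ)
      have h3 := H.posC (hsub hσ)
      have h4 := ht σ hσ
      positivity
  have hc : ContinuousOn (fun σ => 1 / (A (x σ 1) * B (x σ 1) * C (x σ 1)) / ℓ σ 1 ^ 2)
      (uIcc 0 s) :=
    ((H.continuousOn_radial H.contDiffOn_wABC).mono hsub).div
      (((H.continuousOn_velocity 1).mono hsub).pow 2) fun σ hσ => pow_ne_zero 2 (ht σ hσ)
  rw [affineQuadrature]
  rcases hs0.lt_or_gt with h | h
  · rw [uIcc_of_ge h.le] at hpos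
    rw [intervalIntegral.integral_symm, neg_ne_zero]
    exact (intervalIntegral.intervalIntegral_pos_of_pos_on hc.intervalIntegrable.symm
      (fun σ hσ => hpos σ (Ioo_subset_Icc_self hσ)) h).ne'
  · rw [uIcc_of_le h.le] at hpos
    exact (intervalIntegral.intervalIntegral_pos_of_pos_on hc.intervalIntegrable
      (fun σ hσ => hpos σ (Ioo_subset_Icc_self hσ)) h).ne'

/-- The transverse block is diagonal. Its second entry is a nonzero multiple of I_ABC, hence
nonzero, so only the factor sin φ can vanish. -/
theorem isConjugatePoint_iff_phi (ht : TurningFree ℓ s) (hs0 : s ≠ 0) :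
    IsConjugatePoint (sssMetric A B C) x ℓ J s ↔ ∃ n : ℤ, x s 3 = n * π := by
  rw [H.isConjugatePoint_iff_det_transverse hW hL hε hQ hs hs0,
    ← H.sntComponents_XL_theta_eq_zero_iff hW hL hε hQ hs]
  have h22 : sntComponents A B C x ℓ Q W.XL s 2 2 ≠ 0 := by
    have h0 := ht 0 left_mem_uIcc
    have h1 := ht s right_mem_uIcc
    rw [(H.sntComponents_L_eq hW hL hε hQ h0 hs h1 (H.isRadialIntegrals_affine hs ht)).1]
    simp only [sntXL, orbitData, Matrix.of_apply, Matrix.cons_val]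
    exact mul_ne_zero (mul_ne_zero (mul_ne_zero (mul_ne_zero (H.sqrt_mul_pos hs).ne'
      (H.sqrt_mul_pos H.zero_mem).ne') h1) h0) (H.affineQuadrature_wABC_ne_zero hs ht hs0)
  rw [(H.isSparseBlock_bgo hW hL hε hQ hs).2.1.eq_of, Matrix.det_fin_two]
  simp [h22]

end IsAlignedOrbit

/-! ### Assembly of the theorem -/

theorem mainTheorem1
    (A B C : ℝ → ℝ) (R : Set ℝ) (hR : IsOpen R)
    (hA : ContDiffOn ℝ ∞ A R) (hB : ContDiffOn ℝ ∞ B R) (hC : ContDiffOn ℝ ∞ C R)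
    (hApos : ∀ r ∈ R, 0 < A r) (hBpos : ∀ r ∈ R, 0 < B r) (hCpos : ∀ r ∈ R, 0 < C r)
    (J : Set ℝ) (hJo : IsOpen J) (hJc : J.OrdConnected) (hJ0 : (0 : ℝ) ∈ J)
    (x ℓ : ℝ → Fin 4 → ℝ)
    (hgeo : IsGeodesic (sssMetric A B C) x ℓ J)
    (hchart : ∀ s ∈ J, x s ∈ sphericalChart R)
    (haligned : IsAligned x ℓ) :
    let g := sssMetric A B C
    let E := energy A (x 0) (ℓ 0)
    let L := angMomZ C (x 0) (ℓ 0)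
    let ε := normalization A B C (x 0) (ℓ 0)
    -- the geodesic in aligned coordinates
    (∀ s ∈ J, x s 2 = π / 2 ∧ ℓ s 2 = 0 ∧ energy A (x s) (ℓ s) = E ∧
      angMomX C (x s) (ℓ s) = 0 ∧ angMomY C (x s) (ℓ s) = 0 ∧ angMomZ C (x s) (ℓ s) = L ∧
      normalization A B C (x s) (ℓ s) = ε ∧ ℓ s 1 ^ 2 = radialSq A B C E L ε (x s 1) ∧
      x s 0 - x 0 0 = -∫ σ in (0 : ℝ)..s, E / A (x σ 1) ∧
      x s 3 = ∫ σ in (0 : ℝ)..s, L / C (x σ 1)) ∧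
    (∀ s ∈ J, TurningFree ℓ s →
      s = ∫ ρ in (x 0 1)..(x s 1), 1 / (SignType.sign (ℓ 0 1) * √(radialSq A B C E L ε ρ))) ∧
    -- the radial quadratures
    (ℓ 0 1 ≠ 0 → ∀ s ∈ J, ℓ s 1 ≠ 0 → ∃ I, IsRadialIntegrals A B C x ℓ J s I) ∧
    (∀ s ∈ J, TurningFree ℓ s → ∀ I, IsRadialIntegrals A B C x ℓ J s I →
      I = ⟨affineQuadrature (fun r => 1 / B r) x ℓ s,
        affineQuadrature (fun r => 1 / (A r * B r)) x ℓ s,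
        affineQuadrature (fun r => 1 / (B r * C r)) x ℓ s,
        affineQuadrature (fun r => 1 / (A r * B r * C r)) x ℓ s⟩ ∧
      I = ⟨radiusQuadrature (fun r => 1 / B r) (radialSq A B C E L ε)
          (SignType.sign (ℓ 0 1)) (x 0 1) (x s 1),
        radiusQuadrature (fun r => 1 / (A r * B r)) (radialSq A B C E L ε)
          (SignType.sign (ℓ 0 1)) (x 0 1) (x s 1),
        radiusQuadrature (fun r => 1 / (B r * C r)) (radialSq A B C E L ε)
          (SignType.sign (ℓ 0 1)) (x 0 1) (x s 1),
        radiusQuadrature (fun r => 1 / (A r * B r * C r)) (radialSq A B C E L ε)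
          (SignType.sign (ℓ 0 1)) (x 0 1) (x s 1)⟩) ∧
    -- the general solution of the geodesic deviation equation by first integrals
    (L ≠ 0 → ℓ 0 1 ≠ 0 →
      (∀ ξ η, IsDeviation g x ℓ J ξ η → ∃ k, IsExplicitDeviation A B C x ℓ J ξ η k) ∧
      (∀ k, ∃ ξ η, IsDeviation g x ℓ J ξ η ∧ IsExplicitDeviation A B C x ℓ J ξ η k)) ∧
    -- the bilocal geodesic operators
    (∃ W, IsBGO g x ℓ J W) ∧
    ∀ W, IsBGO g x ℓ J W →
      -- resolvent property
      (∀ ξ η, IsDeviation g x ℓ J ξ η → ∀ s ∈ J,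
        ξ s = (W.XX s).mulVec (ξ 0) + (W.XL s).mulVec (η 0) ∧
        η s = (W.LX s).mulVec (ξ 0) + (W.LL s).mulVec (η 0)) ∧
      -- the operators as covariant variations of the general solution of the geodesic equation
      (∀ U Φ, IsGeneralSolution g (sphericalChart R) x ℓ J U Φ → ∀ s ∈ J,
        ∀ (δx δℓ : Fin 4 → ℝ) (δs : ℝ),
        let D := fderiv ℝ Φ ((x 0, ℓ 0), s) ((δx, δℓ), δs)
        let Δℓ := δℓ + gammaVec g (x 0) (ℓ 0) δx
        D.1 = (W.XX s).mulVec δx + (W.XL s).mulVec Δℓ + δs • ℓ s ∧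
        D.2 + gammaVec g (x s) (ℓ s) D.1 = (W.LX s).mulVec δx + (W.LL s).mulVec Δℓ ∧
        -- linearized implicit general solution
        (let δE := firstVariation (energy A) (x 0) (ℓ 0) δx δℓ
         let δL := firstVariation (angMomZ C) (x 0) (ℓ 0) δx δℓ
         let δε := firstVariation (normalization A B C) (x 0) (ℓ 0) δx δℓ
         (L ≠ 0 →
            D.1 2 = cos (x s 3) * δx 2 + sin (x s 3) * (δℓ 2 / ℓ 0 3) ∧
            D.2 2 = C (x 0 1) / C (x s 1)
              * (cos (x s 3) * δℓ 2 - sin (x s 3) * ℓ 0 3 * δx 2)) ∧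
         (ℓ 0 1 ≠ 0 → ℓ s 1 ≠ 0 → ∀ I, IsRadialIntegrals A B C x ℓ J s I →
            let d := orbitData A B C x ℓ s I
            δs = D.1 1 / d.lr - δx 1 / d.lr₀ + L * I.IBC * δL - E * I.IAB * δE
              - I.IB / 2 * δε ∧
            D.1 0 = δx 0 + E * (δx 1 / (d.A₀ * d.lr₀) - D.1 1 / (d.A * d.lr))
              + I.IABC * L * (L * δE - E * δL) + I.IAB * (E / 2 * δε - ε * δE) ∧
            D.1 3 = δx 3 + L * (D.1 1 / (d.C * d.lr) - δx 1 / (d.C₀ * d.lr₀))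
              + I.IABC * E * (E * δL - L * δE) + I.IBC * (ε * δL - L * δε / 2) ∧
            D.2 0 = -δE / d.A + E / d.A ^ 2 * d.dA * D.1 1 ∧
            D.2 3 = δL / d.C - L / d.C ^ 2 * d.dC * D.1 1 ∧
            D.2 1 = 1 / d.lr * (δε / (2 * d.B) + E * δE / (d.A * d.B) - L * δL / (d.B * d.C))
              - 1 / (2 * d.lr) * (ε * deriv B (x s 1) / d.B ^ 2
                  + E ^ 2 / (d.A * d.B) * (d.dA / d.A + deriv B (x s 1) / d.B)
                  - L ^ 2 / (d.B * d.C) * (deriv B (x s 1) / d.B + d.dC / d.C)) * D.1 1))) ∧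
      -- decoupling and closed form of the `θ` components, through turning points
      (∀ s ∈ J, ∀ μ, μ ≠ 2 →
        W.XX s μ 2 = 0 ∧ W.XX s 2 μ = 0 ∧ W.XL s μ 2 = 0 ∧ W.XL s 2 μ = 0 ∧
        W.LX s μ 2 = 0 ∧ W.LX s 2 μ = 0 ∧ W.LL s μ 2 = 0 ∧ W.LL s 2 μ = 0) ∧
      (L ≠ 0 → ∀ s ∈ J, ∀ I, let d := orbitData A B C x ℓ s I
        W.XX s 2 2 = coordXX d 2 2 ∧ W.XL s 2 2 = coordXL d 2 2 ∧
        W.LX s 2 2 = coordLX d 2 2 ∧ W.LL s 2 2 = coordLL d 2 2) ∧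
      -- closed form of all components in the aligned coordinate frame
      (ℓ 0 1 ≠ 0 → ∀ s ∈ J, ℓ s 1 ≠ 0 → ∀ I, IsRadialIntegrals A B C x ℓ J s I →
        let d := orbitData A B C x ℓ s I
        (∀ μ ν, (μ ≠ 2 ∨ ν ≠ 2 ∨ L ≠ 0) →
          W.XX s μ ν = coordXX d μ ν ∧ W.XL s μ ν = coordXL d μ ν ∧
          W.LX s μ ν = coordLX d μ ν ∧ W.LL s μ ν = coordLL d μ ν)) ∧
      -- the parallel-propagated semi-null tetrad and the closed forms in it
      (L ≠ 0 → ε = 0 → ∀ Q : ℝ, 0 < Q →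
        (∀ s ∈ J, ∀ a, HasCovDerivAt g x ℓ (fun σ => sntVector A B C x ℓ Q σ a) 0 s) ∧
        (∀ s ∈ J, ∀ a b, metricInner g (x s) (sntVector A B C x ℓ Q s a)
            (sntVector A B C x ℓ Q s b)
          = (!![-1, 0, 0, Q; 0, 1, 0, 0; 0, 0, 1, 0; Q, 0, 0, 0] : Matrix (Fin 4) (Fin 4) ℝ) a b) ∧
        (∀ s ∈ J, IsUnit (sntFrame A B C x ℓ Q s).det) ∧
        (0 < E → ∀ s ∈ J, 0 < sntVector A B C x ℓ Q s 0 0) ∧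
        (∀ s ∈ J, HasDerivAt (sntPsi A B C x ℓ Q)
          (-(deriv C (x s 1) / (2 * √(A (x s 1) * B (x s 1) * C (x s 1))) * (E / L) * Q)) s) ∧
        (∀ s ∈ J,
          IsSparseBlock 1 (sntComponents A B C x ℓ Q W.XX s) ∧
          IsSparseBlock s (sntComponents A B C x ℓ Q W.XL s) ∧
          IsSparseBlock 0 (sntComponents A B C x ℓ Q W.LX s) ∧
          IsSparseBlock 1 (sntComponents A B C x ℓ Q W.LL s)) ∧
        (∀ s ∈ J, ∀ I, let d := orbitData A B C x ℓ s I
          let Ψ := sntPsi A B C x ℓ Q s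
          sntComponents A B C x ℓ Q W.XL s 1 1 = √(C (x s 1) * C (x 0 1)) * sin (x s 3) / L ∧
          sntComponents A B C x ℓ Q W.XX s 1 1 = sntXX d Q Ψ 1 1 ∧
          sntComponents A B C x ℓ Q W.LX s 1 1 = sntLX d Q Ψ 1 1 ∧
          sntComponents A B C x ℓ Q W.LL s 1 1 = sntLL d Q Ψ 1 1) ∧
        (ℓ 0 1 ≠ 0 → ∀ s ∈ J, ℓ s 1 ≠ 0 → ∀ I, IsRadialIntegrals A B C x ℓ J s I →
          let d := orbitData A B C x ℓ s I
          let Ψ := sntPsi A B C x ℓ Q s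
          sntComponents A B C x ℓ Q W.XX s = sntXX d Q Ψ ∧
          sntComponents A B C x ℓ Q W.XL s = sntXL d Q Ψ ∧
          sntComponents A B C x ℓ Q W.LX s = sntLX d Q Ψ ∧
          sntComponents A B C x ℓ Q W.LL s = sntLL d Q Ψ) ∧
        -- conjugate points
        (∀ s ∈ J, s ≠ 0 →
          (IsConjugatePoint g x ℓ J s ↔
            ((sntComponents A B C x ℓ Q W.XL s).submatrix ![1, 2] ![1, 2]).det = 0) ∧
          (sntComponents A B C x ℓ Q W.XL s 1 1 = 0 ↔ ∃ n : ℤ, x s 3 = n * π) ∧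
          (TurningFree ℓ s → (IsConjugatePoint g x ℓ J s ↔ ∃ n : ℤ, x s 3 = n * π)))) ∧
      (L ≠ 0 → ∀ s ∈ J, s ≠ 0 → (∃ n : ℤ, x s 3 = n * π) → IsConjugatePoint g x ℓ J s) := by
  intro g E L ε
  have H : IsAlignedOrbit A B C R J x ℓ :=
    ⟨⟨hR, hA, hB, hC, hApos, hBpos, hCpos⟩, hJo, hJc, hJ0, hgeo, hchart, haligned⟩
  refine ⟨fun s hs => ⟨H.theta_eq hs, H.velocity_theta hs, H.energy_const hs,
      H.angMomX_eq_zero hs, H.angMomY_eq_zero hs, H.angMomZ_const hs, H.normalization_const hs,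
      H.velocity_r_sq hs, H.time_eq hs, H.phi_eq hs⟩, fun s hs ht => ?_,
    fun h0 s hs h1 => H.exists_isRadialIntegrals h0 hs h1, fun s hs ht I hI => ?_,
    fun hL h0 => ⟨fun ξ η hD => H.exists_isExplicitDeviation_of_isDeviation h0 hL hD,
      fun k => H.exists_isDeviation_isExplicitDeviation h0 hL k⟩,
    exists_isBGO H.profile.isSmoothRegion hgeo hchart hJo hJc hJ0,
    fun W hW => ⟨fun ξ η hD s hs => H.bgo_mulVec hW hD hs,
      fun U Φ hΦ s hs δx δℓ δs => ?_, fun s hs μ hμ => H.bgo_decouple hW hs hμ,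
      fun hL s hs I => H.bgo_theta hW hL hs I,
      fun h0 s hs h1 I hI μ ν hμν => H.bgo_coord hW h0 hs h1 hI hμν,
      fun hL hε Q hQ => ?_, fun hL s hs _ hφ => H.isConjugatePoint_of_phi hL hs hφ⟩⟩
  -- Substitution with weight 1 and exponent 0: the parameter integral of 1 is s.
  · simpa using (H.integral_comp_radius hs ht (w := fun _ => 1) contDiffOn_const 0).symm
  · rw [hI.unique (H.isRadialIntegrals_affine hs ht)]
    refine ⟨rfl, ?_⟩
    simp only [radiusQuadrature, affineQuadrature, RadialIntegrals.mk.injEq]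
    exact ⟨(H.integral_comp_radius hs ht H.contDiffOn_wB 2).symm,
      (H.integral_comp_radius hs ht H.contDiffOn_wAB 2).symm,
      (H.integral_comp_radius hs ht H.contDiffOn_wBC 2).symm,
      (H.integral_comp_radius hs ht H.contDiffOn_wABC 2).symm⟩
  · obtain ⟨h1, h2⟩ := H.variation_eq_bgo hΦ hW hs δx δℓ δs
    exact ⟨h1, h2, fun hL => H.variation_theta_of_isGeneralSolution hΦ hL hs δx δℓ δs,
      fun h0 h1 I hI => H.variation_closed_form_of_isGeneralSolution hΦ h0 hs h1 hI δx δℓ δs rfl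
        rfl rfl rfl rfl rfl rfl⟩
  · have hQ' := hQ.ne'
    refine ⟨fun s hs a => H.hasCovDerivAt_sntVector hL hε hQ' hs a,
      fun s hs a b => H.metricInner_sntVector hL hε hQ' hs a b,
      fun s hs => H.isUnit_det_sntFrame hL hε hQ' hs,
      fun hE s hs => H.sntVector_t_pos hL hε hQ hE hs, fun s hs => H.hasDerivAt_sntPsi Q hs,
      fun s hs => H.isSparseBlock_bgo hW hL hε hQ' hs, fun s hs I => ?_,
      fun h0 s hs h1 I hI => ?_, fun s hs hs0 => ⟨
        H.isConjugatePoint_iff_det_transverse hW hL hε hQ' hs hs0,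
        H.sntComponents_XL_theta_eq_zero_iff hW hL hε hQ' hs,
        fun ht => H.isConjugatePoint_iff_phi hW hL hε hQ' hs ht hs0⟩⟩
    · obtain ⟨h1, -, h3, h4⟩ :=
        H.sntComponents_bgo_theta hW hL hε hQ' hs I (sntPsi A B C x ℓ Q s)
      exact ⟨H.sntComponents_XL_theta hW hL hε hQ' hs, h1, h3, h4⟩
    · obtain ⟨hXX, hLX⟩ := H.sntComponents_X_eq hW hL hε hQ' h0 hs h1 hI
      obtain ⟨hXL, hLL⟩ := H.sntComponents_L_eq hW hL hε hQ' h0 hs h1 hI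
      exact ⟨hXX, hXL, hLX, hLL⟩
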